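/- Let $(C_n)_{n\ge 1}$ be a family of layered arithmetic circuits of fan-in 2 with gates $+$ and $\times$; $C_n$ has $n$ inputs, one output gate, depth $d(n)$ and size $S(n)$ (the number of gates, inputs included). Layer $0$ is the output gate, layer $d(n)$ consists of the inputs, and every gate of layer $i$ has its two in-neighbours in layer $i+1$. Assume that the family is log-space uniform: a deterministic Turing machine with a read-only input tape, on input $1^n$, writes down the description of $C_n$ in work space $O(\log S(n))$. Computations over a field $\mathbb F$ are done by random access machines with a memory of words (natural numbers below $S(n)^{O(1)}$) and a memory of field elements; an operation on, an access to, a random choice of, or a transmission of one word or one field element takes unit time. An input $a\in\mathbb F^n$ is given as a stream of $O(n)$ updates $(i,\delta)$ with $i\in[n]$, $\delta\in\mathbb F$; $a_i$ is the sum of all $\delta$ that come with $i$. Prover $\mathcal P$ and verifier $\mathcal V$ see the stream and then exchange messages; $\mathcal P$ is given the explicit description of $C_n$ as a table, $\mathcal V$ is given only $n$. Consider the following protocol (of Goldwasser, Kalai and Rothblum, with multilinear extensions). For a layer $i$ with $w_i$ gates let $v_i=\lceil\log_2 w_i\rceil$, let $\tilde V_i$ be the multilinear extension in $v_i$ variables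 of the function that maps a gate label to the value of that gate (and unused labels to $0$), and let $\widetilde{add}_i,\widetilde{mult}_i$ be the multilinear extensions in $v_i+2v_{i+1}$ variables of the predicates "gate $j_1$ of layer $i$ is the sum (product) of the gates $j_2,j_3$ of layer $i+1$". $\mathcal P$ claims a value $y$ of the output gate. For $i=0,\dots,d(n)-1$, a claimed value of $\tilde V_i(z_i)$ is reduced to one of $\tilde V_{i+1}(z_{i+1})$: the sum-check protocol is applied to $$f_i(p,\omega_1,\omega_2)=\beta(z_i,p)\bigl(\widetilde{add}_i(p,\omega_1,\omega_2)(\tilde V_{i+1}(\omega_1)+\tilde V_{i+1}(\omega_2))+\widetilde{mult}_i(p,\omega_1,\omega_2)\tilde V_{i+1}(\omega_1)\tilde V_{i+1}(\omega_2)\bigr),$$ $\beta(z,p)=\prod_k\bigl(z_kp_k+(1-z_k)(1-p_k)\bigr)$, where in each round $\mathcal P$ sends the coefficients of a univariate polynomial of degree at most $2$ and $\mathcal V$ answers by a random challenge; then $\mathcal P$ sends the coefficients of a polynomial $h$ of degree at most $v_{i+1}$, claimed to be the restriction of $\tilde V_{i+1}$ to the line $t\mapsto(1-t)\omega_1+t\omega_2$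 through the two challenge points; $\mathcal V$ uses $h(0),h(1)$ for $\tilde V_{i+1}(\omega_1),\tilde V_{i+1}(\omega_2)$ in the final check of the sum-check protocol, answers by a random $t$, and the new claim is $\tilde V_{i+1}(z_{i+1})=h(t)$ with $z_{i+1}=(1-t)\omega_1+t\omega_2$. Finally $\mathcal V$ compares the last claim with the multilinear extension of $a$ at $z_{d(n)}$. $\mathcal V$ outputs $y$ if all checks succeed and $\bot$ otherwise. Then there are fixed programs for $\mathcal V$ and $\mathcal P$, depending only on the family, that implement this protocol for all $n\ge1$, all fields $\mathbb F$ and all streams of length $O(n)$, such that: 1. The honest prover $\mathcal P$ takes time $O(S(n)\log S(n))$ over the entire execution, and $\mathcal V$ then outputs the value $C_n(a)$ with probability $1$. 2. Against every prover, the work of $\mathcal V$ splits into a non-interactive, data-independent preprocessing phase (before the stream is seen) in space $O(d(n)\log S(n))$ and time $\mathrm{poly}(S(n))$, and an online phase (one pass over the stream, then the interaction) in space $O(d(n)\log S(n))$ and time $O(n\log n+d(n)\log S(n))$. The number of messages and the total communication are $O(d(n)\log S(n))$ field elements. 3. If the random values are drawn independently and uniformly from a finite set $R\subseteq\mathbb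 F$ with $|R|\ge 100\,d(n)\log S(n)$, where here $\log$ is the base-2 logarithm rounded down, then for every stream and every prover strategy the probability that $\mathcal V$ outputs a value other than $C_n(a)$ and $\bot$ is at most $1/3$. The constants depend only on the family and on the constant in the bound $O(n)$ on the length of the stream. -/

import Mathlib

/-! ### Layered arithmetic circuits of fan-in two -/

inductive GateOp where
  | add
  | mul
deriving DecidableEq

/-- A gate: its operation and the positions of its two in-neighbours in the next layer. -/
structure Gate where
  op : GateOp
  left : ℕ
  right : ℕ
deriving DecidableEq

/-- A layered circuit, as the list of its layers of gates, the output layer first. The inputs form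
one more layer, after the last one of the list. -/
abbrev Circuit := List (List Gate)

namespace Circuit

/-- The gates of layer `i` (layer `0` holds the output gate). -/
def layer (C : Circuit) (i : ℕ) : List Gate := C.getD i []

/-- The depth `d`: the number of layers of gates. -/
def depth (C : Circuit) : ℕ := C.length

/-- The number of gates of layer `i`; layer `d` consists of the `n` input gates. -/
def width (n : ℕ) (C : Circuit) (i : ℕ) : ℕ :=
  if i < C.depth then (C.layer i).length else n

/-- The size `S`: the number of gates, the `n` input gates included. -/
def size (n : ℕ) (C : Circuit) : ℕ := n + (C.map List.length).sum

/-- `C` is a circuit on `n` inputs: it has exactly one output gate, and each wire into a gate of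
layer `i` comes from an existing gate (or input) of layer `i + 1`. -/
def WellFormed (n : ℕ) (C : Circuit) : Prop :=
  (∃ g : Gate, C.head? = some [g]) ∧
  ∀ i < C.depth, ∀ g ∈ C.layer i, g.left < C.width n (i + 1) ∧ g.right < C.width n (i + 1)

/-- The value of gate number `j` of the first layer of the given list of layers on input `a`
(zero if there is no such gate). -/
def eval {F : Type*} [Field F] (a : ℕ → F) : Circuit → ℕ → F
  | [], j => a j
  | L :: C, j =>
    match L[j]? with
    | some ⟨.add, l, r⟩ => eval a C l + eval a C r
    | some ⟨.mul, l, r⟩ => eval a C l * eval a C r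
    | none => 0

/-- `V_i(j)`, the value of gate `j` of layer `i`. -/
def gateValue {F : Type*} [Field F] (C : Circuit) (a : ℕ → F) (i : ℕ) : ℕ → F :=
  eval a (C.drop i)

/-- The value of the output gate. -/
def output {F : Type*} [Field F] (C : Circuit) (a : ℕ → F) : F := C.gateValue a 0 0

end Circuit

/-! ### Log-space uniformity -/

/-- The alphabet of circuit descriptions. -/
inductive DescSym where
  | add
  | mul
  | bit (b : Bool)
  | comma
  | endLayer

/-- A gate is described by its operation and the binary notations of its two in-neighbours (least
significant bit first). -/
def Gate.encode (g : Gate) : List DescSym :=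
  [match g.op with | .add => DescSym.add | .mul => DescSym.mul] ++
    g.left.bits.map DescSym.bit ++ [DescSym.comma] ++ g.right.bits.map DescSym.bit ++ [DescSym.comma]

/-- The description of a circuit: layer by layer, gate by gate. -/
def Circuit.encode (C : Circuit) : List DescSym :=
  C.flatMap fun L => L.flatMap Gate.encode ++ [DescSym.endLayer]

/-- The symbols of the input tape, which holds `1ⁿ` between two end markers. -/
inductive InSym where
  | leftEnd
  | one
  | rightEnd

inductive Dir where
  | left
  | stay
  | right

def Dir.move : Dir → ℕ → ℕ
  | .left, p => p - 1
  | .stay, p => p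
  | .right, p => p + 1

/-- What a transducer does in one step: new state, symbol written to the work tape, moves of the
two heads, and possibly a symbol appended to the output. -/
structure TAction (states symbols : ℕ) where
  state : Fin (states + 1)
  write : Fin (symbols + 1)
  moveIn : Dir
  moveWork : Dir
  emit : Option DescSym

/-- A deterministic Turing machine with a two-way read-only input tape, a one-sided infinite
read-write work tape and a write-only output tape. State `0` is the initial state and symbol `0` is
the blank; the machine halts where `delta` is undefined. -/
structure Transducer where
  states : ℕ
  symbols : ℕ
  delta : Fin (states + 1) → InSym → Fin (symbols + 1) → Option (TAction states symbols)

namespace Transducer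

structure Config (T : Transducer) where
  state : Fin (T.states + 1)
  inHead : ℕ
  workHead : ℕ
  tape : ℕ → Fin (T.symbols + 1)
  out : List DescSym

/-- The symbol in cell `p` of the input tape: a marker in cell `0`, ones in the cells `1, …, n`,
a marker in cell `n + 1`. -/
def inputSym (n p : ℕ) : InSym :=
  if p = 0 then .leftEnd else if p ≤ n then .one else .rightEnd

def start (T : Transducer) : T.Config := ⟨0, 0, 0, fun _ => 0, []⟩

/-- One step on input `1ⁿ`. A head stays where it is instead of leaving its tape. -/
def step (T : Transducer) (n : ℕ) (c : T.Config) : Option T.Config :=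
  (T.delta c.state (inputSym n c.inHead) (c.tape c.workHead)).map fun A =>
    { state := A.state
      inHead := min (A.moveIn.move c.inHead) (n + 1)
      workHead := A.moveWork.move c.workHead
      tape := Function.update c.tape c.workHead A.write
      out := c.out ++ A.emit.toList }

/-- The configuration `c` occurs in the computation on input `1ⁿ`. -/
def Reaches (T : Transducer) (n : ℕ) (c : T.Config) : Prop :=
  Relation.ReflTransGen (fun c₁ c₂ => T.step n c₁ = some c₂) T.start c

/-- On input `1ⁿ` the machine halts with output `w`, and it visits only the first `s` cells of its
work tape. -/
def Computes (T : Transducer) (n s : ℕ) (w : List DescSym) : Prop :=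
  (∀ c, T.Reaches n c → c.workHead < s) ∧
  ∃ c, T.Reaches n c ∧ T.step n c = none ∧ c.out = w

end Transducer

/-- The family `C` is `O(log S(n))`-space uniform: some Turing machine outputs the description of
`C n` on input `1ⁿ`, in work space `O(log S(n))`. -/
def LogSpaceUniform (C : ℕ → Circuit) : Prop :=
  ∃ (T : Transducer) (c : ℕ), ∀ n, 1 ≤ n →
    T.Computes n (c * Nat.log 2 ((C n).size n)) (C n).encode

/-! ### Random access machines over a field

A machine has a memory for words (bounded natural numbers) and a memory for field elements. Each
operation on words or on field elements, each memory access, each test and each input, output or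
communication of a value takes one unit of time. -/

/-- An entry `x` that a party has sent to, or received from, the other party. -/
inductive Event (F : Type*) where
  | sent (x : F)
  | received (x : F)

/-- The same event from the point of view of the other party. -/
def Event.dual {F : Type*} : Event F → Event F
  | .sent x => .received x
  | .received x => .sent x

/-- A stream of updates `(i, δ)`. -/
abbrev UpdateStream (F : Type*) := List (ℕ × F)

/-- The frequency vector defined by a stream: `a_i` is the sum of all `δ` associated with `i`. -/
def frequency {F : Type*} [Field F] (A : UpdateStream F) (i : ℕ) : F :=
  ((A.filter fun u => u.1 = i).map Prod.snd).sum

/-- A machine: the number of cells of each of its two memories, the (strict) bound on the words that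
it can handle, a read-only table that it can query, and the behaviour of its environment, that is,
the next value received from the other party as a function of the communication so far. -/
structure Machine (F : Type*) where
  mem : ℕ
  word : ℕ
  table : ℕ → ℕ → ℕ → ℕ
  answer : List (Event F) → F

structure State (F : Type*) where
  /-- word memory -/
  w : ℕ → ℕ
  /-- field memory -/
  f : ℕ → F
  /-- random field elements not yet used -/
  coins : List F
  /-- the part of the input stream not yet read -/
  stream : UpdateStream F
  /-- the communication so far -/
  trace : List (Event F)

inductive WOp where
  | add
  | sub
  | mul
  | div
  | mod

def WOp.apply : WOp → ℕ → ℕ → ℕ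
  | .add, a, b => a + b
  | .sub, a, b => a - b
  | .mul, a, b => a * b
  | .div, a, b => a / b
  | .mod, a, b => a % b

/-- Word expressions. -/
inductive WExpr where
  | const (k : ℕ)
  | load (a : WExpr)
  | op (o : WOp) (a b : WExpr)
  | query (k a b : WExpr)

/-- Field expressions; `load a` is the content of the cell of the field memory with address `a`. -/
inductive FExpr where
  | zero
  | one
  | load (a : WExpr)
  | add (a b : FExpr)
  | sub (a b : FExpr)
  | mul (a b : FExpr)
  | inv (a : FExpr)

/-- Tests; `more` tests whether the input stream has a further update. -/
inductive Test where
  | lt (a b : WExpr)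
  | eq (a b : WExpr)
  | feq (a b : FExpr)
  | more

/-- Programs. -/
inductive Cmd where
  | skip
  /-- store a word -/
  | wset (a e : WExpr)
  /-- store a field element -/
  | fset (a : WExpr) (e : FExpr)
  /-- store a fresh random field element -/
  | sample (a : WExpr)
  /-- read the next update of the stream: store its index and its increment -/
  | read (a b : WExpr)
  /-- send a field element to the other party -/
  | send (e : FExpr)
  /-- store the next field element received from the other party -/
  | recv (a : WExpr)
  | seq (p q : Cmd)
  | cond (b : Test) (p q : Cmd)
  | loop (b : Test) (p : Cmd)

section Semantics

variable {F : Type*} [Field F]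

def WExpr.cost : WExpr → ℕ
  | .const _ => 1
  | .load a => a.cost + 1
  | .op _ a b => a.cost + b.cost + 1
  | .query k a b => k.cost + a.cost + b.cost + 1

def WExpr.val (M : Machine F) (s : State F) : WExpr → ℕ
  | .const k => k
  | .load a => s.w (a.val M s)
  | .op o a b => o.apply (a.val M s) (b.val M s)
  | .query k a b => M.table (k.val M s) (a.val M s) (b.val M s)

/-- All memory accesses lie in the memory and all values are words of the machine. -/
def WExpr.Fits (M : Machine F) (s : State F) : WExpr → Prop
  | .const k => k < M.word
  | .load a => a.Fits M s ∧ a.val M s < M.mem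
  | .op o a b => a.Fits M s ∧ b.Fits M s ∧ o.apply (a.val M s) (b.val M s) < M.word
  | .query k a b => k.Fits M s ∧ a.Fits M s ∧ b.Fits M s ∧
      M.table (k.val M s) (a.val M s) (b.val M s) < M.word

def FExpr.cost : FExpr → ℕ
  | .zero => 1
  | .one => 1
  | .load a => a.cost + 1
  | .add a b => a.cost + b.cost + 1
  | .sub a b => a.cost + b.cost + 1
  | .mul a b => a.cost + b.cost + 1
  | .inv a => a.cost + 1

def FExpr.val (M : Machine F) (s : State F) : FExpr → F
  | .zero => 0
  | .one => 1
  | .load a => s.f (a.val M s)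
  | .add a b => a.val M s + b.val M s
  | .sub a b => a.val M s - b.val M s
  | .mul a b => a.val M s * b.val M s
  | .inv a => (a.val M s)⁻¹

def FExpr.Fits (M : Machine F) (s : State F) : FExpr → Prop
  | .zero => True
  | .one => True
  | .load a => a.Fits M s ∧ a.val M s < M.mem
  | .add a b => a.Fits M s ∧ b.Fits M s
  | .sub a b => a.Fits M s ∧ b.Fits M s
  | .mul a b => a.Fits M s ∧ b.Fits M s
  | .inv a => a.Fits M s

def Test.cost : Test → ℕ
  | .lt a b => a.cost + b.cost + 1
  | .eq a b => a.cost + b.cost + 1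
  | .feq a b => a.cost + b.cost + 1
  | .more => 1

def Test.Holds (M : Machine F) (s : State F) : Test → Prop
  | .lt a b => a.val M s < b.val M s
  | .eq a b => a.val M s = b.val M s
  | .feq a b => a.val M s = b.val M s
  | .more => s.stream ≠ []

def Test.Fits (M : Machine F) (s : State F) : Test → Prop
  | .lt a b => a.Fits M s ∧ b.Fits M s
  | .eq a b => a.Fits M s ∧ b.Fits M s
  | .feq a b => a.Fits M s ∧ b.Fits M s
  | .more => True

/-- `Exec M p s t s'`: started in state `s`, the machine `M` executes the program `p` in time `t`
and ends in state `s'`. There is no such `t` and `s'` if the program does not terminate, accesses a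
cell outside the memory, exceeds the word size, or asks for input that does not exist. -/
inductive Exec (M : Machine F) : Cmd → State F → ℕ → State F → Prop
  | skip (s : State F) : Exec M .skip s 1 s
  | wset (s : State F) (a e : WExpr) (ha : a.Fits M s) (hm : a.val M s < M.mem)
      (he : e.Fits M s) :
      Exec M (.wset a e) s (a.cost + e.cost + 1)
        { s with w := Function.update s.w (a.val M s) (e.val M s) }
  | fset (s : State F) (a : WExpr) (e : FExpr) (ha : a.Fits M s) (hm : a.val M s < M.mem)
      (he : e.Fits M s) :
      Exec M (.fset a e) s (a.cost + e.cost + 1)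
        { s with f := Function.update s.f (a.val M s) (e.val M s) }
  | sample (s : State F) (a : WExpr) (x : F) (l : List F) (ha : a.Fits M s)
      (hm : a.val M s < M.mem) (hl : s.coins = x :: l) :
      Exec M (.sample a) s (a.cost + 1)
        { s with f := Function.update s.f (a.val M s) x, coins := l }
  | read (s : State F) (a b : WExpr) (i : ℕ) (x : F) (l : UpdateStream F)
      (ha : a.Fits M s) (hma : a.val M s < M.mem) (hb : b.Fits M s) (hmb : b.val M s < M.mem)
      (hl : s.stream = (i, x) :: l) (hi : i < M.word) :
      Exec M (.read a b) s (a.cost + b.cost + 1)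
        { s with
          w := Function.update s.w (a.val M s) i
          f := Function.update s.f (b.val M s) x
          stream := l }
  | send (s : State F) (e : FExpr) (he : e.Fits M s) :
      Exec M (.send e) s (e.cost + 1) { s with trace := s.trace ++ [.sent (e.val M s)] }
  | recv (s : State F) (a : WExpr) (ha : a.Fits M s) (hm : a.val M s < M.mem) :
      Exec M (.recv a) s (a.cost + 1)
        { s with
          f := Function.update s.f (a.val M s) (M.answer s.trace)
          trace := s.trace ++ [.received (M.answer s.trace)] }
  | seq {s s' s'' : State F} {p q : Cmd} {t t' : ℕ} (hp : Exec M p s t s')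
      (hq : Exec M q s' t' s'') : Exec M (.seq p q) s (t + t') s''
  | condTrue {s s' : State F} {b : Test} {p q : Cmd} {t : ℕ} (hf : b.Fits M s)
      (hb : b.Holds M s) (hp : Exec M p s t s') : Exec M (.cond b p q) s (b.cost + t) s'
  | condFalse {s s' : State F} {b : Test} {p q : Cmd} {t : ℕ} (hf : b.Fits M s)
      (hb : ¬ b.Holds M s) (hq : Exec M q s t s') : Exec M (.cond b p q) s (b.cost + t) s'
  | loopTrue {s s' s'' : State F} {b : Test} {p : Cmd} {t t' : ℕ} (hf : b.Fits M s)
      (hb : b.Holds M s) (hp : Exec M p s t s') (hl : Exec M (.loop b p) s' t' s'') :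
      Exec M (.loop b p) s (b.cost + t + t') s''
  | loopFalse {s : State F} {b : Test} {p : Cmd} (hf : b.Fits M s) (hb : ¬ b.Holds M s) :
      Exec M (.loop b p) s b.cost s

/-- The initial state: the first word cell holds `n`, all other cells hold zero. -/
def State.initial (n : ℕ) (coins : List F) (A : UpdateStream F) : State F :=
  { w := Function.update (fun _ => 0) 0 n
    f := fun _ => 0
    coins := coins
    stream := A
    trace := [] }

/-- The result computed by a verifier: the first field cell, if the first word cell holds `1`, and
`⊥` (`none`) otherwise. -/
def State.result (s : State F) : Option F := if s.w 0 = 1 then some (s.f 0) else none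

end Semantics

/-- A verifier: the program for the preprocessing phase, and those for the two parts of the online
phase, in which it observes the stream and then talks to the prover. -/
structure Verifier where
  pre : Cmd
  observe : Cmd
  talk : Cmd

/-- With `mem` cells of memory, words below `word` and random values `coins`, the verifier needs
time `tPre` for a preprocessing phase without stream and without communication, and then, on the
stream `A`, time `tOnline` for a single pass over the stream and for the communication with a prover
whose next value is `σ` of the communication so far. The communication is `trace` and the result
is `out`. -/
def Verifier.Runs {F : Type*} [Field F] (V : Verifier) (n mem word : ℕ) (coins : List F)
    (A : UpdateStream F) (σ : List (Event F) → F) (tPre tOnline : ℕ) (trace : List (Event F))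
    (out : Option F) : Prop :=
  ∃ (s₁ s₂ s₃ : State F) (t₂ t₃ : ℕ),
    Exec ⟨mem, word, fun _ _ _ => 0, σ⟩ V.pre (State.initial n coins []) tPre s₁ ∧
    s₁.trace = [] ∧
    Exec ⟨mem, word, fun _ _ _ => 0, σ⟩ V.observe { s₁ with stream := A } t₂ s₂ ∧
    s₂.stream = [] ∧ s₂.trace = [] ∧
    Exec ⟨mem, word, fun _ _ _ => 0, σ⟩ V.talk s₂ t₃ s₃ ∧
    t₂ + t₃ = tOnline ∧ s₃.trace = trace ∧ s₃.result = out

/-- The explicit description of a circuit, as a table: depth, widths of the layers, and operation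
(`0` for an addition, `1` for a multiplication) and in-neighbours of gate `j` of layer `i`. -/
def Circuit.table (n : ℕ) (C : Circuit) (k i j : ℕ) : ℕ :=
  match k, (C.layer i)[j]? with
  | 0, _ => C.depth
  | 1, _ => C.width n i
  | 2, some g => if g.op = .add then 0 else 1
  | 3, some g => g.left
  | 4, some g => g.right
  | _, _ => 0

/-- The program `P`, given the description of the circuit `C` and the stream `A`, takes time `t`
when it communicates with a verifier whose next value is `σ` of the communication so far. The
communication, as seen by the verifier, is `trace`. -/
def ProverRuns {F : Type*} [Field F] (P : Cmd) (n : ℕ) (C : Circuit) (word : ℕ) (A : UpdateStream F)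
    (σ : List (Event F) → F) (t : ℕ) (trace : List (Event F)) : Prop :=
  ∃ s : State F, Exec ⟨word, word, C.table n, σ⟩ P (State.initial n [] A) t s ∧
    s.trace = trace.map Event.dual

/-! ### The protocol of Goldwasser, Kalai and Rothblum with multilinear extensions

Layer `i` is reduced to layer `i + 1` for `i = 0, …, d - 1`. Points of affine spaces are sequences
of which only the first coordinates matter, and gate labels are identified with their binary
representations. -/

section Multilinear

variable {A : Type*} [CommRing A]

/-- `χ_j`, the multilinear extension in `v` variables of the indicator function of `j`. -/
def chi (v j : ℕ) (x : ℕ → A) : A :=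
  ∏ k ∈ Finset.range v, if j.testBit k then x k else 1 - x k

/-- The multilinear extension of `V : {0,1}^v → A`. -/
def mle (v : ℕ) (V : ℕ → A) (x : ℕ → A) : A :=
  ∑ j ∈ Finset.range (2 ^ v), V j * chi v j x

/-- `β(z, p)`, the multilinear extension of the equality predicate on `{0,1}^v`. -/
def beta (v : ℕ) (z p : ℕ → A) : A :=
  ∏ k ∈ Finset.range v, (z k * p k + (1 - z k) * (1 - p k))

end Multilinear

namespace Circuit

/-- The number of bits of the labels of the gates of layer `i`. -/
def vars (n : ℕ) (C : Circuit) (i : ℕ) : ℕ := Nat.clog 2 (C.width n i)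

/-- The number of variables `(p, ω₁, ω₂)` of the polynomial for layer `i`. -/
def arity (n : ℕ) (C : Circuit) (i : ℕ) : ℕ := C.vars n i + 2 * C.vars n (i + 1)

section Polys

variable {A : Type*} [CommRing A]

/-- The wiring predicate: whether gate `j₁` of layer `i` is the addition (multiplication) of gates
`j₂` and `j₃` of layer `i + 1`. -/
def wiring (C : Circuit) (o : GateOp) (i j₁ j₂ j₃ : ℕ) : A :=
  if (C.layer i)[j₁]? = some ⟨o, j₂, j₃⟩ then 1 else 0

/-- The first block `ω₁` of variables for layer `i + 1`. -/
def omega₁ (n : ℕ) (C : Circuit) (i : ℕ) (x : ℕ → A) : ℕ → A := fun k => x (C.vars n i + k)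

/-- The second block `ω₂` of variables for layer `i + 1`. -/
def omega₂ (n : ℕ) (C : Circuit) (i : ℕ) (x : ℕ → A) : ℕ → A :=
  fun k => x (C.vars n i + C.vars n (i + 1) + k)

/-- The multilinear extension of the wiring predicate. -/
def wiringExt (n : ℕ) (C : Circuit) (o : GateOp) (i : ℕ) (x : ℕ → A) : A :=
  ∑ j₁ ∈ Finset.range (2 ^ C.vars n i), ∑ j₂ ∈ Finset.range (2 ^ C.vars n (i + 1)),
    ∑ j₃ ∈ Finset.range (2 ^ C.vars n (i + 1)), C.wiring o i j₁ j₂ j₃ *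
      (chi (C.vars n i) j₁ x * chi (C.vars n (i + 1)) j₂ (C.omega₁ n i x) *
        chi (C.vars n (i + 1)) j₃ (C.omega₂ n i x))

/-- The polynomial `f(p, ω₁, ω₂)` to which the sum-check protocol is applied, for the values `V` of
the gates of layer `i + 1` and the point `z` at which the extension for layer `i` is claimed. -/
def layerPoly (n : ℕ) (C : Circuit) (i : ℕ) (V z x : ℕ → A) : A :=
  beta (C.vars n i) z x *
    (C.wiringExt n .add i x *
        (mle (C.vars n (i + 1)) V (C.omega₁ n i x) + mle (C.vars n (i + 1)) V (C.omega₂ n i x)) +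
      C.wiringExt n .mul i x *
        (mle (C.vars n (i + 1)) V (C.omega₁ n i x) * mle (C.vars n (i + 1)) V (C.omega₂ n i x)))

end Polys

/-- The number of random values used for the layers before layer `i`: one for each variable of the
sum-check protocols and one for each of the lines. -/
def offset (n : ℕ) (C : Circuit) (i : ℕ) : ℕ := ∑ l ∈ Finset.range i, (C.arity n l + 1)

/-- The number of random values used by the verifier. -/
def numCoins (n : ℕ) (C : Circuit) : ℕ := C.offset n C.depth

section Protocol

open Polynomial

variable {F : Type*} [Field F]

/-- The `k`-th random value for layer `i`. For `k < arity` it is the challenge for variable `k` of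
the sum-check protocol, for `k = arity` it is the parameter of a point on a line. -/
def coin (n : ℕ) (C : Circuit) (ρ : List F) (i k : ℕ) : F := ρ.getD (C.offset n i + k) 0

/-- The point `z` at which the multilinear extension of the gate values of layer `i` is claimed. For
`i > 0`, it is a random point on the line through the two points `ω₁` and `ω₂` for layer `i`. -/
def point (n : ℕ) (C : Circuit) (ρ : List F) : ℕ → ℕ → F
  | 0 => fun _ => 0
  | i + 1 => fun k =>
      (1 - C.coin n ρ i (C.arity n i)) * C.omega₁ n i (C.coin n ρ i) k +
        C.coin n ρ i (C.arity n i) * C.omega₂ n i (C.coin n ρ i) k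

/-- The univariate polynomial that the honest prover sends in round `k` for layer `i`: the partial
sum of `f` with variable `k` left free in the sum-check protocol, and the restriction of the
extension for layer `i + 1` to the line through `ω₁` and `ω₂` in the last round. -/
noncomputable def honest (n : ℕ) (C : Circuit) (a : ℕ → F) (ρ : List F) (i k : ℕ) : F[X] :=
  if k < C.arity n i then
    ∑ b ∈ Finset.range (2 ^ (C.arity n i - (k + 1))),
      C.layerPoly n i (fun j => Polynomial.C (C.gateValue a (i + 1) j))
        (fun l => Polynomial.C (C.point n ρ i l))
        (fun l => if l < k then Polynomial.C (C.coin n ρ i l) else if l = k then X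
          else if b.testBit (l - (k + 1)) then 1 else 0)
  else
    mle (C.vars n (i + 1)) (fun j => Polynomial.C (C.gateValue a (i + 1) j))
      (fun l => (1 - X) * Polynomial.C (C.omega₁ n i (C.coin n ρ i) l) +
        X * Polynomial.C (C.omega₂ n i (C.coin n ρ i) l))

/-- The bound on the degree of the polynomial sent in round `k` for layer `i`. -/
def msgDegree (n : ℕ) (C : Circuit) (i k : ℕ) : ℕ :=
  if k < C.arity n i then 2 else C.vars n (i + 1)

/-- The communication as seen by the verifier, if the prover claims the output `y` and then sends
the polynomials `g i k` by their coefficients, each of which the verifier answers by a random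
value. -/
noncomputable def transcript (n : ℕ) (C : Circuit) (ρ : List F) (y : F) (g : ℕ → ℕ → F[X]) :
    List (Event F) :=
  .received y :: (List.range C.depth).flatMap fun i => (List.range (C.arity n i + 1)).flatMap
    fun k => ((List.range (C.msgDegree n i k + 1)).map fun e => .received ((g i k).coeff e)) ++
      [.sent (C.coin n ρ i k)]

/-- The value claimed before round `k` for layer `i`. -/
noncomputable def claim (n : ℕ) (C : Circuit) (ρ : List F) (y : F) (g : ℕ → ℕ → F[X]) :
    ℕ → ℕ → F
  | i, k + 1 => (g i k).eval (C.coin n ρ i k)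
  | 0, 0 => y
  | i + 1, 0 => (g i (C.arity n i)).eval (C.coin n ρ i (C.arity n i))

/-- The checks of the verifier: in each round of a sum-check protocol, the polynomial sent sums to
the claimed value; the last claim of a sum-check protocol agrees with the values that the
polynomial `h` sent afterwards gives for the extension at `ω₁` and `ω₂`; and the final claim agrees
with the multilinear extension of the input. -/
def Accepts (n : ℕ) (C : Circuit) (a : ℕ → F) (ρ : List F) (y : F) (g : ℕ → ℕ → F[X]) : Prop :=
  (∀ i < C.depth,
    (∀ k < C.arity n i, (g i k).eval 0 + (g i k).eval 1 = C.claim n ρ y g i k) ∧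
    C.claim n ρ y g i (C.arity n i) =
      beta (C.vars n i) (C.point n ρ i) (C.coin n ρ i) *
        (C.wiringExt n .add i (C.coin n ρ i) *
            ((g i (C.arity n i)).eval 0 + (g i (C.arity n i)).eval 1) +
          C.wiringExt n .mul i (C.coin n ρ i) *
            ((g i (C.arity n i)).eval 0 * (g i (C.arity n i)).eval 1))) ∧
  C.claim n ρ y g C.depth 0 = mle (C.vars n C.depth) a (C.point n ρ C.depth)

open Classical in
/-- The verifier's result: the claimed output, or `⊥`. -/
noncomputable def verdict (n : ℕ) (C : Circuit) (a : ℕ → F) (ρ : List F) (y : F)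
    (g : ℕ → ℕ → F[X]) : Option F :=
  if C.Accepts n a ρ y g then some y else none

end Protocol

end Circuit

/-!
The proof has an algebraic part, about the protocol, and a computational part, about the programs
that carry it out.

*The honest prover.* The wiring predicates are sums over gates, and a gate contributes the indicator
polynomial of the concatenation of its label with those of its in-neighbours. In a sum over the
Boolean values of the variables that are still free, this indicator kills all terms but one. Hence a
partial sum of the sum-check polynomial of a layer is a sum over the gates of the layer
(`Circuit.WellFormed.partialSum_eq`), and so is the message of a round
(`Circuit.WellFormed.honest_eq_sum`): gate `g` contributes the product of its weight, which is the
indicator of its label in the variables that are already bound, and of one entry from each of three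
tables, for `β`, for the left and for the right in-neighbour. The tables are multilinear extensions
in which the first variables have been replaced by the challenges (`fold`). After a challenge every
weight gets one more factor and one table is folded to half of its size. A layer with `w` gates, of
which the next one has `w'` gates, has `O(log S)` rounds and takes time `O((w + w') log S)`.
The restriction to a line is found in the same way by folding a table of polynomials: the tables
shrink geometrically while the degrees grow by one, so this costs `O(w' log w')`. Since
every width is used for two layers, the total is `O(S log S)` (`PName.layerTime_le`,
`PName.ht_prove`).

*The verifier.* The random values are independent of the messages, so they can all be drawn in the
preprocessing phase, and everything that depends only on them and on the circuit is computed before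
the stream is seen (`VName.ht_pre`). The circuit does not fit into the memory; the
transducer that describes it is simulated twice, with a hook that consumes its output symbol by
symbol, first to count the gates of each layer and then to add up the terms of the wiring predicates.
A computation that halts repeats no configuration, apart from the part of the output tape, which
bounds its time (`Transducer.Computes.exists_halt`). What is kept are the random values and `O(1)`
numbers for each layer, in space `O(d log S)`. In the online phase an update `(i, δ)` adds `δ` times
an indicator polynomial to the multilinear extension of the input (`mle_frequency`), and the
interaction takes constant time for each field element that is exchanged (`VName.ht_talk`).

*Soundness.* If the claimed output is false and all checks succeed, then in some round the
polynomial of the prover differs from the honest one and agrees with it at the challenge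
(`Circuit.WellFormed.exists_bad_round`). Both polynomials depend only on earlier challenges, so a
round is bad for at most its degree many values of its challenge (`card_filter_mem_le`). The degrees
sum up to at most `14 d log S`, which is less than a third of `100 d log S`
(`Circuit.WellFormed.soundness`).

*The programs.* Both programs are written in a small language with named arrays (`Prog`), whose
commands translate to those of the random access machine (`Prog.compile`, `PExec.compile`). The
predicate `HT` is a Hoare logic for total correctness with a time bound; bounds on the indices and
the words in use give the bounds on space and word size. Since machines are deterministic
(`Exec.deterministic`), a run constructed in this way is the only one, which transfers soundness from
the protocol to the machine.
-/

set_option linter.unusedSectionVars false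
set_option linter.unusedSimpArgs false

/-! ### A programming language with named arrays -/

/-- Names for the arrays of a program. The cell `k` of the array with name `r` is stored at the
address `64 * k + code r`, so that arrays of unknown lengths can grow side by side. -/
class Names (ν : Type) where
  /-- equality of names is decidable -/
  decEq : DecidableEq ν
  code : ν → ℕ
  code_lt : ∀ r, code r < 64
  code_inj : Function.Injective code

attribute [reducible, instance] Names.decEq

/-- A state in which both memories are collections of named arrays. -/
structure Memory (ν : Type) (F : Type*) where
  w : ν → ℕ → ℕ
  f : ν → ℕ → F
  coins : List F
  stream : UpdateStream F
  trace : List (Event F)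

/-- Word expressions over named arrays. -/
inductive WE (ν : Type) where
  | const (k : ℕ)
  | get (r : ν) (i : WE ν)
  | op (o : WOp) (a b : WE ν)
  | query (k a b : WE ν)

/-- Field expressions over named arrays. -/
inductive FE (ν : Type) where
  | zero
  | one
  | get (r : ν) (i : WE ν)
  | add (a b : FE ν)
  | sub (a b : FE ν)
  | mul (a b : FE ν)

/-- Tests over named arrays. -/
inductive TE (ν : Type) where
  | lt (a b : WE ν)
  | eq (a b : WE ν)
  | feq (a b : FE ν)
  | more

/-- Programs over named arrays. -/
inductive Prog (ν : Type) where
  | skip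
  | wset (r : ν) (i e : WE ν)
  | fset (r : ν) (i : WE ν) (e : FE ν)
  | sample (r : ν) (i : WE ν)
  | read (r q : ν)
  | send (e : FE ν)
  | recv (r : ν)
  | seq (p q : Prog ν)
  | cond (b : TE ν) (p q : Prog ν)
  | loop (b : TE ν) (p : Prog ν)

infixr:60 ";;" => Prog.seq

section Notation

variable {ν : Type}

instance (k : ℕ) : OfNat (WE ν) k := ⟨.const k⟩
instance : Add (WE ν) := ⟨.op .add⟩
instance : Sub (WE ν) := ⟨.op .sub⟩
instance : Mul (WE ν) := ⟨.op .mul⟩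
instance : Div (WE ν) := ⟨.op .div⟩
instance : Mod (WE ν) := ⟨.op .mod⟩
/-- A name stands for the first cell of its array, which serves as a scalar variable. -/
instance : Coe ν (WE ν) := ⟨fun r => .get r 0⟩
instance : Zero (FE ν) := ⟨.zero⟩
instance : One (FE ν) := ⟨.one⟩
instance : Add (FE ν) := ⟨.add⟩
instance : Sub (FE ν) := ⟨.sub⟩
instance : Mul (FE ν) := ⟨.mul⟩
instance : Coe ν (FE ν) := ⟨fun r => .get r 0⟩

/-- `for i = 0, …, x - 1`, where the bound `x` is a scalar variable. -/
def Prog.for_ (i x : ν) (p : Prog ν) : Prog ν :=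
  .wset i 0 0 ;; .loop (.lt i x) (p ;; .wset i 0 (i + 1))

end Notation

namespace Memory

variable {ν : Type} [Names ν] {F : Type*}

/-- Writes `x` into the cell `k` of the word array `r`. -/
def setW (h : Memory ν F) (r : ν) (k x : ℕ) : Memory ν F :=
  { h with w := fun r' k' => if r' = r ∧ k' = k then x else h.w r' k' }

/-- Writes `x` into the cell `k` of the field array `r`. -/
def setF (h : Memory ν F) (r : ν) (k : ℕ) (x : F) : Memory ν F :=
  { h with f := fun r' k' => if r' = r ∧ k' = k then x else h.f r' k' }

section
variable (h : Memory ν F) (r r' : ν) (k k' x : ℕ) (y : F)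
@[simp] theorem setW_w : (h.setW r k x).w r' k' = if r' = r ∧ k' = k then x else h.w r' k' := rfl
@[simp] theorem setW_f : (h.setW r k x).f = h.f := rfl
@[simp] theorem setW_coins : (h.setW r k x).coins = h.coins := rfl
@[simp] theorem setW_stream : (h.setW r k x).stream = h.stream := rfl
@[simp] theorem setW_trace : (h.setW r k x).trace = h.trace := rfl
@[simp] theorem setF_f : (h.setF r k y).f r' k' = if r' = r ∧ k' = k then y else h.f r' k' := rfl
@[simp] theorem setF_w : (h.setF r k y).w = h.w := rfl
@[simp] theorem setF_coins : (h.setF r k y).coins = h.coins := rfl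
@[simp] theorem setF_stream : (h.setF r k y).stream = h.stream := rfl
@[simp] theorem setF_trace : (h.setF r k y).trace = h.trace := rfl
end

/-- All words in memory are at most `B`. -/
def Bounded (h : Memory ν F) (B : ℕ) : Prop := ∀ r k, h.w r k ≤ B

theorem Bounded.setW {h : Memory ν F} {B : ℕ} (hB : h.Bounded B) (r : ν) (k : ℕ) {x : ℕ}
    (hx : x ≤ B) : (h.setW r k x).Bounded B := by
  intro r' k'
  rw [setW_w]
  split
  · exact hx
  · exact hB r' k'

/-- The address of a cell of a named array. -/
def cell (p : ν × ℕ) : ℕ := 64 * p.2 + Names.code p.1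

theorem cell_injective : Function.Injective (cell (ν := ν)) := by
  rintro ⟨r, k⟩ ⟨r', k'⟩ h
  have h1 := Names.code_lt r
  have h2 := Names.code_lt r'
  simp only [cell] at h
  have hk : k = k' := by omega
  subst hk
  have : r = r' := Names.code_inj (by omega)
  rw [this]

/-- The machine state that represents a collection of named arrays. -/
noncomputable def toState [Field F] (h : Memory ν F) : State F where
  w := Function.extend cell (fun p => h.w p.1 p.2) 0
  f := Function.extend cell (fun p => h.f p.1 p.2) 0
  coins := h.coins
  stream := h.stream
  trace := h.trace

variable [Field F] (h : Memory ν F)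

theorem toState_w (r : ν) (k : ℕ) : h.toState.w (64 * k + Names.code r) = h.w r k :=
  cell_injective.extend_apply (fun p : ν × ℕ => h.w p.1 p.2) 0 (r, k)

theorem toState_f (r : ν) (k : ℕ) : h.toState.f (64 * k + Names.code r) = h.f r k :=
  cell_injective.extend_apply (fun p : ν × ℕ => h.f p.1 p.2) 0 (r, k)

theorem extend_cell_update {X : Type*} (g : ν → ℕ → X) (z : ℕ → X) (r : ν) (k : ℕ) (x : X) :
    Function.extend cell (fun p : ν × ℕ => if p.1 = r ∧ p.2 = k then x else g p.1 p.2) z =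
      Function.update (Function.extend cell (fun p : ν × ℕ => g p.1 p.2) z)
        (64 * k + Names.code r) x := by
  funext a
  by_cases ha : ∃ p : ν × ℕ, cell p = a
  · obtain ⟨p, rfl⟩ := ha
    rw [cell_injective.extend_apply]
    by_cases hp : p = (r, k)
    · subst hp
      have : cell (r, k) = 64 * k + Names.code r := rfl
      simp [this]
    · have h1 : cell p ≠ 64 * k + Names.code r := fun h => hp (cell_injective h)
      have h2 : ¬ (p.1 = r ∧ p.2 = k) := fun h => hp (Prod.ext h.1 h.2)
      rw [Function.update_of_ne h1, cell_injective.extend_apply, if_neg h2]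
  · have h1 : a ≠ 64 * k + Names.code r := fun h => ha ⟨(r, k), h.symm⟩
    rw [Function.update_of_ne h1, Function.extend_apply' _ _ _ ha, Function.extend_apply' _ _ _ ha]

theorem toState_setW (r : ν) (k x : ℕ) : (h.setW r k x).toState =
    { h.toState with w := Function.update h.toState.w (64 * k + Names.code r) x } := by
  simp only [toState, setW]
  congr 1
  exact extend_cell_update h.w 0 r k x

theorem toState_setF (r : ν) (k : ℕ) (x : F) : (h.setF r k x).toState =
    { h.toState with f := Function.update h.toState.f (64 * k + Names.code r) x } := by
  simp only [toState, setF]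
  congr 1
  exact extend_cell_update h.f 0 r k x

theorem extend_cell_const {X : Type*} (z : X) :
    Function.extend (cell (ν := ν)) (fun _ => z) (fun _ => z) = fun _ => z := by
  funext a
  by_cases ha : ∃ p : ν × ℕ, cell p = a
  · obtain ⟨p, rfl⟩ := ha
    rw [cell_injective.extend_apply]
  · rw [Function.extend_apply' _ _ _ ha]

/-- The initial memory, with `n` in the first cell of the array with code `0`. -/
def initial (main : ν) (n : ℕ) (coins : List F) (A : UpdateStream F) : Memory ν F where
  w := fun r k => if r = main ∧ k = 0 then n else 0
  f := fun _ _ => 0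
  coins := coins
  stream := A
  trace := []

/-- A machine stores its input in the cell `0`, hence the condition on the code of `main`. -/
theorem toState_initial {main : ν} (hm : Names.code main = 0) (n : ℕ) (coins : List F)
    (A : UpdateStream F) : (initial main n coins A).toState = State.initial n coins A := by
  simp only [toState, initial, State.initial]
  congr 1
  · rw [extend_cell_update (fun _ _ => 0) 0 main 0 n, hm]
    exact congrArg (fun u : ℕ → ℕ => Function.update u 0 n) (extend_cell_const 0)
  · exact extend_cell_const 0

end Memory

/-- The environment of a program: a limit (if any) on the indices of the arrays, a bound on the
words in memory, the table that can be queried, and the values received from the other party. -/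
structure Env (F : Type*) where
  limit : Option ℕ
  bound : ℕ
  table : ℕ → ℕ → ℕ → ℕ
  table_le : ∀ k a b, table k a b ≤ bound
  answer : List (Event F) → F

attribute [simp] WOp.apply

section Semantics

variable {ν : Type} [Names ν] {F : Type*} [Field F]

/-- The index `k` respects the limit of the environment. -/
def Env.Idx (E : Env F) (k : ℕ) : Prop := ∀ l ∈ E.limit, k ≤ l

@[simp] theorem Env.idx_zero (E : Env F) : E.Idx 0 := fun _ _ => Nat.zero_le _

/-- The value of a word expression. -/
@[simp] def WE.val (E : Env F) (h : Memory ν F) : WE ν → ℕ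
  | .const k => k
  | .get r i => h.w r (i.val E h)
  | .op o a b => o.apply (a.val E h) (b.val E h)
  | .query k a b => E.table (k.val E h) (a.val E h) (b.val E h)

/-- All indices in an expression respect the limit of the environment. -/
@[simp] def WE.Ok (E : Env F) (h : Memory ν F) : WE ν → Prop
  | .const _ => True
  | .get _ i => i.Ok E h ∧ E.Idx (i.val E h)
  | .op _ a b => a.Ok E h ∧ b.Ok E h
  | .query k a b => k.Ok E h ∧ a.Ok E h ∧ b.Ok E h

/-- The value of a field expression. -/
@[simp] def FE.val (E : Env F) (h : Memory ν F) : FE ν → F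
  | .zero => 0
  | .one => 1
  | .get r i => h.f r (i.val E h)
  | .add a b => a.val E h + b.val E h
  | .sub a b => a.val E h - b.val E h
  | .mul a b => a.val E h * b.val E h

/-- All indices in an expression respect the limit of the environment. -/
@[simp] def FE.Ok (E : Env F) (h : Memory ν F) : FE ν → Prop
  | .zero => True
  | .one => True
  | .get _ i => i.Ok E h ∧ E.Idx (i.val E h)
  | .add a b => a.Ok E h ∧ b.Ok E h
  | .sub a b => a.Ok E h ∧ b.Ok E h
  | .mul a b => a.Ok E h ∧ b.Ok E h

/-- The outcome of a test. -/
@[simp] def TE.Holds (E : Env F) (h : Memory ν F) : TE ν → Prop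
  | .lt a b => a.val E h < b.val E h
  | .eq a b => a.val E h = b.val E h
  | .feq a b => a.val E h = b.val E h
  | .more => h.stream ≠ []

/-- All indices in a test respect the limit of the environment. -/
@[simp] def TE.Ok (E : Env F) (h : Memory ν F) : TE ν → Prop
  | .lt a b => a.Ok E h ∧ b.Ok E h
  | .eq a b => a.Ok E h ∧ b.Ok E h
  | .feq a b => a.Ok E h ∧ b.Ok E h
  | .more => True

section
variable (E : Env F) (h : Memory ν F) (a b : WE ν) (x y : FE ν)
@[simp] theorem WE.val_ofNat (k : ℕ) : (OfNat.ofNat k : WE ν).val E h = k := rfl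
@[simp] theorem WE.val_add : (a + b).val E h = a.val E h + b.val E h := rfl
@[simp] theorem WE.val_sub : (a - b).val E h = a.val E h - b.val E h := rfl
@[simp] theorem WE.val_mul : (a * b).val E h = a.val E h * b.val E h := rfl
@[simp] theorem WE.val_div : (a / b).val E h = a.val E h / b.val E h := rfl
@[simp] theorem WE.val_mod : (a % b).val E h = a.val E h % b.val E h := rfl
@[simp] theorem WE.ok_ofNat (k : ℕ) : (OfNat.ofNat k : WE ν).Ok E h := trivial
@[simp] theorem WE.ok_add : (a + b).Ok E h ↔ a.Ok E h ∧ b.Ok E h := Iff.rfl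
@[simp] theorem WE.ok_sub : (a - b).Ok E h ↔ a.Ok E h ∧ b.Ok E h := Iff.rfl
@[simp] theorem WE.ok_mul : (a * b).Ok E h ↔ a.Ok E h ∧ b.Ok E h := Iff.rfl
@[simp] theorem WE.ok_div : (a / b).Ok E h ↔ a.Ok E h ∧ b.Ok E h := Iff.rfl
@[simp] theorem WE.ok_mod : (a % b).Ok E h ↔ a.Ok E h ∧ b.Ok E h := Iff.rfl
@[simp] theorem FE.val_zero : (0 : FE ν).val E h = 0 := rfl
@[simp] theorem FE.val_one : (1 : FE ν).val E h = 1 := rfl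
@[simp] theorem FE.val_add : (x + y).val E h = x.val E h + y.val E h := rfl
@[simp] theorem FE.val_sub : (x - y).val E h = x.val E h - y.val E h := rfl
@[simp] theorem FE.val_mul : (x * y).val E h = x.val E h * y.val E h := rfl
@[simp] theorem FE.ok_zero : (0 : FE ν).Ok E h := trivial
@[simp] theorem FE.ok_one : (1 : FE ν).Ok E h := trivial
@[simp] theorem FE.ok_add : (x + y).Ok E h ↔ x.Ok E h ∧ y.Ok E h := Iff.rfl
@[simp] theorem FE.ok_sub : (x - y).Ok E h ↔ x.Ok E h ∧ y.Ok E h := Iff.rfl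
@[simp] theorem FE.ok_mul : (x * y).Ok E h ↔ x.Ok E h ∧ y.Ok E h := Iff.rfl
end

/-- The expression of the machine for a word expression: names are replaced by addresses. -/
def WE.compile : WE ν → WExpr
  | .const k => .const k
  | .get r i => .load (.op .add (.op .mul (.const 64) i.compile) (.const (Names.code r)))
  | .op o a b => .op o a.compile b.compile
  | .query k a b => .query k.compile a.compile b.compile

/-- The expression for the address of the cell of the array `r` with index `i`. -/
def WE.addr (r : ν) (i : WE ν) : WExpr :=
  .op .add (.op .mul (.const 64) i.compile) (.const (Names.code r))

/-- The expression of the machine for a field expression. -/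
def FE.compile : FE ν → FExpr
  | .zero => .zero
  | .one => .one
  | .get r i => .load (WE.addr r i)
  | .add a b => .add a.compile b.compile
  | .sub a b => .sub a.compile b.compile
  | .mul a b => .mul a.compile b.compile

/-- The test of the machine for a test over named arrays. -/
def TE.compile : TE ν → Test
  | .lt a b => .lt a.compile b.compile
  | .eq a b => .eq a.compile b.compile
  | .feq a b => .feq a.compile b.compile
  | .more => .more

/-- The program of the machine for a program over named arrays. -/
def Prog.compile : Prog ν → Cmd
  | .skip => .skip
  | .wset r i e => .wset (WE.addr r i) e.compile
  | .fset r i e => .fset (WE.addr r i) e.compile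
  | .sample r i => .sample (WE.addr r i)
  | .read r q => .read (WE.addr r 0) (WE.addr q 0)
  | .send e => .send e.compile
  | .recv r => .recv (WE.addr r 0)
  | .seq p q => .seq p.compile q.compile
  | .cond b p q => .cond b.compile p.compile q.compile
  | .loop b p => .loop b.compile p.compile

/-- A bound on all numbers that occur in the evaluation of an expression, if the words in memory are
at most `B`. -/
def WE.size (B : ℕ) : WE ν → ℕ
  | .const k => k
  | .get _ i => 64 * i.size B + B + 64
  | .op .mul a b => a.size B * b.size B + a.size B + b.size B
  | .op _ a b => a.size B + b.size B
  | .query k a b => k.size B + a.size B + b.size B + B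

/-- A bound on all words that occur in the evaluation of a field expression, that is, in the
computation of addresses. -/
def FE.size (B : ℕ) : FE ν → ℕ
  | .zero => 0
  | .one => 0
  | .get _ i => 64 * i.size B + 64
  | .add a b => a.size B + b.size B
  | .sub a b => a.size B + b.size B
  | .mul a b => a.size B + b.size B

/-- A bound on all words that occur in the evaluation of a test. -/
def TE.size (B : ℕ) : TE ν → ℕ
  | .lt a b => a.size B + b.size B
  | .eq a b => a.size B + b.size B
  | .feq a b => a.size B + b.size B
  | .more => 0

/-- A bound on all numbers that occur in the execution of a program, if the words in memory stay
below `B`. -/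
def Prog.size (B : ℕ) : Prog ν → ℕ
  | .skip => 0
  | .wset _ i e => 64 * i.size B + 64 + e.size B
  | .fset _ i e => 64 * i.size B + 64 + e.size B
  | .sample _ i => 64 * i.size B + 64
  | .read _ _ => B + 64
  | .send e => e.size B
  | .recv _ => 64
  | .seq p q => p.size B + q.size B
  | .cond b p q => b.size B + p.size B + q.size B
  | .loop b p => b.size B + p.size B

/-- A polynomial bound. -/
def PolyBounded (u : ℕ → ℕ) : Prop := ∃ e, ∀ B, 2 ≤ B → u B ≤ B ^ e

namespace PolyBounded

theorem const (k : ℕ) : PolyBounded fun _ => k :=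
  ⟨k, fun _ hB => (Nat.lt_pow_self hB).le⟩

theorem id : PolyBounded fun B => B := ⟨1, fun B _ => by simp⟩

theorem mul {u v : ℕ → ℕ} : PolyBounded u → PolyBounded v → PolyBounded fun B => u B * v B
  | ⟨e, he⟩, ⟨e', he'⟩ => ⟨e + e', fun B hB => by
      rw [pow_add]
      exact Nat.mul_le_mul (he B hB) (he' B hB)⟩

theorem add {u v : ℕ → ℕ} : PolyBounded u → PolyBounded v → PolyBounded fun B => u B + v B
  | ⟨e, he⟩, ⟨e', he'⟩ => ⟨e + e' + 1, fun B hB => by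
      have h1 : B ^ e ≤ B ^ (e + e') := Nat.pow_le_pow_right (by omega) (by omega)
      have h2 : B ^ e' ≤ B ^ (e + e') := Nat.pow_le_pow_right (by omega) (by omega)
      have h3 : B ^ (e + e') * 2 ≤ B ^ (e + e') * B := Nat.mul_le_mul_left _ hB
      have h4 := he B hB
      have h5 := he' B hB
      have h6 : B ^ (e + e' + 1) = B ^ (e + e') * B := pow_succ _ _
      change u B + v B ≤ _
      omega⟩

end PolyBounded

theorem WE.polyBounded_size (e : WE ν) : PolyBounded fun B => e.size B := by
  induction e with
  | const k => exact PolyBounded.const k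
  | get r i hi => exact ((PolyBounded.const 64).mul hi).add PolyBounded.id |>.add (PolyBounded.const 64)
  | op o a b ha hb =>
    cases o
    case mul => exact ((ha.mul hb).add ha).add hb
    all_goals exact ha.add hb
  | query k a b hk ha hb => exact ((hk.add ha).add hb).add PolyBounded.id

theorem FE.polyBounded_size (e : FE ν) : PolyBounded fun B => e.size B := by
  induction e with
  | zero => exact PolyBounded.const 0
  | one => exact PolyBounded.const 0
  | get r i => exact ((PolyBounded.const 64).mul i.polyBounded_size).add (PolyBounded.const 64)
  | add a b ha hb => exact ha.add hb
  | sub a b ha hb => exact ha.add hb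
  | mul a b ha hb => exact ha.add hb

theorem TE.polyBounded_size (e : TE ν) : PolyBounded fun B => e.size B := by
  cases e with
  | lt a b => exact a.polyBounded_size.add b.polyBounded_size
  | eq a b => exact a.polyBounded_size.add b.polyBounded_size
  | feq a b => exact a.polyBounded_size.add b.polyBounded_size
  | more => exact .const 0

/-- The program is fixed while the bound `B` on the words in memory grows, so words of `O(log B)`
bits suffice for all intermediate results. -/
theorem Prog.polyBounded_size (p : Prog ν) : PolyBounded fun B => p.size B := by
  induction p with
  | skip => exact PolyBounded.const 0
  | wset r i e =>
    exact (((PolyBounded.const 64).mul i.polyBounded_size).add (PolyBounded.const 64)).add e.polyBounded_size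
  | fset r i e =>
    exact (((PolyBounded.const 64).mul i.polyBounded_size).add (PolyBounded.const 64)).add e.polyBounded_size
  | sample r i => exact ((PolyBounded.const 64).mul i.polyBounded_size).add (PolyBounded.const 64)
  | read r q => exact PolyBounded.id.add (PolyBounded.const 64)
  | send e => exact e.polyBounded_size
  | recv r => exact PolyBounded.const 64
  | seq p q hp hq => exact hp.add hq
  | cond b p q hp hq => exact (b.polyBounded_size.add hp).add hq
  | loop b p hp => exact b.polyBounded_size.add hp

/-- The machine `M` provides the environment `E`. Without a limit on the indices, all words of the
machine are addresses. -/
structure Env.Models (E : Env F) (M : Machine F) : Prop where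
  table : M.table = E.table
  answer : M.answer = E.answer
  mem : ∀ l ∈ E.limit, 64 * (l + 1) ≤ M.mem
  word : E.limit = none → M.word ≤ M.mem

theorem Env.Models.address_lt {E : Env F} {M : Machine F} (hM : E.Models M) (r : ν) {k : ℕ}
    (hk : E.Idx k) (hw : 64 * k + 64 < M.word) : 64 * k + Names.code r < M.mem := by
  have hr := Names.code_lt r
  rcases h : E.limit with _ | l
  · have := hM.word h
    omega
  · have h1 := hM.mem l h
    have h2 := hk l h
    omega

theorem WE.val_le_size {E : Env F} {h : Memory ν F} (hB : h.Bounded E.bound) (e : WE ν) :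
    e.val E h ≤ e.size E.bound := by
  induction e with
  | const k => exact le_rfl
  | get r i hi =>
    have := hB r (i.val E h)
    simp only [val, size]
    omega
  | op o a b ha hb =>
    cases o
    case add => exact Nat.add_le_add ha hb
    case sub => simp only [val, size, WOp.apply]; omega
    case mul =>
      simp only [val, size, WOp.apply]
      have := Nat.mul_le_mul ha hb
      omega
    case div =>
      simp only [val, size, WOp.apply]
      have := Nat.div_le_self (a.val E h) (b.val E h)
      omega
    case mod =>
      simp only [val, size, WOp.apply]
      have := Nat.mod_le (a.val E h) (b.val E h)
      omega
  | query k a b hk ha hb =>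
    have := E.table_le (k.val E h) (a.val E h) (b.val E h)
    simp only [val, size]
    omega

theorem WE.val_compile {E : Env F} {M : Machine F} (hM : E.Models M) (h : Memory ν F) (e : WE ν) :
    e.compile.val M h.toState = e.val E h := by
  induction e with
  | const k => rfl
  | get r i hi =>
    simp only [compile, WExpr.val, val, hi, WOp.apply]
    exact h.toState_w r _
  | op o a b ha hb => simp only [compile, WExpr.val, val, ha, hb]
  | query k a b hk ha hb => simp only [compile, WExpr.val, val, hk, ha, hb, hM.table]

theorem WE.val_addr {E : Env F} {M : Machine F} (hM : E.Models M) (h : Memory ν F) (r : ν)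
    (i : WE ν) : (WE.addr r i).val M h.toState = 64 * i.val E h + Names.code r := by
  simp only [addr, WExpr.val, WE.val_compile hM, WOp.apply]

theorem WE.fits_compile {E : Env F} {M : Machine F} (hM : E.Models M) {h : Memory ν F}
    (hB : h.Bounded E.bound) (e : WE ν) (he : e.Ok E h) (hs : e.size E.bound < M.word) :
    e.compile.Fits M h.toState := by
  induction e with
  | const k => exact hs
  | get r i hi =>
    simp only [size] at hs
    have h1 := i.val_le_size hB
    have h2 := Names.code_lt r
    have h3 := hM.address_lt r he.2 (by omega)
    have h4 := hi he.1 (by omega)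
    simp only [compile, WExpr.Fits, WExpr.val, WE.val_compile hM, WOp.apply]
    refine ⟨⟨⟨?_, h4, ?_⟩, ?_, ?_⟩, h3⟩ <;> omega
  | op o a b ha hb =>
    have h0 := (WE.op o a b).val_le_size hB
    have h1 : a.size E.bound + b.size E.bound ≤ (WE.op o a b).size E.bound := by
      cases o <;> simp only [size] <;> omega
    refine ⟨ha he.1 (by omega), hb he.2 (by omega), ?_⟩
    rw [WE.val_compile hM, WE.val_compile hM]
    simp only [val] at h0
    omega
  | query k a b hk ha hb =>
    simp only [size] at hs
    refine ⟨hk he.1 (by omega), ha he.2.1 (by omega), hb he.2.2 (by omega), ?_⟩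
    rw [hM.table]
    have := E.table_le (k.compile.val M h.toState) (a.compile.val M h.toState)
      (b.compile.val M h.toState)
    omega

theorem WE.fits_addr {E : Env F} {M : Machine F} (hM : E.Models M) {h : Memory ν F}
    (hB : h.Bounded E.bound) (r : ν) (i : WE ν) (hi : i.Ok E h) (hx : E.Idx (i.val E h))
    (hs : 64 * i.size E.bound + 64 < M.word) :
    (WE.addr r i).Fits M h.toState ∧ (WE.addr r i).val M h.toState < M.mem := by
  have h1 := i.val_le_size hB
  have h2 := Names.code_lt r
  have h3 := hM.address_lt r hx (by omega)
  have h4 := i.fits_compile hM hB hi (by omega)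
  rw [WE.val_addr hM]
  simp only [addr, WExpr.Fits, WExpr.val, WE.val_compile hM, WOp.apply]
  refine ⟨⟨⟨?_, h4, ?_⟩, ?_, ?_⟩, h3⟩ <;> omega

theorem FE.val_compile {E : Env F} {M : Machine F} (hM : E.Models M) (h : Memory ν F) (e : FE ν) :
    e.compile.val M h.toState = e.val E h := by
  induction e with
  | zero => rfl
  | one => rfl
  | get r i =>
    simp only [compile, FExpr.val, val, WE.val_addr hM]
    exact h.toState_f r _
  | add a b ha hb => simp only [compile, FExpr.val, val, ha, hb]
  | sub a b ha hb => simp only [compile, FExpr.val, val, ha, hb]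
  | mul a b ha hb => simp only [compile, FExpr.val, val, ha, hb]

theorem FE.fits_compile {E : Env F} {M : Machine F} (hM : E.Models M) {h : Memory ν F}
    (hB : h.Bounded E.bound) (e : FE ν) (he : e.Ok E h) (hs : e.size E.bound < M.word) :
    e.compile.Fits M h.toState := by
  induction e with
  | zero => trivial
  | one => trivial
  | get r i => exact WE.fits_addr hM hB r i he.1 he.2 hs
  | add a b ha hb =>
    simp only [size] at hs
    exact ⟨ha he.1 (by omega), hb he.2 (by omega)⟩
  | sub a b ha hb =>
    simp only [size] at hs
    exact ⟨ha he.1 (by omega), hb he.2 (by omega)⟩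
  | mul a b ha hb =>
    simp only [size] at hs
    exact ⟨ha he.1 (by omega), hb he.2 (by omega)⟩

theorem TE.holds_compile {E : Env F} {M : Machine F} (hM : E.Models M) (h : Memory ν F)
    (b : TE ν) : b.compile.Holds M h.toState ↔ b.Holds E h := by
  cases b with
  | lt a b => simp only [compile, Test.Holds, Holds, WE.val_compile hM]
  | eq a b => simp only [compile, Test.Holds, Holds, WE.val_compile hM]
  | feq a b => simp only [compile, Test.Holds, Holds, FE.val_compile hM]
  | more => rfl

theorem TE.fits_compile {E : Env F} {M : Machine F} (hM : E.Models M) {h : Memory ν F}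
    (hB : h.Bounded E.bound) (b : TE ν) (hb : b.Ok E h) (hs : b.size E.bound < M.word) :
    b.compile.Fits M h.toState := by
  cases b with
  | lt a b =>
    simp only [size] at hs
    exact ⟨a.fits_compile hM hB hb.1 (by omega), b.fits_compile hM hB hb.2 (by omega)⟩
  | eq a b =>
    simp only [size] at hs
    exact ⟨a.fits_compile hM hB hb.1 (by omega), b.fits_compile hM hB hb.2 (by omega)⟩
  | feq a b =>
    simp only [size] at hs
    exact ⟨a.fits_compile hM hB hb.1 (by omega), b.fits_compile hM hB hb.2 (by omega)⟩
  | more => trivial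

/-- Execution of a program over named arrays, in the same time as its compiled form. Values that are
stored must respect the bound of the environment, and indices must respect its limit. -/
inductive PExec (E : Env F) : Prog ν → Memory ν F → ℕ → Memory ν F → Prop
  | skip (h : Memory ν F) : PExec E .skip h 1 h
  | wset (h : Memory ν F) (r : ν) (i e : WE ν) (hi : i.Ok E h) (hx : E.Idx (i.val E h))
      (he : e.Ok E h) (hv : e.val E h ≤ E.bound) :
      PExec E (.wset r i e) h ((WE.addr r i).cost + e.compile.cost + 1)
        (h.setW r (i.val E h) (e.val E h))
  | fset (h : Memory ν F) (r : ν) (i : WE ν) (e : FE ν) (hi : i.Ok E h) (hx : E.Idx (i.val E h))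
      (he : e.Ok E h) :
      PExec E (.fset r i e) h ((WE.addr r i).cost + e.compile.cost + 1)
        (h.setF r (i.val E h) (e.val E h))
  | sample (h : Memory ν F) (r : ν) (i : WE ν) (x : F) (l : List F) (hi : i.Ok E h)
      (hx : E.Idx (i.val E h)) (hl : h.coins = x :: l) :
      PExec E (.sample r i) h ((WE.addr r i).cost + 1)
        { h.setF r (i.val E h) x with coins := l }
  | read (h : Memory ν F) (r q : ν) (i : ℕ) (x : F) (l : UpdateStream F)
      (hl : h.stream = (i, x) :: l) (hi : i ≤ E.bound) :
      PExec E (.read r q) h ((WE.addr r 0).cost + (WE.addr q 0).cost + 1)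
        { (h.setW r 0 i).setF q 0 x with stream := l }
  | send (h : Memory ν F) (e : FE ν) (he : e.Ok E h) :
      PExec E (.send e) h (e.compile.cost + 1) { h with trace := h.trace ++ [.sent (e.val E h)] }
  | recv (h : Memory ν F) (r : ν) :
      PExec E (.recv r) h ((WE.addr r 0).cost + 1)
        { h.setF r 0 (E.answer h.trace) with
          trace := h.trace ++ [.received (E.answer h.trace)] }
  | seq {h h' h'' : Memory ν F} {p q : Prog ν} {t t' : ℕ} (hp : PExec E p h t h')
      (hq : PExec E q h' t' h'') : PExec E (p ;; q) h (t + t') h''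
  | condTrue {h h' : Memory ν F} {b : TE ν} {p q : Prog ν} {t : ℕ} (ho : b.Ok E h)
      (hb : b.Holds E h) (hp : PExec E p h t h') :
      PExec E (.cond b p q) h (b.compile.cost + t) h'
  | condFalse {h h' : Memory ν F} {b : TE ν} {p q : Prog ν} {t : ℕ} (ho : b.Ok E h)
      (hb : ¬ b.Holds E h) (hq : PExec E q h t h') :
      PExec E (.cond b p q) h (b.compile.cost + t) h'
  | loopTrue {h h' h'' : Memory ν F} {b : TE ν} {p : Prog ν} {t t' : ℕ} (ho : b.Ok E h)
      (hb : b.Holds E h) (hp : PExec E p h t h') (hl : PExec E (.loop b p) h' t' h'') :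
      PExec E (.loop b p) h (b.compile.cost + t + t') h''
  | loopFalse {h : Memory ν F} {b : TE ν} {p : Prog ν} (ho : b.Ok E h) (hb : ¬ b.Holds E h) :
      PExec E (.loop b p) h b.compile.cost h

/-- The bound on the words in memory is an invariant, since `PExec` demands it of all values that
are stored. -/
theorem PExec.bounded {E : Env F} {p : Prog ν} {h h' : Memory ν F} {t : ℕ} (H : PExec E p h t h') :
    h.Bounded E.bound → h'.Bounded E.bound := by
  induction H with
  | skip => exact fun h => h
  | wset h r i e hi hx he hv => exact fun hB => hB.setW _ _ hv
  | fset => exact fun hB => hB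
  | sample => exact fun hB => hB
  | read h r q i x l hl hi => exact fun hB => hB.setW r 0 hi
  | send => exact fun hB => hB
  | recv => exact fun hB => hB
  | seq _ _ h1 h2 => exact fun hB => h2 (h1 hB)
  | condTrue _ _ _ h1 => exact h1
  | condFalse _ _ _ h1 => exact h1
  | loopTrue _ _ _ _ h1 h2 => exact fun hB => h2 (h1 hB)
  | loopFalse => exact fun hB => hB

theorem Exec.congr_state {M : Machine F} {c : Cmd} {s s₁ s₂ : State F} {t : ℕ}
    (h : Exec M c s t s₁) (e : s₁ = s₂) : Exec M c s t s₂ := e ▸ h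

/-- The compiled program does what the program over named arrays does, in the same time. -/
theorem PExec.compile {E : Env F} {M : Machine F} (hM : E.Models M) {p : Prog ν}
    {h h' : Memory ν F} {t : ℕ} (H : PExec E p h t h') : h.Bounded E.bound →
    p.size E.bound < M.word → Exec M p.compile h.toState t h'.toState := by
  have h0 : ∀ {B : ℕ}, (0 : WE ν).size B = 0 := rfl
  induction H with
  | skip h => exact fun _ _ => .skip _
  | wset h r i e hi hx he hv =>
    intro hB hs
    simp only [Prog.size] at hs
    obtain ⟨h1, h2⟩ := WE.fits_addr hM hB r i hi hx (by omega)
    have h3 := Exec.wset (M := M) h.toState _ _ h1 h2 (e.fits_compile hM hB he (by omega))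
    rwa [WE.val_addr hM, WE.val_compile hM, ← Memory.toState_setW] at h3
  | fset h r i e hi hx he =>
    intro hB hs
    simp only [Prog.size] at hs
    obtain ⟨h1, h2⟩ := WE.fits_addr hM hB r i hi hx (by omega)
    have h3 := Exec.fset (M := M) h.toState _ _ h1 h2 (e.fits_compile hM hB he (by omega))
    rwa [WE.val_addr hM, FE.val_compile hM, ← Memory.toState_setF] at h3
  | sample h r i x l hi hx hl =>
    intro hB hs
    simp only [Prog.size] at hs
    obtain ⟨h1, h2⟩ := WE.fits_addr hM hB r i hi hx (by omega)
    have h3 := Exec.sample (M := M) h.toState _ x l h1 h2 hl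
    rw [WE.val_addr hM] at h3
    have h4 := congrArg (fun s : State F => { s with coins := l })
      (Memory.toState_setF h r (i.val E h) x)
    exact h3.congr_state h4.symm
  | read h r q i x l hl hi =>
    intro hB hs
    simp only [Prog.size] at hs
    obtain ⟨h1, h2⟩ := WE.fits_addr hM hB r 0 trivial E.idx_zero (by rw [h0]; omega)
    obtain ⟨h3, h4⟩ := WE.fits_addr hM hB q 0 trivial E.idx_zero (by rw [h0]; omega)
    have h5 := Exec.read (M := M) h.toState _ _ i x l h1 h2 h3 h4 hl (by omega)
    rw [WE.val_addr hM, WE.val_addr hM] at h5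
    have h6 := congrArg (fun s : State F => { s with stream := l })
      ((Memory.toState_setF (h.setW r 0 i) q 0 x).trans
        (congrArg (fun s : State F => { s with
            f := Function.update s.f (64 * 0 + Names.code q) x })
          (Memory.toState_setW h r 0 i)))
    exact h5.congr_state h6.symm
  | send h e he =>
    intro hB hs
    have h1 := Exec.send (M := M) h.toState _ (e.fits_compile hM hB he hs)
    rw [FE.val_compile hM] at h1
    exact h1
  | recv h r =>
    intro hB hs
    simp only [Prog.size] at hs
    obtain ⟨h1, h2⟩ := WE.fits_addr hM hB r 0 trivial E.idx_zero (by rw [h0]; omega)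
    have h3 := Exec.recv (M := M) h.toState _ h1 h2
    rw [WE.val_addr hM, hM.answer] at h3
    have h4 := congrArg (fun s : State F => { s with
        trace := h.trace ++ [Event.received (E.answer h.trace)] })
      (Memory.toState_setF h r 0 (E.answer h.trace))
    exact h3.congr_state h4.symm
  | seq hp hq h1 h2 =>
    intro hB hs
    simp only [Prog.size] at hs
    exact .seq (h1 hB (by omega)) (h2 (hp.bounded hB) (by omega))
  | condTrue ho hb hp h1 =>
    intro hB hs
    simp only [Prog.size] at hs
    exact .condTrue (TE.fits_compile hM hB _ ho (by omega)) ((TE.holds_compile hM _ _).2 hb)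
      (h1 hB (by omega))
  | condFalse ho hb hp h1 =>
    intro hB hs
    simp only [Prog.size] at hs
    exact .condFalse (TE.fits_compile hM hB _ ho (by omega))
      (fun hh => hb ((TE.holds_compile hM _ _).1 hh)) (h1 hB (by omega))
  | loopTrue ho hb hp hl h1 h2 =>
    intro hB hs
    have hs' := hs
    simp only [Prog.size] at hs
    exact .loopTrue (TE.fits_compile hM hB _ ho (by omega)) ((TE.holds_compile hM _ _).2 hb)
      (h1 hB (by omega)) (h2 (hp.bounded hB) hs')
  | loopFalse ho hb =>
    intro hB hs
    simp only [Prog.size] at hs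
    exact .loopFalse (TE.fits_compile hM hB _ ho (by omega))
      (fun hh => hb ((TE.holds_compile hM _ _).1 hh))

/-! ### Rules for reasoning about programs -/

/-- The names of the word arrays that a program may modify. -/
@[simp] def Prog.wmods : Prog ν → List ν
  | .wset r _ _ => [r]
  | .read r _ => [r]
  | .seq p q => p.wmods ++ q.wmods
  | .cond _ p q => p.wmods ++ q.wmods
  | .loop _ p => p.wmods
  | _ => []

/-- The names of the field arrays that a program may modify. -/
@[simp] def Prog.fmods : Prog ν → List ν
  | .fset r _ _ => [r]
  | .sample r _ => [r]
  | .read _ q => [q]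
  | .recv r => [r]
  | .seq p q => p.fmods ++ q.fmods
  | .cond _ p q => p.fmods ++ q.fmods
  | .loop _ p => p.fmods
  | _ => []

/-- Whether a program draws random values. -/
@[simp] def Prog.samples : Prog ν → Bool
  | .sample _ _ => true
  | .seq p q => p.samples || q.samples
  | .cond _ p q => p.samples || q.samples
  | .loop _ p => p.samples
  | _ => false

/-- Whether a program reads from the stream. -/
@[simp] def Prog.reads : Prog ν → Bool
  | .read _ _ => true
  | .seq p q => p.reads || q.reads
  | .cond _ p q => p.reads || q.reads
  | .loop _ p => p.reads
  | _ => false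

/-- Whether a program sends or receives messages. -/
@[simp] def Prog.talks : Prog ν → Bool
  | .send _ => true
  | .recv _ => true
  | .seq p q => p.talks || q.talks
  | .cond _ p q => p.talks || q.talks
  | .loop _ p => p.talks
  | _ => false

/-- The memory `h'` differs from `h` at most in what the program `p` may modify. -/
structure Frame (p : Prog ν) (h h' : Memory ν F) : Prop where
  w : ∀ r, r ∉ p.wmods → h'.w r = h.w r
  f : ∀ r, r ∉ p.fmods → h'.f r = h.f r
  coins : p.samples = false → h'.coins = h.coins
  stream : p.reads = false → h'.stream = h.stream
  trace : p.talks = false → h'.trace = h.trace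

theorem Frame.refl (p : Prog ν) (h : Memory ν F) : Frame p h h :=
  ⟨fun _ _ => rfl, fun _ _ => rfl, fun _ => rfl, fun _ => rfl, fun _ => rfl⟩

theorem Frame.trans {p : Prog ν} {h h' h'' : Memory ν F} (H : Frame p h h') (H' : Frame p h' h'') :
    Frame p h h'' :=
  ⟨fun r hr => (H'.w r hr).trans (H.w r hr), fun r hr => (H'.f r hr).trans (H.f r hr),
    fun hr => (H'.coins hr).trans (H.coins hr), fun hr => (H'.stream hr).trans (H.stream hr),
    fun hr => (H'.trace hr).trans (H.trace hr)⟩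

theorem Frame.seq_left {p : Prog ν} {h h' : Memory ν F} (H : Frame p h h') (q : Prog ν) :
    Frame (p ;; q) h h' := by
  constructor <;> simp +contextual [H.w, H.f, H.coins, H.stream, H.trace]

theorem Frame.seq_right {q : Prog ν} {h h' : Memory ν F} (H : Frame q h h') (p : Prog ν) :
    Frame (p ;; q) h h' := by
  constructor <;> simp +contextual [H.w, H.f, H.coins, H.stream, H.trace]

theorem Frame.loop {p : Prog ν} {h h' : Memory ν F} (H : Frame p h h') (b : TE ν) :
    Frame (.loop b p) h h' := ⟨H.w, H.f, H.coins, H.stream, H.trace⟩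

/-- The frame of an execution is read off from the text of the program; this is what makes it
cheap to carry facts about one array across the execution of a program that modifies others. -/
theorem PExec.frame {E : Env F} {p : Prog ν} {h h' : Memory ν F} {t : ℕ} (H : PExec E p h t h') :
    Frame p h h' := by
  induction H with
  | skip h => exact .refl _ _
  | wset h r i e =>
    refine ⟨fun r' hr => ?_, fun _ _ => rfl, fun _ => rfl, fun _ => rfl, fun _ => rfl⟩
    funext k
    have : r' ≠ r := by simpa using hr
    simp [this]
  | fset h r i e =>
    refine ⟨fun _ _ => rfl, fun r' hr => ?_, fun _ => rfl, fun _ => rfl, fun _ => rfl⟩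
    funext k
    have : r' ≠ r := by simpa using hr
    simp [this]
  | sample h r i x l =>
    refine ⟨fun _ _ => rfl, fun r' hr => ?_, fun h => by simp at h, fun _ => rfl, fun _ => rfl⟩
    funext k
    have : r' ≠ r := by simpa using hr
    simp [this]
  | read h r q i x l =>
    refine ⟨fun r' hr => ?_, fun r' hr => ?_, fun _ => rfl, fun h => by simp at h, fun _ => rfl⟩
    · funext k
      have : r' ≠ r := by simpa using hr
      simp [this]
    · funext k
      have : r' ≠ q := by simpa using hr
      simp [this]
  | send h e =>
    exact ⟨fun _ _ => rfl, fun _ _ => rfl, fun _ => rfl, fun _ => rfl, fun h => by simp at h⟩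
  | recv h r =>
    refine ⟨fun _ _ => rfl, fun r' hr => ?_, fun _ => rfl, fun _ => rfl, fun h => by simp at h⟩
    funext k
    have : r' ≠ r := by simpa using hr
    simp [this]
  | seq _ _ h1 h2 => exact (h1.seq_left _).trans (h2.seq_right _)
  | condTrue _ _ _ h1 =>
    constructor <;> simp +contextual [h1.w, h1.f, h1.coins, h1.stream, h1.trace]
  | condFalse _ _ _ h1 =>
    constructor <;> simp +contextual [h1.w, h1.f, h1.coins, h1.stream, h1.trace]
  | loopTrue _ _ _ _ h1 h2 => exact (h1.loop _).trans h2
  | loopFalse => exact .refl _ _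

/-- Total correctness with a time bound: started in a memory `h` whose words respect the bound of
the environment, the program `p` ends within time `T` in a memory that satisfies `Q`. -/
def HT (E : Env F) (p : Prog ν) (T : ℕ) (Q : Memory ν F → Prop) (h : Memory ν F) : Prop :=
  h.Bounded E.bound → ∃ t h', t ≤ T ∧ PExec E p h t h' ∧ Q h'

namespace HT

variable {E : Env F} {p q : Prog ν} {T T' : ℕ} {Q Q' R : Memory ν F → Prop} {h : Memory ν F}

/-- The consequence rule; the postcondition may be weakened using the frame of the program. -/
theorem mono (H : HT E p T Q h) (hT : T ≤ T')
    (hQ : ∀ h', Frame p h h' → h'.Bounded E.bound → Q h' → Q' h') : HT E p T' Q' h := fun hB =>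
  let ⟨t, h', ht, he, hq⟩ := H hB
  ⟨t, h', ht.trans hT, he, hQ h' he.frame (he.bounded hB) hq⟩

theorem time (H : HT E p T Q h) (hT : T ≤ T') : HT E p T' Q h :=
  H.mono hT fun _ _ _ hq => hq

/-- Sequential composition; the second program may rely on the frame of the first. -/
theorem seq (H : HT E p T R h)
    (H' : ∀ h', Frame p h h' → h'.Bounded E.bound → R h' → HT E q T' Q h') :
    HT E (p ;; q) (T + T') Q h := fun hB =>
  let ⟨t, h', ht, he, hr⟩ := H hB
  have hB' := he.bounded hB
  let ⟨t', h'', ht', he', hq⟩ := H' h' he.frame hB' hr hB'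
  ⟨t + t', h'', Nat.add_le_add ht ht', .seq he he', hq⟩

/-- The bound on the words in memory may be assumed. -/
theorem of_bounded (H : h.Bounded E.bound → HT E p T Q h) : HT E p T Q h := fun hB => H hB hB

/-- Sequential composition is associative. -/
theorem assoc {p₁ p₂ p₃ : Prog ν} (H : HT E ((p₁ ;; p₂) ;; p₃) T Q h) :
    HT E (p₁ ;; p₂ ;; p₃) T Q h := fun hB => by
  obtain ⟨t, h', ht, he, hq⟩ := H hB
  cases he with
  | seq h1 h2 =>
    cases h1 with
    | seq h3 h4 => exact ⟨_, h', by omega, .seq h3 (.seq h4 h2), hq⟩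

theorem cond {b : TE ν} (ho : b.Ok E h) (H : b.Holds E h → HT E p T Q h)
    (H' : ¬ b.Holds E h → HT E q T Q h) : HT E (.cond b p q) (b.compile.cost + T) Q h := fun hB => by
  by_cases hb : b.Holds E h
  · obtain ⟨t, h', ht, he, hq⟩ := H hb hB
    exact ⟨_, h', by omega, .condTrue ho hb he, hq⟩
  · obtain ⟨t, h', ht, he, hq⟩ := H' hb hB
    exact ⟨_, h', by omega, .condFalse ho hb he, hq⟩

end HT

/-- An upper bound for the time of a program without loops. -/
def Prog.cost : Prog ν → ℕ
  | .skip => 1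
  | .wset r i e => (WE.addr r i).cost + e.compile.cost + 1
  | .fset r i e => (WE.addr r i).cost + e.compile.cost + 1
  | .sample r i => (WE.addr r i).cost + 1
  | .read r q => (WE.addr r 0).cost + (WE.addr q 0).cost + 1
  | .send e => e.compile.cost + 1
  | .recv r => (WE.addr r 0).cost + 1
  | .seq p q => p.cost + q.cost
  | .cond b p q => b.compile.cost + max p.cost q.cost
  | .loop _ _ => 0

open Classical in
/-- The weakest precondition of a program without loops. -/
@[simp] def Prog.wp (E : Env F) : Prog ν → (Memory ν F → Prop) → Memory ν F → Prop
  | .skip, Q, h => Q h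
  | .wset r i e, Q, h => (i.Ok E h ∧ E.Idx (i.val E h)) ∧ (e.Ok E h ∧ e.val E h ≤ E.bound) ∧
      Q (h.setW r (i.val E h) (e.val E h))
  | .fset r i e, Q, h => (i.Ok E h ∧ E.Idx (i.val E h)) ∧ e.Ok E h ∧
      Q (h.setF r (i.val E h) (e.val E h))
  | .sample r i, Q, h => (i.Ok E h ∧ E.Idx (i.val E h)) ∧ ∃ x l, h.coins = x :: l ∧
      Q { h.setF r (i.val E h) x with coins := l }
  | .read r q, Q, h => ∃ i x l, h.stream = (i, x) :: l ∧ i ≤ E.bound ∧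
      Q { (h.setW r 0 i).setF q 0 x with stream := l }
  | .send e, Q, h => e.Ok E h ∧ Q { h with trace := h.trace ++ [.sent (e.val E h)] }
  | .recv r, Q, h => Q { h.setF r 0 (E.answer h.trace) with
      trace := h.trace ++ [.received (E.answer h.trace)] }
  | .seq p q, Q, h => p.wp E (q.wp E Q) h
  | .cond b p q, Q, h => b.Ok E h ∧ if b.Holds E h then p.wp E Q h else q.wp E Q h
  | .loop _ _, _, _ => False

theorem Prog.exists_of_wp {E : Env F} (p : Prog ν) {Q : Memory ν F → Prop} {h : Memory ν F}
    (H : p.wp E Q h) : ∃ t h', t ≤ p.cost ∧ PExec E p h t h' ∧ Q h' := by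
  induction p generalizing Q h with
  | skip => exact ⟨_, _, le_rfl, .skip _, H⟩
  | wset r i e =>
    obtain ⟨⟨h1, h2⟩, ⟨h3, h4⟩, h5⟩ := H
    exact ⟨_, _, le_rfl, .wset _ _ _ _ h1 h2 h3 h4, h5⟩
  | fset r i e =>
    obtain ⟨⟨h1, h2⟩, h3, h5⟩ := H
    exact ⟨_, _, le_rfl, .fset _ _ _ _ h1 h2 h3, h5⟩
  | sample r i =>
    obtain ⟨⟨h1, h2⟩, x, l, h3, h5⟩ := H
    exact ⟨_, _, le_rfl, .sample _ _ _ _ _ h1 h2 h3, h5⟩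
  | read r q =>
    obtain ⟨i, x, l, h1, h2, h5⟩ := H
    exact ⟨_, _, le_rfl, .read _ _ _ _ _ _ h1 h2, h5⟩
  | send e => exact ⟨_, _, le_rfl, .send _ _ H.1, H.2⟩
  | recv r => exact ⟨_, _, le_rfl, .recv _ _, H⟩
  | seq p q hp hq =>
    obtain ⟨t, h', ht, he, hr⟩ := hp H
    obtain ⟨t', h'', ht', he', hr'⟩ := hq hr
    exact ⟨_, _, Nat.add_le_add ht ht', .seq he he', hr'⟩
  | cond b p q hp hq =>
    obtain ⟨ho, H⟩ := H
    split at H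
    · obtain ⟨t, h', ht, he, hr⟩ := hp H
      exact ⟨_, _, Nat.add_le_add_left (ht.trans (le_max_left _ _)) _, .condTrue ho ‹_› he, hr⟩
    · obtain ⟨t, h', ht, he, hr⟩ := hq H
      exact ⟨_, _, Nat.add_le_add_left (ht.trans (le_max_right _ _)) _, .condFalse ho ‹_› he, hr⟩
  | loop b p => exact H.elim

namespace HT

variable {E : Env F} {p q : Prog ν} {T T' : ℕ} {Q Q' R : Memory ν F → Prop} {h : Memory ν F}

/-- A program without loops satisfies its specification if its weakest precondition holds; its
running time is computed from its text. -/
theorem block (H : h.Bounded E.bound → p.wp E Q h) (hT : p.cost ≤ T) : HT E p T Q h := fun hB =>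
  let ⟨t, h', ht, he, hq⟩ := p.exists_of_wp (H hB)
  ⟨t, h', ht.trans hT, he, hq⟩

/-- A loop that is executed `m` times, with invariant `I k` before round `k`. -/
theorem loop {b : TE ν} {T : ℕ → ℕ} (m : ℕ) (I : ℕ → Memory ν F → Prop) (h0 : I 0 h)
    (ho : ∀ k ≤ m, ∀ h', Frame p h h' → h'.Bounded E.bound → I k h' →
      b.Ok E h' ∧ (b.Holds E h' ↔ k < m))
    (hs : ∀ k < m, ∀ h', Frame p h h' → h'.Bounded E.bound → I k h' →
      HT E p (T k) (I (k + 1)) h') :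
    HT E (.loop b p) (∑ k ∈ Finset.range m, (T k + b.compile.cost) + b.compile.cost) (I m) h := by
  suffices H : ∀ j ≤ m, ∀ h', Frame p h h' → I (m - j) h' → HT E (.loop b p)
      (∑ k ∈ Finset.Ico (m - j) m, (T k + b.compile.cost) + b.compile.cost) (I m) h' by
    have := H m le_rfl h (.refl _ _) (by simpa using h0)
    simpa using this
  intro j
  -- induction on the number `j` of the remaining rounds
  induction j with
  | zero =>
    intro _ h' hf hI hB
    obtain ⟨h1, h2⟩ := ho m le_rfl h' hf hB hI
    exact ⟨_, h', by simp, .loopFalse h1 fun hh => lt_irrefl _ (h2.1 hh), hI⟩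
  | succ j ih =>
    intro hj h' hf hI hB
    obtain ⟨h1, h2⟩ := ho _ (Nat.sub_le _ _) h' hf hB hI
    have hlt : m - (j + 1) < m := by omega
    obtain ⟨t, h'', ht, he, hq⟩ := hs _ hlt h' hf hB hI hB
    have e1 : m - (j + 1) + 1 = m - j := by omega
    rw [e1] at hq
    obtain ⟨t', h3, ht', he', hq'⟩ := ih (by omega) h'' (hf.trans he.frame) hq (he.bounded hB)
    refine ⟨_, h3, ?_, .loopTrue h1 (h2.2 hlt) he he', hq'⟩
    rw [Finset.sum_eq_sum_Ico_succ_bot hlt, e1]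
    omega

/-- The rule for counting loops, where `I k` holds before round `k`, and does not depend on the
counter. The constant `40` covers the initialisation, the test and the increment of the counter.
-/
theorem for_ {i x : ν} {T : ℕ → ℕ} (m : ℕ) (I : ℕ → Memory ν F → Prop) (hm : h.w x 0 = m)
    (hx : x ∉ p.wmods) (hxi : x ≠ i) (hi : i ∉ p.wmods)
    (hI : ∀ k h v, I k h → I k (h.setW i 0 v)) (h0 : I 0 h)
    (hs : ∀ k < m, ∀ h', Frame (.for_ i x p) h h' → h'.Bounded E.bound → h'.w i 0 = k → I k h' →
      HT E p (T k) (I (k + 1)) h') :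
    HT E (.for_ i x p) (∑ k ∈ Finset.range m, (T k + 40) + 40) (I m) h := by
  refine of_bounded fun hB0 => ?_
  have hmB : m ≤ E.bound := hm ▸ hB0 x 0
  have key : HT E (.for_ i x p) (7 + (∑ k ∈ Finset.range m, (T k + 14 + 13) + 13))
      (fun h' => h'.w i 0 = m ∧ I m h') h := by
    have hc1 : (Prog.wset i 0 0 : Prog ν).cost = 7 := rfl
    refine seq (R := fun h' => h' = h.setW i 0 0) (block (fun _ => ?_) hc1.le) ?_
    · simp
    · rintro h' hf hB rfl
      refine loop m (fun k h' => h'.w i 0 = k ∧ I k h') ⟨by simp, hI 0 h 0 h0⟩ ?_ ?_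
      · rintro k hk h' hf' hB' ⟨hk', hI'⟩
        have : h'.w x 0 = m := by
          rw [hf'.w x (by simp [hx, hxi])]
          simp [hxi, hm]
        simp [hk', this]
      · rintro k hk h' hf' hB' ⟨hk', hI'⟩
        have hf'' : Frame (Prog.for_ i x p) h h' :=
          (hf.seq_left _).trans ((hf'.loop _).seq_right _)
        refine seq (hs k hk h' hf'' hB' hk' hI') (T' := 14) ?_
        intro h2 hf2 hB2 hI2
        have e : h2.w i 0 = k := by rw [hf2.w i hi, hk']
        have hc1 : (Prog.wset i 0 (i + 1) : Prog ν).cost = 14 := rfl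
        refine block (fun _ => ?_) hc1.le
        simp only [Prog.wp, Env.idx_zero, WE.Ok, WE.val, WOp.apply, e, and_self, true_and]
        exact ⟨by omega, by simp, hI _ _ _ hI2⟩
  refine key.mono ?_ fun h' _ _ hq => hq.2
  have : ∑ k ∈ Finset.range m, (T k + 14 + 13) ≤ ∑ k ∈ Finset.range m, (T k + 40) :=
    Finset.sum_le_sum fun k _ => by omega
  omega

/-- The loop rule with the same time bound for all rounds. -/
theorem for_const {i x : ν} {T : ℕ} (m : ℕ) (I : ℕ → Memory ν F → Prop) (hm : h.w x 0 = m)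
    (hx : x ∉ p.wmods) (hxi : x ≠ i) (hi : i ∉ p.wmods)
    (hI : ∀ k h v, I k h → I k (h.setW i 0 v)) (h0 : I 0 h)
    (hs : ∀ k < m, ∀ h', Frame (.for_ i x p) h h' → h'.Bounded E.bound → h'.w i 0 = k → I k h' →
      HT E p T (I (k + 1)) h') :
    HT E (.for_ i x p) (m * (T + 40) + 40) (I m) h :=
  (for_ m I hm hx hxi hi hI h0 hs (T := fun _ => T)).time (by simp)

/-- A program that satisfies its specification runs on every machine that provides the
environment. -/
theorem exec {M : Machine F} (H : HT E p T Q h) (hB : h.Bounded E.bound) (hM : E.Models M)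
    (hs : p.size E.bound < M.word) :
    ∃ t h', t ≤ T ∧ Exec M p.compile h.toState t h'.toState ∧ h'.Bounded E.bound ∧ Frame p h h' ∧
      Q h' :=
  let ⟨t, h', ht, he, hq⟩ := H hB
  ⟨t, h', ht, he.compile hM hB hs, he.bounded hB, he.frame, hq⟩

end HT

end Semantics

/-! ### Executions are deterministic -/

/-- A program has at most one result for given random values, stream and messages. Thus the
executions constructed for the programs of the two parties are the only ones. -/
theorem Exec.deterministic {F : Type*} [Field F] {M : Machine F} {p : Cmd} {s s₁ s₂ : State F}
    {t₁ t₂ : ℕ} (h₁ : Exec M p s t₁ s₁) (h₂ : Exec M p s t₂ s₂) : s₁ = s₂ := by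
  induction h₁ generalizing s₂ t₂ with
  | skip => cases h₂; rfl
  | wset => cases h₂; rfl
  | fset => cases h₂; rfl
  | sample s a x l ha hm hl =>
    cases h₂ with
    | sample _ _ x' l' _ _ hl' =>
      rw [hl] at hl'
      cases hl'
      rfl
  | read s a b i x l ha hma hb hmb hl hi =>
    cases h₂ with
    | read _ _ _ i' x' l' _ _ _ _ hl' _ =>
      rw [hl] at hl'
      cases hl'
      rfl
  | send => cases h₂; rfl
  | recv => cases h₂; rfl
  | seq _ _ ih₁ ih₂ =>
    cases h₂ with
    | seq h h' =>
      cases ih₁ h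
      exact ih₂ h'
  | condTrue hf hb hp ih =>
    cases h₂ with
    | condTrue _ _ h => exact ih h
    | condFalse _ hb' _ => exact absurd hb hb'
  | condFalse hf hb hp ih =>
    cases h₂ with
    | condTrue _ hb' _ => exact absurd hb' hb
    | condFalse _ _ h => exact ih h
  | loopTrue hf hb hp hl ih₁ ih₂ =>
    cases h₂ with
    | loopTrue _ _ h h' =>
      cases ih₁ h
      exact ih₂ h'
    | loopFalse _ hb' => exact absurd hb hb'
  | loopFalse hf hb =>
    cases h₂ with
    | loopTrue _ hb' _ _ => exact absurd hb' hb
    | loopFalse => rfl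


/-! ### Multilinear extensions -/

section Multilinear

variable {A B : Type*} [CommRing A] [CommRing B]

theorem sum_range_two_pow_succ (f : ℕ → A) (k : ℕ) :
    ∑ b ∈ Finset.range (2 ^ (k + 1)), f b =
      ∑ b ∈ Finset.range (2 ^ k), f b + ∑ b ∈ Finset.range (2 ^ k), f (2 ^ k + b) := by
  rw [pow_succ, mul_two, Finset.sum_range_add]

theorem sum_range_two_mul (f : ℕ → A) (m : ℕ) :
    ∑ b ∈ Finset.range (2 * m), f b = ∑ b ∈ Finset.range m, (f (2 * b) + f (2 * b + 1)) := by
  induction m with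
  | zero => simp
  | succ m ih =>
    rw [Nat.mul_succ, Finset.sum_range_succ, Finset.sum_range_succ, ih, Finset.sum_range_succ,
      add_assoc]

theorem chi_congr {v j j' : ℕ} {x x' : ℕ → A} (hj : ∀ k < v, j.testBit k = j'.testBit k)
    (hx : ∀ k < v, x k = x' k) : chi v j x = chi v j' x' :=
  Finset.prod_congr rfl fun k hk => by
    rw [hj k (Finset.mem_range.1 hk), hx k (Finset.mem_range.1 hk)]

theorem chi_zero (j : ℕ) (x : ℕ → A) : chi 0 j x = 1 := Finset.prod_range_zero _

theorem chi_succ (v j : ℕ) (x : ℕ → A) :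
    chi (v + 1) j x = chi v j x * if j.testBit v then x v else 1 - x v :=
  Finset.prod_range_succ _ _

theorem chi_succ_of_lt {v j : ℕ} (hj : j < 2 ^ v) (x : ℕ → A) :
    chi (v + 1) j x = chi v j x * (1 - x v) := by
  rw [chi_succ, Nat.testBit_lt_two_pow hj]
  rfl

theorem chi_succ_two_pow_add {v j : ℕ} (hj : j < 2 ^ v) (x : ℕ → A) :
    chi (v + 1) (2 ^ v + j) x = chi v j x * x v := by
  rw [chi_succ, Nat.testBit_two_pow_add_eq, Nat.testBit_lt_two_pow hj]
  congr 1
  exact chi_congr (fun k hk => Nat.testBit_two_pow_add_gt hk j) fun _ _ => rfl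

/-- The indicator polynomials of concatenated labels factor. -/
theorem chi_add {a j : ℕ} (hj : j < 2 ^ a) (b l : ℕ) (x : ℕ → A) :
    chi (a + b) (2 ^ a * l + j) x = chi a j x * chi b l fun k => x (a + k) := by
  simp only [chi, Finset.prod_range_add, Nat.testBit_two_pow_mul_add _ hj]
  congr 1
  · exact Finset.prod_congr rfl fun k hk => by simp [Finset.mem_range.1 hk]
  · exact Finset.prod_congr rfl fun k _ => by simp

theorem map_chi (φ : A →+* B) (v j : ℕ) (x : ℕ → A) : φ (chi v j x) = chi v j fun k => φ (x k) := by
  simp only [chi, map_prod, apply_ite φ, map_sub, map_one]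

theorem map_mle (φ : A →+* B) (v : ℕ) (V x : ℕ → A) :
    φ (mle v V x) = mle v (fun j => φ (V j)) fun k => φ (x k) := by
  simp only [mle, map_sum, map_mul, map_chi]

theorem map_beta (φ : A →+* B) (v : ℕ) (z p : ℕ → A) :
    φ (beta v z p) = beta v (fun k => φ (z k)) fun k => φ (p k) := by
  simp only [beta, map_prod, map_add, map_mul, map_sub, map_one]

theorem mle_congr {v : ℕ} {V V' x x' : ℕ → A} (hV : ∀ j, V j = V' j) (hx : ∀ k < v, x k = x' k) :
    mle v V x = mle v V' x' :=
  Finset.sum_congr rfl fun j _ => by rw [hV, chi_congr (fun _ _ => rfl) hx]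

theorem beta_congr {v : ℕ} {z z' p p' : ℕ → A} (hz : ∀ k < v, z k = z' k)
    (hp : ∀ k < v, p k = p' k) : beta v z p = beta v z' p' :=
  Finset.prod_congr rfl fun k hk => by
    rw [hz k (Finset.mem_range.1 hk), hp k (Finset.mem_range.1 hk)]

/-- The equality predicate at `(z, p)` is a multilinear extension in `p`, so that it can be
treated like the values of the gates. -/
theorem beta_eq_mle (v : ℕ) (z p : ℕ → A) : beta v z p = mle v (fun j => chi v j z) p := by
  induction v with
  | zero => simp [beta, mle, chi]
  | succ v ih =>
    have h1 : beta (v + 1) z p = beta v z p * (z v * p v + (1 - z v) * (1 - p v)) :=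
      Finset.prod_range_succ _ _
    have h2 : mle (v + 1) (fun j => chi (v + 1) j z) p =
      ∑ j ∈ Finset.range (2 ^ (v + 1)), chi (v + 1) j z * chi (v + 1) j p := rfl
    rw [h1, ih, h2, sum_range_two_pow_succ, ← Finset.sum_add_distrib, mle, Finset.sum_mul]
    refine Finset.sum_congr rfl fun j hj => ?_
    have hj := Finset.mem_range.1 hj
    rw [chi_succ_of_lt hj, chi_succ_of_lt hj, chi_succ_two_pow_add hj, chi_succ_two_pow_add hj]
    ring

/-- The table `T` of a function on `{0,1}^v` after its first `k` variables have been bound to the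
values `r 0, …, r (k - 1)`. -/
def fold (T r : ℕ → A) : ℕ → ℕ → A
  | 0, j => T j
  | k + 1, j => (1 - r k) * fold T r k (2 * j) + r k * fold T r k (2 * j + 1)

theorem fold_congr {T T' r r' : ℕ → A} (hT : ∀ j, T j = T' j) {k : ℕ} (hr : ∀ l < k, r l = r' l)
    (j : ℕ) : fold T r k j = fold T' r' k j := by
  induction k generalizing j with
  | zero => exact hT j
  | succ k ih =>
    have ih := ih fun l hl => hr l (by omega)
    rw [fold, fold, ih, ih, hr k (by omega)]

theorem map_fold (φ : A →+* B) (T r : ℕ → A) (k j : ℕ) :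
    φ (fold T r k j) = fold (fun j => φ (T j)) (fun l => φ (r l)) k j := by
  induction k generalizing j with
  | zero => rfl
  | succ k ih => simp only [fold, map_add, map_mul, map_sub, map_one, ih]

/-- Low bits are bound first: the entry `j` of the folded table collects the `2 ^ k` entries whose
labels agree with `j` above the first `k` bits. -/
theorem fold_eq_sum (T r : ℕ → A) (k j : ℕ) :
    fold T r k j = ∑ b ∈ Finset.range (2 ^ k), T (2 ^ k * j + b) * chi k b r := by
  induction k generalizing j with
  | zero => simp [fold, chi]
  | succ k ih =>
    rw [fold, ih, ih, sum_range_two_pow_succ, Finset.mul_sum, Finset.mul_sum]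
    congr 1
    · refine Finset.sum_congr rfl fun b hb => ?_
      rw [chi_succ_of_lt (Finset.mem_range.1 hb), show 2 ^ (k + 1) * j = 2 ^ k * (2 * j) by ring]
      ring
    · refine Finset.sum_congr rfl fun b hb => ?_
      rw [chi_succ_two_pow_add (Finset.mem_range.1 hb),
        show 2 ^ (k + 1) * j + (2 ^ k + b) = 2 ^ k * (2 * j + 1) + b by ring]
      ring

theorem fold_eq_mle (T r : ℕ → A) (v : ℕ) : fold T r v 0 = mle v T r := by
  simp [fold_eq_sum, mle]

/-- Binding variables to the bits of a label selects an entry of the table. -/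
theorem fold_of_bits (T r : ℕ → A) {q v : ℕ} (hq : q ≤ v) (j : ℕ)
    (hr : ∀ l, q ≤ l → l < v → r l = if j.testBit l then 1 else 0) :
    fold T r v (j / 2 ^ v) = fold T r q (j / 2 ^ q) := by
  induction v, hq using Nat.le_induction with
  | base => rfl
  | succ v hq ih =>
    rw [← ih fun l h1 h2 => hr l h1 (by omega), fold, hr v hq (by omega)]
    have h1 : j / 2 ^ (v + 1) = j / 2 ^ v / 2 := by rw [pow_succ, Nat.div_div_eq_div_mul]
    have h2 : j.testBit v = decide (j / 2 ^ v % 2 = 1) := by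
      rw [Nat.testBit_eq_decide_div_mod_eq]
    rw [h1, h2]
    by_cases hb : j / 2 ^ v % 2 = 1
    · simp only [hb, decide_true, if_true, sub_self, zero_mul, one_mul, zero_add]
      congr 1
      omega
    · simp only [hb, decide_false, Bool.false_eq_true, if_false, sub_zero, zero_mul, one_mul,
        add_zero]
      congr 1
      omega

theorem mle_of_bits (T r : ℕ → A) {q v : ℕ} (hq : q ≤ v) {j : ℕ} (hj : j < 2 ^ v)
    (hr : ∀ l, q ≤ l → l < v → r l = if j.testBit l then 1 else 0) :
    mle v T r = fold T r q (j / 2 ^ q) := by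
  rw [← fold_of_bits T r hq j hr, Nat.div_eq_of_lt hj, fold_eq_mle]

/-- Summing over the Boolean values of all variables but the first `q` selects the label. This is why
the honest prover needs no sum over exponentially many points: the indicator polynomial of the label of
a gate vanishes at all of them but one. -/
theorem sum_chi_mul {m q J : ℕ} (hq : q ≤ m) (hJ : J < 2 ^ m) (x : ℕ → A) (G : (ℕ → A) → A) :
    ∑ b ∈ Finset.range (2 ^ (m - q)),
      chi m J (fun l => if l < q then x l else if b.testBit (l - q) then 1 else 0) *
        G (fun l => if l < q then x l else if b.testBit (l - q) then 1 else 0) =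
    chi q J x * G (fun l => if l < q then x l else if J.testBit l then 1 else 0) := by
  have hlt : J / 2 ^ q < 2 ^ (m - q) := by
    rw [Nat.div_lt_iff_lt_mul (by positivity), ← pow_add]
    rwa [Nat.sub_add_cancel hq]
  have hbit : ∀ l, (J / 2 ^ q).testBit l = J.testBit (q + l) := fun l => by
    rw [Nat.testBit_div_two_pow, add_comm]
  have hfac : ∀ b : ℕ, chi m J (fun l => if l < q then x l else if b.testBit (l - q) then (1 : A) else 0) =
      chi q J x * ∏ l ∈ Finset.range (m - q),
        (if (J / 2 ^ q).testBit l = b.testBit l then (1 : A) else 0) := by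
    intro b
    obtain ⟨c, rfl⟩ := Nat.exists_eq_add_of_le hq
    rw [Nat.add_sub_cancel_left]
    simp only [chi, Finset.prod_range_add]
    congr 1
    · exact Finset.prod_congr rfl fun k hk => by simp [Finset.mem_range.1 hk]
    · refine Finset.prod_congr rfl fun k _ => ?_
      rw [hbit]
      cases J.testBit (q + k) <;> cases hb : b.testBit k <;> simp [hb]
  rw [Finset.sum_eq_single_of_mem _ (Finset.mem_range.2 hlt)]
  · rw [hfac]
    have : (fun l => if l < q then x l else if (J / 2 ^ q).testBit (l - q) then (1 : A) else 0) =
        fun l => if l < q then x l else if J.testBit l then 1 else 0 := by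
      funext l
      by_cases hl : l < q
      · simp [hl]
      · rw [hbit, Nat.add_sub_cancel' (by omega)]
    rw [this]
    simp
  · intro b hb hne
    have hb := Finset.mem_range.1 hb
    obtain ⟨l, hl⟩ : ∃ l, (J / 2 ^ q).testBit l ≠ b.testBit l := by
      by_contra! h
      exact hne (Nat.eq_of_testBit_eq fun l => (h l).symm)
    have hl' : l < m - q := by
      by_contra h
      have h1 : 2 ^ (m - q) ≤ 2 ^ l := Nat.pow_le_pow_right (by norm_num) (by omega)
      exact hl ((Nat.testBit_lt_two_pow (hlt.trans_le h1)).trans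
        (Nat.testBit_lt_two_pow (hb.trans_le h1)).symm)
    rw [hfac, Finset.prod_eq_zero (Finset.mem_range.2 hl') (by simp [hl]), mul_zero, zero_mul]

end Multilinear

/-! ### The polynomials of the sum-check protocols -/

namespace Circuit

variable {n : ℕ} {C : Circuit}

theorem WellFormed.depth_pos (hC : C.WellFormed n) : 0 < C.depth := by
  obtain ⟨⟨g, hg⟩, _⟩ := hC
  cases C with
  | nil => simp at hg
  | cons L C => simp [depth]

theorem WellFormed.width_zero (hC : C.WellFormed n) : C.width n 0 = 1 := by
  obtain ⟨⟨g, hg⟩, _⟩ := hC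
  cases C with
  | nil => simp at hg
  | cons L C =>
    simp only [List.head?_cons, Option.some.injEq] at hg
    simp [width, layer, depth, hg]

theorem layer_of_ge {i : ℕ} (hi : C.depth ≤ i) : C.layer i = [] := by
  simp only [layer, depth] at *
  simp [List.getD_eq_getElem?_getD, List.getElem?_eq_none hi]

theorem width_of_lt {i : ℕ} (hi : i < C.depth) : C.width n i = (C.layer i).length := if_pos hi

theorem width_depth : C.width n C.depth = n := if_neg (lt_irrefl _)

theorem width_le_two_pow (n : ℕ) (C : Circuit) (i : ℕ) : C.width n i ≤ 2 ^ C.vars n i :=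
  Nat.le_pow_clog (by norm_num) _

theorem table_zero (n : ℕ) (C : Circuit) (i j : ℕ) : C.table n 0 i j = C.depth := rfl

theorem table_one (n : ℕ) (C : Circuit) (i j : ℕ) : C.table n 1 i j = C.width n i := rfl

theorem getElem?_layer {i j : ℕ} (hi : i < C.depth) (hj : j < C.width n i) :
    ∃ g, (C.layer i)[j]? = some g ∧ g ∈ C.layer i := by
  rw [width_of_lt hi] at hj
  exact ⟨_, List.getElem?_eq_getElem hj, List.getElem_mem hj⟩

/-- The labels of gate `j` of layer `i` and of its two in-neighbours. -/
def lab (n : ℕ) (C : Circuit) (i : ℕ) (b j : ℕ) : ℕ :=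
  if b = 0 then j else C.table n (b + 2) i j

/-- The numbers of variables of the three blocks of variables for layer `i`. -/
def blockVars (n : ℕ) (C : Circuit) (i b : ℕ) : ℕ :=
  if b = 0 then C.vars n i else C.vars n (i + 1)

/-- The first variable of a block. -/
def blockStart (n : ℕ) (C : Circuit) (i b : ℕ) : ℕ :=
  if b = 0 then 0 else if b = 1 then C.vars n i else C.vars n i + C.vars n (i + 1)

/-- How many variables of block `b` are among the first `q` variables for layer `i`. -/
def bound (n : ℕ) (C : Circuit) (i q b : ℕ) : ℕ :=
  min (q - C.blockStart n i b) (C.blockVars n i b)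

/-- The concatenation of the three labels of gate `j` of layer `i`. -/
def label (n : ℕ) (C : Circuit) (i j : ℕ) : ℕ :=
  2 ^ C.vars n i * (2 ^ C.vars n (i + 1) * C.lab n i 2 j + C.lab n i 1 j) + j

theorem WellFormed.lab_lt (hC : C.WellFormed n) {i j : ℕ} (hi : i < C.depth)
    (hj : j < C.width n i) (b : ℕ) : C.lab n i b j < 2 ^ C.blockVars n i b := by
  obtain ⟨g, hg, hgm⟩ := getElem?_layer hi hj
  have h1 := hC.2 i hi g hgm
  have h2 := width_le_two_pow n C (i + 1)
  rcases b with _ | _ | _ | b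
  · exact hj.trans_le (width_le_two_pow n C i)
  · simp only [lab, table, hg, blockVars]; simp only [Nat.reduceAdd, one_ne_zero, if_false]; omega
  · simp only [lab, table, hg, blockVars]; simp only [Nat.reduceAdd]; simp; omega
  · simp only [lab, blockVars, table, hg]; simp

theorem WellFormed.label_lt (hC : C.WellFormed n) {i j : ℕ} (hi : i < C.depth)
    (hj : j < C.width n i) : C.label n i j < 2 ^ C.arity n i := by
  have h0 := hC.lab_lt hi hj 0
  have h1 := hC.lab_lt hi hj 1
  have h2 := hC.lab_lt hi hj 2
  simp only [blockVars, if_true, one_ne_zero, OfNat.ofNat_ne_zero, if_false] at h0 h1 h2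
  have h0' : j < 2 ^ C.vars n i := h0
  have h3 : 2 ^ C.vars n (i + 1) * C.lab n i 2 j + C.lab n i 1 j <
      2 ^ C.vars n (i + 1) * 2 ^ C.vars n (i + 1) := by
    calc _ < 2 ^ C.vars n (i + 1) * C.lab n i 2 j + 2 ^ C.vars n (i + 1) := by omega
      _ = 2 ^ C.vars n (i + 1) * (C.lab n i 2 j + 1) := by ring
      _ ≤ _ := Nat.mul_le_mul_left _ h2
  calc _ < 2 ^ C.vars n i * (2 ^ C.vars n (i + 1) * C.lab n i 2 j + C.lab n i 1 j) +
        2 ^ C.vars n i := by simp only [label]; omega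
    _ = 2 ^ C.vars n i * (2 ^ C.vars n (i + 1) * C.lab n i 2 j + C.lab n i 1 j + 1) := by ring
    _ ≤ 2 ^ C.vars n i * (2 ^ C.vars n (i + 1) * 2 ^ C.vars n (i + 1)) := Nat.mul_le_mul_left _ h3
    _ = 2 ^ C.arity n i := by rw [arity, ← pow_add, ← pow_add]; congr 1; ring

/-- The bits of the concatenated label are those of the three labels. -/
theorem WellFormed.testBit_label (hC : C.WellFormed n) {i j : ℕ} (hi : i < C.depth)
    (hj : j < C.width n i) {b l : ℕ} (hb : b < 3) (hl : l < C.blockVars n i b) :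
    (C.label n i j).testBit (C.blockStart n i b + l) = (C.lab n i b j).testBit l := by
  have h0 := hC.lab_lt hi hj 0
  have h1 := hC.lab_lt hi hj 1
  simp only [blockVars, if_true, one_ne_zero, if_false] at h0 h1
  have h0' : j < 2 ^ C.vars n i := h0
  rw [label, Nat.testBit_two_pow_mul_add _ h0', Nat.testBit_two_pow_mul_add _ h1]
  interval_cases b
  · simp only [blockVars, if_true] at hl
    simp [blockStart, hl, lab]
  · simp only [blockVars, one_ne_zero, if_false] at hl
    simp [blockStart, hl]
  · simp [blockStart, add_assoc]

section Ring

variable {A : Type*} [CommRing A]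

/-- The variables of block `b` for layer `i`. -/
def block (n : ℕ) (C : Circuit) (i b : ℕ) (x : ℕ → A) : ℕ → A :=
  fun k => x (C.blockStart n i b + k)

theorem block_zero (i : ℕ) (x : ℕ → A) : C.block n i 0 x = x := by
  funext k
  simp [block, blockStart]

theorem block_one (i : ℕ) (x : ℕ → A) : C.block n i 1 x = C.omega₁ n i x := rfl

theorem block_two (i : ℕ) (x : ℕ → A) : C.block n i 2 x = C.omega₂ n i x := rfl

/-- The tables of the functions whose extensions are evaluated at the three blocks. -/
def blockTable (n : ℕ) (C : Circuit) (i : ℕ) (V z : ℕ → A) (b : ℕ) : ℕ → A :=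
  if b = 0 then fun j => chi (C.vars n i) j z else V

/-- The contribution of gate `j` of layer `i`, for the values `e 0` of the equality predicate and
`e 1`, `e 2` of the extension for layer `i + 1`. -/
def comb (n : ℕ) (C : Circuit) (i j : ℕ) (e : ℕ → A) : A :=
  e 0 * if C.table n 2 i j = 0 then e 1 + e 2 else e 1 * e 2

theorem WellFormed.chi_label (hC : C.WellFormed n) {i j : ℕ} (hi : i < C.depth)
    (hj : j < C.width n i) (x : ℕ → A) : chi (C.arity n i) (C.label n i j) x =
      chi (C.vars n i) j x * chi (C.vars n (i + 1)) (C.lab n i 1 j) (C.omega₁ n i x) *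
        chi (C.vars n (i + 1)) (C.lab n i 2 j) (C.omega₂ n i x) := by
  have h0 : j < 2 ^ C.vars n i := hC.lab_lt hi hj 0
  have h1 : C.lab n i 1 j < 2 ^ C.vars n (i + 1) := hC.lab_lt hi hj 1
  rw [arity, label, chi_add h0, two_mul, chi_add h1, mul_assoc]
  congr 2
  exact chi_congr (fun _ _ => rfl) fun k _ => by simp only [omega₂, add_assoc]

/-- The extension of a wiring predicate is a sum over the gates. -/
theorem WellFormed.wiringExt_eq (hC : C.WellFormed n) {i : ℕ} (hi : i < C.depth) (o : GateOp)
    (x : ℕ → A) : C.wiringExt n o i x = ∑ j ∈ Finset.range (C.width n i),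
      if C.table n 2 i j = (if o = .add then 0 else 1) then chi (C.arity n i) (C.label n i j) x
        else 0 := by
  have hw := width_le_two_pow n C i
  rw [wiringExt, ← Finset.sum_subset (Finset.range_mono hw)]
  · refine Finset.sum_congr rfl fun j hj => ?_
    have hj := Finset.mem_range.1 hj
    obtain ⟨⟨o', l, r⟩, hg, -⟩ := getElem?_layer hi hj
    have h1 : C.lab n i 1 j = l := by simp [lab, table, hg]
    have h2 : C.lab n i 2 j = r := by simp [lab, table, hg]
    have hl : l < 2 ^ C.vars n (i + 1) := h1 ▸ hC.lab_lt hi hj 1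
    have hr : r < 2 ^ C.vars n (i + 1) := h2 ▸ hC.lab_lt hi hj 2
    rw [hC.chi_label hi hj, h1, h2]
    have h3 : (C.table n 2 i j = if o = .add then 0 else 1) ↔ o' = o := by
      cases o <;> cases o' <;> simp [table, hg]
    by_cases ho : o' = o
    · rw [if_pos (h3.2 ho), Finset.sum_eq_single_of_mem l (Finset.mem_range.2 hl),
        Finset.sum_eq_single_of_mem r (Finset.mem_range.2 hr)]
      · simp [wiring, hg, ho]
      · intro r' _ hne
        have : r ≠ r' := hne.symm
        simp [wiring, hg, this]
      · intro l' _ hne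
        have : l ≠ l' := hne.symm
        simp [wiring, hg, this]
    · rw [if_neg fun h => ho (h3.1 h)]
      refine Finset.sum_eq_zero fun l' _ => Finset.sum_eq_zero fun r' _ => ?_
      simp [wiring, hg, ho]
  · intro j _ hj
    have hj : (C.layer i)[j]? = none := by
      rw [List.getElem?_eq_none_iff, ← width_of_lt (n := n) hi]
      simpa using hj
    refine Finset.sum_eq_zero fun l' _ => Finset.sum_eq_zero fun r' _ => ?_
    simp [wiring, hj]

/-- The polynomial of the sum-check protocol as a sum over the gates, in which the wiring enters
only through the indicator polynomials of the concatenated labels. -/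
theorem WellFormed.layerPoly_eq_sum (hC : C.WellFormed n) {i : ℕ} (hi : i < C.depth)
    (V z x : ℕ → A) : C.layerPoly n i V z x = ∑ j ∈ Finset.range (C.width n i),
      chi (C.arity n i) (C.label n i j) x *
        C.comb n i j fun b => mle (C.blockVars n i b) (C.blockTable n i V z b)
          (C.block n i b x) := by
  rw [layerPoly, hC.wiringExt_eq hi, hC.wiringExt_eq hi, Finset.sum_mul, Finset.sum_mul,
    ← Finset.sum_add_distrib, Finset.mul_sum]
  refine Finset.sum_congr rfl fun j hj => ?_
  have h01 : C.table n 2 i j = 0 ∨ C.table n 2 i j = 1 := by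
    obtain ⟨⟨o', l, r⟩, hg, -⟩ := getElem?_layer hi (Finset.mem_range.1 hj)
    cases o' <;> simp [table, hg]
  simp only [comb, blockVars, blockTable, if_true, one_ne_zero, if_false, OfNat.ofNat_ne_zero,
    block_zero, block_one, block_two, ← beta_eq_mle, reduceCtorEq]
  rcases h01 with h | h <;> simp [h] <;> ring

/-- The sum of the polynomial for layer `i` over the Boolean values of all variables but the
first `q`. -/
def partialSum (n : ℕ) (C : Circuit) (i q : ℕ) (V z x : ℕ → A) : A :=
  ∑ b ∈ Finset.range (2 ^ (C.arity n i - q)),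
    C.layerPoly n i V z fun l => if l < q then x l else if b.testBit (l - q) then 1 else 0

theorem blockStart_add_blockVars_le (i : ℕ) {b : ℕ} (hb : b < 3) :
    C.blockStart n i b + C.blockVars n i b ≤ C.arity n i := by
  interval_cases b <;> simp [blockStart, blockVars, arity] <;> omega

/-- The partial sums are sums over the gates, with one entry of each of the three folded tables for
each gate. -/
theorem WellFormed.partialSum_eq (hC : C.WellFormed n) {i q : ℕ} (hi : i < C.depth)
    (hq : q ≤ C.arity n i) (V z x : ℕ → A) :
    C.partialSum n i q V z x = ∑ j ∈ Finset.range (C.width n i),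
      chi q (C.label n i j) x * C.comb n i j fun b =>
        fold (C.blockTable n i V z b) (C.block n i b x) (C.bound n i q b)
          (C.lab n i b j / 2 ^ C.bound n i q b) := by
  simp only [partialSum, hC.layerPoly_eq_sum hi]
  rw [Finset.sum_comm]
  refine Finset.sum_congr rfl fun j hj => ?_
  have hj := Finset.mem_range.1 hj
  rw [sum_chi_mul hq (hC.label_lt hi hj) x fun y => C.comb n i j fun b =>
    mle (C.blockVars n i b) (C.blockTable n i V z b) (C.block n i b y)]
  have key : ∀ b < 3, mle (C.blockVars n i b) (C.blockTable n i V z b) (C.block n i b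
        fun l => if l < q then x l else if (C.label n i j).testBit l then 1 else 0) =
      fold (C.blockTable n i V z b) (C.block n i b x) (C.bound n i q b)
        (C.lab n i b j / 2 ^ C.bound n i q b) := by
    intro b hb
    rw [mle_of_bits _ _ (min_le_right _ _ : C.bound n i q b ≤ _) (hC.lab_lt hi hj b)]
    · refine fold_congr (fun _ => rfl) (fun l hl => ?_) _
      have : C.blockStart n i b + l < q := by
        have := hl.trans_le (min_le_left _ _)
        omega
      simp [block, this]
    · intro l hl hl'
      have : ¬ C.blockStart n i b + l < q := by
        omega
      simp [block, this, hC.testBit_label hi hj hb hl']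
  simp only [comb, key 0 (by norm_num), key 1 (by norm_num), key 2 (by norm_num)]

theorem blockVars_congr (i : ℕ) {x x' : ℕ → A} (h : ∀ l < C.arity n i, x l = x' l) {b : ℕ}
    (hb : b < 3) : ∀ k < C.blockVars n i b, C.block n i b x k = C.block n i b x' k := by
  intro k hk
  have := blockStart_add_blockVars_le (n := n) (C := C) i hb
  exact h _ (by omega)

theorem WellFormed.partialSum_arity (hC : C.WellFormed n) {i : ℕ} (hi : i < C.depth)
    (V z x : ℕ → A) : C.partialSum n i (C.arity n i) V z x = C.layerPoly n i V z x := by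
  rw [partialSum, Nat.sub_self, pow_zero, Finset.sum_range_one, hC.layerPoly_eq_sum hi,
    hC.layerPoly_eq_sum hi]
  have h : ∀ l < C.arity n i, (if l < C.arity n i then x l else
      if Nat.testBit 0 (l - C.arity n i) then 1 else 0) = x l := fun l hl => if_pos hl
  refine Finset.sum_congr rfl fun j hj => ?_
  rw [chi_congr (fun _ _ => rfl) h]
  simp only [comb]
  rw [mle_congr (fun _ => rfl) (blockVars_congr i h (b := 0) (by norm_num)),
    mle_congr (fun _ => rfl) (blockVars_congr i h (b := 1) (by norm_num)),
    mle_congr (fun _ => rfl) (blockVars_congr i h (b := 2) (by norm_num))]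

/-- Partial sums are related as in the checks of the sum-check protocol. -/
theorem partialSum_succ_add (i : ℕ) {q : ℕ} (hq : q < C.arity n i) (V z x : ℕ → A) :
    C.partialSum n i (q + 1) V z (Function.update x q 0) +
      C.partialSum n i (q + 1) V z (Function.update x q 1) = C.partialSum n i q V z x := by
  have h2 : 2 ^ (C.arity n i - q) = 2 * 2 ^ (C.arity n i - (q + 1)) := by
    rw [← pow_succ']
    congr 1
    omega
  rw [partialSum, partialSum, partialSum, h2, sum_range_two_mul, ← Finset.sum_add_distrib]
  refine Finset.sum_congr rfl fun b _ => ?_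
  congr 1 <;> congr 1 <;> funext l
  · rcases lt_trichotomy l q with hl | rfl | hl
    · simp [hl, hl.ne, hl.trans (Nat.lt_succ_self q)]
    · simp
    · obtain ⟨e, rfl⟩ := Nat.exists_eq_add_of_lt hl
      have h3 : ¬ q + e + 1 < q + 1 := by omega
      have h4 : ¬ q + e + 1 < q := by omega
      have h5 : q + e + 1 - q = e + 1 := by omega
      have h6 : q + e + 1 - (q + 1) = e := by omega
      simp [h3, h4, h5, h6, Nat.testBit_succ]
  · rcases lt_trichotomy l q with hl | rfl | hl
    · simp [hl, hl.ne, hl.trans (Nat.lt_succ_self q)]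
    · simp
    · obtain ⟨e, rfl⟩ := Nat.exists_eq_add_of_lt hl
      have h3 : ¬ q + e + 1 < q + 1 := by omega
      have h4 : ¬ q + e + 1 < q := by omega
      have h5 : q + e + 1 - q = e + 1 := by omega
      have h6 : q + e + 1 - (q + 1) = e := by omega
      have h7 : (2 * b + 1) / 2 = b := by omega
      simp [h3, h4, h5, h6, h7, Nat.testBit_succ]

theorem map_layerPoly {B : Type*} [CommRing B] (φ : A →+* B) (i : ℕ) (V z x : ℕ → A) :
    φ (C.layerPoly n i V z x) =
      C.layerPoly n i (fun j => φ (V j)) (fun l => φ (z l)) fun l => φ (x l) := by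
  have h1 : ∀ v j, φ (chi v j (C.omega₁ n i x)) = chi v j (C.omega₁ n i fun l => φ (x l)) :=
    fun v j => map_chi φ v j _
  have h2 : ∀ v j, φ (chi v j (C.omega₂ n i x)) = chi v j (C.omega₂ n i fun l => φ (x l)) :=
    fun v j => map_chi φ v j _
  simp only [layerPoly, wiringExt, wiring, mle, map_beta, map_mul, map_add, map_sum, map_chi,
    apply_ite φ, map_one, map_zero, h1, h2]

end Ring

section Field

open Polynomial

variable {F : Type*} [Field F]

theorem gateValue_depth (a : ℕ → F) : C.gateValue a C.depth = a := by
  funext j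
  simp [gateValue, depth, eval]

theorem gateValue_eq (a : ℕ → F) {i j : ℕ} (hi : i < C.depth) :
    C.gateValue a i j = match (C.layer i)[j]? with
      | some ⟨.add, l, r⟩ => C.gateValue a (i + 1) l + C.gateValue a (i + 1) r
      | some ⟨.mul, l, r⟩ => C.gateValue a (i + 1) l * C.gateValue a (i + 1) r
      | none => 0 := by
  have h : C.drop i = C.layer i :: C.drop (i + 1) := by
    rw [List.drop_eq_getElem_cons hi]
    simp only [depth] at hi
    simp [layer, List.getD_eq_getElem?_getD, hi]
  rcases hg : (C.layer i)[j]? with _ | ⟨_ | _, l, r⟩ <;> simp [gateValue, h, eval, hg]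

theorem gateValue_of_ge (a : ℕ → F) {i j : ℕ} (hi : i < C.depth) (hj : C.width n i ≤ j) :
    C.gateValue a i j = 0 := by
  rw [width_of_lt hi] at hj
  rw [gateValue_eq a hi, List.getElem?_eq_none hj]

theorem gateValue_eq_table (a : ℕ → F) {i j : ℕ} (hi : i < C.depth) (hj : j < C.width n i) :
    C.gateValue a i j = if C.table n 2 i j = 0 then
        C.gateValue a (i + 1) (C.table n 3 i j) + C.gateValue a (i + 1) (C.table n 4 i j)
      else C.gateValue a (i + 1) (C.table n 3 i j) * C.gateValue a (i + 1) (C.table n 4 i j) := by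
  obtain ⟨⟨o, l, r⟩, hg, -⟩ := getElem?_layer hi hj
  rw [gateValue_eq a hi, hg]
  cases o <;> simp [table, hg]

/-- The initial claim for a layer: the extension of a layer is the sum of the polynomial over the
hypercube. -/
theorem WellFormed.partialSum_zero (hC : C.WellFormed n) {i : ℕ} (hi : i < C.depth) (a z x : ℕ → F) :
    C.partialSum n i 0 (C.gateValue a (i + 1)) z x = mle (C.vars n i) (C.gateValue a i) z := by
  rw [hC.partialSum_eq hi (Nat.zero_le _), mle,
    ← Finset.sum_subset (Finset.range_mono (width_le_two_pow n C i))]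
  · refine Finset.sum_congr rfl fun j hj => ?_
    have hj := Finset.mem_range.1 hj
    rw [gateValue_eq_table (n := n) a hi hj, chi_zero]
    simp [comb, bound, fold, blockTable, lab, mul_comm]
  · intro j _ hj
    rw [gateValue_of_ge (n := n) a hi (by simpa using hj), zero_mul]

/-- The true value of the claim before round `k` for layer `i`. -/
noncomputable def truth (n : ℕ) (C : Circuit) (a : ℕ → F) (ρ : List F) (i k : ℕ) : F :=
  C.partialSum n i k (C.gateValue a (i + 1)) (C.point n ρ i) (C.coin n ρ i)

/-- An honest message is a partial sum over `F[X]`, whose next variable is `X`; so the facts on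
partial sums over commutative rings apply to it. -/
theorem honest_of_lt {a : ℕ → F} {ρ : List F} {i k : ℕ} (hk : k < C.arity n i) :
    C.honest n a ρ i k = C.partialSum n i (k + 1) (fun j => Polynomial.C (C.gateValue a (i + 1) j))
      (fun l => Polynomial.C (C.point n ρ i l))
      (fun l => if l < k then Polynomial.C (C.coin n ρ i l) else X) := by
  rw [honest, if_pos hk, partialSum]
  refine Finset.sum_congr rfl fun b _ => ?_
  congr 1
  funext l
  rcases lt_trichotomy l k with hl | rfl | hl
  · simp [hl, hl.trans (Nat.lt_succ_self k)]
  · simp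
  · simp [hl.ne', hl.not_gt, show ¬ l < k + 1 by omega]

theorem eval_honest (a : ℕ → F) (ρ : List F) {i k : ℕ} (hk : k < C.arity n i) (r : F) :
    (C.honest n a ρ i k).eval r = C.partialSum n i (k + 1) (C.gateValue a (i + 1)) (C.point n ρ i)
      (Function.update (C.coin n ρ i) k r) := by
  rw [honest_of_lt hk, ← coe_evalRingHom, partialSum, map_sum]
  simp only [map_layerPoly, partialSum, coe_evalRingHom, eval_C]
  refine Finset.sum_congr rfl fun b _ => ?_
  congr 1
  funext l
  rcases lt_trichotomy l k with hl | rfl | hl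
  · simp [hl, hl.ne, hl.trans (Nat.lt_succ_self k)]
  · simp
  · simp only [show ¬ l < k + 1 by omega, if_false]
    split <;> simp

theorem honest_check (a : ℕ → F) (ρ : List F) {i k : ℕ} (hk : k < C.arity n i) :
    (C.honest n a ρ i k).eval 0 + (C.honest n a ρ i k).eval 1 = C.truth n a ρ i k := by
  rw [eval_honest a ρ hk, eval_honest a ρ hk]
  exact partialSum_succ_add i hk _ _ _

/-- The honest polynomial at the challenge is the next true claim. -/
theorem honest_challenge (a : ℕ → F) (ρ : List F) {i k : ℕ} (hk : k < C.arity n i) :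
    (C.honest n a ρ i k).eval (C.coin n ρ i k) = C.truth n a ρ i (k + 1) := by
  rw [eval_honest a ρ hk, Function.update_eq_self]
  rfl

theorem eval_honest_line (a : ℕ → F) (ρ : List F) (i : ℕ) (t : F) :
    (C.honest n a ρ i (C.arity n i)).eval t = mle (C.vars n (i + 1)) (C.gateValue a (i + 1))
      fun l => (1 - t) * C.omega₁ n i (C.coin n ρ i) l + t * C.omega₂ n i (C.coin n ρ i) l := by
  rw [honest, if_neg (lt_irrefl _), ← coe_evalRingHom, map_mle]
  simp only [coe_evalRingHom, eval_C, eval_add, eval_mul, eval_sub, eval_one, eval_X]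

/-- The final check of a layer holds for the true claim. -/
theorem WellFormed.truth_arity (hC : C.WellFormed n) (a : ℕ → F) (ρ : List F) {i : ℕ}
    (hi : i < C.depth) : C.truth n a ρ i (C.arity n i) =
      beta (C.vars n i) (C.point n ρ i) (C.coin n ρ i) *
        (C.wiringExt n .add i (C.coin n ρ i) *
            ((C.honest n a ρ i (C.arity n i)).eval 0 + (C.honest n a ρ i (C.arity n i)).eval 1) +
          C.wiringExt n .mul i (C.coin n ρ i) *
            ((C.honest n a ρ i (C.arity n i)).eval 0 *
              (C.honest n a ρ i (C.arity n i)).eval 1)) := by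
  rw [truth, hC.partialSum_arity hi, layerPoly, eval_honest_line, eval_honest_line]
  simp

theorem WellFormed.truth_zero (hC : C.WellFormed n) (a : ℕ → F) (ρ : List F) {i : ℕ}
    (hi : i < C.depth) :
    C.truth n a ρ i 0 = mle (C.vars n i) (C.gateValue a i) (C.point n ρ i) :=
  hC.partialSum_zero hi a _ _

theorem honest_line_challenge (a : ℕ → F) (ρ : List F) (i : ℕ) :
    (C.honest n a ρ i (C.arity n i)).eval (C.coin n ρ i (C.arity n i)) =
      mle (C.vars n (i + 1)) (C.gateValue a (i + 1)) (C.point n ρ (i + 1)) :=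
  eval_honest_line a ρ i _

theorem WellFormed.vars_zero (hC : C.WellFormed n) : C.vars n 0 = 0 := by
  simp [vars, hC.width_zero]

theorem WellFormed.truth_output (hC : C.WellFormed n) (a : ℕ → F) (ρ : List F) :
    C.truth n a ρ 0 0 = C.output a := by
  rw [hC.truth_zero a ρ hC.depth_pos, hC.vars_zero]
  simp [mle, chi, output]

/-- The honest prover passes all checks. -/
theorem WellFormed.accepts_honest (hC : C.WellFormed n) (a : ℕ → F) (ρ : List F) :
    C.Accepts n a ρ (C.output a) (C.honest n a ρ) := by
  have hclaim : ∀ i < C.depth, ∀ k ≤ C.arity n i,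
      C.claim n ρ (C.output a) (C.honest n a ρ) i k = C.truth n a ρ i k := by
    intro i hi k hk
    rcases k with _ | k
    · rcases i with _ | i
      · exact (hC.truth_output a ρ).symm
      · rw [hC.truth_zero a ρ hi]
        exact honest_line_challenge a ρ i
    · exact honest_challenge a ρ hk
  refine ⟨fun i hi => ⟨fun k hk => ?_, ?_⟩, ?_⟩
  · rw [hclaim i hi k hk.le, honest_check a ρ hk]
  · rw [hclaim i hi _ le_rfl, hC.truth_arity a ρ hi]
  · have hd := hC.depth_pos
    obtain ⟨e, he⟩ : ∃ e, C.depth = e + 1 := ⟨C.depth - 1, by omega⟩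
    have h1 := honest_line_challenge (C := C) (n := n) a ρ e
    rw [← he, gateValue_depth] at h1
    rw [← h1, he]
    rfl

/-- A false claim survives only if, in some round, a polynomial different from the honest one agrees
with it at the challenge. -/
theorem WellFormed.exists_bad_round (hC : C.WellFormed n) (a : ℕ → F) (ρ : List F) {y : F}
    {g : ℕ → ℕ → F[X]} (hy : y ≠ C.output a) (hacc : C.Accepts n a ρ y g) :
    ∃ i < C.depth, ∃ k ≤ C.arity n i, g i k ≠ C.honest n a ρ i k ∧
      (g i k).eval (C.coin n ρ i k) = (C.honest n a ρ i k).eval (C.coin n ρ i k) := by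
  by_contra! hgood
  obtain ⟨hchk, hfin⟩ := hacc
  -- within a layer, a false claim stays false from round to round
  have hlayer : ∀ i < C.depth, C.claim n ρ y g i 0 ≠ C.truth n a ρ i 0 →
      ∀ k ≤ C.arity n i, C.claim n ρ y g i k ≠ C.truth n a ρ i k := by
    intro i hi h0 k
    induction k with
    | zero => exact fun _ => h0
    | succ k ih =>
      intro hk
      have h1 := ih (by omega)
      rw [← (hchk i hi).1 k hk, ← honest_check a ρ hk] at h1
      have h2 := hgood i hi k (by omega) fun h => h1 (by rw [h])
      rwa [honest_challenge a ρ hk] at h2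
  -- from a false claim for a layer, the line leads to a false claim for the next one
  have hline : ∀ i < C.depth, C.claim n ρ y g i 0 ≠ C.truth n a ρ i 0 →
      C.claim n ρ y g (i + 1) 0 ≠
        mle (C.vars n (i + 1)) (C.gateValue a (i + 1)) (C.point n ρ (i + 1)) := by
    intro i hi h0
    have h1 := hlayer i hi h0 _ le_rfl
    rw [(hchk i hi).2, hC.truth_arity a ρ hi] at h1
    have h2 := hgood i hi _ le_rfl fun h => h1 (by rw [h])
    rwa [honest_line_challenge] at h2
  have hall : ∀ i < C.depth, C.claim n ρ y g i 0 ≠ C.truth n a ρ i 0 := by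
    intro i
    induction i with
    | zero =>
      intro _
      rw [hC.truth_output]
      exact hy
    | succ i ih =>
      intro hi
      rw [hC.truth_zero a ρ hi]
      exact hline i (by omega) (ih (by omega))
  have hd := hC.depth_pos
  obtain ⟨e, he⟩ : ∃ e, C.depth = e + 1 := ⟨C.depth - 1, by omega⟩
  have h1 := hline e (by omega) (hall e (by omega))
  rw [← he, gateValue_depth] at h1
  exact h1 hfin

/-- The entries of the folded tables that gate `j` of layer `i` contributes to the polynomial of a
round in which a variable of block `s` is free, at the value `c ∈ {0,1}` of that variable. -/
def entry (n : ℕ) (C : Circuit) (i q s : ℕ) (V z x : ℕ → F) (j c b : ℕ) : F :=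
  fold (C.blockTable n i V z b) (C.block n i b x) (C.bound n i q b)
    (if b = s then 2 * (C.lab n i b j / 2 ^ C.bound n i q b / 2) + c
      else C.lab n i b j / 2 ^ C.bound n i q b)

/-- A round for a variable of block `s` leaves the tables of the other blocks alone. -/
theorem bound_of_ne {i s k b : ℕ} (hs : s < 3) (hb : b < 3) (hbs : b ≠ s)
    (hk : k < C.blockVars n i s) :
    C.bound n i (C.blockStart n i s + k + 1) b = C.bound n i (C.blockStart n i s + k) b := by
  interval_cases s <;> interval_cases b <;>
    simp [bound, blockStart, blockVars] at * <;> omega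

theorem bound_self {i s k : ℕ} (hk : k ≤ C.blockVars n i s) :
    C.bound n i (C.blockStart n i s + k) s = k := by
  simp [bound, hk]

theorem bound_lt_block {i s k b l : ℕ} (hl : l < C.bound n i (C.blockStart n i s + k) b) :
    C.blockStart n i b + l < C.blockStart n i s + k := by
  have := hl.trans_le (min_le_left _ _)
  omega

/-- The polynomial for a round in which the variable `k` of block `s` is free is a sum over the
gates. The contribution of a gate is the product of its weight, of `X` or `1 - X` according to the
bit `k` of its label, and of a linear polynomial that interpolates between the values at `0` and
`1`. Only one entry pair of the table of block `s` depends on the free variable, hence the degree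
`2`. -/
theorem WellFormed.honest_eq_sum (hC : C.WellFormed n) (a : ℕ → F) (ρ : List F) {i s k : ℕ}
    (hi : i < C.depth) (hs : s < 3) (hk : k < C.blockVars n i s) :
    C.honest n a ρ i (C.blockStart n i s + k) = ∑ j ∈ Finset.range (C.width n i),
      Polynomial.C (chi (C.blockStart n i s + k) (C.label n i j) (C.coin n ρ i)) *
        (if C.lab n i s j / 2 ^ k % 2 = 1 then X else 1 - X) *
        ((1 - X) * Polynomial.C (C.comb n i j (C.entry n i (C.blockStart n i s + k) s
            (C.gateValue a (i + 1)) (C.point n ρ i) (C.coin n ρ i) j 0)) +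
          X * Polynomial.C (C.comb n i j (C.entry n i (C.blockStart n i s + k) s
            (C.gateValue a (i + 1)) (C.point n ρ i) (C.coin n ρ i) j 1))) := by
  have hle := blockStart_add_blockVars_le (n := n) (C := C) i hs
  rw [honest_of_lt (by omega), hC.partialSum_eq hi (by omega)]
  refine Finset.sum_congr rfl fun j hj => ?_
  have hj := Finset.mem_range.1 hj
  set q := C.blockStart n i s + k with hq
  set x : ℕ → F[X] := fun l => if l < q then Polynomial.C (C.coin n ρ i l) else X with hx
  have hchi : chi (q + 1) (C.label n i j) x =
      Polynomial.C (chi q (C.label n i j) (C.coin n ρ i)) *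
        (if C.lab n i s j / 2 ^ k % 2 = 1 then X else 1 - X) := by
    rw [chi_succ, map_chi]
    congr 1
    · exact chi_congr (fun _ _ => rfl) fun l hl => if_pos hl
    · rw [hq, hC.testBit_label hi hj hs hk, Nat.testBit_eq_decide_div_mod_eq]
      simp [hx, hq]
  have htab : ∀ b, C.blockTable n i (fun j => Polynomial.C (C.gateValue a (i + 1) j))
      (fun l => Polynomial.C (C.point n ρ i l)) b =
      fun j => Polynomial.C (C.blockTable n i (C.gateValue a (i + 1)) (C.point n ρ i) b j) := by
    intro b
    by_cases hb : b = 0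
    · simp [blockTable, hb, map_chi]
    · simp [blockTable, hb]
  have hfold : ∀ b l, fold (fun j => Polynomial.C
      (C.blockTable n i (C.gateValue a (i + 1)) (C.point n ρ i) b j)) (C.block n i b x)
      (C.bound n i q b) l = Polynomial.C (fold
        (C.blockTable n i (C.gateValue a (i + 1)) (C.point n ρ i) b)
        (C.block n i b (C.coin n ρ i)) (C.bound n i q b) l) := by
    intro b l
    rw [map_fold]
    exact fold_congr (fun _ => rfl) (fun l hl => if_pos (bound_lt_block hl)) _
  -- the tables of the other blocks do not depend on the free variable
  have hne : ∀ b < 3, b ≠ s → ∀ c, fold (C.blockTable n i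
      (fun j => Polynomial.C (C.gateValue a (i + 1) j)) (fun l => Polynomial.C (C.point n ρ i l)) b)
      (C.block n i b x) (C.bound n i (q + 1) b) (C.lab n i b j / 2 ^ C.bound n i (q + 1) b) =
      Polynomial.C (C.entry n i q s (C.gateValue a (i + 1)) (C.point n ρ i) (C.coin n ρ i)
        j c b) := by
    intro b hb hbs c
    rw [bound_of_ne hs hb hbs hk, htab, hfold, entry, if_neg hbs]
  -- the table of block `s` is linear in the free variable
  have hself : fold (C.blockTable n i
      (fun j => Polynomial.C (C.gateValue a (i + 1) j)) (fun l => Polynomial.C (C.point n ρ i l)) s)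
      (C.block n i s x) (C.bound n i (q + 1) s) (C.lab n i s j / 2 ^ C.bound n i (q + 1) s) =
      (1 - X) * Polynomial.C (C.entry n i q s (C.gateValue a (i + 1)) (C.point n ρ i)
          (C.coin n ρ i) j 0 s) +
        X * Polynomial.C (C.entry n i q s (C.gateValue a (i + 1)) (C.point n ρ i)
          (C.coin n ρ i) j 1 s) := by
    have h1 : C.bound n i (q + 1) s = k + 1 := by rw [hq, add_assoc]; exact bound_self hk
    have h2 : C.bound n i q s = k := bound_self hk.le
    have h3 : C.block n i s x k = X := by simp [block, hx, hq]
    have h4 := hfold s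
    rw [h2] at h4
    rw [h1, fold, htab, h3, h4, h4, entry, entry, if_pos rfl, if_pos rfl, h2, pow_succ,
      Nat.div_div_eq_div_mul]
    rfl
  rw [hchi]
  congr 1
  simp only [comb]
  interval_cases s
  · rw [hself, hne 1 (by norm_num) (by norm_num) 0, hne 2 (by norm_num) (by norm_num) 0]
    have e1 := hne 1 (by norm_num) (by norm_num) 1
    have e2 := hne 2 (by norm_num) (by norm_num) 1
    rw [hne 1 (by norm_num) (by norm_num) 0, C_inj] at e1
    rw [hne 2 (by norm_num) (by norm_num) 0, C_inj] at e2
    rw [← e1, ← e2]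
    split <;> simp only [map_mul, map_add] <;> ring
  · rw [hself, hne 0 (by norm_num) (by norm_num) 0, hne 2 (by norm_num) (by norm_num) 0]
    have e1 := hne 0 (by norm_num) (by norm_num) 1
    have e2 := hne 2 (by norm_num) (by norm_num) 1
    rw [hne 0 (by norm_num) (by norm_num) 0, C_inj] at e1
    rw [hne 2 (by norm_num) (by norm_num) 0, C_inj] at e2
    rw [← e1, ← e2]
    split <;> simp only [map_mul, map_add] <;> ring
  · rw [hself, hne 0 (by norm_num) (by norm_num) 0, hne 1 (by norm_num) (by norm_num) 0]
    have e1 := hne 0 (by norm_num) (by norm_num) 1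
    have e2 := hne 1 (by norm_num) (by norm_num) 1
    rw [hne 0 (by norm_num) (by norm_num) 0, C_inj] at e1
    rw [hne 1 (by norm_num) (by norm_num) 0, C_inj] at e2
    rw [← e1, ← e2]
    split <;> simp only [map_mul, map_add] <;> ring

/-- Every round of the sum-check protocol for a layer belongs to one of the three blocks. -/
theorem exists_block (i : ℕ) {k : ℕ} (hk : k < C.arity n i) :
    ∃ s < 3, ∃ l < C.blockVars n i s, k = C.blockStart n i s + l := by
  rw [arity] at hk
  by_cases h0 : k < C.vars n i
  · exact ⟨0, by norm_num, k, by simpa [blockVars] using h0, by simp [blockStart]⟩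
  by_cases h1 : k < C.vars n i + C.vars n (i + 1)
  · exact ⟨1, by norm_num, k - C.vars n i, by simp [blockVars]; omega, by simp [blockStart]; omega⟩
  · exact ⟨2, by norm_num, k - (C.vars n i + C.vars n (i + 1)), by simp [blockVars]; omega,
      by simp [blockStart]; omega⟩

theorem natDegree_one_sub_X_le : (1 - X : F[X]).natDegree ≤ 1 :=
  (natDegree_sub_le _ _).trans (by simp)

theorem natDegree_fold_le {T r : ℕ → F[X]} (hT : ∀ j, (T j).natDegree ≤ 0)
    (hr : ∀ l, (r l).natDegree ≤ 1) (k j : ℕ) : (fold T r k j).natDegree ≤ k := by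
  induction k generalizing j with
  | zero => exact hT j
  | succ k ih =>
    rw [fold]
    refine natDegree_add_le_of_degree_le ?_ ?_
    · rw [add_comm k]
      refine natDegree_mul_le_of_le ((natDegree_sub_le _ _).trans ?_) (ih _)
      simpa using hr k
    · rw [add_comm k]
      exact natDegree_mul_le_of_le (hr k) (ih _)

theorem WellFormed.natDegree_honest_le (hC : C.WellFormed n) (a : ℕ → F) (ρ : List F) {i : ℕ}
    (hi : i < C.depth) (k : ℕ) : (C.honest n a ρ i k).natDegree ≤ C.msgDegree n i k := by
  rw [msgDegree]
  split
  · next hk =>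
    obtain ⟨s, hs, l, hl, rfl⟩ := exists_block i hk
    rw [hC.honest_eq_sum a ρ hi hs hl]
    refine natDegree_sum_le_of_forall_le _ _ fun j _ => ?_
    refine natDegree_mul_le_of_le (m := 1) (n := 1) (natDegree_C_mul_le _ _ |>.trans ?_) ?_
    · split
      · simp
      · exact natDegree_one_sub_X_le
    · refine natDegree_add_le_of_degree_le ?_ ?_
      · exact natDegree_mul_le_of_le (m := 1) (n := 0) natDegree_one_sub_X_le (by simp)
      · exact natDegree_mul_le_of_le (m := 1) (n := 0) (by simp) (by simp)
  · next hk =>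
    rw [honest, if_neg hk, ← fold_eq_mle]
    refine natDegree_fold_le (fun j => by simp) (fun l => ?_) _ _
    refine natDegree_add_le_of_degree_le ?_ ?_
    · exact natDegree_mul_le_of_le (m := 1) (n := 0) natDegree_one_sub_X_le (by simp)
    · exact natDegree_mul_le_of_le (m := 1) (n := 0) (by simp) (by simp)

end Field

end Circuit


/-! ### The parameters of the protocol -/

namespace Circuit

open Polynomial

variable {n : ℕ} {C : Circuit}

theorem offset_succ (n : ℕ) (C : Circuit) (i : ℕ) :
    C.offset n (i + 1) = C.offset n i + (C.arity n i + 1) := Finset.sum_range_succ _ _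

theorem offset_mono (n : ℕ) (C : Circuit) : Monotone (C.offset n) :=
  monotone_nat_of_le_succ fun i => by rw [offset_succ]; omega

theorem offset_add_lt {i k : ℕ} (hi : i < C.depth) (hk : k ≤ C.arity n i) :
    C.offset n i + k < C.numCoins n := by
  have h1 := offset_mono n C (show i + 1 ≤ C.depth from hi)
  rw [offset_succ] at h1
  rw [numCoins]
  omega

theorem width_le_size {i : ℕ} (hi : i ≤ C.depth) : C.width n i ≤ C.size n := by
  rcases hi.eq_or_lt with rfl | hi
  · rw [width_depth, size]
    omega
  · rw [width_of_lt hi, size]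
    have h1 : C.layer i ∈ C := by
      simp only [depth] at hi
      simp [layer, List.getD_eq_getElem?_getD, hi]
    have h2 : (C.layer i).length ≤ (C.map List.length).sum :=
      List.le_sum_of_mem (List.mem_map_of_mem h1)
    omega

theorem WellFormed.width_pos (hC : C.WellFormed n) {i : ℕ} (hi : i ≤ C.depth) :
    0 < C.width n i := by
  induction i with
  | zero => simp [hC.width_zero]
  | succ i ih =>
    have h1 := ih (by omega)
    obtain ⟨g, -, hg⟩ := getElem?_layer (n := n) (show i < C.depth by omega) h1
    have := hC.2 i (by omega) g hg
    omega

theorem sum_width (n : ℕ) (C : Circuit) :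
    ∑ i ∈ Finset.range (C.depth + 1), C.width n i = C.size n := by
  rw [Finset.sum_range_succ, width_depth, size, add_comm]
  congr 1
  have h1 : ∑ i ∈ Finset.range C.depth, C.width n i =
      ∑ i ∈ Finset.range C.length, (C.getD i []).length :=
    Finset.sum_congr rfl fun i hi => width_of_lt (Finset.mem_range.1 hi)
  rw [h1]
  clear h1
  induction C with
  | nil => simp
  | cons L C ih =>
    rw [List.length_cons, Finset.sum_range_succ']
    simp only [List.getD_cons_succ, List.getD_cons_zero, List.map_cons, List.sum_cons, ih]
    omega

/-- Each layer has a gate, because each gate has in-neighbours in the next layer. -/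
theorem WellFormed.depth_lt_size (hC : C.WellFormed n) : C.depth < C.size n := by
  have h1 : ∑ i ∈ Finset.range (C.depth + 1), 1 ≤
      ∑ i ∈ Finset.range (C.depth + 1), C.width n i :=
    Finset.sum_le_sum fun i hi => hC.width_pos (by have := Finset.mem_range.1 hi; omega)
  rw [sum_width] at h1
  simpa using h1

theorem WellFormed.two_le_size (hC : C.WellFormed n) : 2 ≤ C.size n := by
  have := hC.depth_lt_size
  have := hC.depth_pos
  omega

theorem WellFormed.one_le_log (hC : C.WellFormed n) : 1 ≤ Nat.log 2 (C.size n) :=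
  Nat.log_pos (by norm_num) hC.two_le_size

/-- The rounded up logarithm of a width is `O(log S)` even for the logarithm that is rounded down,
because `S ≥ 2`. -/
theorem WellFormed.vars_le (hC : C.WellFormed n) {i : ℕ} (hi : i ≤ C.depth) :
    C.vars n i ≤ 2 * Nat.log 2 (C.size n) := by
  have h1 : C.vars n i ≤ Nat.clog 2 (C.size n) := Nat.clog_mono_right 2 (width_le_size hi)
  have h2 : Nat.clog 2 (C.size n) ≤ Nat.log 2 (C.size n) + 1 :=
    Nat.clog_le_of_le_pow (Nat.lt_pow_succ_log_self (by norm_num) _).le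
  have := hC.one_le_log
  omega

theorem WellFormed.arity_le (hC : C.WellFormed n) {i : ℕ} (hi : i < C.depth) :
    C.arity n i ≤ 6 * Nat.log 2 (C.size n) := by
  have h1 := hC.vars_le hi.le
  have h2 := hC.vars_le (show i + 1 ≤ C.depth from hi)
  rw [arity]
  omega

theorem WellFormed.numCoins_le (hC : C.WellFormed n) :
    C.numCoins n ≤ 7 * (C.depth * Nat.log 2 (C.size n)) := by
  have h1 : C.numCoins n ≤ ∑ _i ∈ Finset.range C.depth, 7 * Nat.log 2 (C.size n) := by
    rw [numCoins, offset]
    refine Finset.sum_le_sum fun i hi => ?_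
    have := hC.arity_le (Finset.mem_range.1 hi)
    have := hC.one_le_log
    omega
  refine h1.trans (le_of_eq ?_)
  rw [Finset.sum_const, Finset.card_range, smul_eq_mul]
  ring

/-- The tables of the prover are at most twice as long as the layers. -/
theorem WellFormed.two_pow_vars_le (hC : C.WellFormed n) {i : ℕ} (hi : i ≤ C.depth) :
    2 ^ C.vars n i ≤ 2 * C.width n i := by
  rcases Nat.lt_or_ge 1 (C.width n i) with h | h
  · have h1 : 2 ^ (C.vars n i - 1) < C.width n i := Nat.pow_pred_clog_lt_self (by norm_num) h
    have h2 : 0 < C.vars n i := Nat.clog_pos (by norm_num) h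
    obtain ⟨v, hv⟩ : ∃ v, C.vars n i = v + 1 := ⟨C.vars n i - 1, by omega⟩
    rw [hv, Nat.add_sub_cancel] at h1
    rw [hv, pow_succ]
    omega
  · have h1 := hC.width_pos hi
    have h2 : C.width n i = 1 := by omega
    simp [vars, h2]

/-! ### Transcripts and prover strategies -/

variable {F : Type*} [Field F]

/-- The communication of round `k` for layer `i`. -/
noncomputable def roundEvents (n : ℕ) (C : Circuit) (ρ : List F) (g : ℕ → ℕ → F[X]) (i k : ℕ) :
    List (Event F) :=
  (List.range (C.msgDegree n i k + 1)).map (fun e => .received ((g i k).coeff e)) ++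
    [.sent (C.coin n ρ i k)]

/-- The communication before round `k` for layer `i`. -/
noncomputable def prefixTrace (n : ℕ) (C : Circuit) (ρ : List F) (y : F) (g : ℕ → ℕ → F[X])
    (i k : ℕ) : List (Event F) :=
  .received y :: (((List.range i).flatMap fun i => (List.range (C.arity n i + 1)).flatMap
    (C.roundEvents n ρ g i)) ++ (List.range k).flatMap (C.roundEvents n ρ g i))

section
variable (ρ : List F) (y : F) (g : ℕ → ℕ → F[X])

theorem prefixTrace_zero : C.prefixTrace n ρ y g 0 0 = [.received y] := by simp [prefixTrace]

theorem prefixTrace_succ (i k : ℕ) : C.prefixTrace n ρ y g i (k + 1) =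
    C.prefixTrace n ρ y g i k ++ C.roundEvents n ρ g i k := by
  simp [prefixTrace, List.range_succ (n := k)]

theorem prefixTrace_layer (i : ℕ) : C.prefixTrace n ρ y g (i + 1) 0 =
    C.prefixTrace n ρ y g i (C.arity n i + 1) := by
  simp only [prefixTrace, List.range_succ (n := i), List.flatMap_append]
  simp

theorem prefixTrace_depth : C.prefixTrace n ρ y g C.depth 0 = C.transcript n ρ y g := by
  simp [prefixTrace, transcript]
  rfl

theorem length_roundEvents (i k : ℕ) :
    (C.roundEvents n ρ g i k).length = C.msgDegree n i k + 2 := by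
  simp [roundEvents]

end

/-- With the next messages given by `σ`, the prover claims the output `y` and sends the
polynomials `g i k`. -/
structure Answers (n : ℕ) (C : Circuit) (ρ : List F) (σ : List (Event F) → F) (y : F)
    (g : ℕ → ℕ → F[X]) : Prop where
  first : σ [] = y
  next : ∀ i < C.depth, ∀ k ≤ C.arity n i, ∀ e ≤ C.msgDegree n i k,
    σ (C.prefixTrace n ρ y g i k ++
      (List.range e).map fun e => .received ((g i k).coeff e)) = (g i k).coeff e

/-- The next `e` values that a prover with strategy `σ` sends after the communication `τ`. -/
def replies (σ : List (Event F) → F) (τ : List (Event F)) : ℕ → List F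
  | 0 => []
  | e + 1 => replies σ τ e ++ [σ (τ ++ (replies σ τ e).map .received)]

theorem length_replies (σ : List (Event F) → F) (τ : List (Event F)) (e : ℕ) :
    (replies σ τ e).length = e := by
  induction e with
  | zero => rfl
  | succ e ih => simp [replies, ih]

theorem getD_replies (σ : List (Event F) → F) (τ : List (Event F)) {e m : ℕ} (h : e < m) :
    (replies σ τ m).getD e 0 = σ (τ ++ (replies σ τ e).map .received) := by
  induction m, h using Nat.le_induction with
  | base => simp [replies, List.getD_eq_getElem?_getD, length_replies]
  | succ m h ih =>
    rw [replies, List.getD_append _ _ _ _ (by rw [length_replies]; exact h), ih]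

/-- The communication with a prover with strategy `σ` during `k` rounds for layer `i`, after the
communication `τ`. -/
def roundsFrom (n : ℕ) (C : Circuit) (ρ : List F) (σ : List (Event F) → F) (i : ℕ)
    (τ : List (Event F)) : ℕ → List (Event F)
  | 0 => τ
  | k + 1 => C.roundsFrom n ρ σ i τ k ++
      (replies σ (C.roundsFrom n ρ σ i τ k) (C.msgDegree n i k + 1)).map .received ++
      [.sent (C.coin n ρ i k)]

/-- The communication with a prover with strategy `σ` before layer `i`. -/
def layersFrom (n : ℕ) (C : Circuit) (ρ : List F) (σ : List (Event F) → F) : ℕ → List (Event F)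
  | 0 => [.received (σ [])]
  | i + 1 => C.roundsFrom n ρ σ i (C.layersFrom n ρ σ i) (C.arity n i + 1)

/-- The polynomial that a prover with strategy `σ` sends in round `k` for layer `i`. -/
noncomputable def strategyPoly (n : ℕ) (C : Circuit) (ρ : List F) (σ : List (Event F) → F)
    (i k : ℕ) : F[X] :=
  ∑ e ∈ Finset.range (C.msgDegree n i k + 1), Polynomial.C
    ((replies σ (C.roundsFrom n ρ σ i (C.layersFrom n ρ σ i) k) (C.msgDegree n i k + 1)).getD e 0) *
      X ^ e

section
variable (ρ : List F) (σ : List (Event F) → F)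

theorem coeff_strategyPoly {i k e : ℕ} (he : e ≤ C.msgDegree n i k) :
    (C.strategyPoly n ρ σ i k).coeff e =
      σ (C.roundsFrom n ρ σ i (C.layersFrom n ρ σ i) k ++
        (replies σ (C.roundsFrom n ρ σ i (C.layersFrom n ρ σ i) k) e).map .received) := by
  rw [strategyPoly, finsetSum_coeff, Finset.sum_eq_single e]
  · rw [coeff_C_mul, coeff_X_pow, if_pos rfl, mul_one, getD_replies _ _ (by omega)]
  · intro e' _ hne
    rw [coeff_C_mul, coeff_X_pow, if_neg hne.symm, mul_zero]
  · intro h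
    simp at h
    omega

theorem natDegree_strategyPoly_le (i k : ℕ) :
    (C.strategyPoly n ρ σ i k).natDegree ≤ C.msgDegree n i k := by
  refine natDegree_sum_le_of_forall_le _ _ fun e he => ?_
  have := Finset.mem_range.1 he
  exact (natDegree_C_mul_X_pow_le _ _).trans (by omega)

theorem replies_strategy {i k e : ℕ} (he : e ≤ C.msgDegree n i k + 1) :
    replies σ (C.roundsFrom n ρ σ i (C.layersFrom n ρ σ i) k) e =
      (List.range e).map fun e => (C.strategyPoly n ρ σ i k).coeff e := by
  induction e with
  | zero => rfl
  | succ e ih =>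
    rw [List.range_succ, List.map_append, ← ih (by omega), replies, List.map_singleton,
      coeff_strategyPoly ρ σ (by omega)]

theorem prefixTrace_strategy (i k : ℕ) :
    C.prefixTrace n ρ (σ []) (C.strategyPoly n ρ σ) i k =
      C.roundsFrom n ρ σ i (C.layersFrom n ρ σ i) k := by
  have hround : ∀ i, C.prefixTrace n ρ (σ []) (C.strategyPoly n ρ σ) i 0 = C.layersFrom n ρ σ i →
      ∀ k, C.prefixTrace n ρ (σ []) (C.strategyPoly n ρ σ) i k =
        C.roundsFrom n ρ σ i (C.layersFrom n ρ σ i) k := by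
    intro i h0 k
    induction k with
    | zero => exact h0
    | succ k ih =>
      rw [prefixTrace_succ, ih, roundsFrom, roundEvents, replies_strategy ρ σ le_rfl, List.map_map,
        List.append_assoc]
      rfl
  refine hround i ?_ k
  induction i with
  | zero => exact prefixTrace_zero _ _ _
  | succ i ih => rw [prefixTrace_layer, hround i ih, layersFrom]

/-- Every strategy amounts to sending some polynomials of the prescribed degrees, so that the
verifier needs to be analysed only for messages of this form. -/
theorem answers_strategy : C.Answers n ρ σ (σ []) (C.strategyPoly n ρ σ) := by
  refine ⟨rfl, fun i _ k _ e he => ?_⟩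
  have h := replies_strategy (n := n) (C := C) ρ σ (i := i) (k := k) (e := e) (by omega)
  rw [prefixTrace_strategy, coeff_strategyPoly ρ σ he, h, List.map_map]
  rfl

end

/-! ### Causality -/

section
variable {ρ ρ' : List F}

theorem coin_congr {i k m : ℕ} (h : ∀ l < m, ρ.getD l 0 = ρ'.getD l 0)
    (hk : C.offset n i + k < m) : C.coin n ρ i k = C.coin n ρ' i k := h _ hk

theorem roundsFrom_congr (σ : List (Event F) → F) {i k : ℕ}
    (h : ∀ l < C.offset n i + k, ρ.getD l 0 = ρ'.getD l 0) :
    C.roundsFrom n ρ σ i (C.layersFrom n ρ σ i) k =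
      C.roundsFrom n ρ' σ i (C.layersFrom n ρ' σ i) k := by
  induction i generalizing k with
  | zero =>
    induction k with
    | zero => rfl
    | succ k ih =>
      rw [roundsFrom, ih fun l hl => h l (by omega), coin_congr h (by omega)]
      rfl
  | succ i ihi =>
    have h0 := ihi (k := C.arity n i + 1) fun l hl => h l (by rw [offset_succ]; omega)
    induction k with
    | zero => exact h0
    | succ k ih =>
      rw [roundsFrom, ih fun l hl => h l (by omega), coin_congr h (by omega)]
      rfl

/-- A message depends only on the random values sent before. -/
theorem strategyPoly_congr (σ : List (Event F) → F) {i k : ℕ}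
    (h : ∀ l < C.offset n i + k, ρ.getD l 0 = ρ'.getD l 0) :
    C.strategyPoly n ρ σ i k = C.strategyPoly n ρ' σ i k := by
  rw [strategyPoly, roundsFrom_congr σ h]
  rfl

theorem point_congr (hC : C.WellFormed n) {i : ℕ}
    (h : ∀ l < C.offset n i, ρ.getD l 0 = ρ'.getD l 0) {k : ℕ} (hk : k < C.vars n i) :
    C.point n ρ i k = C.point n ρ' i k := by
  cases i with
  | zero =>
    rw [hC.vars_zero] at hk
    omega
  | succ i =>
    rw [offset_succ, arity] at h
    simp only [point, omega₁, omega₂, arity]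
    rw [coin_congr h (by omega), coin_congr h (by omega), coin_congr h (by omega)]

/-- The honest message of a round depends only on the random values sent before. -/
theorem honest_congr (hC : C.WellFormed n) (a : ℕ → F) {i k : ℕ} (hk : k ≤ C.arity n i)
    (h : ∀ l < C.offset n i + k, ρ.getD l 0 = ρ'.getD l 0) :
    C.honest n a ρ i k = C.honest n a ρ' i k := by
  have hp : ∀ l < C.vars n i, C.point n ρ i l = C.point n ρ' i l := fun l hl =>
    point_congr hC (fun l hl => h l (by omega)) hl
  rw [honest, honest]
  split
  · refine Finset.sum_congr rfl fun b _ => ?_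
    have hx : (fun l => if l < k then Polynomial.C (C.coin n ρ i l) else if l = k then X
          else if b.testBit (l - (k + 1)) then 1 else 0) =
        (fun l => if l < k then Polynomial.C (C.coin n ρ' i l) else if l = k then X
          else if b.testBit (l - (k + 1)) then 1 else 0) := by
      funext l
      by_cases hl : l < k
      · rw [if_pos hl, if_pos hl, coin_congr h (by omega)]
      · rw [if_neg hl, if_neg hl]
    rw [hx, layerPoly, layerPoly]
    congr 1
    exact beta_congr (fun l hl => by rw [hp l hl]) fun _ _ => rfl
  · refine mle_congr (fun _ => rfl) fun l hl => ?_
    have hk' : k = C.arity n i := by omega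
    subst hk'
    rw [arity] at h
    simp only [omega₁, omega₂]
    rw [coin_congr h (by omega), coin_congr h (by omega)]

end

/-! ### Soundness -/

/-- If the set `B ρ` of at most `D` elements does not depend on the coordinate `q` of `ρ`, then
`ρ q ∈ B ρ` holds for at most `D * |R| ^ (N - 1)` of the `ρ` with coordinates in `R`. -/
theorem card_filter_mem_le [DecidableEq F] {N D : ℕ} (R : Finset F) (q : Fin N)
    (B : (Fin N → F) → Finset F) (hB : ∀ ρ ρ', (∀ l, l ≠ q → ρ l = ρ' l) → B ρ = B ρ')
    (hD : ∀ ρ, (B ρ).card ≤ D) :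
    ((Fintype.piFinset fun _ : Fin N => R).filter fun ρ => ρ q ∈ B ρ).card ≤
      D * R.card ^ (N - 1) := by
  -- `t` lists the values of the other coordinates; coordinate `q` is replaced by `0`
  set t : Finset (Fin N → F) := Fintype.piFinset fun l : Fin N => if l = q then {0} else R with ht
  have hcard : t.card = R.card ^ (N - 1) := by
    rw [ht, Fintype.card_piFinset, ← Finset.mul_prod_erase _ _ (Finset.mem_univ q),
      Finset.prod_congr rfl (g := fun _ => R.card)]
    · simp
    · intro l hl
      rw [if_neg (Finset.ne_of_mem_erase hl)]
  rw [← hcard, mul_comm]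
  -- each fibre over `t` injects into the set `B u` by the coordinate `q`
  refine (Finset.card_le_mul_card_image_of_maps_to (f := fun ρ => Function.update ρ q 0)
    (t := t) ?_ D ?_).trans (by rw [mul_comm])
  · intro ρ hρ
    rw [Finset.mem_filter, Fintype.mem_piFinset] at hρ
    rw [ht, Fintype.mem_piFinset]
    intro l
    by_cases hl : l = q
    · simp [hl]
    · simp [hl, hρ.1 l]
  · intro u _
    refine le_trans ?_ (hD u)
    refine Finset.card_le_card_of_injOn (fun ρ => ρ q) ?_ ?_
    · intro ρ hρ
      simp only [Finset.coe_filter, Finset.mem_filter, Set.mem_ofPred_eq] at hρ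
      have : B ρ = B u := hB _ _ fun l hl => by rw [← hρ.2]; simp [hl]
      simpa [this] using hρ.1.2
    · intro ρ hρ ρ' hρ' h
      simp only [Finset.coe_filter, Finset.mem_filter, Set.mem_ofPred_eq] at hρ hρ'
      funext l
      by_cases hl : l = q
      · rw [hl]
        exact h
      · have h1 := congrFun (hρ.2.trans hρ'.2.symm) l
        simpa [hl] using h1

theorem coin_ofFn {N : ℕ} (hN : N = C.numCoins n) (ρ : Fin N → F) {i k : ℕ} (hi : i < C.depth)
    (hk : k ≤ C.arity n i) :
    C.coin n (List.ofFn ρ) i k = ρ ⟨C.offset n i + k, hN ▸ offset_add_lt hi hk⟩ := by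
  have h := offset_add_lt (n := n) hi hk
  rw [← hN] at h
  simp [coin, List.getD_eq_getElem?_getD, h]

theorem getD_ofFn_congr {N : ℕ} {ρ ρ' : Fin N → F} {q : Fin N} (h : ∀ l, l ≠ q → ρ l = ρ' l) :
    ∀ l < q.1, (List.ofFn ρ).getD l 0 = (List.ofFn ρ').getD l 0 := by
  intro l hl
  have hlN : l < N := hl.trans q.2
  have : (⟨l, hlN⟩ : Fin N) ≠ q := fun e => by
    have := congrArg Fin.val e
    simp only at this
    omega
  simp [List.getD_eq_getElem?_getD, hlN, h _ this]

theorem WellFormed.sum_msgDegree_le (hC : C.WellFormed n) :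
    ∑ i ∈ Finset.range C.depth, ∑ k ∈ Finset.range (C.arity n i + 1), C.msgDegree n i k ≤
      14 * (C.depth * Nat.log 2 (C.size n)) := by
  have h1 : ∀ i ∈ Finset.range C.depth,
      ∑ k ∈ Finset.range (C.arity n i + 1), C.msgDegree n i k ≤ 14 * Nat.log 2 (C.size n) := by
    intro i hi
    have hi := Finset.mem_range.1 hi
    rw [Finset.sum_range_succ, Finset.sum_congr rfl (g := fun _ => 2)]
    · have h2 := hC.arity_le hi
      have h3 := hC.vars_le (show i + 1 ≤ C.depth from hi)
      simp only [Finset.sum_const, Finset.card_range, smul_eq_mul, msgDegree, lt_irrefl, if_false]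
      omega
    · intro k hk
      rw [msgDegree, if_pos (Finset.mem_range.1 hk)]
  refine (Finset.sum_le_sum h1).trans (le_of_eq ?_)
  rw [Finset.sum_const, Finset.card_range, smul_eq_mul]
  ring

/-- A prover that claims a false output is accepted with probability at most `1/3`. -/
theorem WellFormed.soundness (hC : C.WellFormed n) {N : ℕ} (hN : N = C.numCoins n) (a : ℕ → F)
    (σ : List (Event F) → F) (R : Finset F)
    (hR : 100 * (C.depth * Nat.log 2 (C.size n)) ≤ R.card) :
    3 * {ρ : Fin N → F | (∀ k, ρ k ∈ R) ∧ σ [] ≠ C.output a ∧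
      C.Accepts n a (List.ofFn ρ) (σ []) (C.strategyPoly n (List.ofFn ρ) σ)}.ncard ≤
        R.card ^ N := by
  classical
  -- `B i k ρ` is the set of challenges for which a wrong polynomial agrees with the honest one
  let B : ℕ → ℕ → (Fin N → F) → Finset F := fun i k ρ =>
    (C.strategyPoly n (List.ofFn ρ) σ i k - C.honest n a (List.ofFn ρ) i k).roots.toFinset
  let bad : ℕ → ℕ → Finset (Fin N → F) := fun i k =>
    (Fintype.piFinset fun _ : Fin N => R).filter fun ρ => C.coin n (List.ofFn ρ) i k ∈ B i k ρ
  have hsub : {ρ : Fin N → F | (∀ k, ρ k ∈ R) ∧ σ [] ≠ C.output a ∧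
      C.Accepts n a (List.ofFn ρ) (σ []) (C.strategyPoly n (List.ofFn ρ) σ)} ⊆
      ((Finset.range C.depth).biUnion fun i =>
        (Finset.range (C.arity n i + 1)).biUnion (bad i) : Finset (Fin N → F)) := by
    rintro ρ ⟨hρ, hy, hacc⟩
    obtain ⟨i, hi, k, hk, hne, heq⟩ := hC.exists_bad_round a _ hy hacc
    simp only [Finset.coe_biUnion, Set.mem_iUnion, Finset.mem_coe, Finset.mem_range]
    refine ⟨i, hi, k, by omega, ?_⟩
    rw [Finset.mem_filter, Fintype.mem_piFinset]
    refine ⟨hρ, ?_⟩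
    rw [Multiset.mem_toFinset, mem_roots (sub_ne_zero.2 hne), IsRoot, eval_sub, heq, sub_self]
  have hbad : ∀ i < C.depth, ∀ k ≤ C.arity n i,
      (bad i k).card ≤ C.msgDegree n i k * R.card ^ (N - 1) := by
    intro i hi k hk
    have hlt : C.offset n i + k < N := hN ▸ offset_add_lt hi hk
    have h1 := card_filter_mem_le R (⟨C.offset n i + k, hlt⟩ : Fin N) (B i k)
      (D := C.msgDegree n i k) ?_ ?_
    · simpa only [bad, coin_ofFn hN _ hi hk] using h1
    · intro ρ ρ' h
      have h2 := getD_ofFn_congr h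
      simp only [B]
      rw [strategyPoly_congr σ h2, honest_congr hC a hk h2]
    · intro ρ
      refine (Multiset.toFinset_card_le _).trans ((card_roots' _).trans ?_)
      exact (natDegree_sub_le_of_le (natDegree_strategyPoly_le _ _ _ _)
        (hC.natDegree_honest_le a _ hi k)).trans (max_self _).le
  have hN0 : 0 < N := by
    rw [hN]
    exact (Nat.zero_le _).trans_lt (offset_add_lt (n := n) hC.depth_pos (Nat.zero_le _))
  calc 3 * _ ≤ 3 * ((Finset.range C.depth).biUnion fun i =>
        (Finset.range (C.arity n i + 1)).biUnion (bad i)).card := by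
        refine Nat.mul_le_mul_left _ ?_
        rw [← Set.ncard_coe_finset]
        exact Set.ncard_le_ncard hsub (Finset.finite_toSet _)
    _ ≤ 3 * ∑ i ∈ Finset.range C.depth, ∑ k ∈ Finset.range (C.arity n i + 1),
        C.msgDegree n i k * R.card ^ (N - 1) := by
        refine Nat.mul_le_mul_left _ (Finset.card_biUnion_le.trans ?_)
        refine Finset.sum_le_sum fun i hi => Finset.card_biUnion_le.trans ?_
        refine Finset.sum_le_sum fun k hk => ?_
        have := Finset.mem_range.1 hk
        exact hbad i (Finset.mem_range.1 hi) k (by omega)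
    _ = 3 * (∑ i ∈ Finset.range C.depth, ∑ k ∈ Finset.range (C.arity n i + 1),
        C.msgDegree n i k) * R.card ^ (N - 1) := by
        simp only [← Finset.sum_mul, mul_assoc]
    -- the sum of the degrees is at most `14 d log S`, and `3 * 14 ≤ 100`
    _ ≤ R.card * R.card ^ (N - 1) := by
        refine Nat.mul_le_mul_right _ ?_
        have := hC.sum_msgDegree_le
        omega
    _ = R.card ^ N := by rw [← pow_succ', Nat.sub_add_cancel hN0]

/-! ### Scripted communication -/

/-- The other party of a fixed communication: it always sends the next value of it. -/
def script (τ : List (Event F)) (τ' : List (Event F)) : F :=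
  match τ[τ'.length]? with
  | some (.received x) => x
  | some (.sent x) => x
  | none => 0

theorem script_append (τ₁ τ₂ : List (Event F)) (x : F) :
    script (τ₁ ++ .received x :: τ₂) τ₁ = x := by
  simp [script]

theorem prefixTrace_isPrefix (ρ : List F) (y : F) (g : ℕ → ℕ → F[X]) {i k : ℕ} (hi : i < C.depth)
    (hk : k ≤ C.arity n i) :
    C.prefixTrace n ρ y g i k ++ C.roundEvents n ρ g i k <+: C.transcript n ρ y g := by
  have h1 : ∀ i k m, k ≤ m → C.prefixTrace n ρ y g i k <+: C.prefixTrace n ρ y g i m := by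
    intro i k m h
    induction m, h using Nat.le_induction with
    | base => exact List.prefix_refl _
    | succ m _ ih =>
      rw [prefixTrace_succ]
      exact ih.trans (List.prefix_append _ _)
  have h2 : ∀ i m, i ≤ m → C.prefixTrace n ρ y g i 0 <+: C.prefixTrace n ρ y g m 0 := by
    intro i m h
    induction m, h using Nat.le_induction with
    | base => exact List.prefix_refl _
    | succ m _ ih =>
      rw [prefixTrace_layer]
      exact ih.trans (h1 _ _ _ (Nat.zero_le _))
  rw [← prefixTrace_succ, ← prefixTrace_depth]
  refine (h1 i (k + 1) (C.arity n i + 1) (by omega)).trans ?_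
  rw [← prefixTrace_layer]
  exact h2 _ _ hi

theorem range_map_split {X : Type*} (f : ℕ → X) {e m : ℕ} (h : e < m) :
    ∃ l, (List.range m).map f = (List.range e).map f ++ f e :: l := by
  obtain ⟨c, rfl⟩ := Nat.exists_eq_add_of_lt h
  refine ⟨((List.range c).map (e + 1 + ·)).map f, ?_⟩
  rw [show e + c + 1 = (e + 1) + c by omega, List.range_add, List.map_append, List.range_succ]
  simp

/-- A machine that plays against the script of a transcript sees exactly this transcript. -/
theorem answers_script (ρ : List F) (y : F) (g : ℕ → ℕ → F[X]) :
    C.Answers n ρ (script (C.transcript n ρ y g)) y g := by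
  refine ⟨rfl, fun i hi k hk e he => ?_⟩
  obtain ⟨l, hl⟩ := prefixTrace_isPrefix ρ y g hi hk
  obtain ⟨l', hl'⟩ := range_map_split
    (fun e => (Event.received ((g i k).coeff e) : Event F)) (Nat.lt_succ_of_le he)
  rw [← hl, roundEvents, hl']
  have h := script_append (C.prefixTrace n ρ y g i k ++
    (List.range e).map fun e => .received ((g i k).coeff e))
    (l' ++ [.sent (C.coin n ρ i k)] ++ l) ((g i k).coeff e)
  simpa only [List.append_assoc, List.cons_append] using h

/-- From the point of view of the prover, the random values are what it receives. -/
theorem script_dual (ρ : List F) (y : F) (g : ℕ → ℕ → F[X]) {i k : ℕ} (hi : i < C.depth)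
    (hk : k ≤ C.arity n i) :
    script ((C.transcript n ρ y g).map Event.dual) ((C.prefixTrace n ρ y g i k).map Event.dual ++
      (List.range (C.msgDegree n i k + 1)).map fun e => .sent ((g i k).coeff e)) =
        C.coin n ρ i k := by
  obtain ⟨l, hl⟩ := prefixTrace_isPrefix ρ y g hi hk
  rw [← hl, roundEvents]
  have h := script_append ((C.prefixTrace n ρ y g i k).map Event.dual ++
    (List.range (C.msgDegree n i k + 1)).map fun e => .sent ((g i k).coeff e))
    (l.map Event.dual) (C.coin n ρ i k)
  simpa [List.append_assoc, Event.dual, Function.comp_def] using h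

/-- The communication consists of `O(d log S)` field elements. -/
theorem WellFormed.length_transcript_le (hC : C.WellFormed n) (ρ : List F) (y : F)
    (g : ℕ → ℕ → F[X]) :
    (C.transcript n ρ y g).length ≤ 29 * (C.depth * Nat.log 2 (C.size n)) := by
  have h1 : ∀ i k, (C.prefixTrace n ρ y g i k).length = (C.prefixTrace n ρ y g i 0).length +
      (∑ l ∈ Finset.range k, C.msgDegree n i l + 2 * k) := by
    intro i k
    induction k with
    | zero => simp
    | succ k ih =>
      rw [prefixTrace_succ, List.length_append, ih, length_roundEvents, Finset.sum_range_succ]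
      ring
  have h2 : ∀ i, (C.prefixTrace n ρ y g i 0).length = 1 +
      ∑ l ∈ Finset.range i, ∑ k ∈ Finset.range (C.arity n l + 1), C.msgDegree n l k +
      2 * C.offset n i := by
    intro i
    induction i with
    | zero => simp [prefixTrace, offset]
    | succ i ih =>
      rw [prefixTrace_layer, h1, ih, offset_succ, Finset.sum_range_succ (n := i)]
      ring
  have h3 := hC.sum_msgDegree_le
  have h4 := hC.numCoins_le
  have h5 : 1 ≤ C.depth * Nat.log 2 (C.size n) := Nat.mul_pos hC.depth_pos hC.one_le_log
  rw [← prefixTrace_depth, h2]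
  rw [numCoins] at h4
  omega

end Circuit


/-! ### Computations of a transducer -/

namespace Transducer

variable {T : Transducer} {n s : ℕ} {w : List DescSym}

/-- The configuration after `k` steps (or after fewer, if the machine halts earlier). -/
def conf (T : Transducer) (n k : ℕ) : T.Config := (fun c => (T.step n c).getD c)^[k] T.start

theorem conf_zero : T.conf n 0 = T.start := rfl

theorem conf_succ {k : ℕ} {c : T.Config} (h : T.step n (T.conf n k) = some c) :
    T.conf n (k + 1) = c := by
  rw [conf, Function.iterate_succ_apply']
  change (T.step n (T.conf n k)).getD (T.conf n k) = c
  rw [h]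
  rfl

theorem exists_conf_of_reaches {c : T.Config} (h : T.Reaches n c) :
    ∃ k, c = T.conf n k ∧ ∀ j < k, T.step n (T.conf n j) = some (T.conf n (j + 1)) := by
  induction h with
  | refl => exact ⟨0, rfl, fun j hj => absurd hj (Nat.not_lt_zero j)⟩
  | tail _ hstep ih =>
    obtain ⟨k, rfl, hk⟩ := ih
    have h1 := conf_succ hstep
    refine ⟨k + 1, h1.symm, fun j hj => ?_⟩
    rcases Nat.lt_succ_iff_lt_or_eq.1 hj with hj | rfl
    · exact hk j hj
    · rw [h1]
      exact hstep

/-- A configuration without the output. -/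
def Config.core (c : T.Config) : Fin (T.states + 1) × ℕ × ℕ × (ℕ → Fin (T.symbols + 1)) :=
  (c.state, c.inHead, c.workHead, c.tape)

theorem core_step {c c' : T.Config} (h : c.core = c'.core) :
    (T.step n c).map Config.core = (T.step n c').map Config.core := by
  simp only [Config.core, Prod.mk.injEq] at h
  obtain ⟨h1, h2, h3, h4⟩ := h
  simp only [step, h1, h2, h3, h4, Option.map_map]
  rfl

/-- The number of configurations with a work tape of `s` cells, up to the output. -/
def numCores (T : Transducer) (n s : ℕ) : ℕ :=
  (T.states + 1) * ((n + 2) * (s * (T.symbols + 1) ^ s))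

/-- A halting computation does not repeat a configuration; this bounds its length. -/
theorem Computes.exists_halt (h : T.Computes n s w) : ∃ H < T.numCores n s,
    (∀ k < H, T.step n (T.conf n k) = some (T.conf n (k + 1))) ∧ T.step n (T.conf n H) = none ∧
    (T.conf n H).out = w ∧ ∀ k ≤ H, (T.conf n k).workHead < s ∧ (T.conf n k).inHead ≤ n + 1 := by
  obtain ⟨hs, c, hc, hnone, hout⟩ := h
  obtain ⟨H, rfl, hstep⟩ := exists_conf_of_reaches hc
  have hreach : ∀ k ≤ H, T.Reaches n (T.conf n k) := by
    intro k
    induction k with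
    | zero => exact fun _ => .refl
    | succ k ih => exact fun hk => (ih (by omega)).tail (hstep k (by omega))
  have hin : ∀ k ≤ H, (T.conf n k).inHead ≤ n + 1 := by
    intro k hk
    rcases k with _ | k
    · exact Nat.zero_le _
    · have h1 := hstep k (by omega)
      simp only [step, Option.map_eq_some_iff] at h1
      obtain ⟨A, -, h2⟩ := h1
      rw [← h2]
      exact min_le_right _ _
  -- the head never reaches the cells from `s` on, so they stay blank
  have htape : ∀ k ≤ H, ∀ m, s ≤ m → (T.conf n k).tape m = 0 := by
    intro k
    induction k with
    | zero => exact fun _ _ _ => rfl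
    | succ k ih =>
      intro hk m hm
      have h1 := hstep k (by omega)
      simp only [step, Option.map_eq_some_iff] at h1
      obtain ⟨A, -, h2⟩ := h1
      have h3 := hs _ (hreach k (by omega))
      rw [← h2]
      simp only
      rw [Function.update_of_ne (by omega), ih (by omega) m hm]
  -- a repeated configuration could not halt after `H - j` further steps in one of the two runs
  -- and after more in the other
  have hinj : ∀ i j, i < j → j ≤ H → (T.conf n i).core ≠ (T.conf n j).core := by
    intro i j hij hj heq
    have h1 : ∀ m, j + m ≤ H → (T.conf n (i + m)).core = (T.conf n (j + m)).core := by
      intro m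
      induction m with
      | zero => exact fun _ => heq
      | succ m ih =>
        intro hm
        have h2 := core_step (n := n) (ih (by omega))
        rw [hstep _ (by omega), hstep _ (by omega)] at h2
        simpa only [Option.map_some, Option.some.injEq, ← add_assoc] using h2
    have h2 := core_step (n := n) (h1 (H - j) (by omega))
    rw [show j + (H - j) = H by omega, hnone, hstep _ (by omega)] at h2
    simp at h2
  refine ⟨H, ?_, hstep, hnone, hout, fun k hk => ⟨hs _ (hreach k hk), hin k hk⟩⟩
  have hcard := Fintype.card_le_of_injective
    (fun k : Fin (H + 1) => ((T.conf n k).state,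
      (⟨(T.conf n k).inHead, Nat.lt_succ_of_le (hin k (Nat.lt_succ_iff.1 k.2))⟩ : Fin (n + 2)),
      (⟨(T.conf n k).workHead, hs _ (hreach k (Nat.lt_succ_iff.1 k.2))⟩ : Fin s),
      fun m : Fin s => (T.conf n k).tape m)) ?_
  · simp only [Fintype.card_prod, Fintype.card_fin, Fintype.card_fun] at hcard
    rw [numCores]
    omega
  · intro k k' hkk
    simp only [Prod.mk.injEq, Fin.mk.injEq] at hkk
    obtain ⟨h1, h2, h3, h4⟩ := hkk
    have hcore : (T.conf n k).core = (T.conf n k').core := by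
      simp only [Config.core, h1, h2, h3, Prod.mk.injEq, true_and]
      funext m
      by_cases hm : m < s
      · exact congrFun h4 ⟨m, hm⟩
      · rw [htape k (Nat.lt_succ_iff.1 k.2) m (by omega),
          htape k' (Nat.lt_succ_iff.1 k'.2) m (by omega)]
    rcases lt_trichotomy k k' with hlt | heq | hlt
    · exact absurd hcore (hinj _ _ hlt (Nat.lt_succ_iff.1 k'.2))
    · exact heq
    · exact absurd hcore.symm (hinj _ _ hlt (Nat.lt_succ_iff.1 k.2))

theorem out_isPrefix {H : ℕ} (hstep : ∀ k < H, T.step n (T.conf n k) = some (T.conf n (k + 1)))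
    {k : ℕ} (hk : k ≤ H) : (T.conf n k).out <+: (T.conf n H).out := by
  induction H, hk using Nat.le_induction with
  | base => exact List.prefix_refl _
  | succ H hkH ih =>
    refine (ih fun j hj => hstep j (by omega)).trans ?_
    have h1 := hstep H (by omega)
    simp only [step, Option.map_eq_some_iff] at h1
    obtain ⟨A, -, h2⟩ := h1
    rw [← h2]
    exact List.prefix_append _ _

end Transducer

/-! ### Simulation of a transducer -/

/-- The names of the arrays and variables of the verifier. -/
inductive VName where
  -- the number of inputs, and finally the verdict and the result
  | main | ok
  -- the simulated transducer
  | state | inHead | workHead | halted | inSym | workSym | tapeA | tapeB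
  -- the description of the circuit
  | layer | width | gate | phase | op | left | acc | pow
  -- the parameters of the protocol
  | depth | layers | vars | count | index | offsets | arity | rounds
  -- counters
  | i | k
  -- evaluation of indicator polynomials
  | label | number | start | value
  -- field elements
  | rho | z | adds | muls | total | claim | coeff₀ | coeff₁ | coeff₂ | power
deriving DecidableEq

instance : Names VName where
  decEq := inferInstance
  code := VName.ctorIdx
  code_lt r := by cases r <;> decide
  code_inj := fun a b h => by rw [← VName.ofNat_ctorIdx a, h, VName.ofNat_ctorIdx]

/-- The memories `h` and `h'` agree, except for the word arrays in the list `l`. -/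
structure AgreeOff {ν : Type} {F : Type*} (l : List ν) (h h' : Memory ν F) : Prop where
  w : ∀ r, r ∉ l → h'.w r = h.w r
  f : h'.f = h.f
  coins : h'.coins = h.coins
  stream : h'.stream = h.stream
  trace : h'.trace = h.trace

namespace Simulation

open VName

/-- Two work tapes are available, so that two computations can start with a blank tape. -/
def tape : Bool → VName
  | false => tapeA
  | true => tapeB

/-- The variables of the simulation. -/
@[simp] def vars (b : Bool) : List VName :=
  [state, inHead, workHead, halted, inSym, workSym, tape b]

/-- The words that stand for the symbols of the input tape. -/
def code : InSym → ℕ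
  | .leftEnd => 0
  | .one => 1
  | .rightEnd => 2

/-- Reads the symbols under the two heads. The input tape `1^n` needs no memory: its symbol is
determined by the position of the head. -/
def scan (b : Bool) : Prog VName :=
  .cond (.lt 0 inHead) (.cond (.lt main inHead) (.wset inSym 0 2) (.wset inSym 0 1))
    (.wset inSym 0 0) ;;
  .wset workSym 0 (.get (tape b) workHead)

/-- Moves the head on the input tape. -/
def moveIn : Dir → Prog VName
  | .left => .wset inHead 0 (inHead - 1)
  | .stay => .skip
  | .right => .cond (.lt main inHead) .skip (.wset inHead 0 (inHead + 1))

/-- Moves the head on the work tape. -/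
def moveWork : Dir → Prog VName
  | .left => .wset workHead 0 (workHead - 1)
  | .stay => .skip
  | .right => .wset workHead 0 (workHead + 1)

variable (T : Transducer) (b : Bool) (hook : DescSym → Prog VName)

/-- Changes the state, the work tape and the positions of the heads. -/
def update {T : Transducer} (A : TAction T.states T.symbols) : Prog VName :=
  .wset state 0 (.const A.state) ;; .wset (tape b) workHead (.const A.write) ;;
    moveIn A.moveIn ;; moveWork A.moveWork

/-- The program for an entry of the transition table. For each symbol that the transducer appends to
its output, the program `hook` is executed. -/
def act {T : Transducer} : Option (TAction T.states T.symbols) → Prog VName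
  | none => .wset halted 0 1
  | some A => update b A ;; match A.emit with
    | none => .skip
    | some x => hook x

/-- The search for the current situation in a list of situations. -/
def search {T : Transducer} :
    List (Fin (T.states + 1) × InSym × Fin (T.symbols + 1)) → Prog VName
  | [] => .skip
  | x :: l => .cond (.eq state (.const x.1))
      (.cond (.eq inSym (.const (code x.2.1)))
        (.cond (.eq workSym (.const x.2.2)) (act b hook (T.delta x.1 x.2.1 x.2.2)) (search l))
        (search l))
      (search l)

/-- All situations of the transducer. -/
def situations : List (Fin (T.states + 1) × InSym × Fin (T.symbols + 1)) :=
  (List.finRange (T.states + 1)).flatMap fun q =>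
    [InSym.leftEnd, .one, .rightEnd].flatMap fun x =>
      (List.finRange (T.symbols + 1)).map fun y => (q, x, y)

theorem mem_situations (q : Fin (T.states + 1)) (x : InSym) (y : Fin (T.symbols + 1)) :
    (q, x, y) ∈ situations T := by
  simp only [situations, List.mem_flatMap, List.mem_map]
  exact ⟨q, List.mem_finRange q, x, by cases x <;> simp, y, List.mem_finRange y, rfl⟩

/-- The simulation of one step. -/
def body : Prog VName := scan b ;; search b hook (situations T)

/-- Sets up the initial configuration, up to the work tape, which has to be blank. -/
def reset : Prog VName :=
  .wset state 0 0 ;; .wset inHead 0 0 ;; .wset workHead 0 0 ;; .wset halted 0 0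

/-- The simulation of the transducer `T`. -/
def simulate : Prog VName := reset ;; .loop (.eq halted 0) (body T b hook)

variable {T b hook} {F : Type*} [Field F] {E : Env F} {n s : ℕ}

/-- The entry for the current situation is found and executed. The time of the search is a
constant, since the transition table is a part of the program. -/
theorem ht_search {Q : Memory VName F → Prop} {h : Memory VName F} {t : ℕ}
    {q : Fin (T.states + 1)} {x : InSym} {y : Fin (T.symbols + 1)}
    (hq : h.w state 0 = q) (hx : h.w inSym 0 = code x) (hy : h.w workSym 0 = y)
    (H : HT E (act b hook (T.delta q x y)) t Q h)
    (l : List (Fin (T.states + 1) × InSym × Fin (T.symbols + 1))) (hmem : (q, x, y) ∈ l) :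
    HT E (search b hook l) (24 * l.length + t) Q h := by
  induction l with
  | nil => simp at hmem
  | cons z l ih =>
    have key : HT E (search b hook (z :: l)) (8 + (8 + (8 + (24 * l.length + t)))) Q h := by
      have hne : (q, x, y) ≠ z → HT E (search b hook l) (24 * l.length + t) Q h := fun hne =>
        ih (by simpa [hne] using hmem)
      refine HT.cond (by simp) (fun h1 => HT.cond (by simp) (fun h2 => HT.cond (by simp)
        (fun h3 => ?_) fun h3 => hne ?_) fun h2 => (hne ?_).time (by omega))
        fun h1 => (hne ?_).time (by omega)
      · simp only [TE.Holds, WE.val, hq, hx, hy] at h1 h2 h3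
        have e1 : q = z.1 := Fin.ext h1
        have e2 : x = z.2.1 := by
          revert h2
          cases x <;> cases z.2.1 <;> simp [code]
        have e3 : y = z.2.2 := Fin.ext h3
        rw [e1, e2, e3] at H
        exact H.time (by omega)
      · rintro rfl
        exact h3 (by simpa using hy)
      · rintro rfl
        exact h2 (by simpa using hx)
      · rintro rfl
        exact h1 (by simpa using hq)
    exact key.time (by simp; omega)

/-- The memory represents the configuration `c`. -/
structure Represents (b : Bool) (c : T.Config) (h : Memory VName F) : Prop where
  state : h.w state 0 = c.state
  inHead : h.w inHead 0 = c.inHead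
  workHead : h.w workHead 0 = c.workHead
  tape : ∀ k, h.w (tape b) k = c.tape k

theorem Represents.agree {c : T.Config} {h h' : Memory VName F} (H : Represents b c h) {p : Prog VName}
    (hf : Frame p h h') (hp : ∀ r ∈ vars b, r ∉ p.wmods) : Represents b c h' := by
  obtain ⟨h1, h2, h3, h4⟩ := H
  constructor
  · rw [hf.w _ (hp _ (by simp)), h1]
  · rw [hf.w _ (hp _ (by simp)), h2]
  · rw [hf.w _ (hp _ (by simp)), h3]
  · rw [hf.w _ (hp _ (by simp))]
    exact h4

/-- What the environment has to provide for the simulation. -/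
structure Provides (T : Transducer) (n s : ℕ) (E : Env F) : Prop where
  idx : ∀ k < s, E.Idx k
  states : T.states ≤ E.bound
  symbols : T.symbols ≤ E.bound
  input : n + 1 ≤ E.bound
  space : s ≤ E.bound

theorem ht_scan (hE : Provides T n s E) {c : T.Config} {h : Memory VName F}
    (hc : Represents b c h) (hs : c.workHead < s) (hn : h.w main 0 = n) (hn1 : 1 ≤ n) :
    HT E (scan b) 70 (fun h' => Represents b c h' ∧ AgreeOff (vars b) h h' ∧
      h'.w halted 0 = h.w halted 0 ∧
      h'.w inSym 0 = code (Transducer.inputSym n c.inHead) ∧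
      h'.w workSym 0 = c.tape c.workHead) h := by
  obtain ⟨h1, h2, h3, h4⟩ := hc
  have hB := hE.input
  have hidx := hE.idx _ hs
  have hcost : (scan b).cost ≤ 70 := by cases b <;> decide
  refine HT.block (fun hbd => ?_) hcost
  have h5 := (h4 c.workHead).symm ▸ hbd (tape b) c.workHead
  rcases Nat.eq_zero_or_pos c.inHead with h0 | h0
  · cases b <;> simp only [tape] at h4 h5 <;>
      simp [scan, h2, h3, h4, hn, h0, hidx, h5, tape, Transducer.inputSym, code] <;>
      exact ⟨⟨by simp [h1], by simp [h2], by simp [h3], by simp [tape, h4]⟩,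
        ⟨fun r hr => by funext k; simp [tape] at hr; simp [hr], rfl, rfl, rfl, rfl⟩⟩
  · by_cases hle : c.inHead ≤ n
    · have hlt : ¬ n < c.inHead := by omega
      cases b <;> simp only [tape] at h4 h5 <;>
      simp [scan, h2, h3, h4, hn, h0, h0.ne', hle, hlt, hidx, h5, tape, Transducer.inputSym,
        code] <;>
      exact ⟨by omega, ⟨by simp [h1], by simp [h2], by simp [h3], by simp [tape, h4]⟩,
        ⟨fun r hr => by funext k; simp [tape] at hr; simp [hr], rfl, rfl, rfl, rfl⟩⟩
    · have hlt : n < c.inHead := by omega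
      cases b <;> simp only [tape] at h4 h5 <;>
      simp [scan, h2, h3, h4, hn, h0, h0.ne', hle, hlt, hidx, h5, tape, Transducer.inputSym,
        code] <;>
      exact ⟨by omega, ⟨by simp [h1], by simp [h2], by simp [h3], by simp [tape, h4]⟩,
        ⟨fun r hr => by funext k; simp [tape] at hr; simp [hr], rfl, rfl, rfl, rfl⟩⟩

theorem setW_self (h : Memory VName F) (r : VName) (k : ℕ) : h.setW r k (h.w r k) = h := by
  have : (fun r' k' => if r' = r ∧ k' = k then h.w r k else h.w r' k') = h.w := by
    funext r' k'
    split
    · next hh => rw [hh.1, hh.2]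
    · rfl
  simp only [Memory.setW, this]

theorem ht_moveIn (d : Dir) {p : ℕ} {h : Memory VName F} (hp : h.w inHead 0 = p)
    (hn : h.w main 0 = n) (hle : p ≤ n + 1) (hB : n + 1 ≤ E.bound) :
    HT E (moveIn d) 40 (· = h.setW inHead 0 (min (d.move p) (n + 1))) h := by
  cases d with
  | left =>
    refine HT.block (fun _ => ?_) (by decide : (moveIn .left).cost ≤ 40)
    have h1 : p - 1 ≤ n + 1 := by omega
    simp [moveIn, hp, Dir.move, min_eq_left h1]
    omega
  | stay =>
    refine HT.block (fun _ => ?_) (by decide : (moveIn .stay).cost ≤ 40)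
    have h1 := setW_self h inHead 0
    rw [hp] at h1
    simp [moveIn, Dir.move, min_eq_left hle, h1]
  | right =>
    refine HT.block (fun _ => ?_) (by decide : (moveIn .right).cost ≤ 40)
    have h1 := setW_self h inHead 0
    by_cases hlt : n < p
    · have h2 : p = n + 1 := by omega
      rw [hp, h2] at h1
      simp [moveIn, hp, hn, Dir.move, h2, h1]
    · have h2 : min (p + 1) (n + 1) = p + 1 := by omega
      simp [moveIn, hp, hn, hlt, Dir.move, h2]
      omega

theorem ht_moveWork (d : Dir) {p : ℕ} {h : Memory VName F} (hp : h.w workHead 0 = p)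
    (hB : p + 1 ≤ E.bound) : HT E (moveWork d) 20 (· = h.setW workHead 0 (d.move p)) h := by
  cases d with
  | left =>
    refine HT.block (fun _ => ?_) (by decide : (moveWork .left).cost ≤ 20)
    simp [moveWork, hp, Dir.move]
    omega
  | stay =>
    refine HT.block (fun _ => ?_) (by decide : (moveWork .stay).cost ≤ 20)
    have h1 := setW_self h workHead 0
    rw [hp] at h1
    simp [moveWork, Dir.move, h1]
  | right =>
    refine HT.block (fun _ => ?_) (by decide : (moveWork .right).cost ≤ 20)
    simp [moveWork, hp, Dir.move]
    omega

theorem ht_update (hE : Provides T n s E) {c : T.Config} {h : Memory VName F}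
    (hc : Represents b c h) (hs : c.workHead < s) (hn : h.w main 0 = n) (hin : c.inHead ≤ n + 1)
    (A : TAction T.states T.symbols) (out : List DescSym) :
    HT E (update b A) 90 (fun h' => Represents b
        { state := A.state
          inHead := min (A.moveIn.move c.inHead) (n + 1)
          workHead := A.moveWork.move c.workHead
          tape := Function.update c.tape c.workHead A.write
          out := out } h' ∧ AgreeOff (vars b) h h' ∧ h'.w halted 0 = h.w halted 0) h := by
  obtain ⟨h1, h2, h3, h4⟩ := hc
  have hidx := hE.idx _ hs
  have e1 : (A.state : ℕ) ≤ E.bound := (Nat.lt_succ_iff.1 A.state.2).trans hE.states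
  have e2 : (A.write : ℕ) ≤ E.bound := (Nat.lt_succ_iff.1 A.write.2).trans hE.symbols
  have e3 := hE.space
  have hupd : ∀ k, (if k = c.workHead then (A.write : ℕ) else c.tape k) =
      (Function.update c.tape c.workHead A.write k : Fin (T.symbols + 1)) := by
    intro k
    by_cases hk : k = c.workHead
    · subst hk; simp
    · simp [hk]
  refine (HT.seq (T := 7) (R := (· = h.setW state 0 A.state)) ?_ ?_ (T' := 83)).time (by norm_num)
  · exact HT.block (fun _ => by simp [e1]) (le_of_eq rfl)
  rintro _ - - rfl
  refine (HT.seq (T := 14) (R := (· = (h.setW state 0 A.state).setW (tape b) c.workHead A.write))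
    ?_ ?_ (T' := 60)).time (by norm_num)
  · exact HT.block (fun _ => by simp [e2, h3, hidx]) (by decide : 12 ≤ 14)
  rintro _ - - rfl
  have hne : inHead ≠ tape b ∧ workHead ≠ tape b ∧ halted ≠ tape b ∧ main ≠ tape b ∧
    state ≠ tape b := by cases b <;> simp [tape]
  refine (HT.seq (T := 40) (T' := 20) (ht_moveIn A.moveIn (p := c.inHead) (n := n) (by simp [hne, h2])
    (by simp [hne, hn]) hin hE.input) ?_).time (by norm_num)
  rintro _ - - rfl
  refine (ht_moveWork A.moveWork (p := c.workHead) (by simp [hne, h3]) (by omega)).mono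
    le_rfl ?_
  rintro _ - - rfl
  refine ⟨⟨by simp [hne], by simp, by simp, fun k => ?_⟩, ⟨fun r hr => ?_, rfl, rfl, rfl, rfl⟩,
    by simp [hne]⟩
  · rw [← hupd]
    simp [hne.1.symm, hne.2.1.symm, hne.2.2.2.2.symm, h4]
  · funext k
    simp only [vars, List.mem_cons, not_or] at hr
    simp [hr]

/-- If the transducer computes `w`, and the program `hook` processes each further symbol of `w`,
then the simulation processes `w`. -/
theorem ht_simulate {w : List DescSym} (hT : T.Computes n s w) (hE : Provides T n s E)
    (hn1 : 1 ≤ n) (J : List DescSym → Memory VName F → Prop) {t : ℕ}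
    (hJ : ∀ out h h', AgreeOff (vars b) h h' → J out h → J out h')
    (hmods : ∀ x, ∀ r ∈ main :: vars b, r ∉ (hook x).wmods)
    (hhook : ∀ out x, out ++ [x] <+: w → ∀ h, h.Bounded E.bound → J out h →
      HT E (hook x) t (J (out ++ [x])) h)
    {h : Memory VName F} (hn : h.w main 0 = n) (hb : ∀ k, h.w (tape b) k = 0) (hJ0 : J [] h) :
    HT E (simulate T b hook)
      ((T.numCores n s + 1) * (t + 24 * (situations T).length + 200) + 50) (J w) h := by
  obtain ⟨H, hH, hstep, hnone, hout, hconf⟩ := hT.exists_halt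
  have hne : inHead ≠ tape b ∧ workHead ≠ tape b ∧ halted ≠ tape b ∧ main ≠ tape b ∧
    state ≠ tape b := by cases b <;> simp [tape]
  have hmain : main ∉ vars b := by simp [hne]
  -- after `H + 1` rounds, the machine is marked as halted
  let I : ℕ → Memory VName F → Prop := fun k h' => h'.w main 0 = n ∧ if k ≤ H then
    h'.w halted 0 = 0 ∧ Represents b (T.conf n k) h' ∧ J (T.conf n k).out h'
    else h'.w halted 0 = 1 ∧ J w h'
  have hfin : ∀ h', I (H + 1) h' → J w h' := fun h' hI => by
    have := hI.2
    rw [if_neg (by omega)] at this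
    exact this.2
  refine (HT.seq (T := 28) (R := I 0) ?_ fun h0 _ _ hI0 => ((HT.loop (H + 1) I hI0
    (T := fun _ => t + 24 * (situations T).length + 170) ?_ ?_).mono le_rfl
      fun h' _ _ hI => hfin h' hI)).time ?_
  · refine HT.block (fun _ => ?_) (by decide)
    simp only [I, Transducer.conf_zero]
    have h1 : ∀ k, ((((h.setW state 0 0).setW inHead 0 0).setW workHead 0 0).setW halted 0 0).w
        (tape b) k = 0 := fun k => by
      simp [hb, hne.1.symm, hne.2.1.symm, hne.2.2.1.symm, hne.2.2.2.2.symm]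
    have hrep : Represents b T.start
        ((((h.setW state 0 0).setW inHead 0 0).setW workHead 0 0).setW halted 0 0) :=
      ⟨by simp [Transducer.start], by simp [Transducer.start], by simp [Transducer.start],
        fun k => by rw [h1]; rfl⟩
    have hj : J T.start.out
        ((((h.setW state 0 0).setW inHead 0 0).setW workHead 0 0).setW halted 0 0) := by
      refine hJ _ h _ ⟨fun r hr => ?_, rfl, rfl, rfl, rfl⟩ hJ0
      funext k
      simp only [vars, List.mem_cons, not_or] at hr
      simp [hr]
    simpa [reset, hn] using And.intro hrep hj
  · rintro k hk h' - - ⟨-, hI⟩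
    split at hI
    · simp [hI.1]; omega
    · simp [hI.1]; omega
  · rintro k hk h' - - ⟨hn', hI⟩
    rw [if_pos (by omega)] at hI
    obtain ⟨hh, hc, hj⟩ := hI
    obtain ⟨hws, hin⟩ := hconf k (by omega)
    refine (HT.seq (T := 70) (ht_scan hE hc hws hn' hn1) (T' := 24 * (situations T).length + (t + 100))
      ?_).time (by omega)
    rintro h1 - - ⟨hc1, ho1, hh1, hi1, hw1⟩
    have hj1 := hJ _ _ _ ho1 hj
    have hn1' : h1.w main 0 = n := by rw [ho1.w _ hmain, hn']
    refine ht_search hc1.state hi1 hw1 ?_ _ (mem_situations T _ _ _)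
    -- no entry in the transition table: the simulated machine halts, and this is round `H`
    rcases hA : T.delta (T.conf n k).state (Transducer.inputSym n (T.conf n k).inHead)
      ((T.conf n k).tape (T.conf n k).workHead) with _ | A
    · have hkH : k = H := by
        by_contra hkH
        have := hstep k (by omega)
        simp [Transducer.step, hA] at this
      subst hkH
      refine HT.block (fun _ => ?_) (show (Prog.wset halted 0 1 : Prog VName).cost ≤ t + 100 from
        (by decide : (Prog.wset halted 0 1 : Prog VName).cost ≤ 100).trans (by omega))
      have h1B : 1 ≤ E.bound := (Nat.le_add_left 1 n).trans hE.input
      suffices hs : I (k + 1) (h1.setW halted 0 1) by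
        simpa [act, h1B] using hs
      refine ⟨by simp [hn1'], ?_⟩
      rw [if_neg (by omega)]
      refine ⟨by simp, ?_⟩
      rw [← hout]
      refine hJ _ h1 _ ⟨fun r hr => ?_, rfl, rfl, rfl, rfl⟩ hj1
      funext m
      simp only [vars, List.mem_cons, not_or] at hr
      simp [hr]
    · have hkH : k < H := by
        by_contra hkH
        have : k = H := by omega
        subst this
        simp [Transducer.step, hA] at hnone
      have hs := hstep k hkH
      simp only [Transducer.step, hA, Option.map_some, Option.some.injEq] at hs
      refine (HT.seq (T := 90) (ht_update hE hc1 hws hn1' hin A (T.conf n (k + 1)).out) (T' := t + 1)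
        ?_).time (by omega)
      rintro h2 - - ⟨hc2, ho2, hh2⟩
      have hout2 : (T.conf n (k + 1)).out = (T.conf n k).out ++ A.emit.toList := by rw [← hs]
      have hc2' : Represents b (T.conf n (k + 1)) h2 := by
        have h3 : (T.conf n (k + 1)) = { state := A.state
                                         inHead := min (A.moveIn.move (T.conf n k).inHead) (n + 1)
                                         workHead := A.moveWork.move (T.conf n k).workHead
                                         tape := Function.update (T.conf n k).tape
                                           (T.conf n k).workHead A.write
                                         out := (T.conf n (k + 1)).out } := by
          rw [hout2]
          exact hs.symm
        rw [h3]
        exact hc2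
      have hn2 : h2.w main 0 = n := by rw [ho2.w _ hmain, hn1']
      have hh2' : h2.w halted 0 = 0 := by rw [hh2, hh1, hh]
      have hj2 := hJ _ _ _ ho2 hj1
      have hpre := hout ▸ Transducer.out_isPrefix hstep (show k + 1 ≤ H from hkH)
      -- the hook runs only if the step extends the output
      rcases he : A.emit with _ | x
      · refine HT.block (fun _ => ?_) (show (Prog.skip : Prog VName).cost ≤ t + 1 by
          simp [Prog.cost])
        rw [he] at hout2
        simp only [Prog.wp, I]
        rw [if_pos (by omega), hout2]
        exact ⟨hn2, hh2', hc2', by simpa using hj2⟩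
      · rw [he] at hout2
        rw [hout2] at hpre
        refine (HT.of_bounded fun hB2 => (hhook _ x hpre h2 hB2 hj2).mono (Nat.le_succ t) ?_)
        intro h3 hf _ hj3
        have hm := hmods x
        simp only [I]
        rw [if_pos (by omega), hout2]
        refine ⟨by rw [hf.w _ (hm _ (by simp)), hn2], by rw [hf.w _ (hm _ (by simp)), hh2'],
          hc2'.agree hf fun r hr => hm r (List.mem_cons_of_mem _ hr), by simpa using hj3⟩
  · have hcost : (TE.eq (halted : WE VName) 0).compile.cost = 8 := rfl
    simp only [hcost, Finset.sum_const, Finset.card_range, smul_eq_mul]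
    have : (H + 1) * (t + 24 * (situations T).length + 170 + 8) ≤
        (T.numCores n s + 1) * (t + 24 * (situations T).length + 200) :=
      Nat.mul_le_mul (by omega) (by omega)
    omega

end Simulation


/-! ### Subroutines for logarithms and indicator polynomials -/

section Subroutines

variable {ν : Type} [Names ν] {F : Type*} [Field F] {E : Env F}

/-- Stores the rounded up logarithm of `e` in `c`, by repeated doubling of `p`. -/
def Prog.clog (c p : ν) (e : WE ν) : Prog ν :=
  .wset c 0 0 ;; .wset p 0 1 ;; .loop (.lt p e) (.wset p 0 (p * 2) ;; .wset c 0 (c + 1))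

theorem HT.clog {c p : ν} {e : WE ν} {h : Memory ν F} {w t : ℕ} (hcp : c ≠ p)
    (he : ∀ h', Frame (.clog c p e) h h' → e.Ok E h' ∧ e.val E h' = w)
    (ht : e.compile.cost ≤ t) (hw : 2 * w + 1 ≤ E.bound) :
    HT E (.clog c p e) ((Nat.clog 2 w + 1) * (t + 40))
      (fun h' => h'.w c 0 = Nat.clog 2 w ∧ h'.w p 0 = 2 ^ Nat.clog 2 w) h := by
  have hc1 : (Prog.wset c 0 0 : Prog ν).cost = 7 := rfl
  have hc2 : (Prog.wset p 0 1 : Prog ν).cost = 7 := rfl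
  have hc3 : (Prog.wset p 0 (p * 2) ;; Prog.wset c 0 (c + 1) : Prog ν).cost = 28 := rfl
  have hcost : (TE.lt (p : WE ν) e).compile.cost ≤ t + 7 := by
    change 6 + e.compile.cost + 1 ≤ t + 7
    omega
  refine (HT.seq (T := 7) (R := (· = h.setW c 0 0)) (HT.block (fun _ => by simp) hc1.le) ?_
    (T' := 7 + (Nat.clog 2 w * (28 + (t + 7)) + (t + 7)))).time (by ring_nf; omega)
  rintro _ hf - rfl
  refine HT.seq (R := (· = (h.setW c 0 0).setW p 0 1)) (HT.block (fun _ => by simp; omega) hc2.le) ?_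
  rintro _ hf1 - rfl
  refine (HT.loop (T := fun _ => 28) (Nat.clog 2 w) (fun k h' => h'.w c 0 = k ∧ h'.w p 0 = 2 ^ k)
    (by simp [hcp]) ?_ ?_).time ?_
  · rintro k hk h' hf2 - ⟨-, hp⟩
    obtain ⟨h1, h2⟩ := he h' ((hf.seq_left _).trans ((hf1.seq_left _ |>.trans
      ((hf2.loop _).seq_right _)).seq_right _))
    simp [h1, h2, hp, Nat.lt_clog_iff_pow_lt]
  · rintro k hk h' hf2 - ⟨hc, hp⟩
    refine HT.block (fun _ => ?_) hc3.le
    have hlt : 2 ^ k < w := (Nat.lt_clog_iff_pow_lt (by norm_num)).1 hk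
    have hkw : k < 2 ^ k := Nat.lt_two_pow_self
    simp [hcp, hcp.symm, hc, hp, pow_succ]
    omega
  · simp only [Finset.sum_const, Finset.card_range, smul_eq_mul]
    have := Nat.mul_le_mul_left (Nat.clog 2 w) (Nat.add_le_add_left hcost 28)
    omega

end Subroutines

namespace VName

variable {F : Type*} [Field F] {E : Env F}

/-- Multiplies `value` by the indicator polynomial of `label`, in `count` variables, at the point
that is stored in the array `r` from the index `start` on. -/
def indicator (r : VName) : Prog VName :=
  .for_ k count
    (.cond (.eq (label % 2) 1) (.fset value 0 (value * .get r (start + k)))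
      (.fset value 0 (value * (1 - .get r (start + k)))) ;;
    .wset label 0 (label / 2))

theorem ht_indicator {r : VName} (hr : r ≠ value) {h : Memory VName F} {v j s : ℕ} {x : ℕ → F}
    (hv : h.w count 0 = v) (hj : h.w label 0 = j) (hs : h.w start 0 = s)
    (hx : ∀ k < v, h.f r (s + k) = x k) (hidx : ∀ k < v, E.Idx (s + k)) :
    HT E (indicator r) (v * 110 + 40) (fun h' => h'.f value 0 = h.f value 0 * chi v j x) h := by
  refine (HT.for_const (T := 70) v (fun m h' => h'.w label 0 = j / 2 ^ m ∧
    h'.f value 0 = h.f value 0 * chi m j x) hv (by simp) (by decide) (by simp) ?_ ?_ ?_).mono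
    (by omega) fun _ _ _ hq => hq.2
  · rintro m h' u ⟨h1, h2⟩
    exact ⟨by simp [h1], by simp [h2]⟩
  · simp [hj, chi_zero]
  · rintro m hm h' hf hb hk ⟨h1, h2⟩
    have h3 : h'.w start 0 = s := by rw [hf.w _ (by simp [Prog.for_]), hs]
    have h4 : h'.f r (s + m) = x m := by
      rw [hf.f _ (by simp [Prog.for_, hr]), hx m hm]
    have h5 := hidx m hm
    have h6 : j / 2 ^ (m + 1) = j / 2 ^ m / 2 := by rw [pow_succ, Nat.div_div_eq_div_mul]
    have h7 := hb label 0
    rw [h1] at h7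
    have h8 : j / 2 ^ m / 2 ≤ E.bound := (Nat.div_le_self _ _).trans h7
    have h9 : j.testBit m = decide (j / 2 ^ m % 2 = 1) := Nat.testBit_eq_decide_div_mod_eq
    refine HT.block (fun _ => ?_) (Nat.le_of_ble_eq_true rfl)
    by_cases hbit : j / 2 ^ m % 2 = 1
    · simp [h1, h2, h3, hk, h4, h5, h6, h8, h9, hbit, chi_succ]
      ring
    · simp [h1, h2, h3, hk, h4, h5, h6, h8, h9, hbit, chi_succ]
      ring

end VName

namespace Simulation

variable {T : Transducer} {b : Bool} {hook : DescSym → Prog VName} {F : Type*} [Field F]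

/-- What holds for the atomic parts of the simulation and is preserved by the constructors of
programs holds for the simulation. -/
theorem simulate_induction {Q : Prog VName → Prop} (skip : Q .skip)
    (wset : ∀ r ∈ vars b, ∀ i e, Q (.wset r i e)) (seq : ∀ p q, Q p → Q q → Q (p ;; q))
    (cond : ∀ t p q, Q p → Q q → Q (.cond t p q)) (loop : ∀ t p, Q p → Q (.loop t p))
    (hhook : ∀ x, Q (hook x)) : Q (simulate T b hook) := by
  have hact : ∀ o : Option (TAction T.states T.symbols), Q (act b hook o) := by
    rintro (_ | ⟨q, y, d, d', e⟩)
    · exact wset _ (by simp) _ _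
    · refine seq _ _ (seq _ _ (wset _ (by simp) _ _) (seq _ _ (wset _ (by simp) _ _)
        (seq _ _ ?_ ?_))) ?_
      · rcases d with _ | _ | _
        exacts [wset _ (by simp) _ _, skip, cond _ _ _ skip (wset _ (by simp) _ _)]
      · rcases d' with _ | _ | _
        exacts [wset _ (by simp) _ _, skip, wset _ (by simp) _ _]
      · rcases e with _ | x
        exacts [skip, hhook x]
  have hsearch : ∀ l, Q (search (T := T) b hook l) := by
    intro l
    induction l with
    | nil => exact skip
    | cons x l ih => exact cond _ _ _ (cond _ _ _ (cond _ _ _ (hact _) ih) ih) ih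
  refine seq _ _ (seq _ _ (wset _ (by simp) _ _) (seq _ _ (wset _ (by simp) _ _)
    (seq _ _ (wset _ (by simp) _ _) (wset _ (by simp) _ _)))) (loop _ _ (seq _ _ (seq _ _
      (cond _ _ _ (cond _ _ _ (wset _ (by simp) _ _) (wset _ (by simp) _ _))
        (wset _ (by simp) _ _)) (wset _ (by simp) _ _)) (hsearch _)))

theorem wmods_simulate {r : VName} (hw : r ∉ vars b) (h : ∀ x, r ∉ (hook x).wmods) :
    r ∉ (simulate T b hook).wmods := by
  refine simulate_induction (Q := fun p => r ∉ p.wmods) (by simp) ?_ ?_ ?_ ?_ h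
  · rintro q hq i e hr
    rw [Prog.wmods, List.mem_singleton] at hr
    exact hw (hr ▸ hq)
  all_goals simp +contextual

theorem fmods_simulate {r : VName} (h : ∀ x, r ∉ (hook x).fmods) :
    r ∉ (simulate T b hook).fmods := by
  refine simulate_induction (Q := fun p => r ∉ p.fmods) ?_ ?_ ?_ ?_ ?_ h
  all_goals simp +contextual

theorem samples_simulate (h : ∀ x, (hook x).samples = false) :
    (simulate T b hook).samples = false := by
  refine simulate_induction (Q := fun p => p.samples = false) ?_ ?_ ?_ ?_ ?_ h
  all_goals simp +contextual

theorem talks_simulate (h : ∀ x, (hook x).talks = false) :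
    (simulate T b hook).talks = false := by
  refine simulate_induction (Q := fun p => p.talks = false) ?_ ?_ ?_ ?_ ?_ h
  all_goals simp +contextual

end Simulation


/-! ### Preprocessing: the parameters of the protocol -/

/-- The effect of a symbol of a description on the number of complete layers and on the numbers of
gates of the layers. -/
def countStep (s : ℕ × (ℕ → ℕ)) : DescSym → ℕ × (ℕ → ℕ)
  | .add => (s.1, Function.update s.2 s.1 (s.2 s.1 + 1))
  | .mul => (s.1, Function.update s.2 s.1 (s.2 s.1 + 1))
  | .bit _ => s
  | .comma => s
  | .endLayer => (s.1 + 1, s.2)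

/-- The counts never decrease, so during the run they are bounded by their final values. -/
theorem le_foldl_countStep (l : List DescSym) (s : ℕ × (ℕ → ℕ)) : s ≤ l.foldl countStep s := by
  induction l generalizing s with
  | nil => exact le_rfl
  | cons x l ih =>
    refine le_trans ?_ (ih _)
    have h : s.2 ≤ Function.update s.2 s.1 (s.2 s.1 + 1) := by
      intro k
      by_cases hk : k = s.1
      · subst hk; simp
      · simp [hk]
    cases x
    exacts [⟨le_rfl, h⟩, ⟨le_rfl, h⟩, le_rfl, le_rfl, ⟨Nat.le_succ _, le_rfl⟩]

theorem foldl_countStep_bits (l : List Bool) (s : ℕ × (ℕ → ℕ)) :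
    (l.map DescSym.bit).foldl countStep s = s := by
  induction l with
  | nil => rfl
  | cons x l ih => exact ih

theorem foldl_countStep_gate (g : Gate) (s : ℕ × (ℕ → ℕ)) :
    g.encode.foldl countStep s = (s.1, Function.update s.2 s.1 (s.2 s.1 + 1)) := by
  obtain ⟨o, l, r⟩ := g
  cases o <;> simp [Gate.encode, List.foldl_append, countStep, foldl_countStep_bits]

theorem foldl_countStep_gates (L : List Gate) (s : ℕ × (ℕ → ℕ)) :
    (L.flatMap Gate.encode).foldl countStep s =
      (s.1, Function.update s.2 s.1 (s.2 s.1 + L.length)) := by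
  induction L generalizing s with
  | nil => simp
  | cons g L ih =>
    rw [List.flatMap_cons, List.foldl_append, foldl_countStep_gate, ih]
    simp [add_assoc, add_comm L.length]

theorem foldl_countStep_encode (C : Circuit) (s : ℕ × (ℕ → ℕ)) (hs : ∀ i, s.1 ≤ i → s.2 i = 0) :
    C.encode.foldl countStep s = (s.1 + C.depth, fun i => if i < s.1 then s.2 i else
      (C.layer (i - s.1)).length) := by
  induction C generalizing s with
  | nil =>
    simp only [Circuit.encode, List.flatMap_nil, List.foldl_nil, Circuit.depth, List.length_nil,
      add_zero, Circuit.layer]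
    refine Prod.ext rfl (funext fun i => ?_)
    by_cases hi : i < s.1
    · simp [hi]
    · simp [hi, hs i (by omega)]
  | cons L C ih =>
    rw [Circuit.encode, List.flatMap_cons, List.foldl_append, List.foldl_append,
      foldl_countStep_gates]
    have h := ih (s.1 + 1, Function.update s.2 s.1 (s.2 s.1 + L.length)) (fun i hi => by
      simp only at hi
      have h1 : i ≠ s.1 := by omega
      simp [h1, hs i (by omega)])
    rw [Circuit.encode] at h
    simp only [List.foldl_cons, List.foldl_nil, countStep]
    rw [h]
    refine Prod.ext (by simp [Circuit.depth]; omega) (funext fun i => ?_)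
    simp only
    rcases lt_trichotomy i s.1 with hi | rfl | hi
    · have h1 : i ≠ s.1 := by omega
      simp [hi, h1, show i < s.1 + 1 by omega]
    · simp [hs s.1 le_rfl, Circuit.layer]
    · obtain ⟨k, rfl⟩ := Nat.exists_eq_add_of_lt hi
      have h1 : ¬ s.1 + k + 1 < s.1 + 1 := by omega
      have h2 : ¬ s.1 + k + 1 < s.1 := by omega
      have h3 : s.1 + k + 1 - (s.1 + 1) = k := by omega
      have h4 : s.1 + k + 1 - s.1 = k + 1 := by omega
      simp only [h1, h2, h3, h4, if_false, Circuit.layer, List.getD_cons_succ]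

/-- The environment provides enough room for the data of the protocol. -/
structure Room {F : Type*} (n : ℕ) (C : Circuit) (E : Env F) : Prop where
  idx : ∀ k ≤ C.numCoins n + C.depth + 1, E.Idx k
  bound : 4 * C.size n + C.numCoins n + 4 ≤ E.bound

namespace VName

variable {F : Type*} [Field F] {E : Env F} {n s : ℕ} {C : Circuit} {T : Transducer}

/-- Processes a symbol of the description as in `countStep`. -/
def countHook : DescSym → Prog VName
  | .add => .wset width layer (.get width layer + 1)
  | .mul => .wset width layer (.get width layer + 1)
  | .bit _ => .skip
  | .comma => .skip
  | .endLayer => .wset layer 0 (layer + 1)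

/-- The first run of the transducer counts the layers and their gates. -/
theorem ht_count (hC : C.WellFormed n) (hT : T.Computes n s C.encode)
    (hE : Simulation.Provides T n s E) (hR : Room n C E) (hn1 : 1 ≤ n) {h : Memory VName F}
    (hn : h.w main 0 = n) (hb : ∀ k, h.w tapeA k = 0) (hl : h.w layer 0 = 0)
    (hw : ∀ k, h.w width k = 0) :
    HT E (Simulation.simulate T false countHook)
      ((T.numCores n s + 1) * (30 + 24 * (Simulation.situations T).length + 200) + 50)
      (fun h' => h'.w layer 0 = C.depth ∧ ∀ i, h'.w width i = (C.layer i).length) h := by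
  have hfin : C.encode.foldl countStep (0, fun _ => 0) = (C.depth, fun i => (C.layer i).length) := by
    rw [foldl_countStep_encode _ _ fun _ _ => rfl]
    simp
  have hlast := hC.depth_lt_size
  have hB := hR.bound
  refine (Simulation.ht_simulate (b := false) hT hE hn1 (fun out h' =>
    h'.w layer 0 = (out.foldl countStep (0, fun _ => 0)).1 ∧
      h'.w width = (out.foldl countStep (0, fun _ => 0)).2) ?_ ?_ ?_ hn hb
      ⟨hl, funext hw⟩).mono le_rfl ?_
  · rintro out h h' ha ⟨h1, h2⟩
    exact ⟨by rw [ha.w _ (by decide), h1], by rw [ha.w _ (by decide), h2]⟩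
  · intro x
    cases x <;> simp [countHook, Simulation.tape]
  · rintro out x hx h - ⟨h1, h2⟩
    obtain ⟨l, hl⟩ := hx
    have hle := le_foldl_countStep l ((out ++ [x]).foldl countStep (0, fun _ => 0))
    rw [← List.foldl_append, hl, hfin, List.foldl_append, List.foldl_cons, List.foldl_nil] at hle
    rw [List.foldl_append, List.foldl_cons, List.foldl_nil]
    obtain ⟨hle1, hle2⟩ := hle
    simp only at hle1 hle2
    set u := out.foldl countStep (0, fun _ => 0)
    have hgate : u.1 ≤ C.depth → u.2 u.1 + 1 ≤ (C.layer u.1).length → ∀ T,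
        (T = fun h' : Memory VName F => h'.w layer 0 = u.1 ∧
          h'.w width = Function.update u.2 u.1 (u.2 u.1 + 1)) →
        HT E (.wset width layer (.get width layer + 1)) 30 T h := by
      rintro h3 h4 _ rfl
      refine HT.block (fun _ => ?_) (Nat.le_of_ble_eq_true rfl)
      have h5 : (C.layer u.1).length ≤ C.size n := by
        rcases Nat.lt_or_ge u.1 C.depth with h6 | h6
        · have := Circuit.width_le_size (n := n) h6.le
          rwa [Circuit.width_of_lt h6] at this
        · simp [Circuit.layer_of_ge h6]
      simp [h1, h2, hR.idx u.1 (by omega)]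
      refine ⟨by omega, funext fun k => ?_⟩
      by_cases hk : k = u.1
      · subst hk; simp
      · simp [hk, h2]
    cases x
    · refine hgate hle1 ?_ _ rfl
      simpa [countStep] using hle2 u.1
    · refine hgate hle1 ?_ _ rfl
      simpa [countStep] using hle2 u.1
    · exact HT.block (fun _ => ⟨h1, h2⟩) (Nat.le_of_ble_eq_true rfl)
    · exact HT.block (fun _ => ⟨h1, h2⟩) (Nat.le_of_ble_eq_true rfl)
    · refine HT.block (fun _ => ?_) (Nat.le_of_ble_eq_true rfl)
      simp only [countStep] at hle1
      simp [countHook, h1, countStep]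
      exact ⟨by omega, h2⟩
  · rintro h' - - ⟨h1, h2⟩
    rw [hfin] at h1 h2
    exact ⟨h1, fun i => congrFun h2 i⟩

/-- Computes the numbers of variables of the layers. -/
def findVars : Prog VName :=
  .wset depth 0 layer ;; .wset width depth main ;; .wset layers 0 (depth + 1) ;;
    .for_ i layers (.clog count pow (.get width i) ;; .wset vars i count)

theorem ht_findVars (hC : C.WellFormed n) (hR : Room n C E) {h : Memory VName F}
    (hn : h.w main 0 = n) (hl : h.w layer 0 = C.depth)
    (hw : ∀ i, h.w width i = (C.layer i).length) :
    HT E findVars (60 + ((C.depth + 1) * (((C.size n + 1) * 60 + 20) + 40) + 40))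
      (fun h' => h'.w depth 0 = C.depth ∧ ∀ i ≤ C.depth, h'.w vars i = C.vars n i) h := by
  have hlast := hC.depth_lt_size
  have hns : n ≤ C.size n := Nat.le_add_right _ _
  have hB := hR.bound
  refine HT.assoc (HT.assoc (HT.seq (R := fun h' => h'.w depth 0 = C.depth ∧
    h'.w layers 0 = C.depth + 1 ∧ ∀ i ≤ C.depth, h'.w width i = C.width n i)
    (HT.block (fun _ => ?_) (Nat.le_of_ble_eq_true rfl)) ?_))
  · simp [hn, hl, hR.idx C.depth (by omega)]
    refine ⟨by omega, by omega, by omega, fun k hk => ?_⟩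
    split
    · next h1 => rw [h1, Circuit.width_depth]
    · next h1 => rw [hw, Circuit.width_of_lt (by omega)]
  rintro h1 hf1 - ⟨h2, h3, h4⟩
  refine (HT.for_const (C.depth + 1) (fun m h' => ∀ i < m, h'.w vars i = C.vars n i) h3 (by decide)
    (by decide) (by decide) (fun k h v hk i hi => by simpa using hk i hi)
    (fun i hi => absurd hi (Nat.not_lt_zero i)) ?_).mono le_rfl ?_
  · rintro m hm h' hf - hi hI
    have h5 : ∀ k ≤ C.depth, h'.w width k = C.width n k := fun k hk => by
      rw [hf.w _ (by decide), h4 k hk]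
    have hws := Circuit.width_le_size (n := n) (show m ≤ C.depth by omega)
    refine (HT.seq (HT.clog (w := C.width n m) (t := 20) (by decide) (fun h2 hf2 => ?_)
      (Nat.le_of_ble_eq_true rfl) (by omega)) ?_ (T' := 20)).time ?_
    · have e1 : h2.w i 0 = m := by rw [hf2.w _ (by decide), hi]
      have e2 : h2.w width m = C.width n m := by rw [hf2.w _ (by decide), h5 m (by omega)]
      simp [e1, e2, hR.idx m (by omega)]
    · rintro h2 hf2 hb2 ⟨h6, -⟩
      have e1 : h2.w i 0 = m := by rw [hf2.w _ (by decide), hi]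
      have e2 := hb2 count 0
      have e3 : ∀ k < m, h2.w vars k = C.vars n k := fun k hk => by
        rw [hf2.w _ (by decide), hI k hk]
      refine HT.block (fun _ => ?_) (Nat.le_of_ble_eq_true rfl)
      simp [e1, h6, hR.idx m (by omega)]
      refine ⟨by omega, fun k hk => ?_⟩
      split
      · next h7 => rw [h7]; rfl
      · exact e3 k (by omega)
    · have h7 : Nat.clog 2 (C.width n m) ≤ C.size n :=
        (Nat.clog_le_of_le_pow Nat.lt_two_pow_self.le).trans hws
      have := Nat.mul_le_mul_right 60 (Nat.add_le_add_right h7 1)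
      omega
  · rintro h' hf - hI
    refine ⟨by rw [hf.w _ (by decide), h2], fun i hi => hI i (by omega)⟩

/-- Draws the random values for layer `i`, and computes the point for layer `i + 1`. -/
def drawLayer : Prog VName :=
  (.wset arity i (.get vars i + 2 * .get vars (i + 1)) ;; .wset offsets i index ;;
    .wset rounds 0 (.get arity i + 1)) ;;
  .for_ k rounds (.sample rho index ;; .wset index 0 (index + 1)) ;;
  .wset count 0 (.get vars (i + 1)) ;;
  .for_ k count (.fset z (.get offsets i + k)
    ((1 - .get rho (.get offsets i + .get arity i)) *
        .get rho (.get offsets i + (.get vars i + k)) +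
      .get rho (.get offsets i + .get arity i) *
        .get rho (.get offsets i + (.get vars i + .get vars (i + 1) + k))))

/-- The random values `ρ` for the first `m` layers are in the array `rho`, and the points for the
layers up to layer `m` are in the array `z`. -/
structure Drawn (n : ℕ) (C : Circuit) (ρ : List F) (m : ℕ) (h : Memory VName F) : Prop where
  index : h.w index 0 = C.offset n m
  coins : h.coins = ρ.drop (C.offset n m)
  rho : ∀ j < C.offset n m, h.f rho j = ρ.getD j 0
  offsets : ∀ i < m, h.w offsets i = C.offset n i
  arity : ∀ i < m, h.w arity i = C.arity n i
  z : ∀ i < m, ∀ k < C.vars n (i + 1), h.f z (C.offset n i + k) = C.point n ρ (i + 1) k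

/-- The constants `300` bound the time of the two loops, whose lengths are at most `numCoins`. -/
theorem ht_drawLayer (hR : Room n C E) {ρ : List F} (hρ : ρ.length = C.numCoins n) {m : ℕ}
    (hm : m < C.depth) {h : Memory VName F} (hi : h.w i 0 = m)
    (hv : ∀ i ≤ C.depth, h.w vars i = C.vars n i) (H : Drawn n C ρ m h) :
    HT E drawLayer (300 + 300 * C.numCoins n) (Drawn n C ρ (m + 1)) h := by
  obtain ⟨h1, h2, h3, h4, h5, h6⟩ := H
  have hB := hR.bound
  have hlt := Circuit.offset_add_lt (n := n) hm le_rfl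
  have hsucc := Circuit.offset_succ n C m
  have har : C.vars n m + 2 * C.vars n (m + 1) = C.arity n m := rfl
  have hidx : ∀ k ≤ C.numCoins n, E.Idx k := fun k hk => hR.idx k (by omega)
  have hmi := hR.idx m (by omega)
  have hmi' := hR.idx (m + 1) (by omega)
  refine (HT.seq (T := 100) (T' := 200 + 300 * C.numCoins n)
    (R := fun h' => h'.w i 0 = m ∧ (∀ i ≤ C.depth, h'.w vars i = C.vars n i) ∧
      h'.w index 0 = C.offset n m ∧ h'.coins = ρ.drop (C.offset n m) ∧
      (∀ j < C.offset n m, h'.f VName.rho j = ρ.getD j 0) ∧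
      (∀ i < m + 1, h'.w VName.offsets i = C.offset n i) ∧
      (∀ i < m + 1, h'.w VName.arity i = C.arity n i) ∧
      (∀ i < m, ∀ k < C.vars n (i + 1), h'.f VName.z (C.offset n i + k) = C.point n ρ (i + 1) k) ∧
      h'.w rounds 0 = C.arity n m + 1)
    (HT.block (fun _ => ?_) (Nat.le_of_ble_eq_true rfl)) ?_).time (by omega)
  · simp [hi, hv m (by omega), hv (m + 1) (by omega), h1, hmi, hmi', har]
    refine ⟨by omega, by omega, by omega, hv, h2, h3, fun k hk => ?_, fun k hk => ?_, h6⟩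
    · split
      · next e => rw [e]
      · exact h4 k (by omega)
    · split
      · next e => rw [e]
      · exact h5 k (by omega)
  clear h1 h2 h3 h4 h5 h6 hi hv
  rintro h0 - - ⟨hi, hv, h1, h2, h3, h4, h5, h6, h7⟩
  refine (HT.seq (T := (C.arity n m + 1) * (40 + 40) + 40) (T' := 120 + 220 * C.numCoins n)
    (R := fun h' => h'.w index 0 = C.offset n (m + 1) ∧ h'.coins = ρ.drop (C.offset n (m + 1)) ∧
      (∀ j < C.offset n (m + 1), h'.f VName.rho j = ρ.getD j 0))
    ((HT.for_const (C.arity n m + 1) (fun k h' => h'.w index 0 = C.offset n m + k ∧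
      h'.coins = ρ.drop (C.offset n m + k) ∧
      (∀ j < C.offset n m + k, h'.f VName.rho j = ρ.getD j 0)) h7 (by decide) (by decide)
      (by decide) (fun k h v hk => by simpa using hk) ⟨h1, h2, h3⟩ ?_).mono le_rfl ?_) ?_).time
      (by omega)
  · rintro k hk h' - - - ⟨e1, e2, e3⟩
    have hlen : C.offset n m + k < ρ.length := by omega
    refine HT.block (fun _ => ?_) (Nat.le_of_ble_eq_true rfl)
    obtain ⟨x, hx, hx'⟩ : ∃ x, ρ.drop (C.offset n m + k) = x :: ρ.drop (C.offset n m + k + 1) ∧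
        ρ.getD (C.offset n m + k) 0 = x :=
      ⟨_, List.drop_eq_getElem_cons hlen, by simp [List.getD_eq_getElem?_getD, hlen]⟩
    simp [-List.getD_eq_getElem?_getD, e1, e2, hidx (C.offset n m + k) (by omega), hx]
    refine ⟨by omega, by omega, rfl, fun j hj => ?_⟩
    split
    · next e => rw [e, hx']
    · exact e3 j (by omega)
  · rintro h' - - ⟨e1, e2, e3⟩
    rw [hsucc]
    exact ⟨e1, e2, e3⟩
  rintro h1' hf - ⟨e1, e2, e3⟩
  have e4 : ∀ i < m + 1, h1'.w VName.offsets i = C.offset n i := fun k hk => by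
    rw [hf.w _ (by decide), h4 k hk]
  have e5 : ∀ i < m + 1, h1'.w VName.arity i = C.arity n i := fun k hk => by
    rw [hf.w _ (by decide), h5 k hk]
  have e6 : ∀ i < m, ∀ k < C.vars n (i + 1),
      h1'.f VName.z (C.offset n i + k) = C.point n ρ (i + 1) k := fun k hk l hl => by
    rw [hf.f _ (by decide), h6 k hk l hl]
  have e7 : h1'.w i 0 = m := by rw [hf.w _ (by decide), hi]
  have e8 : ∀ i ≤ C.depth, h1'.w vars i = C.vars n i := fun k hk => by
    rw [hf.w _ (by decide), hv k hk]
  refine (HT.seq (T := 40) (R := fun h' => h' = h1'.setW count 0 (C.vars n (m + 1)))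
    (HT.block (fun _ => ?_) (Nat.le_of_ble_eq_true rfl)) ?_
    (T' := C.vars n (m + 1) * (400 + 40) + 40)).time (by omega)
  · simp [e7, e8 (m + 1) (by omega), hmi']
    omega
  rintro _ - - rfl
  refine (HT.for_const (C.vars n (m + 1)) (fun k h' => (∀ i < m, ∀ k < C.vars n (i + 1),
      h'.f VName.z (C.offset n i + k) = C.point n ρ (i + 1) k) ∧
      ∀ l < k, h'.f VName.z (C.offset n m + l) = C.point n ρ (m + 1) l) (by simp) (by decide)
      (by decide) (by decide) (fun k h v hk => by simpa using hk) ⟨by simpa using e6, by simp⟩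
      ?_).mono le_rfl ?_
  · rintro k hk h2 hf2 - hk2 ⟨f1, f2⟩
    have g1 : h2.w i 0 = m := by rw [hf2.w _ (by decide)]; simp [e7]
    have g2 : h2.w VName.offsets m = C.offset n m := by
      rw [hf2.w _ (by decide)]; simp [e4 m (by omega)]
    have g3 : h2.w VName.arity m = C.arity n m := by
      rw [hf2.w _ (by decide)]; simp [e5 m (by omega)]
    have g4 : ∀ i ≤ C.depth, h2.w vars i = C.vars n i := fun k hk => by
      rw [hf2.w _ (by decide)]; simp [e8 k hk]
    have g5 : ∀ j < C.offset n (m + 1), h2.f VName.rho j = ρ.getD j 0 := fun j hj => by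
      rw [hf2.f _ (by decide)]; simpa using e3 j hj
    refine HT.block (fun _ => ?_) (Nat.le_of_ble_eq_true rfl)
    simp only [Prog.wp, WOp.apply, WE.Ok, WE.val, FE.Ok, FE.val, WE.val_add, WE.val_ofNat, WE.ok_add,
      WE.ok_ofNat, Env.idx_zero, g1, g2, g3, hk2, g4 m (by omega), g4 (m + 1) (by omega), hmi, hmi',
      FE.val_add, FE.val_sub, FE.val_mul, FE.ok_add, FE.ok_sub, FE.ok_mul, FE.val_one, FE.ok_one,
      hidx (C.offset n m + k) (by omega), hidx (C.offset n m + C.arity n m) (by omega),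
      hidx (C.offset n m + (C.vars n m + k)) (by omega),
      hidx (C.offset n m + (C.vars n m + C.vars n (m + 1) + k)) (by omega), true_and, and_self]
    rw [g5 _ (by omega), g5 _ (by omega), g5 _ (by omega)]
    refine ⟨fun i' hi' k' hk' => ?_, fun l hl => ?_⟩
    · have := Circuit.offset_mono n C (show i' + 1 ≤ m from hi')
      rw [Circuit.offset_succ] at this
      have h9 : C.vars n i' + 2 * C.vars n (i' + 1) = C.arity n i' := rfl
      have : C.offset n i' + k' ≠ C.offset n m + k := by omega
      simp [this, f1 i' hi' k' hk']
    · by_cases hlk : l = k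
      · subst hlk
        simp [Circuit.point, Circuit.omega₁, Circuit.omega₂, Circuit.coin]
      · have : C.offset n m + l ≠ C.offset n m + k := by omega
        simp only [Memory.setF_f, this, and_false, if_false]
        exact f2 l (by omega)
  · rintro h2 hf2 - ⟨f1, f2⟩
    refine ⟨?_, ?_, ?_, ?_, ?_, ?_⟩
    · rw [hf2.w _ (by decide)]; simpa using e1
    · rw [hf2.coins rfl]; simpa using e2
    · rw [hf2.f _ (by decide)]; simpa using e3
    · rw [hf2.w _ (by decide)]; simpa using e4
    · rw [hf2.w _ (by decide)]; simpa using e5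
    · intro i' hi' k' hk'
      rcases Nat.lt_succ_iff_lt_or_eq.1 hi' with hi' | rfl
      · exact f1 i' hi' k' hk'
      · exact f2 k' hk'

/-- Draws the random values for all layers. This can be done before the stream is seen, as the
random values do not depend on the messages; the verifier keeps them to itself until they are due.
-/
def drawAll : Prog VName := .wset index 0 0 ;; .for_ i depth drawLayer

theorem ht_drawAll (hR : Room n C E) {ρ : List F} (hρ : ρ.length = C.numCoins n)
    {h : Memory VName F} (hd : h.w depth 0 = C.depth)
    (hv : ∀ i ≤ C.depth, h.w vars i = C.vars n i) (hc : h.coins = ρ) :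
    HT E drawAll (C.depth * (340 + 300 * C.numCoins n) + 50) (Drawn n C ρ C.depth) h := by
  refine (HT.seq (T := 7) (R := (· = h.setW index 0 0)) (HT.block (fun _ => by simp)
    (Nat.le_of_ble_eq_true rfl)) ?_ (T' := C.depth * (300 + 300 * C.numCoins n + 40) + 40)).time ?_
  · rintro _ - - rfl
    refine HT.for_const C.depth (Drawn n C ρ) (by simpa using hd) (by decide) (by decide)
      (by decide) ?_ ?_ ?_
    · rintro k h v ⟨h1, h2, h3, h4, h5, h6⟩
      exact ⟨by simpa using h1, by simpa using h2, by simpa using h3, by simpa using h4,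
        by simpa using h5, by simpa using h6⟩
    · constructor <;> simp [Circuit.offset, hc]
    · rintro m hm h' hf - hi H
      exact ht_drawLayer hR hρ hm hi (fun i hi => by
        rw [hf.w _ (by decide)]; simpa using hv i hi) H
  · have : C.depth * (300 + 300 * C.numCoins n + 40) = C.depth * (340 + 300 * C.numCoins n) := by
      ring
    omega

end VName


/-! ### Preprocessing: the wiring predicates -/

/-- The state of a reader of circuit descriptions that evaluates the multilinear extensions of the
wiring predicates: the current position in the circuit and in the description of a gate, and the
sums of the indicator polynomials of the gates read so far, for the addition gates and for the
multiplication gates of each layer. -/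
structure Reader (F : Type*) where
  layer : ℕ
  gate : ℕ
  phase : ℕ
  op : ℕ
  left : ℕ
  acc : ℕ
  pow : ℕ
  adds : ℕ → F
  muls : ℕ → F

namespace Reader

variable {F : Type*} [Field F] {n : ℕ} {C : Circuit} {ρ : List F}

/-- The indicator polynomial of the gate that has just been read. -/
def term (n : ℕ) (C : Circuit) (ρ : List F) (s : Reader F) : F :=
  chi (C.vars n s.layer) s.gate (C.coin n ρ s.layer) *
    chi (C.vars n (s.layer + 1)) s.left (C.omega₁ n s.layer (C.coin n ρ s.layer)) *
      chi (C.vars n (s.layer + 1)) s.acc (C.omega₂ n s.layer (C.coin n ρ s.layer))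

/-- The reader reads a symbol. The labels of the in-neighbours are accumulated bit by bit, the
least significant bit first; `phase` tells which of the two labels is being read, and the gate is
processed when its second label is complete. -/
def step (n : ℕ) (C : Circuit) (ρ : List F) (s : Reader F) : DescSym → Reader F
  | .add => { s with phase := 0, op := 0, acc := 0, pow := 1 }
  | .mul => { s with phase := 0, op := 1, acc := 0, pow := 1 }
  | .bit b => { s with acc := if b then s.acc + s.pow else s.acc, pow := s.pow * 2 }
  | .comma => if s.phase = 0 then { s with phase := 1, left := s.acc, acc := 0, pow := 1 } else
      { s with
        gate := s.gate + 1
        adds := if s.op = 0 then Function.update s.adds s.layer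
          (s.adds s.layer + s.term n C ρ) else s.adds
        muls := if s.op = 0 then s.muls else Function.update s.muls s.layer
          (s.muls s.layer + s.term n C ρ) }
  | .endLayer => { s with layer := s.layer + 1, gate := 0 }

/-- The numbers in the state are small. -/
structure Small (n : ℕ) (C : Circuit) (s : Reader F) : Prop where
  layer : s.layer < C.depth
  gate : s.gate ≤ C.size n
  acc : s.acc ≤ C.size n
  pow : s.pow ≤ 2 * C.size n

/-- The numbers are small whenever one of the given symbols is read. -/
def Safe (n : ℕ) (C : Circuit) (ρ : List F) : List DescSym → Reader F → Prop
  | [], _ => True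
  | x :: l, s => Small n C s ∧ Safe n C ρ l (step n C ρ s x)

theorem safe_append (l l' : List DescSym) (s : Reader F) : Safe n C ρ (l ++ l') s ↔
    Safe n C ρ l s ∧ Safe n C ρ l' (l.foldl (step n C ρ) s) := by
  induction l generalizing s with
  | nil => simp [Safe]
  | cons x l ih => simp [Safe, ih, and_assoc]

theorem Safe.small {w : List DescSym} {s : Reader F} (h : Safe n C ρ w s) {out : List DescSym}
    {x : DescSym} (hx : out ++ [x] <+: w) : Small n C (out.foldl (step n C ρ) s) := by
  obtain ⟨l, rfl⟩ := hx
  rw [safe_append, safe_append] at h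
  exact h.1.2.1

/-- The bits of a number are read. -/
theorem foldl_bits (l : List Bool) (s : Reader F) :
    (l.map DescSym.bit).foldl (step n C ρ) s =
      { s with
        acc := s.acc + s.pow * Nat.ofDigits 2 (l.map fun b => cond b 1 0)
        pow := s.pow * 2 ^ l.length } := by
  induction l generalizing s with
  | nil => simp
  | cons b l ih =>
    rw [List.map_cons, List.foldl_cons, ih]
    cases b <;> simp [step, Nat.ofDigits_cons, pow_succ] <;> ring_nf <;> trivial

theorem safe_bits {l : List Bool} {s : Reader F} (hl : s.layer < C.depth)
    (hg : s.gate ≤ C.size n)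
    (hacc : s.acc + s.pow * Nat.ofDigits 2 (l.map fun b => cond b 1 0) ≤ C.size n)
    (hpow : s.pow * 2 ^ l.length ≤ 2 * C.size n) : Safe n C ρ (l.map DescSym.bit) s := by
  induction l generalizing s with
  | nil => trivial
  | cons b l ih =>
    rw [List.map_cons, Nat.ofDigits_cons] at hacc
    rw [List.length_cons, pow_succ, mul_comm _ 2, ← mul_assoc] at hpow
    have h1 : 1 ≤ 2 ^ l.length := Nat.one_le_two_pow
    have h2 : s.pow * 2 * 1 ≤ s.pow * 2 * 2 ^ l.length := Nat.mul_le_mul_left _ h1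
    refine ⟨⟨hl, hg, by omega, by omega⟩, ih hl hg ?_ hpow⟩
    cases b
    · simp only [step, cond_false] at hacc ⊢
      convert hacc using 1
      simp
      ring
    · simp only [step, cond_true] at hacc ⊢
      convert hacc using 1
      simp
      ring

theorem ofDigits_bits (m : ℕ) : Nat.ofDigits 2 (m.bits.map fun b => cond b 1 0) = m := by
  rw [← Nat.digits_two_eq_bits, Nat.ofDigits_digits]

theorem two_pow_length_bits {m s : ℕ} (hm : m < s) : 2 ^ m.bits.length ≤ 2 * s := by
  rw [Nat.size_eq_bits_len]
  rcases Nat.eq_zero_or_pos m.size with h | h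
  · rw [h]; omega
  · have h1 : 2 ^ (m.size - 1) ≤ m := Nat.lt_size.1 (by omega)
    obtain ⟨k, hk⟩ : ∃ k, m.size = k + 1 := ⟨m.size - 1, by omega⟩
    rw [hk, Nat.add_sub_cancel] at h1
    rw [hk, pow_succ]
    omega

/-- The part of the multilinear extension of a wiring predicate that is due to the first `j` gates
of layer `i`. -/
def wiringPart (n : ℕ) (C : Circuit) (ρ : List F) (o : GateOp) (i j : ℕ) : F :=
  ∑ j ∈ Finset.range j, if C.table n 2 i j = (if o = .add then 0 else 1) then
    chi (C.arity n i) (C.label n i j) (C.coin n ρ i) else 0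

/-- The number of gates of layer `l` that precede gate `j` of layer `i` in the description. -/
def gatesRead (n : ℕ) (C : Circuit) (i j l : ℕ) : ℕ :=
  if l < i then C.width n l else if l = i then j else 0

/-- The description has been read up to gate `j` of layer `i`. -/
structure At (n : ℕ) (C : Circuit) (ρ : List F) (i j : ℕ) (s : Reader F) : Prop where
  layer : s.layer = i
  gate : s.gate = j
  acc : s.acc ≤ C.size n
  pow : s.pow ≤ 2 * C.size n
  adds : ∀ l, s.adds l = wiringPart n C ρ .add l (gatesRead n C i j l)
  muls : ∀ l, s.muls l = wiringPart n C ρ .mul l (gatesRead n C i j l)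

theorem gatesRead_succ (i j l : ℕ) : gatesRead n C i (j + 1) l =
    if l = i then gatesRead n C i j l + 1 else gatesRead n C i j l := by
  unfold gatesRead
  split_ifs <;> omega

/-- Reading a gate adds its indicator polynomial to the sum for its layer and kind. -/
theorem At.encode_gate (hC : C.WellFormed n) {i j : ℕ} {g : Gate} (hi : i < C.depth)
    (hg : (C.layer i)[j]? = some g) {s : Reader F} (h : At n C ρ i j s) :
    Safe n C ρ g.encode s ∧ At n C ρ i (j + 1) (g.encode.foldl (step n C ρ) s) := by
  obtain ⟨h1, h2, h3, h4, h5, h6⟩ := h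
  have hj : j < C.width n i := by
    rw [Circuit.width_of_lt hi]
    exact (List.getElem?_eq_some_iff.1 hg).1
  have hjs := hj.trans_le (Circuit.width_le_size hi.le)
  obtain ⟨hgl, hgr⟩ := hC.2 i hi g (List.mem_of_getElem? hg)
  have hws := Circuit.width_le_size (n := n) (show i + 1 ≤ C.depth from hi)
  have hl1 : C.lab n i 1 j = g.left := by simp [Circuit.lab, Circuit.table, hg]
  have hl2 : C.lab n i 2 j = g.right := by simp [Circuit.lab, Circuit.table, hg]
  have ht2 : C.table n 2 i j = if g.op = .add then 0 else 1 := by simp [Circuit.table, hg]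
  have hterm := hC.chi_label hi hj (C.coin n ρ i)
  rw [hl1, hl2] at hterm
  obtain ⟨o, l, r⟩ := g
  simp only at hgl hgr hterm ht2
  have hpl := two_pow_length_bits (hgl.trans_le hws)
  have hpr := two_pow_length_bits (hgr.trans_le hws)
  have hgr' : gatesRead n C i j i = j := by simp [gatesRead]
  constructor
  · simp only [Gate.encode, safe_append, List.foldl_append, foldl_bits, List.foldl_cons,
      List.foldl_nil, ofDigits_bits]
    cases o <;> simp only [Safe, step, and_true, zero_add, one_mul, if_true] <;>
    refine ⟨⟨⟨⟨⟨by omega, by omega, h3, h4⟩, safe_bits ?_ ?_ ?_ ?_⟩, ⟨?_, ?_, ?_, ?_⟩⟩,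
      safe_bits ?_ ?_ ?_ ?_⟩, ⟨?_, ?_, ?_, ?_⟩⟩ <;> simp only [ofDigits_bits] <;> omega
  · simp only [Gate.encode, List.foldl_append, foldl_bits, List.foldl_cons,
      List.foldl_nil, ofDigits_bits]
    cases o <;> simp only [step, zero_add, one_mul, if_true, one_ne_zero, if_false, term, h1, h2,
      ← hterm] <;>
    refine ⟨by simp, by simp, by simp; omega, by simpa using hpr, fun k => ?_, fun k => ?_⟩ <;>
    rw [gatesRead_succ] <;> by_cases hk : k = i
    all_goals first
      | (subst hk
         simp [h5, h6, wiringPart, Finset.sum_range_succ, hgr', ht2])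
      | simp [hk, h5, h6]

theorem At.encode_gates (hC : C.WellFormed n) {i : ℕ} (hi : i < C.depth) (L : List Gate) {j : ℕ}
    (hL : (C.layer i).drop j = L) {s : Reader F} (h : At n C ρ i j s) :
    Safe n C ρ (L.flatMap Gate.encode) s ∧
      At n C ρ i (j + L.length) ((L.flatMap Gate.encode).foldl (step n C ρ) s) := by
  induction L generalizing j s with
  | nil => exact ⟨trivial, h⟩
  | cons g L ih =>
    have hg : (C.layer i)[j]? = some g := by
      rw [← List.head?_drop, hL, List.head?_cons]
    have hL' : (C.layer i).drop (j + 1) = L := by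
      rw [← List.tail_drop, hL, List.tail_cons]
    obtain ⟨h1, h2⟩ := h.encode_gate hC hi hg
    obtain ⟨h3, h4⟩ := ih hL' h2
    rw [List.flatMap_cons, safe_append, List.foldl_append, List.length_cons,
      show j + (L.length + 1) = j + 1 + L.length by omega]
    exact ⟨⟨h1, h3⟩, h4⟩

theorem At.encode (hC : C.WellFormed n) (D : Circuit) {i : ℕ} (hD : C.drop i = D)
    {s : Reader F} (h : At n C ρ i 0 s) :
    Safe n C ρ D.encode s ∧ At n C ρ (i + D.length) 0 (D.encode.foldl (step n C ρ) s) := by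
  induction D generalizing i s with
  | nil => exact ⟨trivial, h⟩
  | cons L D ih =>
    have hg : C[i]? = some L := by
      rw [← List.head?_drop, hD, List.head?_cons]
    have hi : i < C.depth := (List.getElem?_eq_some_iff.1 hg).1
    have hl : C.layer i = L := by simp [Circuit.layer, List.getD_eq_getElem?_getD, hg]
    have hL' : C.drop (i + 1) = D := by
      rw [← List.tail_drop, hD, List.tail_cons]
    obtain ⟨h1, h2⟩ := h.encode_gates hC hi L (by rw [hl, List.drop_zero])
    have hw : 0 + L.length = C.width n i := by rw [Circuit.width_of_lt hi, hl, zero_add]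
    rw [hw] at h2
    have hws := Circuit.width_le_size (n := n) hi.le
    obtain ⟨g1, g2, g3, g4, g5, g6⟩ := h2
    have hread : ∀ l, gatesRead n C (i + 1) 0 l = gatesRead n C i (C.width n i) l := by
      intro l
      unfold gatesRead
      rcases lt_trichotomy l i with hl | rfl | hl
      · simp [hl, show l < i + 1 by omega]
      · simp
      · simp [show ¬ l < i + 1 by omega, show ¬ l < i by omega, show l ≠ i by omega]
    have h5 : At n C ρ (i + 1) 0 (step n C ρ ((L.flatMap Gate.encode).foldl (step n C ρ) s) .endLayer) :=
      ⟨by simp [step, g1], rfl, g3, g4, fun l => by rw [hread]; exact g5 l,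
        fun l => by rw [hread]; exact g6 l⟩
    obtain ⟨h3, h4⟩ := ih hL' h5
    rw [Circuit.encode, List.flatMap_cons, List.append_assoc, safe_append, safe_append,
      List.foldl_append, List.foldl_append, List.length_cons,
      show i + (D.length + 1) = i + 1 + D.length by omega]
    exact ⟨⟨h1, ⟨⟨by omega, by omega, g3, g4⟩, trivial⟩, h3⟩, h4⟩

/-- The initial state. -/
def start : Reader F := ⟨0, 0, 0, 0, 0, 0, 0, fun _ => 0, fun _ => 0⟩

/-- The reader reaches the end of the description, and its numbers stay within the words of the
machine. -/
theorem safe_encode (hC : C.WellFormed n) : Safe n C ρ C.encode start ∧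
    At n C ρ C.depth 0 (C.encode.foldl (step n C ρ) start) := by
  have h : At n C ρ 0 0 (start : Reader F) := by
    constructor <;> simp [start, wiringPart, gatesRead]
  simpa [Circuit.depth] using h.encode hC C (by simp)

theorem adds_encode (hC : C.WellFormed n) {i : ℕ} (hi : i < C.depth) :
    (C.encode.foldl (step n C ρ) start).adds i = C.wiringExt n .add i (C.coin n ρ i) := by
  rw [(safe_encode hC).2.adds, hC.wiringExt_eq hi, gatesRead, if_pos hi]
  rfl

theorem muls_encode (hC : C.WellFormed n) {i : ℕ} (hi : i < C.depth) :
    (C.encode.foldl (step n C ρ) start).muls i = C.wiringExt n .mul i (C.coin n ρ i) := by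
  rw [(safe_encode hC).2.muls, hC.wiringExt_eq hi, gatesRead, if_pos hi]
  rfl

end Reader


namespace VName

variable {F : Type*} [Field F] {E : Env F} {n s : ℕ} {C : Circuit} {T : Transducer} {ρ : List F}

/-- Evaluates the indicator polynomial of the gate that has just been read. -/
def gateIndicator : Prog VName :=
  (.fset value 0 1 ;; .wset label 0 gate ;; .wset count 0 (.get vars layer) ;;
    .wset start 0 (.get offsets layer)) ;;
  indicator rho ;;
  (.wset label 0 left ;; .wset count 0 (.get vars (layer + 1)) ;;
    .wset start 0 (.get offsets layer + .get vars layer)) ;;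
  indicator rho ;;
  (.wset label 0 acc ;; .wset count 0 (.get vars (layer + 1)) ;;
    .wset start 0 (.get offsets layer + (.get vars layer + .get vars (layer + 1)))) ;;
  indicator rho

/-- Processes a symbol of the description as in `Reader.step`. -/
def readHook : DescSym → Prog VName
  | .add => .wset phase 0 0 ;; .wset op 0 0 ;; .wset acc 0 0 ;; .wset pow 0 1
  | .mul => .wset phase 0 0 ;; .wset op 0 1 ;; .wset acc 0 0 ;; .wset pow 0 1
  | .bit false => .wset pow 0 (pow * 2)
  | .bit true => .wset acc 0 (acc + pow) ;; .wset pow 0 (pow * 2)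
  | .comma => .cond (.eq phase 0)
      (.wset phase 0 1 ;; .wset left 0 acc ;; .wset acc 0 0 ;; .wset pow 0 1)
      (gateIndicator ;; .cond (.eq op 0) (.fset adds layer (.get adds layer + value))
        (.fset muls layer (.get muls layer + value)) ;; .wset gate 0 (gate + 1))
  | .endLayer => .wset layer 0 (layer + 1) ;; .wset gate 0 0

/-- The memory represents the state of a reader, and it contains the parameters of the protocol
and the random values. -/
structure Reads (n : ℕ) (C : Circuit) (ρ : List F) (s : Reader F) (h : Memory VName F) : Prop where
  layer : h.w layer 0 = s.layer
  gate : h.w gate 0 = s.gate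
  phase : h.w phase 0 = s.phase
  op : h.w op 0 = s.op
  left : h.w left 0 = s.left
  acc : h.w acc 0 = s.acc
  pow : h.w pow 0 = s.pow
  adds : h.f adds = s.adds
  muls : h.f muls = s.muls
  vars : ∀ i ≤ C.depth, h.w vars i = C.vars n i
  offsets : ∀ i < C.depth, h.w offsets i = C.offset n i
  rho : ∀ j < C.numCoins n, h.f rho j = ρ.getD j 0

theorem Reads.congr {r : Reader F} {h h' : Memory VName F} (H : Reads n C ρ r h)
    (hw : ∀ x ∈ [VName.layer, .gate, .phase, .op, .left, .acc, .pow, .vars, .offsets],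
      h'.w x = h.w x)
    (hf : ∀ x ∈ [VName.adds, .muls, .rho], h'.f x = h.f x) : Reads n C ρ r h' := by
  obtain ⟨h1, h2, h3, h4, h5, h6, h7, h8, h9, h10, h11, h12⟩ := H
  constructor
  · rw [hw _ (by simp), h1]
  · rw [hw _ (by simp), h2]
  · rw [hw _ (by simp), h3]
  · rw [hw _ (by simp), h4]
  · rw [hw _ (by simp), h5]
  · rw [hw _ (by simp), h6]
  · rw [hw _ (by simp), h7]
  · rw [hf _ (by simp), h8]
  · rw [hf _ (by simp), h9]
  · rw [hw _ (by simp)]; exact h10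
  · rw [hw _ (by simp)]; exact h11
  · rw [hf _ (by simp)]; exact h12

theorem ht_gateIndicator (hR : Room n C E) {r : Reader F} (hr : r.layer < C.depth)
    {h : Memory VName F} (H : Reads n C ρ r h) :
    HT E gateIndicator (400 + 110 * C.numCoins n)
      (fun h' => Reads n C ρ r h' ∧ h'.f value 0 = r.term n C ρ) h := by
  have hB := hR.bound
  have hlt := Circuit.offset_add_lt (n := n) hr le_rfl
  have har : C.vars n r.layer + 2 * C.vars n (r.layer + 1) = C.arity n r.layer := rfl
  have hidx : ∀ k ≤ C.numCoins n, E.Idx k := fun k hk => hR.idx k (by omega)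
  have hmi := hR.idx r.layer (by omega)
  have hmi' := hR.idx (r.layer + 1) (by omega)
  -- a call of `indicator` for a block of random values that starts at `st`
  have key : ∀ (v j st : ℕ) (x : ℕ → F) (y : F) (h : Memory VName F), Reads n C ρ r h →
      (∀ k < v, st + k < C.numCoins n ∧ ρ.getD (st + k) 0 = x k) →
      h.w label 0 = j → h.w count 0 = v → h.w VName.start 0 = st → h.f value 0 = y →
      HT E (indicator VName.rho) (v * 110 + 40)
        (fun h' => Reads n C ρ r h' ∧ h'.f value 0 = y * chi v j x) h := by
    intro v j st x y h H hx h1 h2 h3 h4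
    refine (ht_indicator (x := x) (by decide) h2 h1 h3 (fun k hk => ?_) fun k hk =>
      hidx _ (hx k hk).1.le).mono le_rfl ?_
    · rw [H.rho _ (hx k hk).1, (hx k hk).2]
    · rintro h' hf - hq
      exact ⟨H.congr (fun x hx => hf.w x (by revert x; decide))
        (fun x hx => hf.f x (by revert x; decide)), by rw [hq, h4]⟩
  refine (HT.seq (T := 60) (R := fun h' => Reads n C ρ r h' ∧ h'.w label 0 = r.gate ∧
      h'.w count 0 = C.vars n r.layer ∧ h'.w VName.start 0 = C.offset n r.layer ∧
      h'.f value 0 = 1) (HT.block (fun _ => ?_) (Nat.le_of_ble_eq_true rfl))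
    (T' := (C.vars n r.layer * 110 + 40) + (80 + ((C.vars n (r.layer + 1) * 110 + 40) + (80 +
      (C.vars n (r.layer + 1) * 110 + 40))))) ?_).time (by omega)
  · have hb : h.w VName.gate 0 ≤ E.bound := ‹h.Bounded E.bound› _ _
    rw [H.gate] at hb
    simp [H.gate, H.layer, H.vars r.layer hr.le, H.offsets r.layer hr, hmi, hb]
    exact ⟨by omega, by omega, H.congr (by intro x hx; funext k; revert x; simp)
      (by intro x hx; funext k; revert x; simp)⟩
  rintro h1 - - ⟨H1, e1, e2, e3, e4⟩
  refine HT.seq (key _ _ _ (C.coin n ρ r.layer) _ h1 H1 (fun k hk => ⟨by omega, rfl⟩) e1 e2 e3 e4)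
    ?_
  rintro h2 - - ⟨H2, e5⟩
  refine HT.seq (R := fun h' => Reads n C ρ r h' ∧ h'.w label 0 = r.left ∧
      h'.w count 0 = C.vars n (r.layer + 1) ∧
      h'.w VName.start 0 = C.offset n r.layer + C.vars n r.layer ∧
      h'.f value 0 = h2.f value 0) (HT.block (fun _ => ?_) (Nat.le_of_ble_eq_true rfl)) ?_
  · have hb : h2.w VName.left 0 ≤ E.bound := ‹h2.Bounded E.bound› _ _
    rw [H2.left] at hb
    simp [H2.left, H2.layer, H2.vars r.layer hr.le, H2.vars (r.layer + 1) hr,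
      H2.offsets r.layer hr, hmi, hmi', hb]
    exact ⟨by omega, by omega, H2.congr (by intro x hx; funext k; revert x; simp)
      (by intro x hx; funext k; revert x; simp)⟩
  rintro h3 - - ⟨H3, e6, e7, e8, e9⟩
  refine HT.seq (key _ _ _ (C.omega₁ n r.layer (C.coin n ρ r.layer)) _ h3 H3
    (fun k hk => ⟨by omega, by rw [add_assoc]; rfl⟩) e6 e7 e8 e9) ?_
  rintro h4 - - ⟨H4, e10⟩
  refine HT.seq (R := fun h' => Reads n C ρ r h' ∧ h'.w label 0 = r.acc ∧
      h'.w count 0 = C.vars n (r.layer + 1) ∧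
      h'.w VName.start 0 = C.offset n r.layer + (C.vars n r.layer + C.vars n (r.layer + 1)) ∧
      h'.f value 0 = h4.f value 0) (HT.block (fun _ => ?_) (Nat.le_of_ble_eq_true rfl)) ?_
  · have hb : h4.w VName.acc 0 ≤ E.bound := ‹h4.Bounded E.bound› _ _
    rw [H4.acc] at hb
    simp [H4.acc, H4.layer, H4.vars r.layer hr.le, H4.vars (r.layer + 1) hr,
      H4.offsets r.layer hr, hmi, hmi', hb]
    exact ⟨by omega, by omega, H4.congr (by intro x hx; funext k; revert x; simp)
      (by intro x hx; funext k; revert x; simp)⟩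
  rintro h5 - - ⟨H5, e11, e12, e13, e14⟩
  refine (key _ _ _ (C.omega₂ n r.layer (C.coin n ρ r.layer)) _ h5 H5
    (fun k hk => ⟨by omega, by rw [add_assoc]; rfl⟩) e11 e12 e13 e14).mono le_rfl ?_
  rintro h6 - - ⟨H6, e15⟩
  refine ⟨H6, ?_⟩
  rw [e15, e10, e5, one_mul]
  rfl

theorem ht_readHook (hC : C.WellFormed n) (hR : Room n C E) {r : Reader F} (hr : r.Small n C)
    {h : Memory VName F} (H : Reads n C ρ r h) (x : DescSym) :
    HT E (readHook x) (600 + 110 * C.numCoins n) (Reads n C ρ (r.step n C ρ x)) h := by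
  have hB := hR.bound
  have hlast := hC.depth_lt_size
  obtain ⟨hl, hg, ha, hp⟩ := hr
  have hmi := hR.idx r.layer (by omega)
  have H0 := H
  obtain ⟨h1, h2, h3, h4, h5, h6, h7, h8, h9, h10, h11, h12⟩ := H0
  have hcost : ∀ {k : ℕ}, k ≤ 600 → k ≤ 600 + 110 * C.numCoins n := fun h => by omega
  rcases x with _ | _ | (_ | _) | _ | _
  · refine HT.block (fun _ => ?_) (hcost (Nat.le_of_ble_eq_true rfl))
    simp [readHook]
    exact ⟨by omega, by constructor <;> intros <;> simp [Reader.step, *]⟩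
  · refine HT.block (fun _ => ?_) (hcost (Nat.le_of_ble_eq_true rfl))
    simp [readHook]
    exact ⟨by omega, by constructor <;> intros <;> simp [Reader.step, *]⟩
  · refine HT.block (fun _ => ?_) (hcost (Nat.le_of_ble_eq_true rfl))
    simp [readHook, h7]
    exact ⟨by omega, by constructor <;> intros <;> simp [Reader.step, *]⟩
  · refine HT.block (fun _ => ?_) (hcost (Nat.le_of_ble_eq_true rfl))
    simp [readHook, h6, h7]
    exact ⟨by omega, by omega, by constructor <;> intros <;> simp [Reader.step, *]⟩
  · by_cases hph : r.phase = 0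
    · refine (HT.cond (T := 100) (by simp) (fun _ => HT.block (fun _ => ?_)
        (Nat.le_of_ble_eq_true rfl)) fun hn => absurd ?_ hn).time (hcost (Nat.le_of_ble_eq_true rfl))
      · simp [h6, Reader.step, hph]
        exact ⟨by omega, by omega, by omega, ⟨by simpa using h1, by simpa using h2, by simp, by simpa using h4,
          rfl, rfl, rfl, h8, h9, by simpa using h10, by simpa using h11, h12⟩⟩
      · simpa [h3] using hph
    · have hcost' : (TE.eq (phase : WE VName) 0).compile.cost = 8 := rfl
      refine (HT.cond (T := 400 + 110 * C.numCoins n + 150) (by simp) (fun hn => absurd ?_ hph)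
        fun _ => HT.seq (ht_gateIndicator hR hl H) ?_).time (by omega)
      · simpa [h3] using hn
      · rintro h' - - ⟨H', hv⟩
        obtain ⟨g1, g2, g3, g4, g5, g6, g7, g8, g9, g10, g11, g12⟩ := H'
        refine HT.block (fun _ => ?_) (Nat.le_of_ble_eq_true rfl)
        by_cases hop : r.op = 0
        · simp [g1, g2, g4, hop, hmi]
          refine ⟨by omega, ?_⟩
          constructor <;> intros <;> (try (funext k; by_cases hk : k = r.layer)) <;>
            simp [Reader.step, hph, hop, *]
        · simp [g1, g2, g4, hop, hmi]
          refine ⟨by omega, ?_⟩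
          constructor <;> intros <;> (try (funext k; by_cases hk : k = r.layer)) <;>
            simp [Reader.step, hph, hop, *]
  · refine HT.block (fun _ => ?_) (hcost (Nat.le_of_ble_eq_true rfl))
    simp [readHook, h1]
    exact ⟨by omega, by constructor <;> intros <;> simp [Reader.step, *]⟩

/-- The second run of the transducer evaluates the multilinear extensions of the wiring
predicates. -/
theorem ht_read (hC : C.WellFormed n) (hT : T.Computes n s C.encode)
    (hE : Simulation.Provides T n s E) (hR : Room n C E) (hn1 : 1 ≤ n) {h : Memory VName F}
    (hn : h.w main 0 = n) (hb : ∀ k, h.w tapeB k = 0) (H : Reads n C ρ .start h) :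
    HT E (Simulation.simulate T true readHook)
      ((T.numCores n s + 1) * (600 + 110 * C.numCoins n +
        24 * (Simulation.situations T).length + 200) + 50)
      (Reads n C ρ (C.encode.foldl (Reader.step n C ρ) .start)) h := by
  refine Simulation.ht_simulate (b := true) hT hE hn1
    (fun out h => Reads n C ρ (out.foldl (Reader.step n C ρ) .start) h) ?_ ?_ ?_ hn hb H
  · rintro out h h' ha H
    exact H.congr (fun x hx => ha.w x (by revert x; decide)) fun x _ => congrFun ha.f x
  · intro x
    rcases x with _ | _ | (_ | _) | _ | _ <;> decide
  · rintro out x hx h - H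
    rw [List.foldl_append, List.foldl_cons, List.foldl_nil]
    exact ht_readHook hC hR ((Reader.safe_encode hC).1.small hx) H x

end VName


/-! ### Preprocessing: the complete phase -/

namespace VName

variable {F : Type*} [Field F] {E : Env F} {n s : ℕ} {C : Circuit} {T : Transducer} {ρ : List F}

/-- Multiplies the values of the wiring predicates by those of `β`. The point for layer `i` is stored at
the offset of layer `i - 1`; the truncated subtraction for `i = 0` is harmless, since the label of the
output gate has no bits. -/
def weigh : Prog VName :=
  .for_ i depth
    ((.fset value 0 1 ;; .wset count 0 (.get vars i)) ;;
    .for_ k count (.fset value 0 (value *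
      (.get z (.get offsets (i - 1) + k) * .get rho (.get offsets i + k) +
        (1 - .get z (.get offsets (i - 1) + k)) * (1 - .get rho (.get offsets i + k))))) ;;
    (.fset adds i (.get adds i * value) ;; .fset muls i (.get muls i * value)))

theorem ht_weigh (hC : C.WellFormed n) (hR : Room n C E) {h : Memory VName F}
    (hd : h.w depth 0 = C.depth) (hv : ∀ i ≤ C.depth, h.w vars i = C.vars n i)
    (ho : ∀ i < C.depth, h.w offsets i = C.offset n i)
    (hr : ∀ j < C.numCoins n, h.f rho j = ρ.getD j 0)
    (hz : ∀ i < C.depth, ∀ k < C.vars n (i + 1), h.f z (C.offset n i + k) = C.point n ρ (i + 1) k) :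
    HT E weigh (C.depth * (300 * C.numCoins n + 300) + 40) (fun h' => ∀ i < C.depth,
      h'.f adds i = h.f adds i * beta (C.vars n i) (C.point n ρ i) (C.coin n ρ i) ∧
      h'.f muls i = h.f muls i * beta (C.vars n i) (C.point n ρ i) (C.coin n ρ i)) h := by
  have hB := hR.bound
  refine (HT.for_const (T := 300 * C.numCoins n + 260) C.depth (fun m h' =>
    (∀ i < m, h'.f adds i = h.f adds i * beta (C.vars n i) (C.point n ρ i) (C.coin n ρ i) ∧
      h'.f muls i = h.f muls i * beta (C.vars n i) (C.point n ρ i) (C.coin n ρ i)) ∧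
    ∀ i, m ≤ i → h'.f adds i = h.f adds i ∧ h'.f muls i = h.f muls i) hd (by decide) (by decide)
    (by decide) (fun k h v hk => by simpa using hk) ⟨fun i hi => absurd hi (Nat.not_lt_zero i),
      fun i _ => ⟨rfl, rfl⟩⟩ ?_).mono
      (Nat.add_le_add_right (Nat.mul_le_mul_left _ (by omega)) _) fun h' _ _ hq => hq.1
  rintro m hm h1 hf1 - hi ⟨hI, hI'⟩
  have hlt := Circuit.offset_add_lt (n := n) hm le_rfl
  have har : C.vars n m + 2 * C.vars n (m + 1) = C.arity n m := rfl
  have hidx : ∀ k ≤ C.numCoins n, E.Idx k := fun k hk => hR.idx k (by omega)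
  have hmi := hR.idx m (by omega)
  have hmi' := hR.idx (m - 1) (by omega)
  have e1 : h1.w vars m = C.vars n m := by rw [hf1.w _ (by decide), hv m hm.le]
  refine (HT.seq (T := 40) (R := (· = (h1.setF value 0 1).setW count 0 (C.vars n m)))
    (HT.block (fun _ => ?_) (Nat.le_of_ble_eq_true rfl)) ?_
    (T' := (C.vars n m * (200 + 40) + 40) + 150)).time (by omega)
  · simp [hi, e1, hmi]
    omega
  rintro _ - - rfl
  refine HT.seq (HT.for_const (T := 200) (C.vars n m)
    (fun k h' => h'.f value 0 = beta k (C.point n ρ m) (C.coin n ρ m)) (by simp) (by decide)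
    (by decide) (by decide) (fun k h v hk => by simpa using hk) (by simp [beta]) ?_) ?_
  · rintro k hk h2 hf2 - hk2 hI2
    have g1 : h2.w i 0 = m := by rw [hf2.w _ (by decide)]; simp [hi]
    have g2 : ∀ l < C.depth, h2.w offsets l = C.offset n l := fun l hl => by
      rw [hf2.w _ (by decide)]
      simp only [Memory.setW_w, Memory.setF_w, reduceCtorEq, false_and, if_false]
      rw [hf1.w _ (by decide), ho l hl]
    have g3 : ∀ j < C.numCoins n, h2.f rho j = ρ.getD j 0 := fun j hj => by
      rw [hf2.f _ (by decide)]
      simp only [Memory.setW_f, Memory.setF_f, reduceCtorEq, false_and, if_false]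
      rw [hf1.f _ (by decide), hr j hj]
    -- there are no variables for layer `0`, and the point for layer `m + 1` is at the offset of
    -- `m`
    obtain ⟨m, rfl⟩ : ∃ m', m = m' + 1 := by
      rcases m with _ | m
      · rw [hC.vars_zero] at hk
        omega
      · exact ⟨m, rfl⟩
    have hlt' := Circuit.offset_add_lt (n := n) (show m < C.depth by omega) le_rfl
    have har' : C.vars n m + 2 * C.vars n (m + 1) = C.arity n m := rfl
    have g4 : h2.f z (C.offset n m + k) = C.point n ρ (m + 1) k := by
      rw [hf2.f _ (by decide)]
      simp only [Memory.setW_f, Memory.setF_f, reduceCtorEq, false_and, if_false]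
      rw [hf1.f _ (by decide), hz m (by omega) k hk]
    have g5 : h2.f rho (C.offset n (m + 1) + k) = C.coin n ρ (m + 1) k := g3 _ (by omega)
    refine HT.block (fun _ => ?_) (Nat.le_of_ble_eq_true rfl)
    simp only [Nat.add_sub_cancel] at hmi'
    simp [g1, g2 m (by omega), g2 (m + 1) hm, hk2, g4, g5, hI2, hmi, hmi',
      hidx (C.offset n m + k) (by omega), hidx (C.offset n (m + 1) + k) (by omega), beta,
      Finset.prod_range_succ]
  · rintro h2 hf2 - e2
    have g1 : h2.w i 0 = m := by rw [hf2.w _ (by decide)]; simp [hi]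
    have g2 : h2.f adds = h1.f adds := by
      rw [hf2.f _ (by decide)]; funext j; simp
    have g3 : h2.f muls = h1.f muls := by
      rw [hf2.f _ (by decide)]; funext j; simp
    refine HT.block (fun _ => ?_) (Nat.le_of_ble_eq_true rfl)
    simp [g1, g2, g3, e2, hmi]
    refine ⟨fun l hl => ?_, fun l hl => ?_⟩
    · rcases hl.lt_or_eq with hl | rfl
      · simpa [hl.ne] using hI l hl
      · obtain ⟨a1, a2⟩ := hI' l le_rfl
        simp [a1, a2]
    · have hne : l ≠ m := by omega
      simpa [hne] using hI' l (by omega)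

/-- The preprocessing phase. The transducer is run twice: first to find the numbers of the random
values, which are then drawn, and again to evaluate the wiring predicates at them. The description of
the circuit is never stored. -/
def pre (T : Transducer) : Prog VName :=
  Simulation.simulate T false countHook ;; findVars ;; drawAll ;;
    (.wset layer 0 0 ;; .wset pow 0 0) ;; Simulation.simulate T true readHook ;; weigh

/-- The memory after the preprocessing phase. -/
structure Prepared (n : ℕ) (C : Circuit) (ρ : List F) (h : Memory VName F) : Prop where
  main : h.w main 0 = n
  depth : h.w depth 0 = C.depth
  vars : ∀ i ≤ C.depth, h.w vars i = C.vars n i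
  arity : ∀ i < C.depth, h.w arity i = C.arity n i
  offsets : ∀ i < C.depth, h.w offsets i = C.offset n i
  rho : ∀ j < C.numCoins n, h.f rho j = ρ.getD j 0
  z : ∀ i < C.depth, ∀ k < C.vars n (i + 1), h.f z (C.offset n i + k) = C.point n ρ (i + 1) k
  adds : ∀ i < C.depth, h.f adds i = beta (C.vars n i) (C.point n ρ i) (C.coin n ρ i) *
    C.wiringExt n .add i (C.coin n ρ i)
  muls : ∀ i < C.depth, h.f muls i = beta (C.vars n i) (C.point n ρ i) (C.coin n ρ i) *
    C.wiringExt n .mul i (C.coin n ρ i)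

theorem Prepared.congr {h h' : Memory VName F} (H : Prepared n C ρ h)
    (hw : ∀ x ∈ [VName.main, .depth, .vars, .arity, .offsets], h'.w x = h.w x)
    (hf : ∀ x ∈ [VName.rho, .z, .adds, .muls], h'.f x = h.f x) : Prepared n C ρ h' := by
  obtain ⟨h1, h2, h3, h4, h5, h6, h7, h8, h9⟩ := H
  constructor
  · rw [hw _ (by simp), h1]
  · rw [hw _ (by simp), h2]
  · rw [hw _ (by simp)]; exact h3
  · rw [hw _ (by simp)]; exact h4
  · rw [hw _ (by simp)]; exact h5
  · rw [hf _ (by simp)]; exact h6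
  · rw [hf _ (by simp)]; exact h7
  · rw [hf _ (by simp)]; exact h8
  · rw [hf _ (by simp)]; exact h9

theorem Prepared.frame {h h' : Memory VName F} (H : Prepared n C ρ h) {p : Prog VName}
    (hp : Frame p h h') (hw : ∀ x ∈ [VName.main, .depth, .vars, .arity, .offsets], x ∉ p.wmods)
    (hf : ∀ x ∈ [VName.rho, .z, .adds, .muls], x ∉ p.fmods) : Prepared n C ρ h' :=
  H.congr (fun x hx => hp.w x (hw x hx)) fun x hx => hp.f x (hf x hx)

/-- A bound on the time of the preprocessing phase. -/
def preTime (T : Transducer) (n s : ℕ) (C : Circuit) : ℕ :=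
  ((T.numCores n s + 1) * (30 + 24 * (Simulation.situations T).length + 200) + 50) +
    ((60 + ((C.depth + 1) * (((C.size n + 1) * 60 + 20) + 40) + 40)) +
      ((C.depth * (340 + 300 * C.numCoins n) + 50) + (20 + (((T.numCores n s + 1) *
        (600 + 110 * C.numCoins n + 24 * (Simulation.situations T).length + 200) + 50) +
          (C.depth * (300 * C.numCoins n + 300) + 40)))))

theorem ht_pre (hC : C.WellFormed n) (hT : T.Computes n s C.encode)
    (hE : Simulation.Provides T n s E) (hR : Room n C E) (hn1 : 1 ≤ n)
    (hρ : ρ.length = C.numCoins n) :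
    HT E (pre T) (preTime T n s C) (fun h => Prepared n C ρ h ∧ h.f total 0 = 0 ∧ h.trace = [])
      (Memory.initial main n ρ []) := by
  -- what the simulations leave unchanged
  have c1 : ∀ x, (countHook x).samples = false := by
    rintro (_ | _ | (_ | _) | _ | _) <;> rfl
  have c2 : ∀ x, (countHook x).talks = false := by
    rintro (_ | _ | (_ | _) | _ | _) <;> rfl
  have c3 : ∀ x, (readHook x).talks = false := by
    rintro (_ | _ | (_ | _) | _ | _) <;> rfl
  have c4 : ∀ r x, r ∉ (countHook x).fmods := by
    rintro r (_ | _ | (_ | _) | _ | _) <;> simp [countHook]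
  have m1 : ∀ r ∉ width :: layer :: Simulation.vars false,
      r ∉ (Simulation.simulate T false countHook).wmods := fun r hr => by
    simp only [List.mem_cons, not_or] at hr
    refine Simulation.wmods_simulate (by simpa using hr.2.2) ?_
    rintro (_ | _ | (_ | _) | _ | _) <;> simp [countHook, hr]
  have m3 : ∀ r ∈ [main, depth, vars, arity, offsets],
      r ∉ (Simulation.simulate T true readHook).wmods := by
    intro r hr
    refine Simulation.wmods_simulate (by revert r; decide) ?_
    rintro (_ | _ | (_ | _) | _ | _) <;> revert r <;> decide
  have m4 : ∀ r ∈ [rho, z, total], r ∉ (Simulation.simulate T true readHook).fmods := by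
    intro r hr
    refine Simulation.fmods_simulate ?_
    rintro (_ | _ | (_ | _) | _ | _) <;> revert r <;> decide
  have hne : (∀ k, (Memory.initial main n ρ [] : Memory VName F).w tapeA k = 0) :=
    fun k => by simp [Memory.initial]
  refine HT.seq (ht_count hC hT hE hR hn1 (by simp [Memory.initial]) hne (by simp [Memory.initial])
    (fun k => by simp [Memory.initial])) ?_
  rintro h1 hf1 - ⟨hl1, hw1⟩
  have w1 : ∀ r ∉ width :: layer :: Simulation.vars false, ∀ k,
      h1.w r k = if r = .main ∧ k = 0 then n else 0 := fun r hr k => by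
    rw [hf1.w r (m1 r hr)]; rfl
  have f1 : ∀ r k, h1.f r k = 0 := fun r k => by
    rw [hf1.f r (Simulation.fmods_simulate (c4 r))]; rfl
  have co1 : h1.coins = ρ := hf1.coins (Simulation.samples_simulate c1)
  have tr1 : h1.trace = [] := hf1.trace (Simulation.talks_simulate c2)
  have n1 : h1.w VName.main 0 = n := by rw [w1 _ (by decide)]; simp
  refine HT.seq (ht_findVars hC hR n1 hl1 hw1) ?_
  rintro h2 hf2 - ⟨hd2, hv2⟩
  refine HT.seq (ht_drawAll hR hρ hd2 hv2 (by rw [hf2.coins rfl, co1])) ?_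
  rintro h3 hf3 - H3
  refine HT.seq (R := (· = (h3.setW layer 0 0).setW pow 0 0)) (HT.block (fun _ => by simp)
    (Nat.le_of_ble_eq_true rfl)) ?_
  rintro _ - - rfl
  -- the variables of the second run are still in their initial state; it uses the other work
  -- tape
  have w3 : ∀ r ∈ [VName.gate, .phase, .op, .left, .acc, .tapeB, .main], h3.w r = h1.w r :=
    fun r hr => by
      rw [hf3.w r (by revert r; decide), hf2.w r (by revert r; decide)]
  have v3 : ∀ i ≤ C.depth, h3.w VName.vars i = C.vars n i := fun i hi => by
    rw [hf3.w _ (by decide), hv2 i hi]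
  have d3 : h3.w VName.depth 0 = C.depth := by rw [hf3.w _ (by decide), hd2]
  have f3 : ∀ r ∈ [VName.adds, .muls, .total], h3.f r = fun _ => 0 := fun r hr => by
    rw [hf3.f r (by revert r; decide), hf2.f r (by revert r; decide)]
    exact funext (f1 r)
  have z1 : ∀ r ∈ [VName.gate, .phase, .op, .left, .acc, .tapeB], ∀ k, h3.w r k = 0 := by
    intro r hr k
    rw [w3 r (by revert r; decide), w1 r (by revert r; decide), if_neg]
    rintro ⟨rfl, -⟩
    revert hr
    decide
  refine HT.seq (ht_read (ρ := ρ) hC hT hE hR hn1 ?_ ?_ ?_) ?_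
  · simp [w3 .main (by decide), n1]
  · intro k
    simp [z1 .tapeB (by decide)]
  · constructor
    · simp [Reader.start]
    · simp [Reader.start, z1 .gate (by decide)]
    · simp [Reader.start, z1 .phase (by decide)]
    · simp [Reader.start, z1 .op (by decide)]
    · simp [Reader.start, z1 .left (by decide)]
    · simp [Reader.start, z1 .acc (by decide)]
    · simp [Reader.start]
    · exact f3 .adds (by decide)
    · exact f3 .muls (by decide)
    · simpa using v3
    · simpa using H3.offsets
    · exact H3.rho
  rintro h4 hf4 - H4
  have z4 : ∀ i < C.depth, ∀ k < C.vars n (i + 1),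
      h4.f VName.z (C.offset n i + k) = C.point n ρ (i + 1) k := fun i hi k hk => by
    rw [hf4.f _ (m4 _ (by decide))]
    exact H3.z i hi k hk
  have d4 : h4.w VName.depth 0 = C.depth := by
    rw [hf4.w _ (m3 _ (by decide))]
    simpa using d3
  refine (ht_weigh hC hR d4 H4.vars H4.offsets H4.rho z4).mono le_rfl ?_
  rintro h5 hf5 - H5
  refine ⟨⟨?_, ?_, ?_, ?_, ?_, ?_, ?_, ?_, ?_⟩, ?_, ?_⟩
  · rw [hf5.w _ (by decide), hf4.w _ (m3 _ (by decide))]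
    simp [w3 .main (by decide), n1]
  · rw [hf5.w _ (by decide), d4]
  · rw [hf5.w _ (by decide)]
    exact H4.vars
  · rw [hf5.w _ (by decide), hf4.w _ (m3 _ (by decide))]
    simpa using H3.arity
  · rw [hf5.w _ (by decide)]
    exact H4.offsets
  · rw [hf5.f _ (by decide)]
    exact H4.rho
  · rw [hf5.f _ (by decide)]
    exact z4
  · intro i hi
    rw [(H5 i hi).1, H4.adds, Reader.adds_encode hC hi, mul_comm]
  · intro i hi
    rw [(H5 i hi).2, H4.muls, Reader.muls_encode hC hi, mul_comm]
  · rw [hf5.f _ (by decide), hf4.f _ (m4 _ (by decide))]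
    exact congrFun (f3 .total (by decide)) 0
  · rw [hf5.trace rfl, hf4.trace (Simulation.talks_simulate c3)]
    change h3.trace = []
    rw [hf3.trace rfl, hf2.trace rfl, tr1]

end VName


/-! ### The verifier on the stream -/

/-- The extension of the input is linear in the updates, so it can be maintained during the pass
over the stream, with time `O(log n)` for each update. -/
theorem mle_frequency {F : Type*} [Field F] (v : ℕ) (A : UpdateStream F) (x : ℕ → F)
    (hA : ∀ u ∈ A, u.1 < 2 ^ v) :
    mle v (frequency A) x = (A.map fun u => u.2 * chi v u.1 x).sum := by
  induction A with
  | nil => simp [mle, frequency]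
  | cons u A ih =>
    have h1 : ∀ i, frequency (u :: A) i = (if i = u.1 then u.2 else 0) + frequency A i := by
      intro i
      by_cases hi : u.1 = i
      · simp [frequency, hi]
      · simp [frequency, hi, Ne.symm hi]
    have h2 := hA u (by simp)
    rw [List.map_cons, List.sum_cons, ← ih fun w hw => hA w (by simp [hw])]
    simp only [mle, h1, add_mul, Finset.sum_add_distrib, ite_mul, zero_mul]
    rw [Finset.sum_ite_eq' (Finset.range (2 ^ v)) u.1, if_pos (Finset.mem_range.2 h2)]

namespace VName

variable {F : Type*} [Field F] {E : Env F} {n : ℕ} {C : Circuit} {ρ : List F}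

/-- The pass over the stream. -/
def observe : Prog VName :=
  (.wset count 0 (.get vars depth) ;; .wset start 0 (.get offsets (depth - 1))) ;;
  .loop .more (.read label value ;; indicator z ;; .fset total 0 (total + value))

theorem ht_observe (hC : C.WellFormed n) (hR : Room n C E) {A : UpdateStream F}
    (hA : ∀ u ∈ A, u.1 < n) {h : Memory VName F} (H : Prepared n C ρ h) (ht : h.f total 0 = 0)
    (hs : h.stream = A) :
    HT E observe (A.length * (110 * C.vars n C.depth + 120) + 60) (fun h' =>
      Prepared n C ρ h' ∧ h'.stream = [] ∧ h'.trace = h.trace ∧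
        h'.f total 0 = mle (C.vars n C.depth) (frequency A) (C.point n ρ C.depth)) h := by
  have hB := hR.bound
  have hd := hC.depth_pos
  obtain ⟨m, hm⟩ : ∃ m, C.depth = m + 1 := ⟨C.depth - 1, by omega⟩
  have hlt := Circuit.offset_add_lt (n := n) (show m < C.depth by omega) le_rfl
  have har : C.vars n m + 2 * C.vars n (m + 1) = C.arity n m := rfl
  have hidx : ∀ k ≤ C.numCoins n, E.Idx k := fun k hk => hR.idx k (by omega)
  have hns : n ≤ C.size n := Nat.le_add_right _ _
  have hnv : n ≤ 2 ^ C.vars n C.depth := by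
    have := Circuit.width_le_two_pow n C C.depth
    rwa [Circuit.width_depth] at this
  refine (HT.seq (T := 50) (R := (· = (h.setW count 0 (C.vars n C.depth)).setW start 0
    (C.offset n m))) (HT.block (fun _ => ?_) (Nat.le_of_ble_eq_true rfl)) (T' := A.length *
      (110 * C.vars n C.depth + 120) + 10) ?_).time (by omega)
  · have h1 := H.vars C.depth le_rfl
    have h2 := H.offsets m (by omega)
    have h3 := hR.idx (m + 1) (by omega)
    have h4 := hR.idx m (by omega)
    rw [hm] at h1
    simp [H.depth, hm, h1, h2, h3, h4]
    omega
  rintro _ hf - rfl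
  have key := HT.loop (E := E) (b := TE.more)
    (p := .read label value ;; indicator z ;; .fset total 0 (total + value))
    (h := (h.setW count 0 (C.vars n C.depth)).setW start 0 (C.offset n m))
    (T := fun _ => 110 * C.vars n C.depth + 110) A.length
    (fun k h' => h'.stream = A.drop k ∧ h'.f total 0 =
      ((A.take k).map fun u => u.2 * chi (C.vars n C.depth) u.1 (C.point n ρ C.depth)).sum)
    (by simp [hs, ht]) ?_ ?_
  · have hcost : (TE.more : TE VName).compile.cost = 1 := rfl
    refine (key.mono ?_ ?_)
    · simp only [hcost, Finset.sum_const, Finset.card_range, smul_eq_mul]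
      have := Nat.mul_le_mul_left A.length (show 110 * C.vars n C.depth + 110 + 1 ≤
        110 * C.vars n C.depth + 120 by omega)
      omega
    · rintro h' hf' - ⟨h1, h2⟩
      refine ⟨(H.frame hf (by decide) (by decide)).frame hf' (by decide) (by decide), by
        rw [h1, List.drop_length], by rw [hf'.trace rfl, hf.trace rfl], ?_⟩
      rw [h2, List.take_length, mle_frequency _ _ _ fun u hu => (hA u hu).trans_le hnv]
  · rintro k hk h' - - ⟨h1, -⟩
    simp [h1]
  · rintro k hk h' hf' - ⟨h1, h2⟩
    obtain ⟨u, hu⟩ : ∃ u, A[k]? = some u := ⟨_, List.getElem?_eq_getElem hk⟩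
    have hdrop : A.drop k = u :: A.drop (k + 1) := by
      rw [List.drop_eq_getElem_cons hk]
      rw [List.getElem?_eq_getElem hk] at hu
      rw [Option.some.inj hu]
    have htake : A.take (k + 1) = A.take k ++ [u] := by
      rw [List.take_add_one, hu]
      rfl
    have hun := hA u (List.mem_of_getElem? hu)
    have H' := (H.frame hf (by decide) (by decide)).frame (hf'.loop .more) (by decide) (by decide)
    refine (HT.seq (T := 20) (R := (· = { (h'.setW label 0 u.1).setF value 0 u.2 with
      stream := A.drop (k + 1) })) (HT.block (fun _ => ?_) (Nat.le_of_ble_eq_true rfl))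
      (T' := (C.vars n C.depth * 110 + 40) + 40) ?_).time (by omega)
    · simp only [Prog.wp, h1, hdrop]
      exact ⟨u.1, u.2, _, rfl, by omega, rfl⟩
    rintro _ hf1 - rfl
    have e1 : h'.w count 0 = C.vars n C.depth := by rw [hf'.w _ (by decide)]; simp
    have e2 : h'.w start 0 = C.offset n m := by rw [hf'.w _ (by decide)]; simp
    refine HT.seq (ht_indicator (v := C.vars n C.depth) (j := u.1) (s := C.offset n m)
      (x := C.point n ρ C.depth) (by decide) (by simpa using e1) (by simp) (by simpa using e2)
      (fun l hl => ?_) fun l hl => hidx _ ?_) ?_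
    · have := H'.z m (by omega) l (by rwa [hm] at hl)
      simpa [hm] using this
    · rw [hm] at hl
      omega
    rintro h3 hf3 - h4
    have e3 : h3.f total 0 = h'.f total 0 := by rw [hf3.f _ (by decide)]; simp
    have e4 : h3.stream = A.drop (k + 1) := by rw [hf3.stream rfl]
    refine HT.block (fun _ => ?_) (Nat.le_of_ble_eq_true rfl)
    simp [e3, e4, h2, h4, htake]

/-! ### The verifier in the interaction -/

/-- A round of a sum-check protocol. -/
def sumcheckRound : Prog VName :=
  .recv coeff₀ ;; .recv coeff₁ ;; .recv coeff₂ ;;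
  .cond (.feq (coeff₀ + (coeff₀ + (coeff₁ + coeff₂))) claim) .skip (.wset ok 0 0) ;;
  .send (.get rho (.get offsets i + k)) ;;
  .fset claim 0 (coeff₀ + .get rho (.get offsets i + k) *
    (coeff₁ + .get rho (.get offsets i + k) * coeff₂))

/-- The last round for a layer. The values at `0` and `1` and at the random parameter of the
polynomial that is received are computed in `coeff₀`, `coeff₁` and `coeff₂`. -/
def lineRound : Prog VName :=
  (.recv coeff₀ ;; .fset coeff₁ 0 coeff₀ ;; .fset coeff₂ 0 coeff₀ ;; .fset power 0 1 ;;
    .wset count 0 (.get vars (i + 1))) ;;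
  .for_ k count (.recv value ;;
    .fset power 0 (power * .get rho (.get offsets i + .get arity i)) ;;
    .fset coeff₁ 0 (coeff₁ + value) ;; .fset coeff₂ 0 (coeff₂ + value * power)) ;;
  .cond (.feq claim (.get adds i * (coeff₀ + coeff₁) + .get muls i * (coeff₀ * coeff₁)))
    .skip (.wset ok 0 0) ;;
  .send (.get rho (.get offsets i + .get arity i)) ;; .fset claim 0 coeff₂

/-- The interaction. At the end, the cell `0` of the word array `main` tells whether all checks have
succeeded, and that of the field array `main` contains the claimed output. -/
def talk : Prog VName :=
  (.recv claim ;; .fset main 0 claim ;; .wset ok 0 1) ;;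
  .for_ i depth (.wset rounds 0 (.get arity i) ;; .for_ k rounds sumcheckRound ;; lineRound) ;;
  .cond (.feq claim total) .skip (.wset ok 0 0) ;; .wset main 0 ok

end VName

namespace Circuit

open Polynomial

variable {F : Type*} [Field F] {n : ℕ} {C : Circuit} {ρ : List F} {y : F} {g : ℕ → ℕ → F[X]}

/-- The checks of a verifier in the first `k` rounds for layer `i`. -/
def RoundChecks (n : ℕ) (C : Circuit) (ρ : List F) (y : F) (g : ℕ → ℕ → F[X]) (i k : ℕ) : Prop :=
  ∀ l < k, (g i l).eval 0 + (g i l).eval 1 = C.claim n ρ y g i l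

/-- The checks of a verifier for layer `i`. -/
def LayerChecks (n : ℕ) (C : Circuit) (ρ : List F) (y : F) (g : ℕ → ℕ → F[X]) (i : ℕ) : Prop :=
  C.RoundChecks n ρ y g i (C.arity n i) ∧ C.claim n ρ y g i (C.arity n i) =
    beta (C.vars n i) (C.point n ρ i) (C.coin n ρ i) *
      (C.wiringExt n .add i (C.coin n ρ i) *
          ((g i (C.arity n i)).eval 0 + (g i (C.arity n i)).eval 1) +
        C.wiringExt n .mul i (C.coin n ρ i) *
          ((g i (C.arity n i)).eval 0 * (g i (C.arity n i)).eval 1))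

theorem claim_succ (i k : ℕ) : C.claim n ρ y g i (k + 1) = (g i k).eval (C.coin n ρ i k) := by
  cases i <;> rfl

theorem Answers.next' {σ : List (Event F) → F} (H : C.Answers n ρ σ y g) {i k e : ℕ}
    (hi : i < C.depth) (hk : k ≤ C.arity n i) (he : e ≤ C.msgDegree n i k)
    {τ : List (Event F)} (hτ : τ = C.prefixTrace n ρ y g i k ++
      (List.range e).map fun e => .received ((g i k).coeff e)) : σ τ = (g i k).coeff e :=
  hτ ▸ H.next i hi k hk e he

end Circuit

namespace VName

open Polynomial

variable {F : Type*} [Field F] {E : Env F} {n : ℕ} {C : Circuit} {ρ : List F} {y : F}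
  {g : ℕ → ℕ → F[X]}

/-- The interaction has been carried out up to round `k` for layer `m`, and the checks so far
succeed if and only if `P` holds. -/
structure Talking (n : ℕ) (C : Circuit) (ρ : List F) (y : F) (g : ℕ → ℕ → F[X]) (a : F)
    (m k : ℕ) (P : Prop) (h : Memory VName F) : Prop where
  prepared : Prepared n C ρ h
  trace : h.trace = C.prefixTrace n ρ y g m k
  claim : h.f claim 0 = C.claim n ρ y g m k
  result : h.f main 0 = y
  total : h.f total 0 = a
  ok : h.w ok 0 = 1 ↔ P

theorem ht_sumcheckRound (hR : Room n C E) (hA : C.Answers n ρ E.answer y g)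
    (hg : ∀ i < C.depth, ∀ k, (g i k).natDegree ≤ C.msgDegree n i k) {m l : ℕ} (hm : m < C.depth)
    (hl : l < C.arity n m) {a : F} {P : Prop} {h : Memory VName F}
    (H : Talking n C ρ y g a m l P h) (hi : h.w i 0 = m) (hk : h.w k 0 = l) :
    HT E sumcheckRound 200 (Talking n C ρ y g a m (l + 1) (P ∧ (g m l).eval 0 + (g m l).eval 1 =
      C.claim n ρ y g m l)) h := by
  have hlt := Circuit.offset_add_lt (n := n) hm hl.le
  have hidx := hR.idx (C.offset n m + l) (by omega)
  have hmi := hR.idx m (by omega)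
  obtain ⟨hP, htr, hcl, hre, hto, hok⟩ := H
  have hdeg : C.msgDegree n m l = 2 := if_pos hl
  have a0 : E.answer (C.prefixTrace n ρ y g m l) = (g m l).coeff 0 :=
    hA.next' hm hl.le (Nat.zero_le _) (by simp)
  have a1 : E.answer (C.prefixTrace n ρ y g m l ++ [.received ((g m l).coeff 0)]) =
      (g m l).coeff 1 := hA.next' hm hl.le (by omega) (by simp)
  have a2 : E.answer (C.prefixTrace n ρ y g m l ++ [.received ((g m l).coeff 0),
      .received ((g m l).coeff 1)]) = (g m l).coeff 2 :=
    hA.next' hm hl.le (by omega) (by simp [List.range_succ])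
  have hrho : h.f rho (C.offset n m + l) = C.coin n ρ m l := hP.rho _ hlt
  have hev : ∀ r, (g m l).eval r = (g m l).coeff 0 + r * ((g m l).coeff 1 + r * (g m l).coeff 2) := by
    intro r
    rw [eval_eq_sum_range' (show (g m l).natDegree < 3 by have := hg m hm l; omega)]
    simp only [Finset.sum_range_succ, Finset.sum_range_zero]
    ring
  have hchk : (g m l).coeff 0 + ((g m l).coeff 0 + ((g m l).coeff 1 + (g m l).coeff 2)) =
      (g m l).eval 0 + (g m l).eval 1 := by rw [hev, hev]; ring
  have hevents : C.prefixTrace n ρ y g m (l + 1) = C.prefixTrace n ρ y g m l ++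
      [.received ((g m l).coeff 0), .received ((g m l).coeff 1), .received ((g m l).coeff 2),
        .sent (C.coin n ρ m l)] := by
    rw [Circuit.prefixTrace_succ, Circuit.roundEvents, hdeg]
    simp [List.range_succ]
  refine HT.block (fun _ => ?_) (Nat.le_of_ble_eq_true rfl)
  by_cases hc : (g m l).eval 0 + (g m l).eval 1 = C.claim n ρ y g m l
  · simp [sumcheckRound, htr, a0, a1, a2, hcl, hchk, hc, hi, hk, hP.offsets m hm, hmi, hidx, hrho]
    refine ⟨hP.congr (by intro x hx; funext k; revert x; simp)
      (by intro x hx; funext k; revert x; simp), by simp [hevents], ?_, by simpa using hre,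
      by simpa using hto, by simpa using hok⟩
    simp [Circuit.claim_succ, hev]
  · simp [sumcheckRound, htr, a0, a1, a2, hcl, hchk, hc, hi, hk, hP.offsets m hm, hmi, hidx, hrho]
    refine ⟨hP.congr (by intro x hx; funext k; revert x; simp)
      (by intro x hx; funext k; revert x; simp), by simp [hevents], ?_, by simpa using hre,
      by simpa using hto, by simp⟩
    simp [Circuit.claim_succ, hev]

end VName


namespace VName

open Polynomial

variable {F : Type*} [Field F] {E : Env F} {n : ℕ} {C : Circuit} {ρ : List F} {y : F}
  {g : ℕ → ℕ → F[X]}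

/-- A loop evaluates the polynomial on the fly at `1` and at the random parameter, so that its
coefficients need not be stored. -/
theorem ht_lineRound (hR : Room n C E) (hA : C.Answers n ρ E.answer y g)
    (hg : ∀ i < C.depth, ∀ k, (g i k).natDegree ≤ C.msgDegree n i k) {m : ℕ} (hm : m < C.depth)
    {a : F} {P : Prop} {h : Memory VName F}
    (H : Talking n C ρ y g a m (C.arity n m) P h) (hi : h.w i 0 = m) :
    HT E lineRound (140 * C.vars n (m + 1) + 250) (Talking n C ρ y g a (m + 1) 0
      (P ∧ C.claim n ρ y g m (C.arity n m) =
        beta (C.vars n m) (C.point n ρ m) (C.coin n ρ m) *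
          (C.wiringExt n .add m (C.coin n ρ m) *
              ((g m (C.arity n m)).eval 0 + (g m (C.arity n m)).eval 1) +
            C.wiringExt n .mul m (C.coin n ρ m) *
              ((g m (C.arity n m)).eval 0 * (g m (C.arity n m)).eval 1)))) h := by
  have hB := hR.bound
  have hlt := Circuit.offset_add_lt (n := n) hm le_rfl
  have har : C.vars n m + 2 * C.vars n (m + 1) = C.arity n m := rfl
  have hidx := hR.idx (C.offset n m + C.arity n m) (by omega)
  have hmi := hR.idx m (by omega)
  have hmi' := hR.idx (m + 1) (by omega)
  obtain ⟨hP, htr, hcl, hre, hto, hok⟩ := H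
  set l := C.arity n m with hl
  have hdeg : C.msgDegree n m l = C.vars n (m + 1) := if_neg (lt_irrefl _)
  set τ := C.prefixTrace n ρ y g m l
  set t := C.coin n ρ m l with htdef
  have hrho : ∀ h', Prepared n C ρ h' → h'.f rho (C.offset n m + l) = t := fun h' hP => hP.rho _ hlt
  have ha : ∀ e ≤ C.vars n (m + 1), ∀ τ', τ' = τ ++ (List.range e).map
      (fun e => .received ((g m l).coeff e)) → E.answer τ' = (g m l).coeff e := fun e he τ' hτ =>
    hA.next' hm le_rfl (he.trans hdeg.ge) hτ
  have hev : ∀ r, (g m l).eval r = ∑ e ∈ Finset.range (C.vars n (m + 1) + 1),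
      (g m l).coeff e * r ^ e := fun r =>
    eval_eq_sum_range' (show (g m l).natDegree < C.vars n (m + 1) + 1 by have := hg m hm l; omega) r
  refine (HT.seq (T := 100) (R := fun h' => Prepared n C ρ h' ∧ h'.w i 0 = m ∧
      h'.w count 0 = C.vars n (m + 1) ∧ (h'.w VName.ok 0 = 1 ↔ P) ∧
      h'.f VName.claim 0 = C.claim n ρ y g m l ∧ h'.f VName.main 0 = y ∧ h'.f VName.total 0 = a ∧
      h'.trace = τ ++ (List.range 1).map (fun e => .received ((g m l).coeff e)) ∧
      h'.f coeff₀ 0 = (g m l).coeff 0 ∧ h'.f coeff₁ 0 = (g m l).coeff 0 ∧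
      h'.f coeff₂ 0 = (g m l).coeff 0 ∧ h'.f power 0 = 1)
    (HT.block (fun _ => ?_) (Nat.le_of_ble_eq_true rfl))
    (T' := (C.vars n (m + 1) * (100 + 40) + 40) + 110) ?_).time (by omega)
  · have a0 := ha 0 (Nat.zero_le _) τ (by simp)
    simp [htr, a0, hi, hmi', hP.vars (m + 1) hm]
    refine ⟨by omega, hP.congr (by intro x hx; funext k; revert x; simp)
      (by intro x hx; funext k; revert x; simp), hok, hcl, hre, hto⟩
  rintro h1 - - ⟨p1, p2, p3, p4, p5, p6, p7, p8, p9, p10, p11, p12⟩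
  refine HT.seq (HT.for_const (T := 100) (C.vars n (m + 1)) (fun k h' =>
      h'.trace = τ ++ (List.range (k + 1)).map (fun e => .received ((g m l).coeff e)) ∧
      h'.f coeff₁ 0 = ∑ e ∈ Finset.range (k + 1), (g m l).coeff e ∧
      h'.f coeff₂ 0 = ∑ e ∈ Finset.range (k + 1), (g m l).coeff e * t ^ e ∧
      h'.f power 0 = t ^ k) p3 (by decide) (by decide) (by decide)
      (fun k h v hk => by simpa using hk) ⟨p8, by simp [p10], by simp [p11], by simp [p12]⟩ ?_) ?_
  · rintro k hk h2 hf2 - - ⟨q1, q2, q3, q4⟩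
    have P2 := p1.frame hf2 (by decide) (by decide)
    have e1 : h2.w i 0 = m := by rw [hf2.w _ (by decide), p2]
    have a1 := ha (k + 1) hk _ rfl
    refine HT.block (fun _ => ?_) (Nat.le_of_ble_eq_true rfl)
    rw [Finset.sum_range_succ _ (k + 1), Finset.sum_range_succ _ (k + 1), List.range_succ (n := k + 1)]
    simp [e1, q1, q2, q3, q4, a1, P2.offsets m hm, P2.arity m hm, hmi, ← hl, hidx, hrho h2 P2,
      pow_succ]
  rintro h2 hf2 - ⟨q1, q2, q3, q4⟩
  have P2 := p1.frame hf2 (by decide) (by decide)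
  have e1 : h2.w i 0 = m := by rw [hf2.w _ (by decide), p2]
  have e2 : h2.f VName.claim 0 = C.claim n ρ y g m l := by rw [hf2.f _ (by decide), p5]
  have e3 : h2.f coeff₀ 0 = (g m l).eval 0 := by
    rw [hf2.f _ (by decide), p9, coeff_zero_eq_eval_zero]
  have e4 : h2.f coeff₁ 0 = (g m l).eval 1 := by rw [q2, hev]; simp
  have e5 : h2.f coeff₂ 0 = (g m l).eval t := by rw [q3, hev]
  have e6 : h2.f VName.main 0 = y := by rw [hf2.f _ (by decide), p6]
  have e7 : h2.f VName.total 0 = a := by rw [hf2.f _ (by decide), p7]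
  have e8 : h2.w VName.ok 0 = 1 ↔ P := by rw [hf2.w _ (by decide), p4]
  have e9 : C.prefixTrace n ρ y g (m + 1) 0 = h2.trace ++ [.sent t] := by
    rw [Circuit.prefixTrace_layer, Circuit.prefixTrace_succ, Circuit.roundEvents, q1, hdeg,
      List.append_assoc]
  have hchk : h2.f adds m * (h2.f coeff₀ 0 + h2.f coeff₁ 0) +
      h2.f muls m * (h2.f coeff₀ 0 * h2.f coeff₁ 0) =
      beta (C.vars n m) (C.point n ρ m) (C.coin n ρ m) *
          (C.wiringExt n .add m (C.coin n ρ m) *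
              ((g m l).eval 0 + (g m l).eval 1) +
            C.wiringExt n .mul m (C.coin n ρ m) *
              ((g m l).eval 0 * (g m l).eval 1)) := by
    rw [P2.adds m hm, P2.muls m hm, e3, e4]
    ring
  refine HT.block (fun _ => ?_) (Nat.le_of_ble_eq_true rfl)
  have hwc : ∀ b : ℕ, Prepared n C ρ ({ (if b = 0 then h2.setW VName.ok 0 0 else h2).setF
      VName.claim 0 ((g m l).eval t) with trace := C.prefixTrace n ρ y g (m + 1) 0 }) := by
    intro b
    refine P2.congr ?_ ?_
    · intro x hx; funext k; split <;> (revert x; simp)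
    · intro x hx; funext k; split <;> (revert x; simp)
  have hcl' : C.claim n ρ y g (m + 1) 0 = (g m l).eval t := rfl
  by_cases hc : C.claim n ρ y g m l = beta (C.vars n m) (C.point n ρ m) (C.coin n ρ m) *
          (C.wiringExt n .add m (C.coin n ρ m) *
              ((g m l).eval 0 + (g m l).eval 1) +
            C.wiringExt n .mul m (C.coin n ρ m) *
              ((g m l).eval 0 * (g m l).eval 1))
  · have hch := e2.trans (hc.trans hchk.symm)
    have hw := hwc 1
    simp only [one_ne_zero, if_false] at hw
    simp only [e9] at hw
    rw [← e5] at hw hcl'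
    simp [e1, hch, hmi, P2.offsets m hm, P2.arity m hm, ← hl, hidx, hrho h2 P2]
    exact ⟨hw, e9.symm, by simp [hcl'], by simpa using e6, by simpa using e7,
      by simp only [hc, and_true]; exact e8⟩
  · have hch : ¬ h2.f VName.claim 0 = h2.f adds m * (h2.f coeff₀ 0 + h2.f coeff₁ 0) +
      h2.f muls m * (h2.f coeff₀ 0 * h2.f coeff₁ 0) := by rwa [e2, hchk]
    have hw := hwc 0
    simp only [if_true] at hw
    simp only [e9] at hw
    rw [← e5] at hw hcl'
    simp [e1, hch, hmi, P2.offsets m hm, P2.arity m hm, ← hl, hidx, hrho h2 P2]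
    exact ⟨hw, e9.symm, by simp [hcl'], by simpa using e6, by simpa using e7,
      by simp [hc]⟩

theorem ht_talk (hR : Room n C E) (hA : C.Answers n ρ E.answer y g)
    (hg : ∀ i < C.depth, ∀ k, (g i k).natDegree ≤ C.msgDegree n i k) {a : ℕ → F} {h : Memory VName F}
    (H : Prepared n C ρ h)
    (ht : h.f total 0 = mle (C.vars n C.depth) a (C.point n ρ C.depth)) (htr : h.trace = []) :
    HT E talk (640 * C.numCoins n + 150) (fun h' => h'.trace = C.transcript n ρ y g ∧
      (h'.w main 0 = 1 ↔ C.Accepts n a ρ y g) ∧ h'.f main 0 = y) h := by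
  have hB := hR.bound
  have hfirst := hA.first
  set tot := mle (C.vars n C.depth) a (C.point n ρ C.depth) with htot
  have hsum : ∑ i ∈ Finset.range C.depth, (600 * (C.arity n i + 1) + 40) ≤ 640 * C.numCoins n := by
    rw [Circuit.numCoins, Circuit.offset, Finset.mul_sum]
    exact Finset.sum_le_sum fun i _ => by omega
  refine (HT.seq (T := 40) (R := Talking n C ρ y g tot 0 0 (∀ i < 0, C.LayerChecks n ρ y g i))
    (HT.block (fun _ => ?_) (Nat.le_of_ble_eq_true rfl)) ?_ (T' := (∑ i ∈ Finset.range C.depth,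
      (600 * (C.arity n i + 1) + 40) + 40) + 60)).time (by omega)
  · simp [htr, hfirst]
    refine ⟨by omega, H.congr (by intro x hx; funext k; revert x; simp)
      (by intro x hx; funext k; revert x; simp), by simp [Circuit.prefixTrace_zero],
      by simp [Circuit.claim], by simp, by simp [ht, htot], by simp⟩
  rintro h1 - - H1
  refine HT.seq (HT.for_ (T := fun i => 600 * (C.arity n i + 1)) C.depth (fun m h =>
    Talking n C ρ y g tot m 0 (∀ i < m, C.LayerChecks n ρ y g i) h) H1.prepared.depth
    (by decide) (by decide) (by decide) ?_ H1 ?_) ?_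
  · rintro k h v ⟨b1, b2, b3, b4, b5, b6⟩
    exact ⟨b1.congr (by intro x hx; funext k; revert x; simp) (fun _ _ => rfl), b2, b3, b4, b5,
      by simpa using b6⟩
  · rintro m hm h2 - - hi H2
    have har : C.vars n m + 2 * C.vars n (m + 1) = C.arity n m := rfl
    have hlt := Circuit.offset_add_lt (n := n) hm le_rfl
    have hmi := hR.idx m (by omega)
    refine (HT.seq (T := 30) (R := (· = h2.setW rounds 0 (C.arity n m)))
      (HT.block (fun _ => by simp [hi, H2.prepared.arity m hm, hmi]; omega)
        (Nat.le_of_ble_eq_true rfl)) ?_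
      (T' := (C.arity n m * (200 + 40) + 40) + (140 * C.vars n (m + 1) + 250))).time (by omega)
    rintro _ - - rfl
    have hP : ∀ k, ((∀ i < m, C.LayerChecks n ρ y g i) ∧ C.RoundChecks n ρ y g m (k + 1)) ↔
        (((∀ i < m, C.LayerChecks n ρ y g i) ∧ C.RoundChecks n ρ y g m k) ∧
          (g m k).eval 0 + (g m k).eval 1 = C.claim n ρ y g m k) := by
      intro k
      rw [and_assoc]
      refine and_congr_right fun _ => ⟨fun hk => ⟨fun l hl => hk l (by omega), hk k (by omega)⟩, ?_⟩
      rintro ⟨hk, hk'⟩ l hl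
      rcases Nat.lt_succ_iff_lt_or_eq.1 hl with hl | rfl
      exacts [hk l hl, hk']
    refine HT.seq (HT.for_const (T := 200) (C.arity n m) (fun k h => Talking n C ρ y g tot m k
      ((∀ i < m, C.LayerChecks n ρ y g i) ∧ C.RoundChecks n ρ y g m k) h) (by simp) (by decide)
      (by decide) (by decide) ?_ ?_ ?_) ?_
    · rintro k h v ⟨b1, b2, b3, b4, b5, b6⟩
      exact ⟨b1.congr (by intro x hx; funext k; revert x; simp) (fun _ _ => rfl), b2, b3, b4, b5,
        by simpa using b6⟩
    · obtain ⟨b1, b2, b3, b4, b5, b6⟩ := H2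
      refine ⟨b1.congr (by intro x hx; funext k; revert x; simp) (fun _ _ => rfl), b2, b3, b4, b5,
        ?_⟩
      have : C.RoundChecks n ρ y g m 0 := fun l hl => absurd hl (Nat.not_lt_zero l)
      simpa [this] using b6
    · rintro k hk h3 hf3 - hk3 H3
      have hi3 : h3.w i 0 = m := by rw [hf3.w _ (by decide)]; simpa using hi
      refine (ht_sumcheckRound hR hA hg hm hk H3 hi3 hk3).mono le_rfl ?_
      rintro h4 - - ⟨b1, b2, b3, b4, b5, b6⟩
      exact ⟨b1, b2, b3, b4, b5, b6.trans (hP k).symm⟩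
    · rintro h3 hf3 - H3
      have hi3 : h3.w i 0 = m := by rw [hf3.w _ (by decide)]; simpa using hi
      refine (ht_lineRound hR hA hg hm H3 hi3).mono le_rfl ?_
      rintro h4 - - ⟨b1, b2, b3, b4, b5, b6⟩
      refine ⟨b1, b2, b3, b4, b5, b6.trans ?_⟩
      rw [and_assoc]
      constructor
      · rintro ⟨hk, hk'⟩ l hl
        rcases Nat.lt_succ_iff_lt_or_eq.1 hl with hl | rfl
        exacts [hk l hl, hk']
      · exact fun hk => ⟨fun l hl => hk l (by omega), hk m (by omega)⟩
  rintro h2 - - ⟨b1, b2, b3, b4, b5, b6⟩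
  refine HT.block (fun _ => ?_) (Nat.le_of_ble_eq_true rfl)
  have hacc : C.Accepts n a ρ y g ↔ (∀ i < C.depth, C.LayerChecks n ρ y g i) ∧
      C.claim n ρ y g C.depth 0 = tot := Iff.rfl
  rw [hacc, ← b6, ← b3, ← b5, ← Circuit.prefixTrace_depth, ← b2]
  by_cases hc : h2.f VName.claim 0 = h2.f VName.total 0
  · have hb : h2.w VName.ok 0 ≤ E.bound := ‹h2.Bounded E.bound› _ _
    simp [hc, hb, b4]
  · simp [hc, b4]

end VName


/-! ### The prover: evaluation of the circuit -/

/-- The names of the arrays and variables of the prover. -/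
inductive PName where
  -- the number of inputs
  | main
  -- the shape of the circuit
  | depth | stride | layer | next | width | vars | sizes | rows
  -- counters
  | i | j | g | s | k | e
  -- auxiliary words
  | label | count | half | exp | three | labels | index
  -- the values of the gates, and the data of the current layer
  | val | table | weights | omega | z | lines
  -- auxiliary field elements
  | delta | c₀ | c₁ | c₂ | r | p₀ | p₁ | diff | prev
deriving DecidableEq

instance : Names PName where
  decEq := inferInstance
  code := PName.ctorIdx
  code_lt x := by cases x <;> decide
  code_inj := fun a b h => by rw [← PName.ofNat_ctorIdx a, h, PName.ofNat_ctorIdx]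

/-- The environment of the prover: all indices are permitted, the words have room for the numbers
that occur, and the table is the description of the circuit. -/
structure Explicit {F : Type*} (n : ℕ) (C : Circuit) (E : Env F) : Prop where
  idx : ∀ k, E.Idx k
  bound : 4 * C.size n + 4 ≤ E.bound
  table : E.table = C.table n

namespace PName

variable {F : Type*} [Field F] {E : Env F} {n : ℕ} {C : Circuit}

/-- Computes the input from the stream. The value of gate `j` of layer `i` has the index
`stride * j + i` in the array `val`. -/
def readInput : Prog PName :=
  (.wset depth 0 (.query 0 0 0) ;; .wset stride 0 (depth + 1)) ;;
  .loop .more (.read label delta ;;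
    .fset val (stride * label + depth) (.get val (stride * label + depth) + delta))

/-- Evaluates the circuit, layer by layer from the inputs to the output gate. Of the table, `query
1` is the width of a layer, and `query 2`, `query 3`, `query 4` are the operation and the two in-
neighbours of a gate. -/
def evaluate : Prog PName :=
  .for_ i depth ((.wset layer 0 (depth - 1 - i) ;; .wset width 0 (.query 1 layer 0)) ;;
    .for_ g width (.cond (.eq (.query 2 layer g) 0)
      (.fset val (stride * g + layer) (.get val (stride * .query 3 layer g + (layer + 1)) +
        .get val (stride * .query 4 layer g + (layer + 1))))
      (.fset val (stride * g + layer) (.get val (stride * .query 3 layer g + (layer + 1)) *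
        .get val (stride * .query 4 layer g + (layer + 1))))))

/-- Values of different gates are stored in different cells. -/
theorem stride_inj {d j l j' l' : ℕ} (hl : l ≤ d) (hl' : l' ≤ d) :
    (d + 1) * j + l = (d + 1) * j' + l' ↔ j = j' ∧ l = l' := by
  constructor
  · intro h
    have h1 : l = l' := by
      have := congrArg (· % (d + 1)) h
      simpa [Nat.mul_add_mod, Nat.mod_eq_of_lt (Nat.lt_succ_of_le hl),
        Nat.mod_eq_of_lt (Nat.lt_succ_of_le hl')] using this
    subst h1
    exact ⟨Nat.eq_of_mul_eq_mul_left (Nat.succ_pos d) (Nat.add_right_cancel h), rfl⟩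
  · rintro ⟨rfl, rfl⟩
    rfl

theorem ht_readInput (hC : C.WellFormed n) (hE : Explicit n C E) {A : UpdateStream F}
    (hA : ∀ u ∈ A, u.1 < n) {h : Memory PName F} (hs : h.stream = A) (hv : ∀ k, h.f val k = 0) :
    HT E readInput (A.length * 100 + 100) (fun h' => h'.w depth 0 = C.depth ∧
      h'.w stride 0 = C.depth + 1 ∧ ∀ j, ∀ l ≤ C.depth, h'.f val ((C.depth + 1) * j + l) =
        if l = C.depth then frequency A j else 0) h := by
  have hB := hE.bound
  have hd := hC.depth_lt_size
  have hns : n ≤ C.size n := Nat.le_add_right _ _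
  refine (HT.seq (T := 50) (R := (· = (h.setW depth 0 C.depth).setW stride 0 (C.depth + 1)))
    (HT.block (fun _ => ?_) (Nat.le_of_ble_eq_true rfl)) (T' := A.length * 100 + 10) ?_).time
    (by omega)
  · simp [hE.table, Circuit.table_zero]
    omega
  rintro _ hf - rfl
  have key := HT.loop (E := E) (b := TE.more) (p := .read label delta ;;
      .fset val (stride * label + depth) (.get val (stride * label + depth) + delta))
    (h := (h.setW depth 0 C.depth).setW stride 0 (C.depth + 1)) (T := fun _ => 99) A.length
    (fun k h' => h'.stream = A.drop k ∧ ∀ j, ∀ l ≤ C.depth, h'.f val ((C.depth + 1) * j + l) =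
        if l = C.depth then frequency (A.take k) j else 0) ?_ ?_ ?_
  · have hcost : (TE.more : TE PName).compile.cost = 1 := rfl
    refine (key.mono ?_ ?_)
    · simp only [hcost, Finset.sum_const, Finset.card_range, smul_eq_mul]
      omega
    · rintro h' hf' - ⟨-, h2⟩
      rw [List.take_length] at h2
      exact ⟨by rw [hf'.w _ (by decide)]; simp, by rw [hf'.w _ (by decide)]; simp, h2⟩
  · refine ⟨by simpa using hs, fun j l _ => ?_⟩
    simp [hv, frequency]
  · rintro k hk h' - - ⟨h1, -⟩
    simp [h1]
  · rintro k hk h' hf' - ⟨h1, h2⟩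
    obtain ⟨u, hu⟩ : ∃ u, A[k]? = some u := ⟨_, List.getElem?_eq_getElem hk⟩
    have hdrop : A.drop k = u :: A.drop (k + 1) := by
      rw [List.drop_eq_getElem_cons hk]
      rw [List.getElem?_eq_getElem hk] at hu
      rw [Option.some.inj hu]
    have htake : A.take (k + 1) = A.take k ++ [u] := by
      rw [List.take_add_one, hu]
      rfl
    have hun := hA u (List.mem_of_getElem? hu)
    have e1 : h'.w depth 0 = C.depth := by rw [hf'.w _ (by decide)]; simp
    have e2 : h'.w stride 0 = C.depth + 1 := by rw [hf'.w _ (by decide)]; simp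
    refine HT.block (fun _ => ?_) (Nat.le_of_ble_eq_true rfl)
    simp only [Prog.wp, h1, hdrop]
    refine ⟨u.1, u.2, _, rfl, by omega, ?_⟩
    simp [e1, e2, hE.idx]
    rintro j l hl
    simp only [stride_inj hl le_rfl, htake]
    have hfr : frequency (A.take k ++ [u]) j =
        frequency (A.take k) j + if u.1 = j then u.2 else 0 := by
      by_cases hj : u.1 = j <;> simp [frequency, hj]
    rw [hfr, h2 _ _ le_rfl, h2 _ _ hl]
    by_cases hj : j = u.1
    · subst hj
      by_cases hl' : l = C.depth <;> simp [hl']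
    · by_cases hl' : l = C.depth <;> simp [hl', hj, Ne.symm hj]

/-- The time is linear in the size, since the loop over the gates of a layer takes time linear in
its width. -/
theorem ht_evaluate (hE : Explicit n C E) {a : ℕ → F} {h : Memory PName F}
    (hd : h.w depth 0 = C.depth) (hst : h.w stride 0 = C.depth + 1)
    (hv : ∀ j, ∀ l ≤ C.depth, h.f val ((C.depth + 1) * j + l) = if l = C.depth then a j else 0) :
    HT E evaluate (340 * C.size n + 200 * C.depth + 40) (fun h' => ∀ j, ∀ l ≤ C.depth,
      h'.f val ((C.depth + 1) * j + l) = C.gateValue a l j) h := by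
  have hB := hE.bound
  have hsum : ∑ m ∈ Finset.range C.depth, ((100 + (C.width n (C.depth - 1 - m) * (200 + 40) + 40)) +
      40) ≤ 240 * C.size n + 180 * C.depth := by
    have h1 := Circuit.sum_width n C
    rw [Finset.sum_range_succ] at h1
    have h2 := Finset.sum_range_reflect (fun i => C.width n i) C.depth
    simp only [Finset.sum_add_distrib, Finset.sum_const, Finset.card_range, smul_eq_mul,
      ← Finset.sum_mul]
    omega
  refine (HT.for_ C.depth (fun m h' => ∀ j, ∀ l ≤ C.depth, h'.f val ((C.depth + 1) * j + l) =
      if C.depth ≤ l + m then C.gateValue a l j else 0) hd (by decide) (by decide) (by decide)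
      (fun k h v H => H) ?_ (T := fun m => 100 + (C.width n (C.depth - 1 - m) * (200 + 40) + 40))
      ?_).mono (by omega) ?_
  · intro j l hl
    rw [hv j l hl]
    by_cases h1 : l = C.depth
    · rw [if_pos h1, if_pos (by omega), h1, Circuit.gateValue_depth]
    · rw [if_neg h1, if_neg (by omega)]
  swap
  · rintro h' - - H j l hl
    rw [H j l hl, if_pos (by omega)]
  rintro m hm h1 hf1 - hi1 H1
  obtain ⟨l, hl⟩ : ∃ l, C.depth - 1 - m = l := ⟨_, rfl⟩
  have hld : l < C.depth := by omega
  rw [hl]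
  have hw := Circuit.width_le_size (n := n) hld.le
  have e1 : h1.w depth 0 = C.depth := by rw [hf1.w _ (by decide), hd]
  have e2 : h1.w stride 0 = C.depth + 1 := by rw [hf1.w _ (by decide), hst]
  refine HT.seq (T := 100) (R := (· = (h1.setW layer 0 l).setW width 0 (C.width n l)))
    (HT.block (fun hb => ?_) (Nat.le_of_ble_eq_true rfl)) ?_
  · have := hb depth 0
    simp [e1, hi1, hl, hE.table, Circuit.table_one]
    omega
  rintro _ - - rfl
  refine (HT.for_const (T := 200) (C.width n l) (fun k h' => ∀ j, ∀ l' ≤ C.depth,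
      h'.f val ((C.depth + 1) * j + l') = if C.depth ≤ l' + m ∨ (l' = l ∧ j < k) then
        C.gateValue a l' j else 0) (by simp) (by decide) (by decide) (by decide)
      (fun k h v H => H) ?_ ?_).mono le_rfl ?_
  · intro j l' hl'
    rw [Memory.setW_f, Memory.setW_f, H1 j l' hl']
    simp
  · rintro k hk h2 hf2 - hg2 H2
    have e3 : h2.w layer 0 = l := by rw [hf2.w _ (by decide)]; simp
    have e4 : h2.w stride 0 = C.depth + 1 := by rw [hf2.w _ (by decide)]; simp [e2]
    have hv1 : ∀ j, h2.f val ((C.depth + 1) * j + (l + 1)) = C.gateValue a (l + 1) j := fun j => by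
      rw [H2 j (l + 1) hld, if_pos (by omega)]
    have hgv := Circuit.gateValue_eq_table (n := n) a hld hk
    have hfin : ∀ j l', l' ≤ C.depth → (if j = k ∧ l' = l then C.gateValue a l k
        else h2.f val ((C.depth + 1) * j + l')) =
        if C.depth ≤ l' + m ∨ (l' = l ∧ j < k + 1) then C.gateValue a l' j else 0 := by
      intro j l' hl'
      by_cases hj : j = k ∧ l' = l
      · obtain ⟨rfl, rfl⟩ := hj
        simp
      · rw [if_neg hj, H2 j l' hl']
        congr 1
        apply propext
        omega
    refine HT.block (fun _ => ?_) (Nat.le_of_ble_eq_true rfl)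
    by_cases hq : C.table n 2 l k = 0
    · simp only [hq, if_true] at hgv
      simp [e3, e4, hg2, hE.idx, hE.table, hq, hv1]
      intro j l' hl'
      simp only [stride_inj hl' hld.le, ← hgv]
      exact (hfin j l' hl').trans (by simp only [Nat.lt_succ_iff])
    · simp only [hq, if_false] at hgv
      simp [e3, e4, hg2, hE.idx, hE.table, hq, hv1]
      intro j l' hl'
      simp only [stride_inj hl' hld.le, ← hgv]
      exact (hfin j l' hl').trans (by simp only [Nat.lt_succ_iff])
  · rintro h3 - - H3 j l' hl'
    rw [H3 j l' hl']
    by_cases hc : C.depth ≤ l' + m ∨ (l' = l ∧ j < C.width n l)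
    · rw [if_pos hc, if_pos (by omega)]
    -- beyond the width of the layer the extension takes the value `0`
    · rw [if_neg hc]
      by_cases hl2 : l' = l
      · subst hl2
        rw [if_pos (by omega), Circuit.gateValue_of_ge (n := n) a hld (by omega)]
      · rw [if_neg (by omega)]

end PName


/-! ### The prover: the rounds of the sum-check protocol -/

namespace Circuit

open Polynomial

variable {F : Type*} [Field F] {n : ℕ} {C : Circuit}

/-- The coefficients of the contribution of a gate to the polynomial for a round of the sum-check
protocol. `W` is the weight of the gate, `β` says whether the free variable is `1` in the label of the
gate, and `u`, `v` are the values of the remaining factor at `0` and `1`. -/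
def gateCoeff (β : Prop) [Decidable β] (W u v : F) (e : ℕ) : F :=
  if e = 0 then (if β then 0 else W * u)
  else if e = 1 then (if β then W * u else W * (v - u - u))
  else if e = 2 then (if β then W * (v - u) else - (W * (v - u)))
  else 0

theorem coeff_gate (β : Prop) [Decidable β] (W u v : F) (e : ℕ) :
    (Polynomial.C W * (if β then X else 1 - X) *
      ((1 - X) * Polynomial.C u + X * Polynomial.C v)).coeff e = gateCoeff β W u v e := by
  have h : Polynomial.C W * (if β then X else 1 - X) *
      ((1 - X) * Polynomial.C u + X * Polynomial.C v) =
      Polynomial.C (gateCoeff β W u v 0) + Polynomial.C (gateCoeff β W u v 1) * X +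
        Polynomial.C (gateCoeff β W u v 2) * X ^ 2 := by
    by_cases hβ : β <;> simp [gateCoeff, hβ] <;> ring
  rw [h]
  rcases e with _ | _ | _ | e <;> simp [coeff_X, coeff_C, gateCoeff, coeff_X_pow]

/-- The contribution of gate `g` to coefficient `e` of the polynomial for variable `k` of block `s`. -/
noncomputable def contribution (n : ℕ) (C : Circuit) (a : ℕ → F) (ρ : List F) (i s k e g : ℕ) : F :=
  gateCoeff (C.lab n i s g / 2 ^ k % 2 = 1)
    (chi (C.blockStart n i s + k) (C.label n i g) (C.coin n ρ i))
    (C.comb n i g (C.entry n i (C.blockStart n i s + k) s (C.gateValue a (i + 1)) (C.point n ρ i)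
      (C.coin n ρ i) g 0))
    (C.comb n i g (C.entry n i (C.blockStart n i s + k) s (C.gateValue a (i + 1)) (C.point n ρ i)
      (C.coin n ρ i) g 1)) e

/-- The message of a round is a sum over the gates of the layer with terms that are read off the
folded tables; this is what makes a round cost time linear in the width. -/
theorem WellFormed.coeff_honest (hC : C.WellFormed n) (a : ℕ → F) (ρ : List F) {i s k : ℕ}
    (hi : i < C.depth) (hs : s < 3) (hk : k < C.blockVars n i s) (e : ℕ) :
    (C.honest n a ρ i (C.blockStart n i s + k)).coeff e =
      ∑ g ∈ Finset.range (C.width n i), C.contribution n a ρ i s k e g := by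
  rw [hC.honest_eq_sum a ρ hi hs hk, finsetSum_coeff]
  exact Finset.sum_congr rfl fun g _ => coeff_gate _ _ _ _ _

end Circuit

namespace PName

open Polynomial

variable {F : Type*} [Field F] {E : Env F} {n : ℕ} {C : Circuit} {a : ℕ → F} {ρ : List F}

/-- The shape of layer `m` and the next layer has been determined. -/
structure Shape (n : ℕ) (C : Circuit) (m : ℕ) (h : Memory PName F) : Prop where
  i : h.w i 0 = m
  next : h.w next 0 = m + 1
  width : h.w width 0 = C.width n m
  three : h.w three 0 = 3
  rows : h.w rows 0 = C.vars n (m + 1) + 1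
  vars : ∀ b < 3, h.w vars b = C.blockVars n m b
  sizes : ∀ b < 3, h.w sizes b = 2 ^ C.blockVars n m b

theorem Shape.congr {m : ℕ} {h h' : Memory PName F} (H : Shape n C m h)
    (hw : ∀ x ∈ [PName.i, .next, .width, .three, .rows, .vars, .sizes], h'.w x = h.w x) :
    Shape n C m h' := by
  obtain ⟨h1, h2, h3, h4, h5, h6, h7⟩ := H
  constructor
  · rw [hw _ (by simp), h1]
  · rw [hw _ (by simp), h2]
  · rw [hw _ (by simp), h3]
  · rw [hw _ (by simp), h4]
  · rw [hw _ (by simp), h5]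
  · rw [hw _ (by simp)]; exact h6
  · rw [hw _ (by simp)]; exact h7

theorem Shape.frame {m : ℕ} {h h' : Memory PName F} (H : Shape n C m h) {p : Prog PName}
    (hp : Frame p h h')
    (hw : ∀ x ∈ [PName.i, .next, .width, .three, .rows, .vars, .sizes], x ∉ p.wmods) :
    Shape n C m h' := H.congr fun x hx => hp.w x (hw x hx)

/-- The tables and the weights after `q` variables for layer `m` have been bound. For block `b`, the
table and the labels of the gates are stored at the indices that are `b` modulo `3`. -/
structure Bound (n : ℕ) (C : Circuit) (a : ℕ → F) (ρ : List F) (m q : ℕ) (h : Memory PName F) :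
    Prop where
  table : ∀ b < 3, ∀ j < 2 ^ (C.blockVars n m b - C.bound n m q b), h.f table (3 * j + b) =
    fold (C.blockTable n m (C.gateValue a (m + 1)) (C.point n ρ m) b)
      (C.block n m b (C.coin n ρ m)) (C.bound n m q b) j
  labels : ∀ b < 3, ∀ g < C.width n m, h.w labels (3 * g + b) =
    C.lab n m b g / 2 ^ C.bound n m q b
  weights : ∀ g < C.width n m, h.f weights g = chi q (C.label n m g) (C.coin n ρ m)
  omega : ∀ b < 3, ∀ l < C.bound n m q b, h.f omega (3 * l + b) = C.block n m b (C.coin n ρ m) l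

theorem Bound.congr {m q : ℕ} {h h' : Memory PName F} (H : Bound n C a ρ m q h)
    (hw : h'.w .labels = h.w .labels)
    (hf : ∀ x ∈ [PName.table, .weights, .omega], h'.f x = h.f x) : Bound n C a ρ m q h' := by
  obtain ⟨h1, h2, h3, h4⟩ := H
  constructor
  · rw [hf _ (by simp)]; exact h1
  · rw [hw]; exact h2
  · rw [hf _ (by simp)]; exact h3
  · rw [hf _ (by simp)]; exact h4

/-- Computes the remaining factor in the contribution of gate `g`, if the free variable of block `s`
has the value `c`. -/
def factor (c : ℕ) (p : PName) : Prog PName :=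
  (.wset index 0 (.get labels (3 * g)) ;; .wset index 1 (.get labels (3 * g + 1)) ;;
    .wset index 2 (.get labels (3 * g + 2)) ;;
    .wset index s (2 * (.get labels (3 * g + s) / 2) + .const c)) ;;
  .cond (.eq (.query 2 i g) 0)
    (.fset p 0 (.get table (3 * .get index 0) * (.get table (3 * .get index 1 + 1) +
      .get table (3 * .get index 2 + 2))))
    (.fset p 0 (.get table (3 * .get index 0) * (.get table (3 * .get index 1 + 1) *
      .get table (3 * .get index 2 + 2))))

/-- The table entries that are read are those for the current labels of the gate, except that the
label in block `t` has its lowest bit replaced by `c`. -/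
theorem ht_factor (hE : Explicit n C E) {c : ℕ} {p : PName} {m t u : ℕ} (ht : t < 3)
    {h : Memory PName F} (hi : h.w i 0 = m) (hg : h.w g 0 = u) (hs : h.w s 0 = t)
    (hl : h.w labels (3 * u + t) + c ≤ E.bound) :
    HT E (factor c p) 300 (fun h' => h'.f p 0 = C.comb n m u (fun b => h.f table
      (3 * (if b = t then 2 * (h.w labels (3 * u + t) / 2) + c else h.w labels (3 * u + b)) + b))) h := by
  have hl2 : 2 * (h.w labels (3 * u + t) / 2) + c ≤ E.bound := by omega
  refine HT.block (fun hb => ?_) (Nat.le_of_ble_eq_true rfl)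
  have b0 := hb labels (3 * u)
  have b1 := hb labels (3 * u + 1)
  have b2 := hb labels (3 * u + 2)
  by_cases hq : C.table n 2 m u = 0
  · interval_cases t <;>
      simp [factor, hi, hg, hs, hE.idx, hE.table, hq, b0, b1, b2, Circuit.comb] <;> simpa using hl2
  · interval_cases t <;>
      simp [factor, hi, hg, hs, hE.idx, hE.table, hq, b0, b1, b2, Circuit.comb] <;> simpa using hl2

/-- Adds the contribution of gate `g` to the coefficients of the polynomial for the round. -/
def gate : Prog PName :=
  factor 0 p₀ ;; factor 1 p₁ ;;
  .cond (.eq (.get labels (3 * g + s) % 2) 1)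
    (.fset c₁ 0 (c₁ + .get weights g * p₀) ;; .fset c₂ 0 (c₂ + .get weights g * (p₁ - p₀)))
    (.fset c₀ 0 (c₀ + .get weights g * p₀) ;;
      .fset c₁ 0 (c₁ + .get weights g * (p₁ - p₀ - p₀)) ;;
      .fset c₂ 0 (c₂ - .get weights g * (p₁ - p₀)))

/-- A gate contributes to the message in constant time. -/
theorem ht_gate (hC : C.WellFormed n) (hE : Explicit n C E) {m t k u : ℕ} (hm : m < C.depth)
    (ht : t < 3) (hk : k < C.blockVars n m t) (hu : u < C.width n m) {h : Memory PName F}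
    (hi : h.w i 0 = m) (hg : h.w g 0 = u) (hs : h.w s 0 = t)
    (H : Bound n C a ρ m (C.blockStart n m t + k) h) :
    HT E gate 1000 (fun h' =>
      h'.f c₀ 0 = h.f c₀ 0 + C.contribution n a ρ m t k 0 u ∧
      h'.f c₁ 0 = h.f c₁ 0 + C.contribution n a ρ m t k 1 u ∧
      h'.f c₂ 0 = h.f c₂ 0 + C.contribution n a ρ m t k 2 u) h := by
  have hB := hE.bound
  set q := C.blockStart n m t + k with hq
  have hbt : C.bound n m q t = k := Circuit.bound_self hk.le
  have hlt : ∀ b < 3, C.lab n m b u / 2 ^ C.bound n m q b <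
      2 ^ (C.blockVars n m b - C.bound n m q b) := by
    intro b hb
    rw [Nat.div_lt_iff_lt_mul (by positivity), ← pow_add,
      Nat.sub_add_cancel (show C.bound n m q b ≤ C.blockVars n m b from min_le_right _ _)]
    exact hC.lab_lt hm hu b
  have hlabel : h.w labels (3 * u + t) = C.lab n m t u / 2 ^ k := by
    rw [H.labels t ht u hu, hbt]
  have hlt' := hlt t ht
  rw [hbt] at hlt'
  obtain ⟨v, hv⟩ : ∃ v, C.blockVars n m t - k = v + 1 := ⟨C.blockVars n m t - k - 1, by omega⟩
  have hsize : 2 ^ C.blockVars n m t ≤ 2 * C.size n := by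
    rw [Circuit.blockVars]
    split
    · exact (hC.two_pow_vars_le hm.le).trans (Nat.mul_le_mul_left _ (Circuit.width_le_size hm.le))
    · exact (hC.two_pow_vars_le hm).trans (Nat.mul_le_mul_left _ (Circuit.width_le_size hm))
  have hpow : 2 ^ (C.blockVars n m t - k) ≤ 2 ^ C.blockVars n m t :=
    Nat.pow_le_pow_right (by norm_num) (Nat.sub_le _ _)
  have hbound : ∀ c ≤ 1, h.w labels (3 * u + t) + c ≤ E.bound := fun c hc => by omega
  -- the entries of the tables that are used for the value `c` of the free variable
  have hentry : ∀ c < 2, C.comb n m u (fun b => h.f table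
      (3 * (if b = t then 2 * (h.w labels (3 * u + t) / 2) + c else h.w labels (3 * u + b)) + b)) =
      C.comb n m u (C.entry n m q t (C.gateValue a (m + 1)) (C.point n ρ m) (C.coin n ρ m) u c) := by
    intro c hc
    have key : ∀ b < 3, h.f table
        (3 * (if b = t then 2 * (h.w labels (3 * u + t) / 2) + c else h.w labels (3 * u + b)) + b) =
        C.entry n m q t (C.gateValue a (m + 1)) (C.point n ρ m) (C.coin n ρ m) u c b := by
      intro b hb
      rw [Circuit.entry]
      by_cases hbt' : b = t
      · subst hbt'
        rw [if_pos rfl, if_pos rfl, H.table b hb, hlabel, hbt]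
        rw [hbt, hlabel, hv, pow_succ]
        rw [hv, pow_succ] at hlt'
        omega
      · rw [if_neg hbt', if_neg hbt', H.labels b hb u hu, H.table b hb _ (hlt b hb)]
    simp only [Circuit.comb, key 0 (by norm_num), key 1 (by norm_num), key 2 (by norm_num)]
  refine (HT.seq (ht_factor hE ht hi hg hs (hbound 0 (by norm_num))) (T' := 600) ?_).time
    (by norm_num)
  rintro h1 hf1 - r1
  rw [hentry 0 (by norm_num)] at r1
  have a1 : h1.w i 0 = m := by rw [hf1.w _ (by decide), hi]
  have a2 : h1.w g 0 = u := by rw [hf1.w _ (by decide), hg]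
  have a3 : h1.w s 0 = t := by rw [hf1.w _ (by decide), hs]
  have a4 : h1.w labels = h.w labels := hf1.w _ (by decide)
  have a5 : h1.f table = h.f table := hf1.f _ (by decide)
  refine (HT.seq (ht_factor hE ht a1 a2 a3 (by rw [a4]; exact hbound 1 le_rfl)) (T' := 300)
    ?_).time (by norm_num)
  rintro h2 hf2 - r2
  rw [a4, a5, hentry 1 (by norm_num)] at r2
  have b2 : h2.w g 0 = u := by rw [hf2.w _ (by decide), a2]
  have b3 : h2.w s 0 = t := by rw [hf2.w _ (by decide), a3]
  have b4 : h2.w labels (3 * u + t) = C.lab n m t u / 2 ^ k := by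
    rw [hf2.w _ (by decide), a4, hlabel]
  have b5 : h2.f weights u = chi q (C.label n m u) (C.coin n ρ m) := by
    rw [hf2.f _ (by decide), hf1.f _ (by decide), H.weights u hu]
  have b6 : h2.f p₀ 0 = C.comb n m u
      (C.entry n m q t (C.gateValue a (m + 1)) (C.point n ρ m) (C.coin n ρ m) u 0) := by
    rw [hf2.f _ (by decide), r1]
  have d0 : h2.f c₀ 0 = h.f c₀ 0 := by rw [hf2.f _ (by decide), hf1.f _ (by decide)]
  have d1 : h2.f c₁ 0 = h.f c₁ 0 := by rw [hf2.f _ (by decide), hf1.f _ (by decide)]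
  have d2 : h2.f c₂ 0 = h.f c₂ 0 := by rw [hf2.f _ (by decide), hf1.f _ (by decide)]
  simp only [Circuit.contribution, ← hq, ← b5, ← b6, ← r2]
  refine HT.block (fun _ => ?_) (Nat.le_of_ble_eq_true rfl)
  by_cases hbit : C.lab n m t u / 2 ^ k % 2 = 1
  · simp [b2, b3, b4, hE.idx, hbit, Circuit.gateCoeff, d0, d1, d2]
  · simp [b2, b3, b4, hE.idx, hbit, Circuit.gateCoeff, d0, d1, d2, sub_eq_add_neg]

/-- Updates the weight and the label of gate `g` after the challenge `r` for a variable of block `s`. -/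
def reweigh : Prog PName :=
  .cond (.eq (.get labels (3 * g + s) % 2) 1) (.fset weights g (.get weights g * r))
    (.fset weights g (.get weights g * (1 - r))) ;;
  .wset labels (3 * g + s) (.get labels (3 * g + s) / 2)

/-- Binds a variable of the table for block `s` to `r`. -/
def foldTable : Prog PName :=
  .fset table (3 * j + s) ((1 - r) * .get table (3 * (2 * j) + s) +
    r * .get table (3 * (2 * j + 1) + s))

/-- The round for variable `k` of block `s`. -/
def round : Prog PName :=
  (.fset c₀ 0 0 ;; .fset c₁ 0 0 ;; .fset c₂ 0 0) ;; .for_ g width gate ;;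
  (.send c₀ ;; .send c₁ ;; .send c₂ ;; .recv r ;; .fset omega (3 * k + s) r ;;
    .wset half 0 (half / 2)) ;;
  .for_ g width reweigh ;; .for_ j half foldTable

theorem ht_gates (hC : C.WellFormed n) (hE : Explicit n C E) {m t v : ℕ} (hm : m < C.depth)
    (ht : t < 3) (hv : v < C.blockVars n m t) {h : Memory PName F} (hS : Shape n C m h)
    (hs : h.w s 0 = t) (H : Bound n C a ρ m (C.blockStart n m t + v) h)
    (h0 : h.f c₀ 0 = 0) (h1 : h.f c₁ 0 = 0) (h2 : h.f c₂ 0 = 0) :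
    HT E (.for_ g width gate) (C.width n m * (1000 + 40) + 40) (fun h' =>
      h'.f c₀ 0 = (C.honest n a ρ m (C.blockStart n m t + v)).coeff 0 ∧
      h'.f c₁ 0 = (C.honest n a ρ m (C.blockStart n m t + v)).coeff 1 ∧
      h'.f c₂ 0 = (C.honest n a ρ m (C.blockStart n m t + v)).coeff 2) h := by
  simp only [hC.coeff_honest a ρ hm ht hv]
  refine HT.for_const (C.width n m) (fun u h' =>
      h'.f c₀ 0 = ∑ g ∈ Finset.range u, C.contribution n a ρ m t v 0 g ∧
      h'.f c₁ 0 = ∑ g ∈ Finset.range u, C.contribution n a ρ m t v 1 g ∧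
      h'.f c₂ 0 = ∑ g ∈ Finset.range u, C.contribution n a ρ m t v 2 g) hS.width (by decide)
      (by decide) (by decide) (fun k h v H => H) (by simp [h0, h1, h2]) ?_
  rintro u hu h3 hf3 - hg3 ⟨r0, r1, r2⟩
  refine (ht_gate hC hE hm ht hv hu (by rw [hf3.w _ (by decide), hS.i]) hg3
    (by rw [hf3.w _ (by decide), hs]) (H.congr (hf3.w _ (by decide)) fun x hx => hf3.f x (by
      revert x; decide))).mono le_rfl ?_
  rintro h4 - - ⟨q0, q1, q2⟩
  simp only [Finset.sum_range_succ, q0, q1, q2, r0, r1, r2, and_self]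

theorem three_mul_add_inj {b b' j j' : ℕ} (hb : b < 3) (hb' : b' < 3) :
    3 * j + b = 3 * j' + b' ↔ j = j' ∧ b = b' := by omega

/-- A round appends the message and the challenge to the trace, and binds one more variable.
Halving the table of the block costs no more than its initial size; the other two tables are
unchanged. -/
theorem ht_round (hC : C.WellFormed n) (hE : Explicit n C E)
    (hA : E.answer = Circuit.script ((C.transcript n ρ (C.output a) (C.honest n a ρ)).map Event.dual))
    {m t v : ℕ} (hm : m < C.depth)
    (ht : t < 3) (hv : v < C.blockVars n m t) {h : Memory PName F} (hS : Shape n C m h)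
    (hs : h.w s 0 = t) (hk : h.w k 0 = v) (hh : h.w half 0 = 2 ^ (C.blockVars n m t - v))
    (H : Bound n C a ρ m (C.blockStart n m t + v) h)
    (htr : h.trace = (C.prefixTrace n ρ (C.output a) (C.honest n a ρ) m
      (C.blockStart n m t + v)).map Event.dual) :
    HT E round (1300 * C.width n m + 200 * 2 ^ C.blockVars n m t + 500) (fun h' =>
      h'.w half 0 = 2 ^ (C.blockVars n m t - (v + 1)) ∧
      Bound n C a ρ m (C.blockStart n m t + (v + 1)) h' ∧
      h'.trace = (C.prefixTrace n ρ (C.output a) (C.honest n a ρ) m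
        (C.blockStart n m t + (v + 1))).map Event.dual) h := by
  have hB := hE.bound
  have hqa : C.blockStart n m t + v < C.arity n m := by
    have := Circuit.blockStart_add_blockVars_le (n := n) (C := C) m ht
    omega
  set q := C.blockStart n m t + v with hq
  set x := C.coin n ρ m with hx
  -- the round binds a variable of block `t` only
  have hbt : C.bound n m q t = v := Circuit.bound_self hv.le
  have hbt' : C.bound n m (q + 1) t = v + 1 := Circuit.bound_self (Nat.succ_le_of_lt hv)
  have hbn : ∀ b < 3, b ≠ t → C.bound n m (q + 1) b = C.bound n m q b := fun b hb hne =>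
    Circuit.bound_of_ne ht hb hne hv
  have hpow : 2 ^ (C.blockVars n m t - v) = 2 ^ (C.blockVars n m t - (v + 1)) * 2 := by
    rw [← pow_succ]
    congr 1
    omega
  have hle : 2 ^ (C.blockVars n m t - (v + 1)) ≤ 2 ^ C.blockVars n m t :=
    Nat.pow_le_pow_right (by norm_num) (Nat.sub_le _ _)
  have hblock : C.block n m t x v = x q := rfl
  have hdeg : C.msgDegree n m q = 2 := if_pos hqa
  have hscript : Circuit.script ((C.transcript n ρ (C.output a) (C.honest n a ρ)).map Event.dual)
      ((C.prefixTrace n ρ (C.output a) (C.honest n a ρ) m q).map Event.dual ++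
        [.sent ((C.honest n a ρ m q).coeff 0), .sent ((C.honest n a ρ m q).coeff 1),
          .sent ((C.honest n a ρ m q).coeff 2)]) = x q := by
    have := Circuit.script_dual ρ (C.output a) (C.honest n a ρ) hm hqa.le
    rw [hdeg] at this
    simpa [List.range_succ] using this
  have hevents : (C.prefixTrace n ρ (C.output a) (C.honest n a ρ) m (q + 1)).map Event.dual =
      (C.prefixTrace n ρ (C.output a) (C.honest n a ρ) m q).map Event.dual ++
        [.sent ((C.honest n a ρ m q).coeff 0), .sent ((C.honest n a ρ m q).coeff 1),
          .sent ((C.honest n a ρ m q).coeff 2), .received (x q)] := by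
    rw [Circuit.prefixTrace_succ, Circuit.roundEvents, hdeg]
    simp [List.range_succ, Event.dual, hx]
  refine (HT.seq (T := 40) (R := (· = ((h.setF c₀ 0 0).setF c₁ 0 0).setF c₂ 0 0))
    (HT.block (fun _ => by simp) (Nat.le_of_ble_eq_true rfl)) (T' := (C.width n m * (1000 + 40) + 40) +
      (120 + ((C.width n m * (150 + 40) + 40) + (2 ^ (C.blockVars n m t - (v + 1)) * (100 + 40) + 40))))
      ?_).time (by omega)
  rintro _ - - rfl
  have hS0 : Shape n C m (((h.setF c₀ 0 0).setF c₁ 0 0).setF c₂ 0 0) := hS.congr fun _ _ => rfl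
  have H0 : Bound n C a ρ m q (((h.setF c₀ 0 0).setF c₁ 0 0).setF c₂ 0 0) :=
    H.congr rfl (by intro x hx; funext k; revert x; simp)
  refine HT.seq (ht_gates hC hE hm ht hv hS0 hs H0 (by simp) (by simp) (by simp)) ?_
  rintro h1 hf1 - ⟨r0, r1, r2⟩
  have S1 := hS0.frame hf1 (by decide)
  have H1 : Bound n C a ρ m q h1 := H0.congr (hf1.w _ (by decide)) fun x hx => hf1.f x (by
    revert x; decide)
  have s1 : h1.w s 0 = t := by rw [hf1.w _ (by decide)]; exact hs
  have k1 : h1.w k 0 = v := by rw [hf1.w _ (by decide)]; exact hk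
  have hh1 : h1.w half 0 = 2 ^ (C.blockVars n m t - v) := by rw [hf1.w _ (by decide)]; exact hh
  have t1 : h1.trace = (C.prefixTrace n ρ (C.output a) (C.honest n a ρ) m q).map Event.dual := by
    rw [hf1.trace rfl]
    exact htr
  refine HT.seq (T := 120) (R := fun h' => Shape n C m h' ∧ h'.w s 0 = t ∧
    h'.w half 0 = 2 ^ (C.blockVars n m t - (v + 1)) ∧ h'.f r 0 = x q ∧
    h'.f omega (3 * v + t) = x q ∧ Bound n C a ρ m q h' ∧
    h'.trace = (C.prefixTrace n ρ (C.output a) (C.honest n a ρ) m (q + 1)).map Event.dual)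
    (HT.block (fun hb => ?_) (Nat.le_of_ble_eq_true rfl)) ?_
  · have hb1 := hb half 0
    rw [← hq] at r0 r1 r2
    simp [hE.idx, s1, k1, hh1, t1, r0, r1, r2, hA, hscript, hpow, hevents]
    refine ⟨by omega, S1.congr (by intro x hx; funext k; revert x; simp), H1.table, H1.labels,
      H1.weights, fun b hb l hl => ?_⟩
    have : l ≠ v ∨ b ≠ t := by
      by_contra! hcon
      obtain ⟨rfl, rfl⟩ := hcon
      omega
    have h3 : 3 * l + b ≠ 3 * v + t := by omega
    simp [h3, H1.omega b hb l hl]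
  -- the weights and the labels are updated for one gate after the other
  rintro h2 - - ⟨S2, s2, hh2, rr2, o2, H2, t2⟩
  have hbit : ∀ u < C.width n m, (C.label n m u).testBit q =
      decide (C.lab n m t u / 2 ^ v % 2 = 1) := by
    intro u hu
    rw [hq, hC.testBit_label hm hu ht hv, Nat.testBit_eq_decide_div_mod_eq]
  refine HT.seq (HT.for_const (T := 150) (C.width n m) (fun u h' =>
    (∀ b < 3, ∀ g < C.width n m, h'.w labels (3 * g + b) =
      if b = t ∧ g < u then C.lab n m b g / 2 ^ (v + 1) else C.lab n m b g / 2 ^ C.bound n m q b) ∧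
    ∀ g < C.width n m, h'.f weights g = chi (if g < u then q + 1 else q) (C.label n m g) x)
    S2.width (by decide) (by decide) (by decide) (fun k h v H => by simpa using H) ?_ ?_) ?_
  · refine ⟨fun b hb g hg => ?_, fun g hg => ?_⟩
    · simpa using H2.labels b hb g hg
    · simpa using H2.weights g hg
  · rintro u hu h3 hf3 hb3 hg3 ⟨L3, W3⟩
    have e1 : h3.w s 0 = t := by rw [hf3.w _ (by decide), s2]
    have e2 : h3.f r 0 = x q := by rw [hf3.f _ (by decide), rr2]
    have e3 : h3.w labels (3 * u + t) = C.lab n m t u / 2 ^ v := by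
      rw [L3 t ht u hu, if_neg (by omega), hbt]
    have e4 : h3.f weights u = chi q (C.label n m u) x := by rw [W3 u hu, if_neg (by omega)]
    have e5 : C.lab n m t u / 2 ^ v / 2 ≤ E.bound := by
      have := hb3 labels (3 * u + t)
      rw [e3] at this
      omega
    have e6 : C.lab n m t u / 2 ^ v / 2 = C.lab n m t u / 2 ^ (v + 1) := by
      rw [pow_succ, Nat.div_div_eq_div_mul]
    have hW : chi (q + 1) (C.label n m u) x = chi q (C.label n m u) x *
        if C.lab n m t u / 2 ^ v % 2 = 1 then x q else 1 - x q := by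
      rw [chi_succ, hbit u hu]
      simp
    have hL' : ∀ b < 3, ∀ g < C.width n m, (if 3 * g + b = 3 * u + t then C.lab n m t u / 2 ^ v / 2
        else h3.w labels (3 * g + b)) = if b = t ∧ g < u + 1 then C.lab n m b g / 2 ^ (v + 1)
          else C.lab n m b g / 2 ^ C.bound n m q b := by
      intro b hb g hg
      by_cases hc : 3 * g + b = 3 * u + t
      · obtain ⟨rfl, rfl⟩ := (three_mul_add_inj hb ht).1 hc
        simp [e6]
      · rw [if_neg hc, L3 b hb g hg]
        congr 1
        apply propext
        omega
    have hW' : ∀ g < C.width n m, g ≠ u → h3.f weights g =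
        chi (if g < u + 1 then q + 1 else q) (C.label n m g) x := by
      intro g hg hne
      rw [W3 g hg]
      congr 1
      simp only [show g < u + 1 ↔ g < u by omega]
    refine HT.block (fun _ => ?_) (Nat.le_of_ble_eq_true rfl)
    by_cases hc : C.lab n m t u / 2 ^ v % 2 = 1
    · simp [reweigh, hE.idx, e1, e2, e3, e4, e5, hg3, hc]
      refine ⟨fun b hb g hg => by simpa [Nat.lt_succ_iff] using hL' b hb g hg, fun g hg => ?_⟩
      by_cases hgu : g = u
      · simp [hgu, hW, hc]
      · simpa [hgu, Nat.lt_succ_iff] using hW' g hg hgu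
    · simp [reweigh, hE.idx, e1, e2, e3, e4, e5, hg3, hc]
      refine ⟨fun b hb g hg => by simpa [Nat.lt_succ_iff] using hL' b hb g hg, fun g hg => ?_⟩
      by_cases hgu : g = u
      · simp [hgu, hW, hc]
      · simpa [hgu, Nat.lt_succ_iff] using hW' g hg hgu
  rintro h3 hf3 - ⟨L3, W3⟩
  have hh3 : h3.w half 0 = 2 ^ (C.blockVars n m t - (v + 1)) := by rw [hf3.w _ (by decide), hh2]
  have s3 : h3.w s 0 = t := by rw [hf3.w _ (by decide), s2]
  have r3 : h3.f r 0 = x q := by rw [hf3.f _ (by decide), rr2]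
  have T3 : h3.f table = h2.f table := hf3.f _ (by decide)
  have O3 : h3.f omega = h2.f omega := hf3.f _ (by decide)
  have t3 : h3.trace = _ := (hf3.trace rfl).trans t2
  -- The table is folded in place: the entries `2 u` and `2 u + 1` are read before any entry with
  -- an index above `u` is written.
  refine (HT.for_const (T := 100) (2 ^ (C.blockVars n m t - (v + 1))) (fun u h' =>
    (∀ b < 3, b ≠ t → ∀ j, h'.f table (3 * j + b) = h2.f table (3 * j + b)) ∧
    (∀ j < u, h'.f table (3 * j + t) = fold (C.blockTable n m (C.gateValue a (m + 1))
      (C.point n ρ m) t) (C.block n m t x) (v + 1) j) ∧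
    (∀ j, u ≤ j → h'.f table (3 * j + t) = h2.f table (3 * j + t))) hh3
    (by decide) (by decide) (by decide) (fun k h v H => H) ?_ ?_).mono le_rfl ?_
  · rw [T3]
    exact ⟨fun _ _ _ _ => rfl, fun j hj => absurd hj (Nat.not_lt_zero _), fun _ _ => rfl⟩
  · rintro u hu h4 hf4 - hj4 ⟨Q1, Q2, Q3⟩
    have e1 : h4.w s 0 = t := by rw [hf4.w _ (by decide), s3]
    have e2 : h4.f r 0 = x q := by rw [hf4.f _ (by decide), r3]
    have T2 := H2.table t ht
    rw [hbt] at T2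
    have e3 := (Q3 (2 * u) (by omega)).trans (T2 (2 * u) (by omega))
    have e4 := (Q3 (2 * u + 1) (by omega)).trans (T2 (2 * u + 1) (by omega))
    refine HT.block (fun _ => ?_) (Nat.le_of_ble_eq_true rfl)
    simp [foldTable, hE.idx, e1, e2, e3, e4, hj4]
    refine ⟨fun b hb hne j => ?_, fun j hj => ?_, fun j hj => ?_⟩
    · rw [if_neg (by omega), Q1 b hb hne]
    · by_cases hju : j = u
      · simp [hju, fold, hblock]
        rfl
      · rw [if_neg hju, Q2 j (by omega)]
    · rw [if_neg (by omega), Q3 j (by omega)]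
  · rintro h4 hf4 - ⟨Q1, Q2, Q3⟩
    refine ⟨by rw [hf4.w _ (by decide), hh3], ⟨fun b hb j hj => ?_, fun b hb g hg => ?_,
      fun g hg => ?_, fun b hb l hl => ?_⟩, by rw [hf4.trace rfl, t3]; rfl⟩
    · by_cases hbt2 : b = t
      · subst hbt2
        rw [← Nat.add_assoc, ← hq, hbt'] at hj ⊢
        exact Q2 j hj
      · rw [← Nat.add_assoc, ← hq, hbn b hb hbt2] at hj ⊢
        rw [Q1 b hb hbt2, H2.table b hb j hj]
    · rw [hf4.w _ (by decide), L3 b hb g hg, ← Nat.add_assoc, ← hq]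
      by_cases hbt2 : b = t
      · subst hbt2
        rw [if_pos ⟨rfl, hg⟩, hbt']
      · rw [if_neg (fun h => hbt2 h.1), hbn b hb hbt2]
    · rw [hf4.f _ (by decide), W3 g hg, if_pos hg]
      rfl
    · rw [hf4.f _ (by decide), O3]
      rw [← Nat.add_assoc, ← hq] at hl
      by_cases hbt2 : b = t
      · subst hbt2
        rw [hbt'] at hl
        rcases Nat.lt_succ_iff_lt_or_eq.1 hl with hl | rfl
        · exact H2.omega b hb l (by rwa [hbt])
        · rw [o2, ← hblock]
      · rw [hbn b hb hbt2] at hl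
        exact H2.omega b hb l hl

end PName


/-! ### The prover: the restriction to a line -/

namespace Circuit

open Polynomial

variable {F : Type*} [Field F] {n : ℕ} {C : Circuit}

/-- The coordinates of the line through the two challenge points for layer `i`. -/
noncomputable def line (n : ℕ) (C : Circuit) (ρ : List F) (i l : ℕ) : F[X] :=
  (1 - X) * Polynomial.C (C.omega₁ n i (C.coin n ρ i) l) +
    X * Polynomial.C (C.omega₂ n i (C.coin n ρ i) l)

/-- The polynomial at position `j`, after `k` variables of the table of the gate values have been
replaced by the coordinates of the line. -/
noncomputable def linePoly (n : ℕ) (C : Circuit) (a : ℕ → F) (ρ : List F) (i k j : ℕ) : F[X] :=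
  fold (fun j => Polynomial.C (C.gateValue a (i + 1) j)) (C.line n ρ i) k j

/-- The last message for a layer is the completely folded table. -/
theorem honest_arity (a : ℕ → F) (ρ : List F) (i : ℕ) :
    C.honest n a ρ i (C.arity n i) = C.linePoly n a ρ i (C.vars n (i + 1)) 0 := by
  rw [honest, if_neg (lt_irrefl _), linePoly, fold_eq_mle]
  rfl

/-- The coefficients after the next variable has been replaced. -/
theorem coeff_linePoly_succ (a : ℕ → F) (ρ : List F) (i k j e : ℕ) :
    (C.linePoly n a ρ i (k + 1) j).coeff e = (C.linePoly n a ρ i k (2 * j)).coeff e +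
      C.omega₁ n i (C.coin n ρ i) k * ((C.linePoly n a ρ i k (2 * j + 1)).coeff e -
        (C.linePoly n a ρ i k (2 * j)).coeff e) +
      (C.omega₂ n i (C.coin n ρ i) k - C.omega₁ n i (C.coin n ρ i) k) *
        (if e = 0 then 0 else (C.linePoly n a ρ i k (2 * j + 1)).coeff (e - 1) -
          (C.linePoly n a ρ i k (2 * j)).coeff (e - 1)) := by
  have h : C.linePoly n a ρ i (k + 1) j = C.linePoly n a ρ i k (2 * j) +
      Polynomial.C (C.omega₁ n i (C.coin n ρ i) k) *
        (C.linePoly n a ρ i k (2 * j + 1) - C.linePoly n a ρ i k (2 * j)) +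
      Polynomial.C (C.omega₂ n i (C.coin n ρ i) k - C.omega₁ n i (C.coin n ρ i) k) *
        (X * (C.linePoly n a ρ i k (2 * j + 1) - C.linePoly n a ρ i k (2 * j))) := by
    simp only [linePoly, fold, line, C_sub]
    ring
  rw [h]
  rcases e with _ | e <;> simp [-map_sub]

end Circuit

namespace PName

open Polynomial

variable {F : Type*} [Field F] {E : Env F} {n : ℕ} {C : Circuit} {a : ℕ → F} {ρ : List F}

/-- Computes the coefficient `e` of the polynomial at position `j` of the folded table. The
polynomials are stored in rows. -/
def lineCoeff : Prog PName :=
  .fset diff 0 (.get lines (rows * (2 * j + 1) + e) - .get lines (rows * (2 * j) + e)) ;;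
  .fset lines (rows * j + e) (.get lines (rows * (2 * j) + e) + .get omega (3 * k + 1) * diff +
    (.get omega (3 * k + 2) - .get omega (3 * k + 1)) * prev) ;;
  .fset prev 0 diff

/-- Computes the polynomial for the restriction of the extension for the next layer to a line. -/
def linePolys : Prog PName :=
  (.wset count 0 (.get vars 1) ;; .wset half 0 (.get sizes 1)) ;;
  .for_ k count (.wset half 0 (half / 2) ;;
    .for_ j half (.fset prev 0 0 ;; .for_ e rows lineCoeff))

theorem row_inj {R j e j' e' : ℕ} (he : e < R) (he' : e' < R) :
    R * j + e = R * j' + e' ↔ j = j' ∧ e = e' := by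
  obtain ⟨d, rfl⟩ : ∃ d, R = d + 1 := ⟨R - 1, by omega⟩
  exact stride_inj (by omega) (by omega)

/-- The rows `2 J` and `2 J + 1` of the table `D` are combined into row `J` of the table `P`. -/
theorem ht_lineRow (hE : Explicit n C E) {R K J N : ℕ} {a b : F} {D P : ℕ → ℕ → F}
    (hJ : 2 * J + 1 < N) {h : Memory PName F} (hR : h.w rows 0 = R) (hk : h.w k 0 = K)
    (hj : h.w j 0 = J) (ha : h.f omega (3 * K + 1) = a) (hb : h.f omega (3 * K + 2) = b)
    (hold : ∀ j, J ≤ j → j < N → ∀ e < R, h.f lines (R * j + e) = D j e)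
    (hnew : ∀ e < R, P J e = D (2 * J) e + a * (D (2 * J + 1) e - D (2 * J) e) +
      (b - a) * if e = 0 then 0 else D (2 * J + 1) (e - 1) - D (2 * J) (e - 1))
    (hprev : ∀ j < J, ∀ e < R, h.f lines (R * j + e) = P j e) :
    HT E (.fset prev 0 0 ;; .for_ e rows lineCoeff) (10 + (R * (300 + 40) + 40)) (fun h' =>
      (∀ j < J + 1, ∀ e < R, h'.f lines (R * j + e) = P j e) ∧
      ∀ j, J + 1 ≤ j → j < N → ∀ e < R, h'.f lines (R * j + e) = D j e) h := by
  refine HT.seq (T := 10) (R := (· = h.setF prev 0 0))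
    (HT.block (fun _ => by simp) (Nat.le_of_ble_eq_true rfl)) ?_
  rintro _ - - rfl
  refine (HT.for_const (T := 300) R (fun u h' =>
      (∀ j e, e < R → j ≠ J → h'.f lines (R * j + e) = h.f lines (R * j + e)) ∧
      (∀ e < u, h'.f lines (R * J + e) = P J e) ∧
      (∀ e, u ≤ e → e < R → h'.f lines (R * J + e) = D J e) ∧
      h'.f prev 0 = if u = 0 then 0 else D (2 * J + 1) (u - 1) - D (2 * J) (u - 1))
      (by simpa using hR) (by decide) (by decide) (by decide) (fun k h v H => H) ?_ ?_).mono le_rfl ?_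
  · simp
    exact fun e he => hold J le_rfl (by omega) e he
  · rintro u hu h1 hf1 - he1 ⟨Q1, Q2, Q3, Q4⟩
    have e1 : h1.w rows 0 = R := by rw [hf1.w _ (by decide)]; simpa using hR
    have e2 : h1.w k 0 = K := by rw [hf1.w _ (by decide)]; simpa using hk
    have e3 : h1.w j 0 = J := by rw [hf1.w _ (by decide)]; simpa using hj
    have e4 : h1.f omega (3 * K + 1) = a := by rw [hf1.f _ (by decide)]; simpa using ha
    have e5 : h1.f omega (3 * K + 2) = b := by rw [hf1.f _ (by decide)]; simpa using hb
    have e6 : h1.f lines (R * (2 * J + 1) + u) = D (2 * J + 1) u := by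
      rw [Q1 _ _ hu (by omega), hold _ (by omega) hJ _ hu]
    -- For `J = 0` the row `2 J` is the row that is being overwritten, but its coefficient `u` is
    -- still the old one; that is why the difference for the coefficient `u - 1` is kept in
    -- `prev`.
    have e7 : h1.f lines (R * (2 * J) + u) = D (2 * J) u := by
      rcases Nat.eq_zero_or_pos J with h0 | h0
      · rw [h0] at Q3 ⊢
        exact Q3 u le_rfl hu
      · rw [Q1 _ _ hu (by omega), hold _ (by omega) (by omega) _ hu]
    have hnew' := hnew u hu
    rw [← Q4] at hnew'
    refine HT.block (fun _ => ?_) (Nat.le_of_ble_eq_true rfl)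
    simp [lineCoeff, hE.idx, e1, e2, e3, e4, e5, e6, e7, he1, ← hnew']
    refine ⟨fun j e he hne => ?_, fun e he => ?_, fun e he he' => ?_⟩
    · rw [if_neg fun hc => hne ((row_inj he hu).1 hc).1, Q1 j e he hne]
    · by_cases heu : e = u
      · simp [heu]
      · rw [if_neg heu, Q2 e (by omega)]
    · rw [if_neg (by omega), Q3 e (by omega) he']
  · rintro h1 - - ⟨Q1, Q2, -, -⟩
    refine ⟨fun j hj e he => ?_, fun j hj hj' e he => ?_⟩
    · rcases Nat.lt_succ_iff_lt_or_eq.1 hj with hj | rfl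
      · rw [Q1 j e he (by omega), hprev j hj e he]
      · exact Q2 e he
    · rw [Q1 j e he (by omega), hold j (by omega) hj' e he]

/-- The sizes of the tables halve in each step, so they sum up to the first one. -/
theorem sum_two_pow_sub (v c : ℕ) :
    ∑ k ∈ Finset.range v, 2 ^ (v - (k + 1)) * c ≤ 2 ^ v * c := by
  rw [← Finset.sum_mul]
  refine Nat.mul_le_mul_right _ ?_
  have h := Finset.sum_range_reflect (fun i => 2 ^ i) v
  have h2 : ∀ v, ∑ i ∈ Finset.range v, 2 ^ i + 1 = 2 ^ v := by
    intro v
    induction v with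
    | zero => rfl
    | succ v ih => rw [Finset.sum_range_succ, pow_succ]; omega
  have h3 : ∑ k ∈ Finset.range v, 2 ^ (v - (k + 1)) = ∑ k ∈ Finset.range v, 2 ^ (v - 1 - k) :=
    Finset.sum_congr rfl fun k _ => by rw [Nat.sub_sub, Nat.add_comm 1]
  have := h2 v
  omega

/-- Folding the table of polynomials takes time `O(w log w)` for a layer with `w` gates: its size
is halved for each variable, and the polynomials have `O(log w)` coefficients. -/
theorem ht_linePolys (hE : Explicit n C E) {m : ℕ} {h : Memory PName F} (hS : Shape n C m h)
    (ho : ∀ b < 3, ∀ l < C.blockVars n m b, h.f omega (3 * l + b) = C.block n m b (C.coin n ρ m) l)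
    (hl : ∀ j < 2 ^ C.vars n (m + 1), ∀ e < C.vars n (m + 1) + 1,
      h.f lines ((C.vars n (m + 1) + 1) * j + e) =
        (Polynomial.C (C.gateValue a (m + 1) j)).coeff e) :
    HT E linePolys (1000 * (2 ^ C.vars n (m + 1) * (C.vars n (m + 1) + 1)) + 200) (fun h' =>
      ∀ e < C.vars n (m + 1) + 1, h'.f lines e = (C.honest n a ρ m (C.arity n m)).coeff e) h := by
  set v := C.vars n (m + 1) with hv
  have hvars : h.w vars 1 = v := hS.vars 1 (by norm_num)
  have hsizes : h.w sizes 1 = 2 ^ v := hS.sizes 1 (by norm_num)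
  have htime : ∑ k ∈ Finset.range v, (20 + (2 ^ (v - (k + 1)) *
      ((10 + ((v + 1) * (300 + 40) + 40)) + 40) + 40) + 40) ≤
        900 * (2 ^ v * (v + 1)) := by
    have h1 := sum_two_pow_sub v ((10 + ((v + 1) * (300 + 40) + 40)) + 40)
    have h2 : 2 ^ v * ((10 + ((v + 1) * (300 + 40) + 40)) + 40) ≤ 2 ^ v * (430 * (v + 1)) :=
      Nat.mul_le_mul_left _ (by omega)
    have h3 : v * 1 ≤ (v + 1) * 2 ^ v := Nat.mul_le_mul (by omega) Nat.one_le_two_pow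
    simp only [Finset.sum_add_distrib, Finset.sum_const, Finset.card_range, smul_eq_mul]
    linarith
  refine (HT.seq (T := 40) (R := (· = (h.setW count 0 v).setW half 0 (2 ^ v)))
    (HT.block (fun hb => ?_) (Nat.le_of_ble_eq_true rfl)) (T' := ∑ k ∈ Finset.range v,
      (20 + (2 ^ (v - (k + 1)) * ((10 + ((v + 1) * (300 + 40) + 40)) + 40) + 40) + 40) + 40)
    ?_).time (by omega)
  · have h1 := hb vars 1
    have h2 := hb sizes 1
    rw [hvars] at h1
    rw [hsizes] at h2
    simp [hE.idx, hvars, hsizes, h1, h2]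
  rintro _ - - rfl
  refine (HT.for_ v (fun u h' => h'.w half 0 = 2 ^ (v - u) ∧ ∀ j < 2 ^ (v - u), ∀ e < v + 1,
      h'.f lines ((v + 1) * j + e) = (C.linePoly n a ρ m u j).coeff e) (by simp) (by decide)
    (by decide) (by decide) (fun k h v H => by simpa using H) ?_ ?_
    (T := fun k => 20 + (2 ^ (v - (k + 1)) *
      ((10 + ((v + 1) * (300 + 40) + 40)) + 40) + 40))).mono le_rfl ?_
  · exact ⟨by simp, hl⟩
  · rintro u hu h1 hf1 hb1 hk1 ⟨q1, q2⟩
    have hpow : 2 ^ (v - u) = 2 ^ (v - (u + 1)) * 2 := by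
      rw [← pow_succ]
      congr 1
      omega
    have S1 : Shape n C m h1 := (hS.congr (by intro x hx; funext k; revert x; simp)).frame hf1
      (by decide)
    have o1 : ∀ b < 3, ∀ l < C.blockVars n m b,
        h1.f omega (3 * l + b) = C.block n m b (C.coin n ρ m) l := by
      rw [hf1.f _ (by decide)]
      simpa using ho
    refine HT.seq (T := 20) (R := (· = h1.setW half 0 (2 ^ (v - (u + 1)))))
      (HT.block (fun hb => ?_) (Nat.le_of_ble_eq_true rfl)) ?_
    · have h2 := hb half 0
      simp [q1, hpow]
      omega
    rintro _ - - rfl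
    refine (HT.for_const (T := 10 + ((v + 1) * (300 + 40) + 40)) (2 ^ (v - (u + 1))) (fun J h' =>
      (∀ j < J, ∀ e < v + 1, h'.f lines ((v + 1) * j + e) =
        (C.linePoly n a ρ m (u + 1) j).coeff e) ∧
      ∀ j, J ≤ j → j < 2 ^ (v - u) → ∀ e < v + 1, h'.f lines ((v + 1) * j + e) =
        (C.linePoly n a ρ m u j).coeff e) (by simp) (by decide) (by decide) (by decide)
      (fun k h v H => by simpa using H) ?_ ?_).mono le_rfl ?_
    · exact ⟨fun j hj => absurd hj (Nat.not_lt_zero _), fun j _ hj e he => q2 j hj e he⟩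
    · rintro J hJ h2 hf2 - hj2 ⟨Q1, Q2⟩
      have S2 : Shape n C m h2 := (S1.congr (by intro x hx; funext k; revert x; simp)).frame hf2
        (by decide)
      have k2 : h2.w k 0 = u := by
        rw [hf2.w _ (by decide)]
        simpa using hk1
      have o2 : ∀ b < 3, ∀ l < C.blockVars n m b,
          h2.f omega (3 * l + b) = C.block n m b (C.coin n ρ m) l := by
        rw [hf2.f _ (by decide)]
        simpa using o1
      exact ht_lineRow hE (D := fun j e => (C.linePoly n a ρ m u j).coeff e)
        (P := fun j e => (C.linePoly n a ρ m (u + 1) j).coeff e) (by omega) S2.rows k2 hj2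
        (o2 1 (by norm_num) u hu) (o2 2 (by norm_num) u hu) Q2
        (fun e _ => Circuit.coeff_linePoly_succ a ρ m u J e) Q1
    · rintro h2 hf2 - ⟨Q1, -⟩
      refine ⟨?_, Q1⟩
      rw [hf2.w _ (by decide)]
      simp
  · rintro h1 - - ⟨-, q2⟩ e he
    rw [Circuit.honest_arity, ← q2 0 (by positivity) e he]
    simp

/-! ### The prover: the reduction of a layer to the next one -/

/-- Determines the shape of the current and the next layer. -/
def findShape : Prog PName :=
  (.wset next 0 (i + 1) ;; .wset width 0 (.query 1 i 0) ;; .wset three 0 3) ;;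
  .clog count exp width ;;
  (.wset vars 0 count ;; .wset sizes 0 exp) ;;
  .clog count exp (.query 1 next 0) ;;
  .wset vars 1 count ;; .wset vars 2 count ;; .wset sizes 1 exp ;; .wset sizes 2 exp ;;
  .wset rows 0 (count + 1)

theorem ht_findShape (hC : C.WellFormed n) (hE : Explicit n C E) {m : ℕ} (hm : m < C.depth)
    {h : Memory PName F} (hi : h.w i 0 = m) :
    HT E findShape (100 * (C.vars n m + C.vars n (m + 1)) + 500) (Shape n C m) h := by
  have hB := hE.bound
  have hd := hC.depth_lt_size
  have w0 := Circuit.width_le_size (n := n) hm.le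
  have w1 := Circuit.width_le_size (n := n) (show m + 1 ≤ C.depth from hm)
  have hv0 := hC.vars_le hm.le
  have hv1 := hC.vars_le (show m + 1 ≤ C.depth from hm)
  refine (HT.seq (T := 50) (R := (· = ((h.setW next 0 (m + 1)).setW width 0 (C.width n m)).setW
    three 0 3)) (HT.block (fun hb => ?_) (Nat.le_of_ble_eq_true rfl)) (T' :=
      (C.vars n m + 1) * (20 + 40) + (40 + ((C.vars n (m + 1) + 1) * (20 + 40) + 100))) ?_).time
      (by omega)
  · simp [hi, hE.table, Circuit.table_one]
    omega
  rintro _ - - rfl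
  refine HT.seq (HT.clog (w := C.width n m) (by decide) (fun h' hf => ?_)
    (Nat.le_of_ble_eq_true rfl) (by omega)) ?_
  · have := hf.w width (by decide)
    simp [this]
  rintro h1 hf1 - ⟨c1, x1⟩
  have i1 : h1.w i 0 = m := by rw [hf1.w _ (by decide)]; simpa using hi
  have n1 : h1.w next 0 = m + 1 := by rw [hf1.w _ (by decide)]; simp
  have wd1 : h1.w width 0 = C.width n m := by rw [hf1.w _ (by decide)]; simp
  have th1 : h1.w three 0 = 3 := by rw [hf1.w _ (by decide)]; simp
  refine HT.seq (T := 40) (R := (· = (h1.setW vars 0 (C.vars n m)).setW sizes 0 (2 ^ C.vars n m)))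
    (HT.block (fun hb => ?_) (Nat.le_of_ble_eq_true rfl)) ?_
  · have b1 := hb count 0
    have b2 := hb exp 0
    rw [c1] at b1
    rw [x1] at b2
    simp [c1, x1, b1, b2, Circuit.vars]
  rintro _ - - rfl
  refine HT.seq (HT.clog (w := C.width n (m + 1)) (by decide) (fun h' hf => ?_)
    (Nat.le_of_ble_eq_true rfl) (by omega)) ?_
  · have := hf.w next (by decide)
    simp [this, n1, hE.table, Circuit.table_one]
  rintro h2 hf2 - ⟨c2, x2⟩
  have i2 : h2.w i 0 = m := by rw [hf2.w _ (by decide)]; simpa using i1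
  have n2 : h2.w next 0 = m + 1 := by rw [hf2.w _ (by decide)]; simpa using n1
  have wd2 : h2.w width 0 = C.width n m := by rw [hf2.w _ (by decide)]; simpa using wd1
  have th2 : h2.w three 0 = 3 := by rw [hf2.w _ (by decide)]; simpa using th1
  have v2 : h2.w vars 0 = C.vars n m := by rw [hf2.w _ (by decide)]; simp
  have s2 : h2.w sizes 0 = 2 ^ C.vars n m := by rw [hf2.w _ (by decide)]; simp
  change h2.w count 0 = C.vars n (m + 1) at c2
  change h2.w exp 0 = 2 ^ C.vars n (m + 1) at x2
  refine HT.block (fun hb => ?_) (Nat.le_of_ble_eq_true rfl)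
  have b1 := hb count 0
  have b2 := hb exp 0
  rw [c2] at b1
  rw [x2] at b2
  have b3 : C.vars n (m + 1) < 2 ^ C.vars n (m + 1) := Nat.lt_two_pow_self
  simp [hE.idx, c2, x2, b1, b2]
  refine ⟨by omega, ?_⟩
  constructor
  · simpa using i2
  · simpa using n2
  · simpa using wd2
  · simpa using th2
  · simp
  · intro b hb
    interval_cases b <;> simp [v2, Circuit.blockVars]
  · intro b hb
    interval_cases b <;> simp [s2, Circuit.blockVars]

end PName


/-! ### The prover: the tables for a layer -/

namespace PName

open Polynomial

variable {F : Type*} [Field F] {E : Env F} {n : ℕ} {C : Circuit} {a : ℕ → F} {ρ : List F}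

/-- Computes the table of the equality predicate, by doubling its size for each of the coordinates
of the point `z`. -/
def equalityTable : Prog PName :=
  (.fset table 0 1 ;; .wset exp 0 1 ;; .wset count 0 (.get vars 0)) ;;
  .for_ k count (.for_ j exp (.fset table (3 * (exp + j)) (.get table (3 * j) * .get z k) ;;
    .fset table (3 * j) (.get table (3 * j) * (1 - .get z k))) ;; .wset exp 0 (exp * 2))

/-- Copies the values of the gates of the next layer to the tables that are folded. -/
def copyValues : Prog PName :=
  .wset count 0 (.get sizes 1) ;;
  .for_ j count (.for_ e rows (.fset lines (rows * j + e) 0) ;;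
    .fset table (3 * j + 1) (.get val (stride * j + next)) ;;
    .fset table (3 * j + 2) (.get val (stride * j + next)) ;;
    .fset lines (rows * j) (.get val (stride * j + next)))

/-- Initializes the weights of the gates and their labels: for gate `g` those of the gate itself and
of its two in-neighbours. -/
def startLabels : Prog PName :=
  .for_ g width (.wset labels (3 * g) g ;; .wset labels (3 * g + 1) (.query 3 i g) ;;
    .wset labels (3 * g + 2) (.query 4 i g) ;; .fset weights g 1)

theorem ht_equalityTable (hE : Explicit n C E) {m : ℕ} {h : Memory PName F} (hS : Shape n C m h)
    {x : ℕ → F} (hz : ∀ k < C.vars n m, h.f z k = x k) :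
    HT E equalityTable (40 + (C.vars n m * ((2 ^ C.vars n m * (150 + 40) + 40) + 30 + 40) + 40))
      (fun h' => ∀ j < 2 ^ C.vars n m, h'.f table (3 * j) = chi (C.vars n m) j x) h := by
  have hvars : h.w vars 0 = C.vars n m := hS.vars 0 (by norm_num)
  have hsizes : h.w sizes 0 = 2 ^ C.vars n m := hS.sizes 0 (by norm_num)
  generalize C.vars n m = v at hz hvars hsizes ⊢
  refine HT.seq (T := 40) (R := (· = ((h.setF table 0 1).setW exp 0 1).setW count 0 v))
    (HT.block (fun hb => ?_) (Nat.le_of_ble_eq_true rfl)) ?_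
  · have h1 := hb vars 0
    have h2 := hb sizes 0
    have h3 : 1 ≤ 2 ^ v := Nat.one_le_two_pow
    rw [hvars] at h1
    rw [hsizes] at h2
    simp [hE.idx, hvars, h1]
    exact h3.trans h2
  rintro _ - - rfl
  refine (HT.for_const v (fun u h' => h'.w exp 0 = 2 ^ u ∧
      ∀ j < 2 ^ u, h'.f table (3 * j) = chi u j x) (by simp) (by decide) (by decide) (by decide)
      (fun k h v H => by simpa using H) (by simp [chi_zero]) ?_).mono le_rfl (fun _ _ _ H => H.2)
  rintro u hu h1 hf1 - hk1 ⟨q1, q2⟩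
  have hle : 2 ^ u ≤ 2 ^ v := Nat.pow_le_pow_right (by norm_num) hu.le
  have hle' : 2 ^ u * 2 ≤ 2 ^ v := by
    rw [← pow_succ]
    exact Nat.pow_le_pow_right (by norm_num) hu
  have z1 : h1.f z u = x u := by
    rw [hf1.f _ (by decide)]
    simpa using hz u hu
  have s1 : h1.w sizes 0 = 2 ^ v := by
    rw [hf1.w _ (by decide)]
    simpa using hsizes
  refine HT.seq (T := 2 ^ v * (150 + 40) + 40) (T' := 30) ((HT.for_const (T := 150) (2 ^ u) (fun J h' =>
      (∀ j < J, h'.f table (3 * j) = chi (u + 1) j x ∧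
        h'.f table (3 * (2 ^ u + j)) = chi (u + 1) (2 ^ u + j) x) ∧
      ∀ j, J ≤ j → j < 2 ^ u → h'.f table (3 * j) = chi u j x) q1 (by decide) (by decide)
      (by decide) (fun k h v H => H) ?_ ?_).time
      (Nat.add_le_add_right (Nat.mul_le_mul_right _ hle) _)) ?_
  · exact ⟨fun j hj => absurd hj (Nat.not_lt_zero _), fun j _ hj => q2 j hj⟩
  · rintro J hJ h2 hf2 - hj2 ⟨Q1, Q2⟩
    have e1 : h2.w exp 0 = 2 ^ u := by rw [hf2.w _ (by decide), q1]
    have e2 : h2.w k 0 = u := by rw [hf2.w _ (by decide), hk1]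
    have e3 : h2.f z u = x u := by rw [hf2.f _ (by decide), z1]
    have e4 := Q2 J le_rfl hJ
    have e5 : ¬ (J = 2 ^ u + J) := by omega
    refine HT.block (fun _ => ?_) (Nat.le_of_ble_eq_true rfl)
    simp [hE.idx, e1, e2, e3, e4, hj2]
    refine ⟨fun j hj => ⟨?_, ?_⟩, fun j hj hj' => ?_⟩
    · by_cases hjJ : j = J
      · rw [if_pos hjJ, hjJ, chi_succ_of_lt hJ]
      · rw [if_neg hjJ, if_neg (by omega), (Q1 j (by omega)).1]
    · rw [if_neg (by omega)]
      by_cases hjJ : j = J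
      · rw [if_pos hjJ, hjJ, chi_succ_two_pow_add hJ]
      · rw [if_neg hjJ, (Q1 j (by omega)).2]
    · rw [if_neg (by omega), if_neg (by omega), Q2 j (by omega) hj']
  rintro h2 hf2 - ⟨Q1, -⟩
  have e1 : h2.w exp 0 = 2 ^ u := by rw [hf2.w _ (by decide), q1]
  have e2 : h2.w sizes 0 = 2 ^ v := by rw [hf2.w _ (by decide), s1]
  refine HT.block (fun hb => ?_) (Nat.le_of_ble_eq_true rfl)
  have hb1 := hb sizes 0
  simp [e1, pow_succ]
  refine ⟨by omega, fun j hj => ?_⟩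
  rcases Nat.lt_or_ge j (2 ^ u) with hj' | hj'
  · exact (Q1 j hj').1
  · obtain ⟨l, rfl⟩ := Nat.exists_eq_add_of_le hj'
    exact (Q1 l (by omega)).2

theorem ht_copyValues (hE : Explicit n C E) {m : ℕ} {h : Memory PName F} (hS : Shape n C m h)
    (hst : h.w stride 0 = C.depth + 1) {V : ℕ → F}
    (hv : ∀ j, h.f val ((C.depth + 1) * j + (m + 1)) = V j) :
    HT E copyValues (20 + (2 ^ C.vars n (m + 1) *
      ((((C.vars n (m + 1) + 1) * (50 + 40) + 40) + 200) + 40) + 40)) (fun h' =>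
      (∀ j, h'.f table (3 * j) = h.f table (3 * j)) ∧ ∀ j < 2 ^ C.vars n (m + 1),
        (h'.f table (3 * j + 1) = V j ∧ h'.f table (3 * j + 2) = V j) ∧
        ∀ e < C.vars n (m + 1) + 1, h'.f lines ((C.vars n (m + 1) + 1) * j + e) =
          (Polynomial.C (V j)).coeff e) h := by
  set v := C.vars n (m + 1) with hvdef
  have hsizes : h.w sizes 1 = 2 ^ v := hS.sizes 1 (by norm_num)
  refine HT.seq (T := 20) (R := (· = h.setW count 0 (2 ^ v)))
    (HT.block (fun hb => ?_) (Nat.le_of_ble_eq_true rfl)) ?_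
  · have h1 := hb sizes 1
    rw [hsizes] at h1
    simp [hE.idx, hsizes, h1]
  rintro _ - - rfl
  refine (HT.for_const (T := ((v + 1) * (50 + 40) + 40) + 200) (2 ^ v) (fun J h' =>
      (∀ j, h'.f table (3 * j) = h.f table (3 * j)) ∧ ∀ j < J,
        (h'.f table (3 * j + 1) = V j ∧ h'.f table (3 * j + 2) = V j) ∧
        ∀ e < v + 1, h'.f lines ((v + 1) * j + e) = (Polynomial.C (V j)).coeff e) (by simp)
      (by decide) (by decide) (by decide) (fun k h v H => H) (by simp) ?_).mono le_rfl
      (fun _ _ _ H => H)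
  rintro J hJ h1 hf1 - hj1 ⟨Q1, Q2⟩
  have S1 : Shape n C m h1 := (hS.congr (by intro x hx; funext k; revert x; simp)).frame hf1
    (by decide)
  have st1 : h1.w stride 0 = C.depth + 1 := by
    rw [hf1.w _ (by decide)]
    simpa using hst
  refine HT.seq (HT.for_const (T := 50) (v + 1) (fun u h' =>
      (∀ j < J, ∀ e < v + 1, h'.f lines ((v + 1) * j + e) = (Polynomial.C (V j)).coeff e) ∧
      ∀ e < u, h'.f lines ((v + 1) * J + e) = 0) S1.rows (by decide) (by decide) (by decide)
      (fun k h v H => H) ⟨fun j hj e he => (Q2 j hj).2 e he,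
        fun e he => absurd he (Nat.not_lt_zero _)⟩ ?_) ?_
  · rintro u hu h2 hf2 - he2 ⟨R1, R2⟩
    have e1 : h2.w rows 0 = v + 1 := by rw [hf2.w _ (by decide), S1.rows]
    have e2 : h2.w j 0 = J := by rw [hf2.w _ (by decide), hj1]
    refine HT.block (fun _ => ?_) (Nat.le_of_ble_eq_true rfl)
    simp only [Prog.wp, WE.val, WE.val_add, WE.val_mul, WOp.apply, e1, e2, he2, WE.val_ofNat, FE.val_zero,
      Memory.setF_f, WE.ok_add, WE.ok_mul, WE.Ok, WE.ok_ofNat, hE.idx, true_and, and_true,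
      FE.ok_zero]
    refine ⟨fun j hj e he => ?_, fun e he => ?_⟩
    · rw [if_neg fun hc => absurd ((row_inj he hu).1 hc).1 (by omega), R1 j hj e he]
    · split
      · rfl
      · next hne => exact R2 e (by
          by_contra hcon
          exact hne (by rw [show e = u by omega]))
  rintro h2 hf2 - ⟨R1, R2⟩
  have S2 : Shape n C m h2 := S1.frame hf2 (by decide)
  have e2 : h2.w j 0 = J := by rw [hf2.w _ (by decide), hj1]
  have e3 : h2.w stride 0 = C.depth + 1 := by rw [hf2.w _ (by decide), st1]
  have e4 : h2.f val ((C.depth + 1) * J + (m + 1)) = V J := by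
    rw [hf2.f _ (by decide), hf1.f _ (by decide)]
    exact hv J
  have e5 : h2.f table = h1.f table := hf2.f _ (by decide)
  have e6 : h2.w rows 0 = v + 1 := S2.rows
  refine HT.block (fun _ => ?_) (Nat.le_of_ble_eq_true rfl)
  simp [hE.idx, e2, e3, e4, e5, e6, S2.next]
  refine ⟨fun j => ?_, fun j hj => ⟨⟨?_, ?_⟩, fun e he => ?_⟩⟩
  · rw [if_neg (by omega), if_neg (by omega), Q1]
  · rw [if_neg (by omega)]
    by_cases hjJ : j = J
    · simp [hjJ]
    · rw [if_neg (by omega), (Q2 j (by omega)).1.1]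
  · by_cases hjJ : j = J
    · simp [hjJ]
    · rw [if_neg hjJ, if_neg (by omega), (Q2 j (by omega)).1.2]
  · have hrow : (v + 1) * j + e = (v + 1) * J ↔ j = J ∧ e = 0 :=
      row_inj (show e < v + 1 by omega) (Nat.succ_pos v)
    rw [if_congr hrow rfl rfl]
    by_cases hjJ : j = J
    · subst hjJ
      by_cases he0 : e = 0
      · simp [he0]
      · simp [he0, R2 e (by omega), coeff_C]
    · rw [if_neg fun hc => hjJ hc.1, R1 j (by omega) e (by omega)]

theorem ht_startLabels (hE : Explicit n C E) {m : ℕ} (hm : m < C.depth)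
    {h : Memory PName F} (hS : Shape n C m h) :
    HT E startLabels (C.width n m * (300 + 40) + 40) (fun h' => ∀ g < C.width n m,
      (∀ b < 3, h'.w labels (3 * g + b) = C.lab n m b g) ∧ h'.f weights g = 1) h := by
  have hB := hE.bound
  have hw := Circuit.width_le_size (n := n) hm.le
  have hw' := Circuit.width_le_size (n := n) (show m + 1 ≤ C.depth from hm)
  refine HT.for_const (C.width n m) (fun u h' => ∀ g < u,
      (∀ b < 3, h'.w labels (3 * g + b) = C.lab n m b g) ∧ h'.f weights g = 1) hS.width
      (by decide) (by decide) (by decide) (fun k h v H => by simpa using H)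
      (fun g hg => absurd hg (Nat.not_lt_zero _)) ?_
  rintro u hu h1 hf1 - hg1 Q
  have S1 : h1.w i 0 = m := by rw [hf1.w _ (by decide), hS.i]
  have t3 := E.table_le 3 m u
  have t4 := E.table_le 4 m u
  rw [hE.table] at t3 t4
  refine HT.block (fun _ => ?_) (Nat.le_of_ble_eq_true rfl)
  simp [hE.idx, S1, hg1, hE.table, t3, t4]
  refine ⟨by omega, fun g hg => ?_⟩
  by_cases hgu : g = u
  · subst hgu
    refine ⟨fun b hb => ?_, by simp⟩
    interval_cases b <;> simp [Circuit.lab]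
  · refine ⟨fun b hb => ?_, by simpa [hgu] using (Q g (by omega)).2⟩
    rw [if_neg (by omega), if_neg (by omega), if_neg (by omega), (Q g (by omega)).1 b hb]

end PName


/-! ### The prover: the complete program -/

namespace Circuit

variable {n : ℕ} {C : Circuit}

theorem sum_blockVars {i s : ℕ} (hs : s < 3) :
    ∑ b ∈ Finset.range s, C.blockVars n i b = C.blockStart n i s := by
  interval_cases s <;> simp [Finset.sum_range_succ, blockVars, blockStart]

theorem sum_blockVars_three (i : ℕ) :
    ∑ b ∈ Finset.range 3, C.blockVars n i b = C.arity n i := by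
  simp [Finset.sum_range_succ, blockVars, arity]
  omega

theorem bound_zero (i b : ℕ) : C.bound n i 0 b = 0 := by simp [bound]

theorem bound_arity (i : ℕ) {b : ℕ} (hb : b < 3) :
    C.bound n i (C.arity n i) b = C.blockVars n i b := by
  have := blockStart_add_blockVars_le (n := n) (C := C) i hb
  rw [bound]
  omega

end Circuit

namespace PName

open Polynomial

variable {F : Type*} [Field F] {E : Env F} {n : ℕ} {C : Circuit} {a : ℕ → F} {ρ : List F}

/-- The sum-check protocol. -/
def sumcheck : Prog PName :=
  .for_ s three ((.wset count 0 (.get vars s) ;; .wset half 0 (.get sizes s)) ;;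
    .for_ k count round)

/-- Sends the polynomial for the line and computes the next point `z`. -/
def sendLine : Prog PName :=
  .for_ e rows (.send (.get lines e)) ;; (.recv r ;; .wset count 0 (.get vars 1)) ;;
  .for_ k count (.fset z k ((1 - r) * .get omega (3 * k + 1) + r * .get omega (3 * k + 2)))

/-- A bound on the time of the sum-check protocol for layer `i`. -/
def sumcheckTime (n : ℕ) (C : Circuit) (i : ℕ) : ℕ :=
  ∑ t ∈ Finset.range 3, ((60 + (C.blockVars n i t *
    ((1300 * C.width n i + 200 * 2 ^ C.blockVars n i t + 500) + 40) + 40)) + 40) + 40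

theorem ht_sumcheck (hC : C.WellFormed n) (hE : Explicit n C E)
    (hA : E.answer = Circuit.script
      ((C.transcript n ρ (C.output a) (C.honest n a ρ)).map Event.dual))
    {m : ℕ} (hm : m < C.depth) {h : Memory PName F} (hS : Shape n C m h)
    (H : Bound n C a ρ m 0 h)
    (htr : h.trace = (C.prefixTrace n ρ (C.output a) (C.honest n a ρ) m 0).map Event.dual) :
    HT E sumcheck (sumcheckTime n C m) (fun h' => Bound n C a ρ m (C.arity n m) h' ∧
      h'.trace = (C.prefixTrace n ρ (C.output a) (C.honest n a ρ) m (C.arity n m)).map Event.dual)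
      h := by
  rw [← Circuit.sum_blockVars_three]
  refine HT.for_ 3 (fun t h' =>
    Bound n C a ρ m (∑ b ∈ Finset.range t, C.blockVars n m b) h' ∧
      h'.trace = (C.prefixTrace n ρ (C.output a) (C.honest n a ρ) m
        (∑ b ∈ Finset.range t, C.blockVars n m b)).map Event.dual) hS.three (by decide)
    (by decide) (by decide) ?_ ⟨H, htr⟩ ?_
  · rintro t h v ⟨q1, q2⟩
    exact ⟨q1.congr (by funext k; simp) fun _ _ => rfl, q2⟩
  rintro t ht h1 hf1 - hs1 ⟨H1, t1⟩
  rw [Finset.sum_range_succ]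
  rw [Circuit.sum_blockVars ht] at H1 t1 ⊢
  have S1 : Shape n C m h1 := hS.frame hf1 (by decide)
  refine HT.seq (T := 60) (R := (· = (h1.setW count 0 (C.blockVars n m t)).setW half 0
    (2 ^ C.blockVars n m t))) (HT.block (fun hb => ?_) (Nat.le_of_ble_eq_true rfl)) ?_
  · have b1 := hb vars t
    have b2 := hb sizes t
    rw [S1.vars t ht] at b1
    rw [S1.sizes t ht] at b2
    simp [hE.idx, hs1, S1.vars t ht, S1.sizes t ht, b1, b2]
  rintro _ - - rfl
  refine (HT.for_const (C.blockVars n m t) (fun v h' =>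
    h'.w half 0 = 2 ^ (C.blockVars n m t - v) ∧ Bound n C a ρ m (C.blockStart n m t + v) h' ∧
      h'.trace = (C.prefixTrace n ρ (C.output a) (C.honest n a ρ) m
        (C.blockStart n m t + v)).map Event.dual) ?_ (by decide) (by decide) (by decide) ?_ ?_
      ?_).mono le_rfl (fun _ _ _ H => H.2)
  · simp
  · rintro t h v ⟨q0, q1, q2⟩
    exact ⟨by simpa using q0, q1.congr (by funext k; simp) fun _ _ => rfl, q2⟩
  · exact ⟨by simp, H1.congr (by funext k; simp) fun _ _ => rfl, t1⟩
  · rintro v hv h2 hf2 - hk2 ⟨q0, q1, q2⟩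
    refine ht_round hC hE hA hm ht hv ?_ ?_ hk2 q0 q1 q2
    · exact (S1.congr (by intro x hx; funext k; revert x; simp)).frame hf2 (by decide)
    · rw [hf2.w _ (by decide)]
      simpa using hs1

theorem ht_sendLine (hE : Explicit n C E)
    (hA : E.answer = Circuit.script
      ((C.transcript n ρ (C.output a) (C.honest n a ρ)).map Event.dual))
    {m : ℕ} (hm : m < C.depth) {h : Memory PName F} (hS : Shape n C m h)
    (ho : ∀ b < 3, ∀ l < C.blockVars n m b, h.f omega (3 * l + b) = C.block n m b (C.coin n ρ m) l)
    (hl : ∀ e < C.vars n (m + 1) + 1, h.f lines e = (C.honest n a ρ m (C.arity n m)).coeff e)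
    (htr : h.trace =
      (C.prefixTrace n ρ (C.output a) (C.honest n a ρ) m (C.arity n m)).map Event.dual) :
    HT E sendLine (((C.vars n (m + 1) + 1) * (20 + 40) + 40) + (40 +
      (C.vars n (m + 1) * (100 + 40) + 40))) (fun h' =>
      (∀ k < C.vars n (m + 1), h'.f z k = C.point n ρ (m + 1) k) ∧
      h'.trace = (C.prefixTrace n ρ (C.output a) (C.honest n a ρ) (m + 1) 0).map Event.dual) h := by
  have hdeg : C.msgDegree n m (C.arity n m) = C.vars n (m + 1) := if_neg (lt_irrefl _)
  have hscript := Circuit.script_dual (n := n) ρ (C.output a) (C.honest n a ρ) hm le_rfl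
  have hevents : (C.prefixTrace n ρ (C.output a) (C.honest n a ρ) (m + 1) 0).map Event.dual =
      (C.prefixTrace n ρ (C.output a) (C.honest n a ρ) m (C.arity n m)).map Event.dual ++
        (List.range (C.vars n (m + 1) + 1)).map
          (fun e => .sent ((C.honest n a ρ m (C.arity n m)).coeff e)) ++
        [.received (C.coin n ρ m (C.arity n m))] := by
    rw [Circuit.prefixTrace_layer, Circuit.prefixTrace_succ, Circuit.roundEvents, hdeg]
    simp [Event.dual, Function.comp_def]
  rw [hdeg] at hscript
  refine HT.seq (HT.for_const (T := 20) (C.vars n (m + 1) + 1) (fun u h' => h'.trace =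
    (C.prefixTrace n ρ (C.output a) (C.honest n a ρ) m (C.arity n m)).map Event.dual ++
      (List.range u).map fun e => Event.sent ((C.honest n a ρ m (C.arity n m)).coeff e)) hS.rows
    (by decide) (by decide) (by decide) (fun k h v H => H) (by simpa using htr) ?_) ?_
  · rintro u hu h1 hf1 - he1 Q
    have e1 : h1.f lines u = (C.honest n a ρ m (C.arity n m)).coeff u := by
      rw [hf1.f _ (by decide), hl u hu]
    refine HT.block (fun _ => ?_) (Nat.le_of_ble_eq_true rfl)
    simp [hE.idx, he1, e1, Q, List.range_succ]
  rintro h1 hf1 - Q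
  have S1 := hS.frame hf1 (by decide)
  have o1 : h1.f omega = h.f omega := hf1.f _ (by decide)
  refine HT.seq (T := 40) (R := fun h' => h'.w count 0 = C.vars n (m + 1) ∧
    h'.f r 0 = C.coin n ρ m (C.arity n m) ∧ h'.f omega = h.f omega ∧
    h'.trace = (C.prefixTrace n ρ (C.output a) (C.honest n a ρ) (m + 1) 0).map Event.dual)
    (HT.block (fun hb => ?_) (Nat.le_of_ble_eq_true rfl)) ?_
  · have b1 := hb vars 1
    have v1 : h1.w vars 1 = C.vars n (m + 1) := S1.vars 1 (by norm_num)
    rw [v1] at b1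
    simp only [Prog.wp, Q, hA, hscript]
    simp [hE.idx, v1, b1, hevents]
    funext k
    simp [o1]
  rintro h2 - - ⟨c2, r2, o2, t2⟩
  refine (HT.for_const (T := 100) (C.vars n (m + 1)) (fun u h' =>
    ∀ k < u, h'.f z k = C.point n ρ (m + 1) k) c2 (by decide) (by decide) (by decide)
    (fun k h v H => H) (fun k hk => absurd hk (Nat.not_lt_zero _)) ?_).mono le_rfl ?_
  · rintro u hu h3 hf3 - hk3 Q3
    have e1 : h3.f r 0 = C.coin n ρ m (C.arity n m) := by rw [hf3.f _ (by decide), r2]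
    have e2 : h3.f omega (3 * u + 1) = C.omega₁ n m (C.coin n ρ m) u := by
      rw [hf3.f _ (by decide), o2, ho 1 (by norm_num) u hu, Circuit.block_one]
    have e3 : h3.f omega (3 * u + 2) = C.omega₂ n m (C.coin n ρ m) u := by
      rw [hf3.f _ (by decide), o2, ho 2 (by norm_num) u hu, Circuit.block_two]
    refine HT.block (fun _ => ?_) (Nat.le_of_ble_eq_true rfl)
    simp [hE.idx, hk3, e1, e2, e3]
    intro k hk
    by_cases hku : k = u
    · simp [hku, Circuit.point]
    · rw [if_neg hku, Q3 k (by omega)]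
  · intro h3 hf3 _ Q3
    exact ⟨Q3, (hf3.trace rfl).trans t2⟩

/-- The messages for one layer. -/
def reduceLayer : Prog PName :=
  findShape ;; equalityTable ;; copyValues ;; startLabels ;; sumcheck ;; linePolys ;; sendLine

/-- The program of the honest prover. -/
def prove : Prog PName :=
  readInput ;; evaluate ;; .send (.get val 0) ;; .for_ i depth reduceLayer

/-- A bound on the time of the prover for layer `i`. -/
def layerTime (n : ℕ) (C : Circuit) (i : ℕ) : ℕ :=
  (100 * (C.vars n i + C.vars n (i + 1)) + 500) +
  ((40 + (C.vars n i * ((2 ^ C.vars n i * (150 + 40) + 40) + 30 + 40) + 40)) +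
  ((20 + (2 ^ C.vars n (i + 1) *
      ((((C.vars n (i + 1) + 1) * (50 + 40) + 40) + 200) + 40) + 40)) +
  ((C.width n i * (300 + 40) + 40) + (sumcheckTime n C i +
  ((1000 * (2 ^ C.vars n (i + 1) * (C.vars n (i + 1) + 1)) + 200) +
  (((C.vars n (i + 1) + 1) * (20 + 40) + 40) + (40 + (C.vars n (i + 1) * (100 + 40) + 40))))))))

/-- The protocol has been carried out for the layers before layer `m`. -/
structure Reduced (n : ℕ) (C : Circuit) (a : ℕ → F) (ρ : List F) (m : ℕ) (h : Memory PName F) :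
    Prop where
  stride : h.w stride 0 = C.depth + 1
  val : ∀ j, ∀ l ≤ C.depth, h.f val ((C.depth + 1) * j + l) = C.gateValue a l j
  z : ∀ k < C.vars n m, h.f z k = C.point n ρ m k
  trace : h.trace = (C.prefixTrace n ρ (C.output a) (C.honest n a ρ) m 0).map Event.dual

theorem ht_reduceLayer (hC : C.WellFormed n) (hE : Explicit n C E)
    (hA : E.answer = Circuit.script
      ((C.transcript n ρ (C.output a) (C.honest n a ρ)).map Event.dual))
    {m : ℕ} (hm : m < C.depth) {h : Memory PName F} (hi : h.w i 0 = m)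
    (H : Reduced n C a ρ m h) :
    HT E reduceLayer (layerTime n C m) (Reduced n C a ρ (m + 1)) h := by
  refine HT.seq (ht_findShape hC hE hm hi) ?_
  rintro h1 hf1 - S1
  refine HT.seq (ht_equalityTable hE S1 (x := C.point n ρ m) ?_) ?_
  · rw [hf1.f _ (by decide)]
    exact H.z
  rintro h2 hf2 - q2
  have S2 := S1.frame hf2 (by decide)
  have hval : ∀ h' : Memory PName F, h'.f .val = h.f .val →
      ∀ j, h'.f .val ((C.depth + 1) * j + (m + 1)) = C.gateValue a (m + 1) j := fun h' e j => by
    rw [e, H.val j (m + 1) hm]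
  refine HT.seq (ht_copyValues hE S2 (V := C.gateValue a (m + 1)) ?_ ?_) ?_
  · rw [hf2.w _ (by decide), hf1.w _ (by decide), H.stride]
  · exact hval h2 (by rw [hf2.f _ (by decide), hf1.f _ (by decide)])
  rintro h3 hf3 - ⟨q3, q3'⟩
  have S3 := S2.frame hf3 (by decide)
  refine HT.seq (ht_startLabels hE hm S3) ?_
  rintro h4 hf4 - q4
  have S4 := S3.frame hf4 (by decide)
  have T4 : h4.f table = h3.f table := hf4.f _ (by decide)
  have B4 : Bound n C a ρ m 0 h4 := by
    refine ⟨fun b hb j hj => ?_, fun b hb g hg => ?_, fun g hg => ?_, fun b hb l hl => ?_⟩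
    · rw [Circuit.bound_zero] at hj ⊢
      rw [T4, fold]
      interval_cases b
      · exact (q3 j).trans (q2 j hj)
      · exact (q3' j hj).1.1
      · exact (q3' j hj).1.2
    · rw [(q4 g hg).1 b hb, Circuit.bound_zero, pow_zero, Nat.div_one]
    · rw [(q4 g hg).2, chi_zero]
    · rw [Circuit.bound_zero] at hl
      exact absurd hl (Nat.not_lt_zero _)
  refine HT.seq (ht_sumcheck hC hE hA hm S4 B4 ?_) ?_
  · rw [hf4.trace rfl, hf3.trace rfl, hf2.trace rfl, hf1.trace rfl, H.trace]
  rintro h5 hf5 - ⟨B5, t5⟩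
  have S5 := S4.frame hf5 (by decide)
  have o5 : ∀ b < 3, ∀ l < C.blockVars n m b,
      h5.f omega (3 * l + b) = C.block n m b (C.coin n ρ m) l := fun b hb l hl =>
    B5.omega b hb l (by rwa [Circuit.bound_arity m hb])
  refine HT.seq (ht_linePolys (a := a) hE S5 o5 ?_) ?_
  · rw [hf5.f _ (by decide), hf4.f _ (by decide)]
    exact fun j hj => (q3' j hj).2
  rintro h6 hf6 - q6
  have S6 := S5.frame hf6 (by decide)
  refine (ht_sendLine hE hA hm S6 ?_ q6 ?_).mono le_rfl ?_
  · rw [hf6.f _ (by decide)]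
    exact o5
  · rw [hf6.trace rfl, t5]
  rintro h7 hf7 - ⟨z7, t7⟩
  refine ⟨?_, ?_, z7, t7⟩
  · rw [hf7.w _ (by decide), hf6.w _ (by decide), hf5.w _ (by decide), hf4.w _ (by decide),
      hf3.w _ (by decide), hf2.w _ (by decide), hf1.w _ (by decide), H.stride]
  · rw [hf7.f _ (by decide), hf6.f _ (by decide), hf5.f _ (by decide), hf4.f _ (by decide),
      hf3.f _ (by decide), hf2.f _ (by decide), hf1.f _ (by decide)]
    exact H.val

/-- The time for a layer is almost linear in the widths of the two layers involved: `O(log S)`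
rounds that visit every gate once. -/
theorem layerTime_le (hC : C.WellFormed n) {m : ℕ} (hm : m < C.depth) :
    layerTime n C m + 40 ≤
      50000 * ((C.width n m + C.width n (m + 1)) * Nat.log 2 (C.size n)) := by
  have h1 := hC.one_le_log
  have v0 := hC.vars_le hm.le
  have v1 := hC.vars_le (show m + 1 ≤ C.depth from hm)
  have p0 := hC.two_pow_vars_le hm.le
  have p1 := hC.two_pow_vars_le (show m + 1 ≤ C.depth from hm)
  have w0 := hC.width_pos hm.le
  have w1 := hC.width_pos (show m + 1 ≤ C.depth from hm)
  have b0 : C.blockVars n m 0 = C.vars n m := rfl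
  have b1 : C.blockVars n m 1 = C.vars n (m + 1) := rfl
  have b2 : C.blockVars n m 2 = C.vars n (m + 1) := rfl
  unfold layerTime sumcheckTime
  rw [Finset.sum_range_succ, Finset.sum_range_succ, Finset.sum_range_succ, Finset.sum_range_zero,
    b0, b1, b2]
  generalize Nat.log 2 (C.size n) = L at *
  generalize C.vars n m = u at *
  generalize C.vars n (m + 1) = v at *
  generalize C.width n m = x at *
  generalize C.width n (m + 1) = y at *
  generalize 2 ^ u = p at *
  generalize 2 ^ v = q at *
  have a1 : u * p ≤ 2 * L * (2 * x) := Nat.mul_le_mul v0 p0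
  have a2 : v * q ≤ 2 * L * (2 * y) := Nat.mul_le_mul v1 p1
  have a3 : u * x ≤ 2 * L * x := Nat.mul_le_mul_right _ v0
  have a4 : v * x ≤ 2 * L * x := Nat.mul_le_mul_right _ v1
  have a5 : x ≤ L * x := Nat.le_mul_of_pos_left _ h1
  have a6 : y ≤ L * y := Nat.le_mul_of_pos_left _ h1
  have a7 : L ≤ L * x := Nat.le_mul_of_pos_right _ w0
  have a8 : L ≤ L * y := Nat.le_mul_of_pos_right _ w1
  nlinarith

/-- Every width enters the times for at most two layers, hence the total time is `O(S log S)`. -/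
theorem ht_prove (hC : C.WellFormed n) (hE : Explicit n C E) {A : UpdateStream F}
    (hu : ∀ u ∈ A, u.1 < n)
    (hA : E.answer = Circuit.script ((C.transcript n ρ (C.output (frequency A))
      (C.honest n (frequency A) ρ)).map Event.dual)) :
    HT E prove (100 * A.length + 101000 * (C.size n * Nat.log 2 (C.size n)))
      (fun h => h.trace = (C.transcript n ρ (C.output (frequency A))
        (C.honest n (frequency A) ρ)).map Event.dual) (Memory.initial main n [] A) := by
  have hd := hC.depth_lt_size
  have hd0 := hC.depth_pos
  have hlog : C.size n ≤ C.size n * Nat.log 2 (C.size n) :=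
    Nat.le_mul_of_pos_right _ hC.one_le_log
  have hsum : ∑ m ∈ Finset.range C.depth, (layerTime n C m + 40) ≤
      100000 * (C.size n * Nat.log 2 (C.size n)) := by
    have h1 : ∑ m ∈ Finset.range C.depth, C.width n m +
        ∑ m ∈ Finset.range C.depth, C.width n (m + 1) ≤ 2 * C.size n := by
      have e1 := Circuit.sum_width n C
      have e2 := e1
      rw [Finset.sum_range_succ] at e1
      rw [Finset.sum_range_succ'] at e2
      omega
    calc _ ≤ ∑ m ∈ Finset.range C.depth,
        50000 * ((C.width n m + C.width n (m + 1)) * Nat.log 2 (C.size n)) :=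
          Finset.sum_le_sum fun m hm => layerTime_le hC (Finset.mem_range.1 hm)
      _ = 50000 * ((∑ m ∈ Finset.range C.depth, C.width n m +
        ∑ m ∈ Finset.range C.depth, C.width n (m + 1)) * Nat.log 2 (C.size n)) := by
          rw [← Finset.mul_sum, ← Finset.sum_mul, Finset.sum_add_distrib]
      _ ≤ 50000 * ((2 * C.size n) * Nat.log 2 (C.size n)) := by gcongr
      _ = _ := by ring
  refine (HT.seq (ht_readInput hC hE hu rfl fun _ => rfl) (T' := (340 * C.size n + 200 * C.depth +
    40) + (20 + (∑ m ∈ Finset.range C.depth, (layerTime n C m + 40) + 40))) ?_).time (by omega)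
  rintro h1 hf1 - ⟨d1, s1, v1⟩
  refine HT.seq (ht_evaluate hE d1 s1 v1) ?_
  rintro h2 hf2 - v2
  have d2 : h2.w depth 0 = C.depth := by rw [hf2.w _ (by decide), d1]
  have s2 : h2.w stride 0 = C.depth + 1 := by rw [hf2.w _ (by decide), s1]
  have t2 : h2.trace = [] := by
    rw [hf2.trace rfl, hf1.trace rfl]
    rfl
  have o2 : h2.f val 0 = C.output (frequency A) := v2 0 0 (Nat.zero_le _)
  refine HT.seq (T := 20) (R := fun h => h.w depth 0 = C.depth ∧ Reduced n C (frequency A) ρ 0 h)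
    (HT.block (fun _ => ?_) (Nat.le_of_ble_eq_true rfl)) ?_
  · simp [o2, t2, d2]
    refine ⟨s2, v2, fun k hk => ?_, ?_⟩
    · rw [hC.vars_zero] at hk
      exact absurd hk (Nat.not_lt_zero _)
    · simp [Circuit.prefixTrace_zero, Event.dual]
  rintro h3 - - ⟨d3, R3⟩
  refine (HT.for_ C.depth (fun m h => Reduced n C (frequency A) ρ m h) d3 (by decide) (by decide)
    (by decide) (fun k h v H => ⟨by simpa using H.stride, H.val, H.z, H.trace⟩) R3
    (fun m hm h4 hf4 _ hi4 R4 => ht_reduceLayer hC hE hA hm hi4 R4)).mono le_rfl ?_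
  -- the prefix of the transcript before layer `depth` is the whole transcript
  intro h4 _ _ R4
  rw [← Circuit.prefixTrace_depth]
  exact R4.trace

end PName


/-! ### Resource bounds -/

namespace Circuit

variable {n : ℕ} {C : Circuit}

theorem WellFormed.table_le (hC : C.WellFormed n) (k i j : ℕ) : C.table n k i j ≤ C.size n := by
  have hd := hC.depth_lt_size
  have h2 := hC.two_le_size
  rcases k with _ | _ | k
  · exact hd.le
  · change C.width n i ≤ _
    by_cases hi : i < C.depth
    · exact width_le_size hi.le
    · rw [width, if_neg hi]
      exact Nat.le_add_right _ _
  · rcases hg : (C.layer i)[j]? with _ | g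
    · rcases k with _ | _ | _ | k <;> simp [table, hg]
    · by_cases hi : i < C.depth
      · have hw := hC.2 i hi g (List.mem_of_getElem? hg)
        have h3 := width_le_size (n := n) (show i + 1 ≤ C.depth from hi)
        rcases k with _ | _ | _ | k <;> simp only [table, hg]
        · split <;> omega
        · omega
        · omega
        · exact Nat.zero_le _
      · rw [layer_of_ge (not_lt.1 hi)] at hg
        simp at hg

end Circuit

/-- The output of a run does not depend on the bounds of its time. -/
theorem Verifier.Runs.out_unique {F : Type*} [Field F] {V : Verifier} {n mem word : ℕ}
    {coins : List F} {A : UpdateStream F} {σ : List (Event F) → F} {t₁ t₂ t₁' t₂' : ℕ}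
    {τ τ' : List (Event F)} {o o' : Option F} (H : V.Runs n mem word coins A σ t₁ t₂ τ o)
    (H' : V.Runs n mem word coins A σ t₁' t₂' τ' o') : o = o' := by
  obtain ⟨s₁, s₂, s₃, _, _, h1, -, h2, -, -, h3, -, -, h4⟩ := H
  obtain ⟨r₁, r₂, r₃, _, _, k1, -, k2, -, -, k3, -, -, k4⟩ := H'
  obtain rfl := h1.deterministic k1
  obtain rfl := h2.deterministic k2
  obtain rfl := h3.deterministic k3
  exact h4.symm.trans k4

/-- The verifier for a family of circuits that is described by the transducer `T`. -/
def verifier (T : Transducer) : Verifier :=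
  ⟨(VName.pre T).compile, VName.observe.compile, VName.talk.compile⟩

section

open VName

variable {F : Type*} [Field F] {T : Transducer} {n s B mem word : ℕ} {C : Circuit}

/-- A machine with `mem` cells and words below `word` can run the verifier, with words at most
`B`, if the space of the transducer is `s`. -/
structure Suffices (T : Transducer) (n s : ℕ) (C : Circuit) (B mem word : ℕ) : Prop where
  mem : 64 * (C.numCoins n + C.depth + s + 2) ≤ mem
  bound : 4 * C.size n + C.numCoins n + s + T.states + T.symbols + 4 ≤ B
  pre : (VName.pre T).size B < word
  observe : VName.observe.size B < word
  talk : VName.talk.size B < word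

open Classical in
/-- Against a prover that sends the value `y` and the polynomials `g`, the machine of the verifier
carries out the protocol. -/
theorem runs_verifier (hC : C.WellFormed n) (hn : 1 ≤ n) (hT : T.Computes n s C.encode)
    (hM : Suffices T n s C B mem word) {ρ : List F} (hρ : ρ.length = C.numCoins n)
    {A : UpdateStream F} (hA : ∀ u ∈ A, u.1 < n) {σ : List (Event F) → F} {y : F}
    {g : ℕ → ℕ → Polynomial F} (hg : ∀ i < C.depth, ∀ k, (g i k).natDegree ≤ C.msgDegree n i k)
    (hσ : C.Answers n ρ σ y g) :
    ∃ tPre tOnline, (verifier T).Runs n mem word ρ A σ tPre tOnline (C.transcript n ρ y g)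
        (C.verdict n (frequency A) ρ y g) ∧ tPre ≤ preTime T n s C ∧
      tOnline ≤ (A.length * (110 * C.vars n C.depth + 120) + 60) +
        (640 * C.numCoins n + 150) := by
  -- all indices that occur are bounded by the space that is claimed for the verifier
  let E : Env F := ⟨some (C.numCoins n + C.depth + s + 1), B, fun _ _ _ => 0,
    fun _ _ _ => Nat.zero_le _, σ⟩
  have hb := hM.bound
  have hns : n ≤ C.size n := Nat.le_add_right _ _
  have h2 := hC.two_le_size
  have hmod : E.Models ⟨mem, word, fun _ _ _ => 0, σ⟩ := by
    refine ⟨rfl, rfl, fun l hl => ?_, fun h => absurd h (by simp [E])⟩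
    obtain rfl := Option.some.inj hl
    exact (Nat.mul_le_mul_left _ (by omega)).trans hM.mem
  have hidx : ∀ k ≤ C.numCoins n + C.depth + s + 1, E.Idx k := fun k hk l hl => by
    obtain rfl := Option.some.inj hl
    exact hk
  have hR : Room n C E := ⟨fun k hk => hidx k (by omega), show _ ≤ B by omega⟩
  have hP : Simulation.Provides T n s E := ⟨fun k hk => hidx k (by omega), show _ ≤ B by omega,
    show _ ≤ B by omega, show _ ≤ B by omega, show _ ≤ B by omega⟩
  have hB0 : (Memory.initial main n ρ [] : Memory VName F).Bounded E.bound := by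
    intro x k
    change (if x = main ∧ k = 0 then n else 0) ≤ B
    split <;> omega
  obtain ⟨t₁, h₁, ht₁, e₁, b₁, -, P₁, z₁, tr₁⟩ :=
    (ht_pre hC hT hP hR hn hρ).exec hB0 hmod hM.pre
  obtain ⟨t₂, h₂, ht₂, e₂, b₂, -, P₂, st₂, tr₂, tot₂⟩ :=
    (ht_observe hC hR hA (h := { h₁ with stream := A }) (P₁.congr (fun _ _ => rfl) fun _ _ => rfl)
      z₁ rfl).exec b₁ hmod hM.observe
  obtain ⟨t₃, h₃, ht₃, e₃, -, -, tr₃, acc₃, y₃⟩ :=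
    (ht_talk hR hσ hg P₂ tot₂ (tr₂.trans tr₁)).exec b₂ hmod hM.talk
  refine ⟨t₁, t₂ + t₃, ⟨h₁.toState, h₂.toState, h₃.toState, t₂, t₃, ?_, tr₁, e₂, st₂,
    tr₂.trans tr₁, e₃, rfl, tr₃, ?_⟩, ht₁, Nat.add_le_add ht₂ ht₃⟩
  · rw [Memory.toState_initial rfl] at e₁
    exact e₁
  · have hw : h₃.toState.w 0 = h₃.w main 0 := h₃.toState_w main 0
    have hf : h₃.toState.f 0 = h₃.f main 0 := h₃.toState_f main 0
    rw [State.result, hw, hf, y₃, Circuit.verdict]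
    simp only [acc₃]

/-- The machine of the prover sends the messages of the honest prover. -/
theorem runs_prover (hC : C.WellFormed n) {B word : ℕ} (hB : 4 * C.size n + 4 ≤ B)
    (hs : PName.prove.size B < word) (ρ : List F) {A : UpdateStream F} (hA : ∀ u ∈ A, u.1 < n) :
    ∃ σ' t, ProverRuns PName.prove.compile n C word A σ' t (C.transcript n ρ
        (C.output (frequency A)) (C.honest n (frequency A) ρ)) ∧
      t ≤ 100 * A.length + 101000 * (C.size n * Nat.log 2 (C.size n)) := by
  -- the prover has no bound on its space, and answers come from a script of the honest execution
  let E : Env F := ⟨none, B, C.table n, fun k i j => (hC.table_le k i j).trans (by omega),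
    Circuit.script ((C.transcript n ρ (C.output (frequency A))
      (C.honest n (frequency A) ρ)).map Event.dual)⟩
  have hns : n ≤ C.size n := Nat.le_add_right _ _
  have hB0 : (Memory.initial .main n [] A : Memory PName F).Bounded E.bound := by
    intro x k
    change (if x = PName.main ∧ k = 0 then n else 0) ≤ B
    split <;> omega
  obtain ⟨t, h, ht, e, -, -, tr⟩ := (PName.ht_prove (E := E) hC ⟨fun k l hl => by simp [E] at hl, hB,
    rfl⟩ hA rfl).exec (M := ⟨word, word, C.table n, E.answer⟩) hB0
    ⟨rfl, rfl, fun l hl => by simp [E] at hl, fun _ => le_rfl⟩ hs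
  rw [Memory.toState_initial rfl] at e
  exact ⟨E.answer, t, ⟨h.toState, e, tr⟩, ht⟩

end

theorem Nat.le_self_pow_of_le {S c k : ℕ} (hS : 2 ≤ S) (hc : c ≤ k) : c ≤ S ^ k :=
  (Nat.lt_two_pow_self.le.trans (Nat.pow_le_pow_left hS c)).trans
    (Nat.pow_le_pow_right (by omega) hc)

/-- The preprocessing takes polynomial time if the transducer works in logarithmic space. -/
theorem preTime_le (T : Transducer) (c : ℕ) : ∃ e, ∀ n C, Circuit.WellFormed n C →
    VName.preTime T n (c * Nat.log 2 (C.size n)) C ≤ C.size n ^ e := by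
  -- an exponent for the number of configurations, which bounds all other numbers that occur
  set G := (Simulation.situations T).length
  set m := (T.states + 1) + 3 + c + (T.symbols + 1) * c + G + 7 with hm
  refine ⟨m * 2 + 13, fun n C hC => ?_⟩
  have hS := hC.two_le_size
  have hd := hC.depth_lt_size
  have hcoins := hC.numCoins_le
  have hns : n ≤ C.size n := Nat.le_add_right _ _
  generalize hSd : C.size n = S at *
  have hS0 : 0 < S := by omega
  have hlog : Nat.log 2 S ≤ S := Nat.log_le_self 2 S
  have hp : ∀ a k, a ≤ k → a ≤ S ^ k := fun a k h => Nat.le_self_pow_of_le hS h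
  have hmono : ∀ {a b}, a ≤ b → S ^ a ≤ S ^ b := fun h => Nat.pow_le_pow_right hS0 h
  have hcore : T.numCores n (c * Nat.log 2 S) ≤ S ^ m := by
    have h1 : (T.symbols + 1) ^ (c * Nat.log 2 S) ≤ S ^ ((T.symbols + 1) * c) := by
      calc (T.symbols + 1) ^ (c * Nat.log 2 S)
          ≤ (2 ^ (T.symbols + 1)) ^ (c * Nat.log 2 S) :=
            Nat.pow_le_pow_left Nat.lt_two_pow_self.le _
        _ = (2 ^ Nat.log 2 S) ^ ((T.symbols + 1) * c) := by
            rw [← pow_mul, ← pow_mul]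
            congr 1
            ring
        _ ≤ S ^ ((T.symbols + 1) * c) := Nat.pow_le_pow_left (Nat.pow_log_le_self 2 hS0.ne') _
    have h2 : n + 2 ≤ S ^ 2 := by nlinarith
    have h3 : c * Nat.log 2 S ≤ S ^ c * S ^ 1 := Nat.mul_le_mul (hp c c le_rfl) (by simpa using hlog)
    rw [Transducer.numCores]
    calc _ ≤ S ^ (T.states + 1) * (S ^ 2 * ((S ^ c * S ^ 1) * S ^ ((T.symbols + 1) * c))) :=
          Nat.mul_le_mul (hp _ _ le_rfl) (Nat.mul_le_mul h2 (Nat.mul_le_mul h3 h1))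
      _ = S ^ ((T.states + 1) + (2 + ((c + 1) + (T.symbols + 1) * c))) := by
          simp only [pow_add]
      _ ≤ S ^ m := hmono (by omega)
  have hSm : S ≤ S ^ m := by simpa using hmono (show 1 ≤ m by omega)
  have hdm : C.depth ≤ S ^ m := by omega
  have hcm : C.numCoins n ≤ S ^ m := by
    calc C.numCoins n ≤ 7 * (C.depth * Nat.log 2 S) := hcoins
      _ ≤ S ^ 7 * (S * S) := Nat.mul_le_mul (hp 7 7 le_rfl) (Nat.mul_le_mul hd.le hlog)
      _ = S ^ 9 := by ring
      _ ≤ S ^ m := hmono (by omega)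
  have hGm : G ≤ S ^ m := hp _ _ (by omega)
  have hM : 1 ≤ S ^ m := Nat.one_le_pow _ _ hS0
  have hfin : VName.preTime T n (c * Nat.log 2 S) C ≤ 8000 * (S ^ m * S ^ m) := by
    rw [VName.preTime, hSd]
    generalize T.numCores n (c * Nat.log 2 S) = x at *
    generalize C.numCoins n = y at *
    generalize C.depth = d at *
    generalize S ^ m = M at *
    change ((x + 1) * (30 + 24 * G + 200) + 50) + ((60 + ((d + 1) * (((S + 1) * 60 + 20) + 40) + 40)) +
      ((d * (340 + 300 * y) + 50) + (20 + (((x + 1) * (600 + 110 * y + 24 * G + 200) + 50) +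
        (d * (300 * y + 300) + 40))))) ≤ _
    calc _ ≤ ((M + 1) * (30 + 24 * M + 200) + 50) + ((60 + ((M + 1) * (((M + 1) * 60 + 20) + 40) + 40)) +
      ((M * (340 + 300 * M) + 50) + (20 + (((M + 1) * (600 + 110 * M + 24 * M + 200) + 50) +
        (M * (300 * M + 300) + 40))))) := by gcongr
      _ ≤ 8000 * (M * M) := by nlinarith
  calc _ ≤ 8000 * (S ^ m * S ^ m) := hfin
    _ ≤ S ^ 13 * (S ^ m * S ^ m) := Nat.mul_le_mul_right _
        ((show 8000 ≤ 2 ^ 13 by norm_num).trans (Nat.pow_le_pow_left hS 13))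
    _ = S ^ (m * 2 + 13) := by ring


/-- Memory of size `O(d log S)` and words of size `O(log S)` bits suffice for the verifier, and such
words suffice for the prover. -/
theorem exists_suffices (T : Transducer) (c : ℕ) : ∃ k, ∀ n C, Circuit.WellFormed n C →
    ∀ k' ≥ k, ∃ B, Suffices T n (c * Nat.log 2 (C.size n)) C B
      (k' * (C.depth * Nat.log 2 (C.size n))) (C.size n ^ k') ∧
      PName.prove.size B < C.size n ^ k' := by
  obtain ⟨e₁, h₁⟩ := (VName.pre T).polyBounded_size
  obtain ⟨e₂, h₂⟩ := VName.observe.polyBounded_size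
  obtain ⟨e₃, h₃⟩ := VName.talk.polyBounded_size
  obtain ⟨e₄, h₄⟩ := PName.prove.polyBounded_size
  set b := (15 + c + T.states + T.symbols) + 2 with hb
  refine ⟨64 * (10 + c) + b * (e₁ + e₂ + e₃ + e₄) + 1, fun n C hC k' hk => ?_⟩
  have hS := hC.two_le_size
  have hd := hC.depth_lt_size
  have hd0 := hC.depth_pos
  have hl := hC.one_le_log
  have hcoins := hC.numCoins_le
  generalize hSd : C.size n = S at *
  have hS0 : 0 < S := by omega
  have hlog : Nat.log 2 S ≤ S := Nat.log_le_self 2 S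
  have hX : 1 ≤ C.depth * Nat.log 2 S := Nat.mul_pos hd0 hl
  have hXl : Nat.log 2 S ≤ C.depth * Nat.log 2 S := Nat.le_mul_of_pos_left _ hd0
  have hXd : C.depth ≤ C.depth * Nat.log 2 S := Nat.le_mul_of_pos_right _ hl
  have hXS : C.depth * Nat.log 2 S ≤ S * S := Nat.mul_le_mul hd.le hlog
  have hSS : S ≤ S * S := Nat.le_mul_of_pos_left _ hS0
  have hB : 4 * S + C.numCoins n + c * Nat.log 2 S + T.states + T.symbols + 4 ≤ S ^ b := by
    have h1 : c * Nat.log 2 S ≤ c * (S * S) := Nat.mul_le_mul_left _ (hlog.trans hSS)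
    have h2 : T.states + T.symbols ≤ (T.states + T.symbols) * (S * S) :=
      Nat.le_mul_of_pos_right _ (by positivity)
    calc _ ≤ (15 + c + T.states + T.symbols) * (S * S) := by
          have h3 : (15 + c + T.states + T.symbols) * (S * S) = 15 * (S * S) + c * (S * S) +
            (T.states + T.symbols) * (S * S) := by ring
          omega
      _ ≤ S ^ (15 + c + T.states + T.symbols) * (S * S) :=
          Nat.mul_le_mul_right _ (Nat.le_self_pow_of_le hS le_rfl)
      _ = S ^ b := by rw [hb, pow_add _ _ 2, sq]
  have hsize : ∀ {ν : Type} {p : Prog ν} {e : ℕ}, (∀ B, 2 ≤ B → p.size B ≤ B ^ e) →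
      e ≤ e₁ + e₂ + e₃ + e₄ → p.size (S ^ b) < S ^ k' := by
    intro ν p e h he
    calc p.size (S ^ b) ≤ (S ^ b) ^ e := h _ (hS.trans (Nat.le_self_pow (by omega) S))
      _ = S ^ (b * e) := (pow_mul _ _ _).symm
      _ < S ^ k' := Nat.pow_lt_pow_right hS (by
          have := Nat.mul_le_mul_left b he
          omega)
  refine ⟨S ^ b, ⟨?_, by rw [hSd]; exact hB, hsize h₁ (by omega), hsize h₂ (by omega),
    hsize h₃ (by omega)⟩, hsize h₄ (by omega)⟩
  have h1 : c * Nat.log 2 S ≤ c * (C.depth * Nat.log 2 S) := Nat.mul_le_mul_left _ hXl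
  have h2 : (64 * (10 + c)) * (C.depth * Nat.log 2 S) ≤ k' * (C.depth * Nat.log 2 S) :=
    Nat.mul_le_mul_right _ (by omega)
  have h3 : (64 * (10 + c)) * (C.depth * Nat.log 2 S) = 640 * (C.depth * Nat.log 2 S) +
    64 * (c * (C.depth * Nat.log 2 S)) := by ring
  omega

/-- The online phase takes time `O(n log n + d log S)`. A stream of `O(n)` updates is covered even for
`n = 1`, where `n log n` vanishes but `d log S` does not. -/
theorem onlineTime_le {n : ℕ} {C : Circuit} (hC : C.WellFormed n) (hn : 1 ≤ n) {K l : ℕ}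
    (hl : l ≤ K * n) : (l * (110 * C.vars n C.depth + 120) + 60) + (640 * C.numCoins n + 150) ≤
      (340 * K + 4690) * (n * Nat.log 2 n + C.depth * Nat.log 2 (C.size n)) := by
  have hcoins := hC.numCoins_le
  have hX : 1 ≤ C.depth * Nat.log 2 (C.size n) := Nat.mul_pos hC.depth_pos hC.one_le_log
  have hv : C.vars n C.depth ≤ Nat.log 2 n + 1 := by
    rw [Circuit.vars, Circuit.width_depth]
    exact Nat.clog_le_of_le_pow (Nat.lt_pow_succ_log_self (by norm_num) _).le
  generalize C.depth * Nat.log 2 (C.size n) = X at *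
  have hnX : n ≤ n * Nat.log 2 n + X := by
    rcases hn.eq_or_lt with rfl | hn
    · simpa using hX
    · exact (Nat.le_mul_of_pos_right n (Nat.log_pos (by norm_num) hn)).trans (Nat.le_add_right _ _)
  have h1 : l * (110 * C.vars n C.depth + 120) ≤ K * n * (110 * (Nat.log 2 n + 1) + 120) :=
    Nat.mul_le_mul hl (by omega)
  have h2 : K * n * (110 * (Nat.log 2 n + 1) + 120) =
      110 * (K * (n * Nat.log 2 n)) + 230 * (K * n) := by ring
  have h3 : K * n ≤ K * (n * Nat.log 2 n + X) := Nat.mul_le_mul_left _ hnX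
  have h4 : K * (n * Nat.log 2 n) ≤ K * (n * Nat.log 2 n + X) :=
    Nat.mul_le_mul_left _ (Nat.le_add_right _ _)
  have h5 : (340 * K + 4690) * (n * Nat.log 2 n + X) = 340 * (K * (n * Nat.log 2 n + X)) +
    4690 * (n * Nat.log 2 n) + 4690 * X := by ring
  omega

/-! ### Programs for the protocol -/

theorem mainTheorem2 (C : ℕ → Circuit) (hC : ∀ n, 1 ≤ n → (C n).WellFormed n)
    (hU : LogSpaceUniform C) :
    ∃ (V : Verifier) (P : Cmd), ∀ K : ℕ, ∃ c : ℕ, ∀ n : ℕ, 1 ≤ n →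
    ∀ (F : Type*) [Field F] (A : UpdateStream F), A.length ≤ K * n → (∀ u ∈ A, u.1 < n) →
    ∀ (S d logS N : ℕ), S = (C n).size n → d = (C n).depth → logS = Nat.log 2 S →
      N = (C n).numCoins n →
    -- against every prover: the verifier follows the protocol, within the resource bounds
    (∀ (ρ : Fin N → F) (σ : List (Event F) → F),
      ∃ (tPre tOnline : ℕ) (y : F) (g : ℕ → ℕ → Polynomial F),
        (∀ i k, (g i k).natDegree ≤ (C n).msgDegree n i k) ∧
        V.Runs n (c * (d * logS)) (S ^ c) (List.ofFn ρ) A σ tPre tOnline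
          ((C n).transcript n (List.ofFn ρ) y g)
          ((C n).verdict n (frequency A) (List.ofFn ρ) y g) ∧
        tPre ≤ c * S ^ c ∧
        tOnline ≤ c * (n * Nat.log 2 n + d * logS) ∧
        ((C n).transcript n (List.ofFn ρ) y g).length ≤ c * (d * logS)) ∧
    -- the honest prover: it follows the protocol in time `O(S log S)` and is always accepted
    (∀ ρ : Fin N → F, ∃ (σ σ' : List (Event F) → F) (tPre tOnline tProver : ℕ),
        V.Runs n (c * (d * logS)) (S ^ c) (List.ofFn ρ) A σ tPre tOnline
          ((C n).transcript n (List.ofFn ρ) ((C n).output (frequency A))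
            ((C n).honest n (frequency A) (List.ofFn ρ)))
          (some ((C n).output (frequency A))) ∧
        ProverRuns P n (C n) (S ^ c) A σ' tProver
          ((C n).transcript n (List.ofFn ρ) ((C n).output (frequency A))
            ((C n).honest n (frequency A) (List.ofFn ρ))) ∧
        tProver ≤ c * (S * logS)) ∧
    -- soundness, for random values from a sufficiently large set of field elements
    (∀ R : Finset F, 100 * (d * logS) ≤ R.card → ∀ σ : List (Event F) → F,
      3 * {ρ : Fin N → F | (∀ k, ρ k ∈ R) ∧
          ∃ (tPre tOnline : ℕ) (τ : List (Event F)) (y : F),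
            V.Runs n (c * (d * logS)) (S ^ c) (List.ofFn ρ) A σ tPre tOnline τ (some y) ∧
            y ≠ (C n).output (frequency A)}.ncard ≤ R.card ^ N) := by
  obtain ⟨T, c₀, hT⟩ := hU
  obtain ⟨k, hk⟩ := exists_suffices T c₀
  obtain ⟨e, he⟩ := preTime_le T c₀
  refine ⟨verifier T, PName.prove.compile, fun K => ⟨k + e + 340 * K + 101000, ?_⟩⟩
  intro n hn F _ A hAl hA S d logS N hS hd hlogS hN
  subst hS hd hlogS hN
  -- `k` provides for the space and the word size, `e` is the exponent for the preprocessing, and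
  -- the other two terms cover the online phase and the prover
  set c := k + e + 340 * K + 101000 with hc
  have hW := hC n hn
  obtain ⟨B, hM, hP⟩ := hk n (C n) hW c (by omega)
  have hS := hW.two_le_size
  have hlen : ∀ ρ : Fin ((C n).numCoins n) → F, (List.ofFn ρ).length = (C n).numCoins n :=
    fun ρ => List.length_ofFn
  have hrun : ∀ (ρ : Fin ((C n).numCoins n) → F) (σ : List (Event F) → F) (y : F)
      (g : ℕ → ℕ → Polynomial F), (∀ i < (C n).depth, ∀ k, (g i k).natDegree ≤
        (C n).msgDegree n i k) → (C n).Answers n (List.ofFn ρ) σ y g → _ :=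
    fun ρ σ y g => runs_verifier hW hn (hT n hn) hM (hlen ρ) hA (σ := σ) (y := y) (g := g)
  have hpre : ∀ t, t ≤ VName.preTime T n (c₀ * Nat.log 2 ((C n).size n)) (C n) →
      t ≤ c * (C n).size n ^ c := fun t ht =>
    ((ht.trans (he n (C n) hW)).trans (Nat.pow_le_pow_right (by omega) (by omega))).trans
      (Nat.le_mul_of_pos_left _ (by omega))
  refine ⟨fun ρ σ => ?_, fun ρ => ?_, fun R hR σ => ?_⟩
  · obtain ⟨tPre, tOnline, h1, h2, h3⟩ := hrun ρ σ _ _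
      (fun i _ k => (C n).natDegree_strategyPoly_le (List.ofFn ρ) σ i k)
      ((C n).answers_strategy (List.ofFn ρ) σ)
    refine ⟨tPre, tOnline, _, _, fun i k => (C n).natDegree_strategyPoly_le (List.ofFn ρ) σ i k,
      h1, hpre tPre h2, ?_, ?_⟩
    · exact (h3.trans (onlineTime_le hW hn hAl)).trans (Nat.mul_le_mul_right _ (by omega))
    · exact (hW.length_transcript_le _ _ _).trans (Nat.mul_le_mul_right _ (by omega))
  · obtain ⟨tPre, tOnline, h1, -, -⟩ := hrun ρ _ _ _
      (fun i hi k => hW.natDegree_honest_le (frequency A) (List.ofFn ρ) hi k)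
      ((C n).answers_script (List.ofFn ρ) ((C n).output (frequency A)) _)
    obtain ⟨σ', t, h2, h3⟩ := runs_prover hW (le_trans (by omega) hM.bound) hP (List.ofFn ρ) hA
    rw [Circuit.verdict, if_pos (hW.accepts_honest _ _)] at h1
    refine ⟨_, σ', tPre, tOnline, t, h1, h2, h3.trans ?_⟩
    have h4 : n ≤ (C n).size n * Nat.log 2 ((C n).size n) :=
      (Nat.le_add_right _ _).trans (Nat.le_mul_of_pos_right _ hW.one_le_log)
    calc 100 * A.length + 101000 * ((C n).size n * Nat.log 2 ((C n).size n))
        ≤ 100 * (K * ((C n).size n * Nat.log 2 ((C n).size n))) +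
          101000 * ((C n).size n * Nat.log 2 ((C n).size n)) := by
          have := hAl.trans (Nat.mul_le_mul_left K h4)
          omega
      _ = (100 * K + 101000) * ((C n).size n * Nat.log 2 ((C n).size n)) := by ring
      _ ≤ _ := Nat.mul_le_mul_right _ (by omega)
  · refine le_trans (Nat.mul_le_mul_left 3 (Set.ncard_le_ncard ?_ ?_))
      (hW.soundness rfl (frequency A) σ R hR)
    -- a given run has the same output as the run that carries out the protocol, for which the
    -- soundness of the protocol applies
    · rintro ρ ⟨hρ, tPre, tOnline, τ, y, h1, hy⟩
      obtain ⟨tPre', tOnline', h2, -, -⟩ := hrun ρ σ _ _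
        (fun i _ k => (C n).natDegree_strategyPoly_le (List.ofFn ρ) σ i k)
        ((C n).answers_strategy (List.ofFn ρ) σ)
      have h3 := h1.out_unique h2
      rw [Circuit.verdict] at h3
      split at h3
      · next hacc =>
        obtain rfl := Option.some.inj h3
        exact ⟨hρ, hy, hacc⟩
      · exact absurd h3 (by simp)
    · exact (Fintype.piFinset fun _ => R).finite_toSet.subset fun ρ hρ => by
        simpa using hρ.1
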